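/- Let $M\ge 1$ and $N_D\ge 1$. Let $R=(R_1,\dots,R_M)$ be an $M$-tuple of real symmetric $4\times4$ matrices, and put $R(\varphi)=\sum_m\varphi_mR_m$ for $\varphi\in\mathbb R^M$. A pair $(Q,\Omega)\in \mathrm O(4N_D)\times \mathrm O(M)$ is a symmetry of $R$ if $Q^T(1_{N_D}\otimes R(\Omega\varphi))Q=1_{N_D}\otimes R(\varphi)$ for all $\varphi$. We say that $\mathrm{SO}(M)$ is unbroken for $R$ if for every $\Omega\in \mathrm{SO}(M)$ there is $Q\in \mathrm O(4N_D)$ such that $(Q,\Omega)$ is a symmetry of $R$. Two tuples $R,R'$ are equivalent if there is one $P\in \mathrm O(4)$ with $PR_mP^T=R'_m$ for all $m$. Let $\mathrm{Vec}$ be the vector representation of $\mathrm{Spin}(M)$ on $\mathbb R^M$. For a continuous orthogonal representation $\rho:\mathrm{Spin}(M)\to \mathrm O(4)$, say that $R$ transforms as $\mathrm{Vec}$ under $\rho$ if $\rho(x)R(\varphi)\rho(x)^T=R(\mathrm{Vec}(x)\varphi)$ for all $x\in \mathrm{Spin}(M)$ and $\varphi\in\mathbb R^M$. (1) For every tuple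 $R$ of real symmetric matrices for which $\mathrm{SO}(M)$ is unbroken, there is a real 4-dimensional representation $\rho_\Psi$ of $\mathrm{Spin}(M)$ (continuous and orthogonal) under which $R$ transforms as $\mathrm{Vec}$. (2) Let $\rho_\Psi$ be any continuous orthogonal representation of $\mathrm{Spin}(M)$ on $\mathbb R^4$. Then $\mathbb R^4$ has an orthogonal decomposition into irreducible subrepresentations, in which the pairwise inequivalent real irreps $\rho_1,\dots,\rho_k$ occur with multiplicities $m_1,\dots,m_k\ge1$, such that the following holds. Attach one real coupling to each pair consisting of a copy of $\rho_i$ and a copy of $\rho_j$ with $i<j$ and $\mathrm{Vec}\in\rho_i\otimes\rho_j$, and one to each copy of $\rho_i$ with $\mathrm{Vec}\in\mathrm{Sym}^2\rho_i$ (where $\sigma\in\tau$ means that $\sigma$ is equivalent to a subrepresentation of $\tau$). The number of these couplings is $$N=\sum_{\substack{i<j\\ \mathrm{Vec}\in\rho_i\otimes\rho_j}}m_im_j+\sum_{\substack{i\\ \mathrm{Vec}\in\mathrm{Sym}^2\rho_i}}m_i ,$$ and there is an injective linear map $g\mapsto F(g)$ from $\mathbb R^N$ to $M$-tuples of real $4\times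 4$ matrices such that * for all $g$, the matrices $F(g)_m$ are symmetric, $F(g)$ transforms as $\mathrm{Vec}$ under $\rho_\Psi$, and $\mathrm{SO}(M)$ is unbroken for $F(g)$; * if only one coupling in $g$ is nonzero, the only possibly nonvanishing matrix elements of the $F(g)_m$ are those between the two copies of irreps (or within the single copy) to which this coupling is attached; * every tuple of real symmetric matrices that transforms as $\mathrm{Vec}$ under $\rho_\Psi$ is equivalent to $F(g)$ for some $g\in\mathbb R^N$. Consequently every $R$ with unbroken $\mathrm{SO}(M)$ is determined, up to equivalence, by a choice of $\rho_\Psi$ and the values of at most $N$ real couplings. -/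

import Mathlib

open scoped Kronecker TensorProduct

noncomputable section

namespace GNY

/-! ### The group `Spin(M)` and its vector representation -/

/-- The positive definite quadratic form `v ↦ ∑ vᵢ²` on `ℝ^M`. -/
def euclidForm (M : ℕ) : QuadraticForm ℝ (Fin M → ℝ) :=
  QuadraticMap.weightedSumSquares ℝ (fun _ : Fin M => (1 : ℝ))

/-- The real Clifford algebra of Euclidean `M`-space. -/
abbrev Cl (M : ℕ) : Type := CliffordAlgebra (euclidForm M)

/-- The canonical topology of the (finite-dimensional) real vector space `Cl M`. -/
instance instTopologicalSpaceCl (M : ℕ) : TopologicalSpace (Cl M) := moduleTopology ℝ (Cl M)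

/-- `Spin(M)`, the group of even unitary elements of the Lipschitz group in `Cl M`.
Its topology is the subspace topology. -/
abbrev Spin (M : ℕ) : Type := ↥(spinGroup (euclidForm M))

theorem ι_injective (M : ℕ) :
    Function.Injective (CliffordAlgebra.ι (euclidForm M)) := by
  intro v w h
  have h2 := congrArg (CliffordAlgebra.equivExterior (euclidForm M)) h
  simpa using h2

theorem conj_ι_mem_range (M : ℕ) (x : Spin M) (v : Fin M → ℝ) :
    (x : Cl M) * CliffordAlgebra.ι (euclidForm M) v * star (x : Cl M) ∈
      LinearMap.range (CliffordAlgebra.ι (euclidForm M)) := by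
  have h := spinGroup.conjAct_smul_ι_mem_range_ι
    (x := spinGroup.toUnits x) x.2 v
  rw [ConjAct.units_smul_def, ConjAct.ofConjAct_toConjAct] at h
  exact h

theorem exists_vec (M : ℕ) (x : Spin M) (v : Fin M → ℝ) :
    ∃ w, CliffordAlgebra.ι (euclidForm M) w =
      (x : Cl M) * CliffordAlgebra.ι (euclidForm M) v * star (x : Cl M) :=
  conj_ι_mem_range M x v

/-- The rotation `v ↦ x v x⁻¹` of `ℝ^M` defined by `x ∈ Spin(M)` (here `x⁻¹ = star x`). -/
def rotate (M : ℕ) (x : Spin M) (v : Fin M → ℝ) : Fin M → ℝ :=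
  (exists_vec M x v).choose

theorem ι_rotate (M : ℕ) (x : Spin M) (v : Fin M → ℝ) :
    CliffordAlgebra.ι (euclidForm M) (rotate M x v) =
      (x : Cl M) * CliffordAlgebra.ι (euclidForm M) v * star (x : Cl M) :=
  (exists_vec M x v).choose_spec

/-- The vector representation `Vec` of `Spin(M)` on `ℝ^M`, through the double cover
`Spin(M) → SO(M)`. -/
def vec (M : ℕ) : Representation ℝ (Spin M) (Fin M → ℝ) where
  toFun x :=
    { toFun := rotate M x
      map_add' := fun v w => ι_injective M (by simp [ι_rotate, mul_add, add_mul])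
      map_smul' := fun c v => ι_injective M (by simp [ι_rotate]) }
  map_one' := LinearMap.ext fun v => ι_injective M (by simp [ι_rotate])
  map_mul' x y := LinearMap.ext fun v => ι_injective M (by simp [ι_rotate, mul_assoc])

/-! ### Representations -/

section Reps

variable {G V W : Type*} [Group G] [AddCommMonoid V] [Module ℝ V] [AddCommMonoid W] [Module ℝ W]

/-- `σ` occurs in `τ`: it is equivalent to a subrepresentation of `τ`. -/
def Occurs (σ : Representation ℝ G V) (τ : Representation ℝ G W) : Prop :=
  ∃ f : σ.IntertwiningMap τ, Function.Injective f

/-- The symmetric square of a representation, realized on the symmetric tensors in `V ⊗ V`. -/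
def symSquare (σ : Representation ℝ G V) : Subrepresentation (σ.tprod σ) where
  toSubmodule := LinearMap.eqLocus (TensorProduct.comm ℝ V V).toLinearMap LinearMap.id
  apply_mem_toSubmodule := by
    intro g v hv
    have hc : (TensorProduct.comm ℝ V V).toLinearMap ∘ₗ (σ.tprod σ) g =
        (σ.tprod σ) g ∘ₗ (TensorProduct.comm ℝ V V).toLinearMap := by
      ext a b
      simp
    have h1 := LinearMap.congr_fun hc v
    simp only [LinearMap.mem_eqLocus, LinearMap.comp_apply, LinearMap.id_apply] at hv h1 ⊢
    rw [h1, hv]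

end Reps

section Decomposition

variable {G V : Type*} [Group G] [AddCommGroup V] [Module ℝ V]

/-- A decomposition of a representation into irreducible subrepresentations `sub ⟨i, a⟩`, where
`i` labels the inequivalent irreps that occur and `a` the `mult i` copies of the `i`-th one. -/
structure IrrepDecomposition (ρ : Representation ℝ G V) where
  num : ℕ
  mult : Fin num → ℕ
  mult_pos : ∀ i, 0 < mult i
  sub : (Σ i, Fin (mult i)) → Subrepresentation ρ
  irreducible : ∀ p, (sub p).toRepresentation.IsIrreducible
  equiv_iff : ∀ p q,
    Nonempty ((sub p).toRepresentation.Equiv (sub q).toRepresentation) ↔ p.1 = q.1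
  isInternal : DirectSum.IsInternal fun p => (sub p).toSubmodule

/-- The `i`-th irrep of the decomposition (its first copy). -/
abbrev IrrepDecomposition.irrep {ρ : Representation ℝ G V} (D : IrrepDecomposition ρ)
    (i : Fin D.num) :
    Representation ℝ G (D.sub ⟨i, ⟨0, D.mult_pos i⟩⟩).toSubmodule :=
  (D.sub ⟨i, ⟨0, D.mult_pos i⟩⟩).toRepresentation

end Decomposition

/-! ### Yukawa matrices -/

/-- Vectors of `M` real `4 × 4` matrices. -/
abbrev Yukawa (M : ℕ) : Type := Fin M → Matrix (Fin 4) (Fin 4) ℝ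

/-- The matrix `R(φ) = ∑ₘ φₘ Rₘ`. -/
def Yukawa.at {M : ℕ} (R : Yukawa M) (φ : Fin M → ℝ) : Matrix (Fin 4) (Fin 4) ℝ :=
  ∑ m, φ m • R m

/-- `(Q, Ω) ∈ O(4 N_D) × O(M)` preserves the Yukawa coupling `φₘ ψᵀ (1 ⊗ Rₘ) ψ`. -/
def IsSymmetry {M : ℕ} (N_D : ℕ) (R : Yukawa M)
    (Q : Matrix (Fin N_D × Fin 4) (Fin N_D × Fin 4) ℝ) (Ω : Matrix (Fin M) (Fin M) ℝ) : Prop :=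
  ∀ φ : Fin M → ℝ,
    Q.transpose * ((1 : Matrix (Fin N_D) (Fin N_D) ℝ) ⊗ₖ R.at (Ω.mulVec φ)) * Q =
      (1 : Matrix (Fin N_D) (Fin N_D) ℝ) ⊗ₖ R.at φ

/-- `SO(M)` is unbroken: every rotation of the scalars extends to a symmetry. -/
def SOUnbroken {M : ℕ} (N_D : ℕ) (R : Yukawa M) : Prop :=
  ∀ Ω ∈ Matrix.specialOrthogonalGroup (Fin M) ℝ,
    ∃ Q ∈ Matrix.orthogonalGroup (Fin N_D × Fin 4) ℝ, IsSymmetry N_D R Q Ω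

/-- Equivalence of Yukawa matrices: a common orthogonal change of basis. -/
def YukawaEquiv {M : ℕ} (R R' : Yukawa M) : Prop :=
  ∃ P ∈ Matrix.orthogonalGroup (Fin 4) ℝ, ∀ m, P * R m * P.transpose = R' m

/-- Real 4-dimensional (orthogonal, continuous) representations of `Spin(M)`. -/
structure SpinRep (M : ℕ) where
  toHom : Spin M →* Matrix.orthogonalGroup (Fin 4) ℝ
  continuous_toHom : Continuous toHom

/-- The matrix of `x ∈ Spin(M)` in a 4-dimensional representation. -/
def SpinRep.mat {M : ℕ} (ρ : SpinRep M) (x : Spin M) : Matrix (Fin 4) (Fin 4) ℝ :=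
  (ρ.toHom x : Matrix (Fin 4) (Fin 4) ℝ)

/-- The action on `ℝ⁴`. -/
def SpinRep.rep {M : ℕ} (ρ : SpinRep M) : Representation ℝ (Spin M) (Fin 4 → ℝ) where
  toFun x := Matrix.toLin' (ρ.mat x)
  map_one' := by simp [SpinRep.mat, Module.End.one_eq_id]
  map_mul' x y := by simp [SpinRep.mat, Matrix.toLin'_mul, Module.End.mul_eq_comp]

/-- `R` transforms in the vector representation when the Majorana spinors transform in `ρ`,
that is, `R` is a rank-one tensor operator. -/
def TransformsAsVec {M : ℕ} (ρ : SpinRep M) (R : Yukawa M) : Prop :=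
  ∀ (x : Spin M) (φ : Fin M → ℝ),
    ρ.mat x * R.at φ * (ρ.mat x).transpose = R.at (vec M x φ)

/-! ### Couplings allowed by the selection rules -/

section Couplings

variable {M : ℕ} {ρ : SpinRep M}

/-- The irreducible summands are mutually orthogonal. -/
def IsOrthogonalDecomposition (D : IrrepDecomposition ρ.rep) : Prop :=
  ∀ p q, p ≠ q → ∀ u ∈ (D.sub p).toSubmodule, ∀ v ∈ (D.sub q).toSubmodule, u ⬝ᵥ v = 0

/-- Selection rule for two inequivalent irreps: `Vec ∈ ρᵢ ⊗ ρⱼ`. -/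
def VecInTensor (D : IrrepDecomposition ρ.rep) (i j : Fin D.num) : Prop :=
  Occurs (vec M) ((D.irrep i).tprod (D.irrep j))

/-- Selection rule for one irrep: `Vec ∈ Sym² ρᵢ`. -/
def VecInSymSquare (D : IrrepDecomposition ρ.rep) (i : Fin D.num) : Prop :=
  Occurs (vec M) (symSquare (D.irrep i)).toRepresentation

/-- Labels of the couplings: a pair of copies of inequivalent irreps `ρᵢ, ρⱼ`, `i < j`, with
`Vec ∈ ρᵢ ⊗ ρⱼ`, or one copy of an irrep `ρᵢ` with `Vec ∈ Sym² ρᵢ`. -/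
abbrev CouplingIndex (D : IrrepDecomposition ρ.rep) : Type :=
  {c : (Σ i, Fin (D.mult i)) × (Σ i, Fin (D.mult i)) //
    c.1.1 < c.2.1 ∧ VecInTensor D c.1.1 c.2.1} ⊕
  {p : (Σ i, Fin (D.mult i)) // VecInSymSquare D p.1}

/-- The two copies of irreps that a coupling connects. -/
def couplingEnds (D : IrrepDecomposition ρ.rep) :
    CouplingIndex D → (Σ i, Fin (D.mult i)) × (Σ i, Fin (D.mult i))
  | Sum.inl c => c.1
  | Sum.inr p => (p.1, p.1)

open Classical in
/-- `∑_{i < j, Vec ∈ ρᵢ ⊗ ρⱼ} mᵢ mⱼ + ∑_{i, Vec ∈ Sym² ρᵢ} mᵢ`. -/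
def couplingBound (D : IrrepDecomposition ρ.rep) : ℕ :=
  (∑ i, ∑ j, if i < j ∧ VecInTensor D i j then D.mult i * D.mult j else 0) +
    ∑ i, if VecInSymSquare D i then D.mult i else 0

/-- All matrix elements of `R` vanish, except those between the summands `p` and `q`. -/
def SupportedOn (D : IrrepDecomposition ρ.rep)
    (p q : Σ i, Fin (D.mult i)) (R : Yukawa M) : Prop :=
  ∀ a b, (a, b) ≠ (p, q) → (a, b) ≠ (q, p) →
    ∀ u ∈ (D.sub a).toSubmodule, ∀ v ∈ (D.sub b).toSubmodule, ∀ m,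
      u ⬝ᵥ (R m).mulVec v = 0

end Couplings

end GNY

end

open GNY

noncomputable section
namespace GNY

/-! ### Elements of `Spin(M)` and the double cover of `SO(M)` -/

section SpinBasics

open CliffordAlgebra

variable {M : ℕ}

/-! The factor `N_D` is removed by cancellation. A tuple of symmetric matrices makes ℝ⁴ a semisimple
module over a free algebra, and semisimple modules can be cancelled from `N_D`-fold powers. Combined
with the polar decomposition this is `exists_orthogonal_of_kronecker`: an unbroken SO(M) lifts every
rotation to an orthogonal matrix acting on a single ℝ⁴ (`RotInvariant`). Since Spin(M) → SO(M) is
onto (`exists_vec_eq`), tuples that transform as Vec have the same property.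

For M ≥ 3 such tuples can be listed. R(φ) and R(-φ) are similar, so the spectrum is {x, -x, y, -y},
and the stabiliser of a direction excludes four distinct eigenvalues. If y = 0, the remaining
components are mutually orthogonal vectors in a plane; if y² = x², the components are anticommuting
Clifford matrices. Dimension four leaves room for at most three components in either case. Hence R =
0 for M ≥ 4, and for M = 3 a nonzero R is equivalent to a multiple of `mixedYukawa` or of
`diracYukawa`, which come from 1 ⊕ Vec and from Clifford matrices. For M = 1 Vec is trivial, and the
trivial ρ works. For M = 2 one symmetry above the rotation by half a radian is enough: its square is
a pair of phases in a suitable frame, the surviving matrix elements carry the character of the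
vector or its inverse, and the same relations are solved by integer charges of Spin(2), which is the
circle.

For part (2), Vec is irreducible (`eq_top_of_vec_invariant`), so a nonvanishing block of a vector
operator between two summands embeds Vec in their tensor product, and an embedding gives back a
block after symmetrisation. Choosing one nonzero tuple T_c supported on the block of each coupling
c, the map F(g) = ∑ g_c T_c is injective because the blocks are disjoint. The remaining claim is
that a common orthogonal matrix, which need not commute with ρ, moves any vector operator into the
span of the T_c (`couplingNormalForm_of_pairs`). For M ≥ 3 a single nonzero T_c suffices: on a
linear space of operators a continuous invariant with values 0 and 1 separates the two families, so
all nonzero operators agree up to scale and equivalence. For M = 1 this is the spectral theorem. For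
M = 2 the operators have complex coefficients in a frame of rotation planes and lines; their phases
are rotated away, and two equivalent planes are treated by Takagi's factorization. -/

theorem euclidForm_apply (v : Fin M → ℝ) : euclidForm M v = v ⬝ᵥ v := by
  simp [euclidForm, dotProduct]

theorem ι_mul_self (v : Fin M → ℝ) :
    ι (euclidForm M) v * ι (euclidForm M) v = algebraMap ℝ (Cl M) (v ⬝ᵥ v) := by
  rw [ι_sq_scalar, euclidForm_apply]

theorem ι_mul_add_mul_swap (v w : Fin M → ℝ) :
    ι (euclidForm M) v * ι (euclidForm M) w + ι (euclidForm M) w * ι (euclidForm M) v =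
      algebraMap ℝ (Cl M) (2 * (v ⬝ᵥ w)) := by
  rw [CliffordAlgebra.ι_mul_ι_add_swap]
  congr 1
  simp only [QuadraticMap.polar, euclidForm_apply, dotProduct_add, add_dotProduct,
    dotProduct_comm w v]
  ring

/-- The reflection of `ℝ^M` in the hyperplane orthogonal to a unit vector `v`. -/
def reflect (v φ : Fin M → ℝ) : Fin M → ℝ := φ - (2 * (v ⬝ᵥ φ)) • v

theorem ι_conj (v φ : Fin M → ℝ) (hv : v ⬝ᵥ v = 1) :
    ι (euclidForm M) v * ι (euclidForm M) φ * ι (euclidForm M) v =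
      -ι (euclidForm M) (reflect v φ) := by
  have h := ι_mul_add_mul_swap v φ
  have h1 := ι_mul_self v
  rw [hv, map_one] at h1
  have h2 : ι (euclidForm M) v * ι (euclidForm M) φ =
      algebraMap ℝ (Cl M) (2 * (v ⬝ᵥ φ)) - ι (euclidForm M) φ * ι (euclidForm M) v :=
    eq_sub_of_add_eq h
  rw [h2, sub_mul, mul_assoc, h1, mul_one, reflect, map_sub, map_smul, ← Algebra.smul_def]
  abel

theorem ι_mul_mem_spin {v w : Fin M → ℝ} (hv : v ⬝ᵥ v = 1) (hw : w ⬝ᵥ w = 1) :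
    ι (euclidForm M) v * ι (euclidForm M) w ∈ spinGroup (euclidForm M) := by
  have hu : ∀ u : Fin M → ℝ, u ⬝ᵥ u = 1 →
      ι (euclidForm M) u * ι (euclidForm M) u = 1 := fun u h => by rw [ι_mul_self, h, map_one]
  let U : ∀ u : Fin M → ℝ, u ⬝ᵥ u = 1 → (Cl M)ˣ := fun u h =>
    ⟨ι (euclidForm M) u, ι (euclidForm M) u, hu u h, hu u h⟩
  have hU : ∀ u h, U u h ∈ lipschitzGroup (euclidForm M) := fun u h =>
    Subgroup.subset_closure ⟨u, rfl⟩
  refine spinGroup.mem_iff.2 ⟨pinGroup.mem_iff.2 ⟨⟨U v hv * U w hw, ?_, rfl⟩, ?_⟩, ?_⟩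
  · exact mul_mem (hU v hv) (hU w hw)
  · rw [Unitary.mem_iff]
    simp only [star_mul, star_ι, mul_neg, neg_mul, neg_neg]
    constructor
    · rw [mul_assoc, ← mul_assoc (ι (euclidForm M) v) _ (ι (euclidForm M) w), hu v hv, one_mul,
        hu w hw]
    · rw [mul_assoc, ← mul_assoc (ι (euclidForm M) w) _ (ι (euclidForm M) v), hu w hw, one_mul,
        hu v hv]
  · exact ι_mul_ι_mem_evenOdd_zero _ _ _

/-- The element `v w` of `Spin(M)`, for unit vectors `v` and `w`. -/
def spinPair (v w : Fin M → ℝ) (hv : v ⬝ᵥ v = 1) (hw : w ⬝ᵥ w = 1) : Spin M :=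
  ⟨ι (euclidForm M) v * ι (euclidForm M) w, ι_mul_mem_spin hv hw⟩

theorem ι_vec (x : Spin M) (φ : Fin M → ℝ) :
    ι (euclidForm M) (vec M x φ) = (x : Cl M) * ι (euclidForm M) φ * star (x : Cl M) :=
  ι_rotate M x φ

theorem vec_spinPair {v w : Fin M → ℝ} (hv : v ⬝ᵥ v = 1) (hw : w ⬝ᵥ w = 1) (φ : Fin M → ℝ) :
    vec M (spinPair v w hv hw) φ = reflect v (reflect w φ) := by
  apply ι_injective M
  rw [ι_vec]
  simp only [spinPair, star_mul, star_ι, mul_neg, neg_mul, neg_neg]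
  have h1 := ι_conj w φ hw
  have h2 := ι_conj v (reflect w φ) hv
  calc _ = ι (euclidForm M) v * (ι (euclidForm M) w * ι (euclidForm M) φ * ι (euclidForm M) w) *
        ι (euclidForm M) v := by simp only [mul_assoc]
    _ = _ := by rw [h1, mul_neg, neg_mul, h2, neg_neg]

theorem vec_mul (x y : Spin M) (φ : Fin M → ℝ) : vec M (x * y) φ = vec M x (vec M y φ) := by
  rw [map_mul]; rfl

/-- The square of a vector is a scalar of the Clifford algebra, and conjugation by x fixes scalars.
-/
theorem vec_dotProduct (x : Spin M) (φ : Fin M → ℝ) : vec M x φ ⬝ᵥ vec M x φ = φ ⬝ᵥ φ := by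
  have hinj : Function.Injective (algebraMap ℝ (Cl M)) := by
    intro a b h
    have := congrArg (CliffordAlgebra.equivExterior (euclidForm M)) h
    simpa using this
  apply hinj
  rw [← ι_mul_self, ← ι_mul_self, ι_vec]
  have h : star (x : Cl M) * (x : Cl M) = 1 := spinGroup.coe_star_mul_self x
  have h' : (x : Cl M) * star (x : Cl M) = 1 := spinGroup.coe_mul_star_self x
  calc _ = (x : Cl M) * ι (euclidForm M) φ * (star (x : Cl M) * (x : Cl M)) *
        ι (euclidForm M) φ * star (x : Cl M) := by simp only [mul_assoc]
    _ = (x : Cl M) * (ι (euclidForm M) φ * ι (euclidForm M) φ) * star (x : Cl M) := by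
        rw [h, mul_one]; simp only [mul_assoc]
    _ = _ := by rw [ι_mul_self, ← Algebra.commutes, mul_assoc, h', mul_one]

theorem det_reflection_orthogonal_singleton {F : Type*} [NormedAddCommGroup F]
    [InnerProductSpace ℝ F] [FiniteDimensional ℝ F] {v : F} (hv : v ≠ 0) :
    LinearMap.det ((ℝ ∙ v)ᗮ.reflection.toLinearMap) = -1 := by
  rw [Submodule.det_reflection, Submodule.orthogonal_orthogonal, finrank_span_singleton hv, pow_one]

/-- Reflections are absorbed in pairs as elements v w of Spin(M), so at most one is left over. The
determinant is carried along because it records the parity. -/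
theorem exists_vec_of_reflections (l : List (EuclideanSpace ℝ (Fin M))) :
    (∃ x : Spin M, ∀ φ : EuclideanSpace ℝ (Fin M),
        ((l.map fun v => (ℝ ∙ v)ᗮ.reflection).prod φ).ofLp = vec M x φ.ofLp) ∧
      LinearMap.det ((l.map fun v => (ℝ ∙ v)ᗮ.reflection).prod.toLinearMap) = 1 ∨
    (∃ (x : Spin M) (u : Fin M → ℝ), u ⬝ᵥ u = 1 ∧ ∀ φ : EuclideanSpace ℝ (Fin M),
        ((l.map fun v => (ℝ ∙ v)ᗮ.reflection).prod φ).ofLp = reflect u (vec M x φ.ofLp)) ∧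
      LinearMap.det ((l.map fun v => (ℝ ∙ v)ᗮ.reflection).prod.toLinearMap) = -1 := by
  induction l with
  | nil =>
    left
    refine ⟨⟨1, fun φ => ?_⟩, ?_⟩
    · rw [map_one]; rfl
    · exact LinearMap.det_id
  | cons v l ih =>
    -- A list of vectors may contain zero, whose "reflection" is the identity.
    by_cases hv : v = 0
    · have : (ℝ ∙ v)ᗮ.reflection = 1 := by
        subst hv
        ext1 x
        apply Submodule.reflection_mem_subspace_eq_self
        simp
      simpa only [List.map_cons, List.prod_cons, this, one_mul] using ih
    · set u : Fin M → ℝ := ‖v‖⁻¹ • v.ofLp with hu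
      have hn : ‖v‖ ≠ 0 := norm_ne_zero_iff.2 hv
      have hvv : v.ofLp ⬝ᵥ v.ofLp = ‖v‖ ^ 2 := by
        rw [EuclideanSpace.real_norm_sq_eq]; simp [dotProduct, sq]
      have huu : u ⬝ᵥ u = 1 := by
        rw [hu, smul_dotProduct, dotProduct_smul, hvv]
        simp only [smul_eq_mul]
        field_simp
      have hr : ∀ φ : EuclideanSpace ℝ (Fin M),
          ((ℝ ∙ v)ᗮ.reflection φ).ofLp = reflect u φ.ofLp := by
        intro φ
        rw [Submodule.reflection_orthogonal_apply, Submodule.reflection_singleton_apply]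
        simp only [reflect, hu, smul_dotProduct, smul_smul]
        have : inner ℝ v φ = v.ofLp ⬝ᵥ φ.ofLp := by
          simp [PiLp.inner_apply, dotProduct, mul_comm]
        rw [this]
        ext i
        simp
        field_simp
      have hd : ∀ f : EuclideanSpace ℝ (Fin M) ≃ₗᵢ[ℝ] EuclideanSpace ℝ (Fin M),
          LinearMap.det (((ℝ ∙ v)ᗮ.reflection * f).toLinearMap) =
            - LinearMap.det f.toLinearMap := by
        intro f
        have : ((ℝ ∙ v)ᗮ.reflection * f).toLinearMap =
          (ℝ ∙ v)ᗮ.reflection.toLinearMap ∘ₗ f.toLinearMap := rfl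
        rw [this, LinearMap.det_comp, det_reflection_orthogonal_singleton hv, neg_one_mul]
      simp only [List.map_cons, List.prod_cons, hd]
      rcases ih with ⟨⟨x, hx⟩, h1⟩ | ⟨⟨x, w, hw, hx⟩, h1⟩
      · right
        refine ⟨⟨x, u, huu, fun φ => ?_⟩, by rw [h1]⟩
        rw [LinearIsometryEquiv.coe_mul, Function.comp_apply, hr, hx]
      · left
        refine ⟨⟨spinPair u w huu hw * x, fun φ => ?_⟩, by rw [h1, neg_neg]⟩
        rw [LinearIsometryEquiv.coe_mul, Function.comp_apply, hr, hx, vec_mul, vec_spinPair]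

/-- `Spin(M) → SO(M)` is surjective. -/
theorem exists_vec_eq {Ω : Matrix (Fin M) (Fin M) ℝ}
    (hΩ : Ω ∈ Matrix.specialOrthogonalGroup (Fin M) ℝ) :
    ∃ x : Spin M, ∀ φ, vec M x φ = Ω.mulVec φ := by
  obtain ⟨ho, hdet⟩ := Matrix.mem_specialOrthogonalGroup_iff.1 hΩ
  have ho' := (Matrix.mem_orthogonalGroup_iff' (Fin M) ℝ).1 ho
  let L : EuclideanSpace ℝ (Fin M) →ₗ[ℝ] EuclideanSpace ℝ (Fin M) := Matrix.toEuclideanLin Ω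
  have hL : ∀ φ, (L φ).ofLp = Ω.mulVec φ.ofLp := fun φ => rfl
  have hn : ∀ φ, ‖L φ‖ = ‖φ‖ := by
    intro φ
    have : ‖L φ‖ ^ 2 = ‖φ‖ ^ 2 := by
      have h : ∀ ψ : EuclideanSpace ℝ (Fin M), ‖ψ‖ ^ 2 = ψ.ofLp ⬝ᵥ ψ.ofLp := fun ψ => by
        rw [EuclideanSpace.real_norm_sq_eq]; simp [dotProduct, sq]
      rw [h, h, hL, Matrix.dotProduct_mulVec, Matrix.vecMul_mulVec]
      have : Ω.transpose * Ω = 1 := ho'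
      rw [this, Matrix.vecMul_one]
    exact (sq_eq_sq₀ (norm_nonneg _) (norm_nonneg _)).1 this
  let I : EuclideanSpace ℝ (Fin M) →ₗᵢ[ℝ] EuclideanSpace ℝ (Fin M) := ⟨L, hn⟩
  let e : EuclideanSpace ℝ (Fin M) ≃ₗᵢ[ℝ] EuclideanSpace ℝ (Fin M) :=
    I.toLinearIsometryEquiv rfl
  have he : ∀ φ, (e φ).ofLp = Ω.mulVec φ.ofLp := fun φ => rfl
  have hde : LinearMap.det e.toLinearMap = 1 := by
    have h1 : e.toLinearMap = Matrix.toLpLin 2 2 Ω := rfl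
    rw [h1, Matrix.toLpLin_eq_toLin, LinearMap.det_toLin, hdet]
  -- Cartan–Dieudonné; determinant one then excludes an odd number of reflections.
  obtain ⟨l, -, hl⟩ := e.reflections_generate_dim
  rcases exists_vec_of_reflections l with ⟨⟨x, hx⟩, -⟩ | ⟨-, h1⟩
  · refine ⟨x, fun φ => ?_⟩
    rw [← hl] at hx
    have := hx (WithLp.toLp 2 φ)
    rw [he] at this
    exact this.symm
  · rw [← hl, hde] at h1
    norm_num at h1

/-- An invariant subspace of the vector representation is trivial. -/
theorem eq_top_of_vec_invariant {K : Submodule ℝ (Fin M → ℝ)}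
    (hK : ∀ (x : Spin M), ∀ φ ∈ K, vec M x φ ∈ K) (hne : K ≠ ⊥) : K = ⊤ := by
  obtain ⟨u, huK, hu0⟩ := Submodule.exists_mem_ne_zero_of_ne_bot hne
  have normalize : ∀ φ : Fin M → ℝ, φ ≠ 0 → ∃ c : ℝ, c ≠ 0 ∧ (c • φ) ⬝ᵥ (c • φ) = 1 := by
    intro φ hφ
    have hp : 0 < φ ⬝ᵥ φ := by
      have := Matrix.dotProduct_star_self_pos_iff (v := φ)
      simpa using this.2 hφ
    refine ⟨(Real.sqrt (φ ⬝ᵥ φ))⁻¹, by positivity, ?_⟩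
    rw [smul_dotProduct, dotProduct_smul, smul_smul, smul_eq_mul, ← mul_inv,
      Real.mul_self_sqrt hp.le, inv_mul_cancel₀ hp.ne']
  obtain ⟨c, hc, hcu⟩ := normalize u hu0
  set v := c • u
  have hvK : v ∈ K := K.smul_mem c huK
  -- The element a v of Spin(M) maps v to -v + 2(a·v)a, so the orbit of v reaches every direction
  -- not orthogonal to v.
  have key : ∀ a : Fin M → ℝ, a ⬝ᵥ a = 1 → a ⬝ᵥ v ≠ 0 → a ∈ K := by
    intro a ha hav
    have h := hK (spinPair a v ha hcu) v hvK
    rw [vec_spinPair] at h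
    have h2 : reflect a (reflect v v) = -v + (2 * (a ⬝ᵥ v)) • a := by
      simp only [reflect, hcu]
      simp [dotProduct_sub]
      module
    rw [h2] at h
    have h3 := K.add_mem h hvK
    rw [show -v + (2 * (a ⬝ᵥ v)) • a + v = (2 * (a ⬝ᵥ v)) • a by abel] at h3
    exact (K.smul_mem_iff (mul_ne_zero two_ne_zero hav)).1 h3
  have key2 : ∀ a : Fin M → ℝ, a ⬝ᵥ v ≠ 0 → a ∈ K := by
    intro a ha
    have ha0 : a ≠ 0 := by rintro rfl; simp at ha
    obtain ⟨d, hd, hda⟩ := normalize a ha0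
    refine (K.smul_mem_iff hd).1 (key _ hda ?_)
    rw [smul_dotProduct]
    exact mul_ne_zero hd ha
  rw [eq_top_iff]
  intro a _
  -- A vector orthogonal to v is reached as the difference of a + v, which is not orthogonal to v,
  -- and v.
  by_cases ha : a ⬝ᵥ v = 0
  · have : a + v ∈ K := key2 _ (by rw [add_dotProduct, ha, hcu]; norm_num)
    simpa using K.sub_mem this hvK
  · exact key2 a ha

/-! ### Rotations of `ℝ^M` -/

/-- The matrix of the reflection in the hyperplane orthogonal to a unit vector `v`. -/
def reflectMat (v : Fin M → ℝ) : Matrix (Fin M) (Fin M) ℝ :=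
  1 - Matrix.vecMulVec ((2 : ℝ) • v) v

theorem reflectMat_mulVec (v φ : Fin M → ℝ) : (reflectMat v).mulVec φ = reflect v φ := by
  rw [reflectMat, Matrix.sub_mulVec, Matrix.one_mulVec, Matrix.vecMulVec_mulVec, reflect]
  ext i
  simp
  ring

theorem reflectMat_mul_mem {v w : Fin M → ℝ} (hv : v ⬝ᵥ v = 1) (hw : w ⬝ᵥ w = 1) :
    reflectMat v * reflectMat w ∈ Matrix.specialOrthogonalGroup (Fin M) ℝ := by
  have ho : ∀ u : Fin M → ℝ, u ⬝ᵥ u = 1 → reflectMat u ∈ Matrix.orthogonalGroup (Fin M) ℝ := by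
    intro u hu
    rw [Matrix.mem_orthogonalGroup_iff]
    simp only [reflectMat, Matrix.transpose_sub, Matrix.transpose_one, Matrix.transpose_vecMulVec,
      sub_mul, mul_sub, one_mul, mul_one, Matrix.vecMulVec_mul_vecMulVec, hu]
    ext i j
    simp [Matrix.vecMulVec_apply]
    ring
  have hd : ∀ u : Fin M → ℝ, u ⬝ᵥ u = 1 → (reflectMat u).det = -1 := by
    intro u hu
    rw [reflectMat, sub_eq_add_neg, ← Matrix.neg_vecMulVec, Matrix.vecMulVec_eq Unit,
      Matrix.det_one_add_replicateCol_mul_replicateRow, dotProduct_neg, dotProduct_smul, hu]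
    norm_num
  refine Matrix.mem_specialOrthogonalGroup_iff.2 ⟨mul_mem (ho v hv) (ho w hw), ?_⟩
  rw [Matrix.det_mul, hd v hv, hd w hw]
  norm_num

/-- A rotation in the plane of two unit vectors. -/
theorem exists_rotation {u w : Fin M → ℝ} (hu : u ⬝ᵥ u = 1) (hw : w ⬝ᵥ w = 1) (h : u + w ≠ 0) :
    ∃ Ω ∈ Matrix.specialOrthogonalGroup (Fin M) ℝ, Ω.mulVec u = w ∧
      ∀ φ : Fin M → ℝ, u ⬝ᵥ φ = 0 → w ⬝ᵥ φ = 0 → Ω.mulVec φ = φ := by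
  have hp : 0 < (u + w) ⬝ᵥ (u + w) := by
    have := Matrix.dotProduct_star_self_pos_iff (v := u + w)
    simpa using this.2 h
  set s := (u + w) ⬝ᵥ (u + w) with hs
  have hs2 : s = 2 + 2 * (u ⬝ᵥ w) := by
    rw [hs, add_dotProduct, dotProduct_add, dotProduct_add, hu, hw, dotProduct_comm w u]; ring
  -- The unit bisector: reflecting along u sends u to -u, and reflecting along the bisector sends -u
  -- to w. Both reflections fix what is orthogonal to u and w.
  set a := (Real.sqrt s)⁻¹ • (u + w) with ha
  have hss : (Real.sqrt s)⁻¹ * (Real.sqrt s)⁻¹ = s⁻¹ := by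
    rw [← mul_inv, Real.mul_self_sqrt hp.le]
  have haa : a ⬝ᵥ a = 1 := by
    rw [ha, smul_dotProduct, dotProduct_smul, smul_smul, hss, ← hs, smul_eq_mul,
      inv_mul_cancel₀ hp.ne']
  have href : ∀ φ, reflect a φ = φ - (2 * s⁻¹ * ((u + w) ⬝ᵥ φ)) • (u + w) := by
    intro φ
    rw [reflect, ha, smul_dotProduct, smul_smul, ← hss, smul_eq_mul]
    congr 2
    ring
  refine ⟨_, reflectMat_mul_mem haa hu, ?_, ?_⟩
  · rw [← Matrix.mulVec_mulVec, reflectMat_mulVec, reflectMat_mulVec]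
    have h1 : reflect u u = -u := by
      rw [reflect, hu]; module
    rw [h1, href, dotProduct_neg, add_dotProduct, hu, dotProduct_comm w u]
    have : 2 * s⁻¹ * -(1 + u ⬝ᵥ w) = -1 := by
      field_simp
      rw [hs2]
      ring
    rw [this]
    module
  · intro φ h1 h2
    rw [← Matrix.mulVec_mulVec, reflectMat_mulVec, reflectMat_mulVec]
    have h3 : reflect u φ = φ := by rw [reflect, h1]; simp
    rw [h3, href, add_dotProduct, h1, h2]
    simp

/-- Antipodal vectors have no bisector, so the rotation is composed through a basis vector different
from ±u. If there were none, every coordinate of u would have square one, and |u|² = M would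
contradict M ≥ 2. -/
theorem exists_rotation_of_two_le (hM : 2 ≤ M) {u w : Fin M → ℝ} (hu : u ⬝ᵥ u = 1)
    (hw : w ⬝ᵥ w = 1) :
    ∃ Ω ∈ Matrix.specialOrthogonalGroup (Fin M) ℝ, Ω.mulVec u = w := by
  by_cases h : u + w = 0
  · obtain ⟨i, hi⟩ : ∃ i : Fin M, u ≠ Pi.single i 1 ∧ u ≠ -Pi.single i 1 := by
      by_contra! hcon
      have e : ∀ i : Fin M, u i * u i = 1 := fun i => by
        by_cases h' : u = Pi.single i 1
        · rw [h']; simp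
        · rw [hcon i h']; simp
      have : ∑ i, u i * u i = 1 := hu
      simp only [e, Finset.sum_const, Finset.card_univ, Fintype.card_fin, nsmul_eq_mul, mul_one]
        at this
      have : M = 1 := by exact_mod_cast this
      omega
    have hi1 : (Pi.single i 1 : Fin M → ℝ) ⬝ᵥ Pi.single i 1 = 1 := by simp
    obtain ⟨Ω, hΩ, h1, -⟩ := exists_rotation hu hi1 (fun h' => hi.2 (eq_neg_of_add_eq_zero_left h'))
    obtain ⟨Ω', hΩ', h2, -⟩ := exists_rotation hi1 hw (fun h' => hi.1 (by
      rw [eq_neg_of_add_eq_zero_left h', eq_neg_of_add_eq_zero_left h]))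
    exact ⟨Ω' * Ω, mul_mem hΩ' hΩ, by rw [← Matrix.mulVec_mulVec, h1, h2]⟩
  · obtain ⟨Ω, hΩ, h1, -⟩ := exists_rotation hu hw h
    exact ⟨Ω, hΩ, h1⟩

end SpinBasics

end GNY
end

noncomputable section
namespace GNY

/-! ### Cancellation: `N` copies of a tuple of symmetric matrices determine the tuple -/

section Cancellation

section Modules

variable {A : Type} [Ring A] [Algebra ℝ A]

theorem finite_hom (S V : Type) [AddCommGroup S] [Module ℝ S] [Module A S] [IsScalarTower ℝ A S]
    [FiniteDimensional ℝ S] [AddCommGroup V] [Module ℝ V] [Module A V] [IsScalarTower ℝ A V]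
    [FiniteDimensional ℝ V] : FiniteDimensional ℝ (S →ₗ[A] V) :=
  FiniteDimensional.of_injective (LinearMap.restrictScalarsₗ ℝ A S V ℝ)
    (LinearMap.restrictScalars_injective ℝ)

theorem finite_submodule {V : Type} [AddCommGroup V] [Module ℝ V] [Module A V]
    [IsScalarTower ℝ A V] [FiniteDimensional ℝ V] (U : Submodule A V) : FiniteDimensional ℝ U :=
  FiniteDimensional.of_injective (U.subtype.restrictScalars ℝ) U.injective_subtype

/-- Post-composition with a linear equivalence. -/
def homCongrRight (S : Type) [AddCommGroup S] [Module A S] {V W : Type} [AddCommGroup V]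
    [Module ℝ V] [Module A V] [IsScalarTower ℝ A V] [AddCommGroup W] [Module ℝ W] [Module A W]
    [IsScalarTower ℝ A W] (e : V ≃ₗ[A] W) : (S →ₗ[A] V) ≃ₗ[ℝ] (S →ₗ[A] W) where
  toFun f := e.toLinearMap.comp f
  map_add' f g := by ext; simp
  map_smul' c f := by
    ext x
    exact (e.restrictScalars ℝ).map_smul c (f x)
  invFun f := e.symm.toLinearMap.comp f
  left_inv f := by ext; simp
  right_inv f := by ext; simp

/-- Semisimple modules with the same dimensions of spaces of homomorphisms are isomorphic. -/
theorem nonempty_linearEquiv_of_finrank_hom_eq (n : ℕ) :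
    ∀ (V W : Type) [AddCommGroup V] [Module ℝ V] [Module A V] [IsScalarTower ℝ A V]
      [FiniteDimensional ℝ V] [IsSemisimpleModule A V]
      [AddCommGroup W] [Module ℝ W] [Module A W] [IsScalarTower ℝ A W]
      [FiniteDimensional ℝ W] [IsSemisimpleModule A W],
      Module.finrank ℝ V = n →
      (∀ (S : Type) [AddCommGroup S] [Module ℝ S] [Module A S] [IsScalarTower ℝ A S]
        [FiniteDimensional ℝ S],
        Module.finrank ℝ (S →ₗ[A] V) = Module.finrank ℝ (S →ₗ[A] W)) →
      Nonempty (V ≃ₗ[A] W) := by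
  induction n using Nat.strong_induction_on with
  | _ n ih =>
  intro V W _ _ _ _ _ _ _ _ _ _ _ _ hn h
  rcases subsingleton_or_nontrivial V with hV | hV
  -- Testing with S = W shows that W has no nonzero endomorphism, hence vanishes together with V.
  · have h1 := h W
    have : Module.finrank ℝ (W →ₗ[A] W) = 0 := by
      rw [← h1]
      have : Subsingleton (W →ₗ[A] V) := ⟨fun f g => by ext x; exact Subsingleton.elim _ _⟩
      exact Module.finrank_zero_of_subsingleton
    have hfin := finite_hom (A := A) W W
    have hs : Subsingleton (W →ₗ[A] W) := Module.finrank_zero_iff.1 this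
    have hW : Subsingleton W := ⟨fun x y => by
      have := LinearMap.congr_fun (Subsingleton.elim (LinearMap.id : W →ₗ[A] W) 0)
      have hx := this x
      have hy := this y
      simp only [LinearMap.id_apply, LinearMap.zero_apply] at hx hy
      rw [hx, hy]⟩
    exact ⟨(0 : V ≃ₗ[A] W)⟩
  · obtain ⟨U, hU⟩ := IsSemisimpleModule.exists_simple_submodule A V
    obtain ⟨V', hV'⟩ := exists_isCompl U
    have hfU := finite_submodule U
    have hfV' := finite_submodule V'
    have hUn : Nontrivial U := IsSimpleModule.nontrivial A U
    have hfin1 := finite_hom (A := A) U V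
    have hfin2 := finite_hom (A := A) U W
    -- A simple submodule U of V is detected by Hom(U, ·), so it also maps nontrivially to W, and by
    -- simplicity injectively.
    have : Nontrivial (U →ₗ[A] W) := by
      rw [← Module.finrank_pos_iff (R := ℝ), ← h U, Module.finrank_pos_iff]
      refine ⟨⟨U.subtype, 0, fun h0 => ?_⟩⟩
      obtain ⟨u, hu⟩ := exists_ne (0 : U)
      exact hu (Subtype.ext (LinearMap.congr_fun h0 u))
    obtain ⟨f, hf⟩ := exists_ne (0 : U →ₗ[A] W)
    have hfi := LinearMap.injective_of_ne_zero hf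
    obtain ⟨W', hW'⟩ := exists_isCompl (LinearMap.range f)
    have hfW' := finite_submodule W'
    let eV : (U × V') ≃ₗ[A] V := Submodule.prodEquivOfIsCompl U V' hV'
    let eW : (U × W') ≃ₗ[A] W :=
      ((LinearEquiv.ofInjective f hfi).prodCongr (LinearEquiv.refl A W')).trans
        (Submodule.prodEquivOfIsCompl _ W' hW')
    have hdim : Module.finrank ℝ V' < n := by
      have h1 := (eV.restrictScalars ℝ).finrank_eq
      rw [Module.finrank_prod, hn] at h1
      have : 0 < Module.finrank ℝ U := Module.finrank_pos
      omega
    -- Hom(S, ·) is additive over the two splittings, and the common term Hom(S, U) drops out of the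
    -- dimensions.
    obtain ⟨e⟩ := ih _ hdim V' W' rfl (by
      intro S _ _ _ _ _
      have hS := h S
      have hf1 := finite_hom (A := A) S U
      have hf2 := finite_hom (A := A) S V'
      have hf3 := finite_hom (A := A) S W'
      have e1 : (S →ₗ[A] V) ≃ₗ[ℝ] (S →ₗ[A] U) × (S →ₗ[A] V') :=
        (homCongrRight S eV.symm).trans (LinearMap.prodEquiv ℝ).symm
      have e2 : (S →ₗ[A] W) ≃ₗ[ℝ] (S →ₗ[A] U) × (S →ₗ[A] W') :=
        (homCongrRight S eW.symm).trans (LinearMap.prodEquiv ℝ).symm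
      rw [e1.finrank_eq, e2.finrank_eq, Module.finrank_prod, Module.finrank_prod] at hS
      omega)
    exact ⟨eV.symm.trans (((LinearEquiv.refl A U).prodCongr e).trans eW)⟩

/-- Cancellation of powers of semisimple modules. -/
theorem nonempty_linearEquiv_of_pi {N : ℕ} (hN : 1 ≤ N) (V W : Type) [AddCommGroup V] [Module ℝ V]
    [Module A V] [IsScalarTower ℝ A V]
      [FiniteDimensional ℝ V] [IsSemisimpleModule A V]
      [AddCommGroup W] [Module ℝ W] [Module A W] [IsScalarTower ℝ A W]
      [FiniteDimensional ℝ W] [IsSemisimpleModule A W]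
      (e : (Fin N → V) ≃ₗ[A] (Fin N → W)) : Nonempty (V ≃ₗ[A] W) := by
  refine nonempty_linearEquiv_of_finrank_hom_eq _ V W rfl ?_
  intro S _ _ _ _ _
  have hpi : ∀ (X : Type) [AddCommGroup X] [Module ℝ X] [Module A X] [IsScalarTower ℝ A X]
      [FiniteDimensional ℝ X],
      Module.finrank ℝ (S →ₗ[A] (Fin N → X)) = N * Module.finrank ℝ (S →ₗ[A] X) := by
    intro X _ _ _ _ _
    have hf := finite_hom (A := A) S X
    let e' : (S →ₗ[A] (Fin N → X)) ≃ₗ[ℝ] (Fin N → (S →ₗ[A] X)) :=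
      { toFun := fun f i => (LinearMap.proj i).comp f
        map_add' := fun f g => rfl
        map_smul' := fun c f => rfl
        invFun := fun f => LinearMap.pi f
        left_inv := fun f => rfl
        right_inv := fun f => rfl }
    rw [e'.finrank_eq, Module.finrank_pi_fintype]
    simp
  have h1 := (homCongrRight S e).finrank_eq
  rw [hpi V, hpi W] at h1
  exact Nat.eq_of_mul_eq_mul_left hN h1

end Modules

variable {n : Type} [Fintype n] [DecidableEq n]

theorem exists_diagonalization {A : Matrix n n ℝ} (hA : A.IsSymm) :
    ∃ T ∈ Matrix.orthogonalGroup n ℝ, ∃ d : n → ℝ,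
      A = T * Matrix.diagonal d * T.transpose := by
  have hH : A.IsHermitian := by
    rw [Matrix.IsHermitian, Matrix.conjTranspose_eq_transpose_of_trivial]; exact hA
  refine ⟨hH.eigenvectorUnitary, hH.eigenvectorUnitary.2, hH.eigenvalues, ?_⟩
  have := hH.spectral_theorem
  rw [Unitary.conjStarAlgAut_apply] at this
  simpa [Matrix.star_eq_conjTranspose] using this

theorem orthogonal_mul_transpose {T : Matrix n n ℝ} (hT : T ∈ Matrix.orthogonalGroup n ℝ) :
    T * T.transpose = 1 := (Matrix.mem_orthogonalGroup_iff n ℝ).1 hT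

theorem orthogonal_transpose_mul {T : Matrix n n ℝ} (hT : T ∈ Matrix.orthogonalGroup n ℝ) :
    T.transpose * T = 1 := (Matrix.mem_orthogonalGroup_iff' n ℝ).1 hT

theorem transpose_mem_orthogonal {T : Matrix n n ℝ} (hT : T ∈ Matrix.orthogonalGroup n ℝ) :
    T.transpose ∈ Matrix.orthogonalGroup n ℝ := by
  rw [Matrix.mem_orthogonalGroup_iff, Matrix.transpose_transpose, orthogonal_transpose_mul hT]

/-- Symmetric matrices that are simultaneously similar are simultaneously orthogonally similar. -/
theorem exists_orthogonal_of_similar {κ : Type} {A B : κ → Matrix n n ℝ} (hA : ∀ m, (A m).IsSymm)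
    (hB : ∀ m, (B m).IsSymm) {X : Matrix n n ℝ} (hX : IsUnit X.det)
    (h : ∀ m, X * A m = B m * X) :
    ∃ P ∈ Matrix.orthogonalGroup n ℝ, ∀ m, P * A m * P.transpose = B m := by
  -- Polar decomposition: the orthogonal matrix will be X (XᵀX)^(-1/2), with the inverse root Y
  -- built from the diagonalization of XᵀX.
  have hS : (X.transpose * X).IsSymm := by
    rw [Matrix.IsSymm, Matrix.transpose_mul, Matrix.transpose_transpose]
  obtain ⟨T, hT, d, hd⟩ := exists_diagonalization hS
  have hT1 := orthogonal_mul_transpose hT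
  have hT2 := orthogonal_transpose_mul hT
  have hdpos : ∀ i, 0 < d i := by
    intro i
    have hdd : Matrix.diagonal d = (X * T).transpose * (X * T) := by
      rw [Matrix.transpose_mul]
      calc Matrix.diagonal d = (T.transpose * T) * Matrix.diagonal d * (T.transpose * T) := by
            rw [hT2, one_mul, mul_one]
        _ = T.transpose * (T * Matrix.diagonal d * T.transpose) * T := by
            simp only [Matrix.mul_assoc]
        _ = _ := by rw [← hd]; simp only [Matrix.mul_assoc]
    have h1 : d i = ∑ j, (X * T) j i * (X * T) j i := by
      have := congrFun (congrFun hdd i) i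
      rw [Matrix.diagonal_apply_eq, Matrix.mul_apply] at this
      simpa using this
    have hdet : Matrix.det (Matrix.diagonal d) ≠ 0 := by
      rw [hdd, Matrix.det_mul, Matrix.det_transpose, Matrix.det_mul]
      have : T.det ≠ 0 := by
        intro h0
        have := congrArg Matrix.det hT1
        rw [Matrix.det_mul, h0] at this
        simp at this
      have := hX.ne_zero
      positivity
    rw [Matrix.det_diagonal, Finset.prod_ne_zero_iff] at hdet
    have h2 : 0 ≤ d i := by
      rw [h1]; exact Finset.sum_nonneg fun j _ => mul_self_nonneg _
    exact lt_of_le_of_ne h2 (Ne.symm (hdet i (Finset.mem_univ i)))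
  set r : n → ℝ := fun i => (Real.sqrt (d i))⁻¹ with hr
  have hrd : ∀ i, r i * d i * r i = 1 := fun i => by
    have h1 := Real.mul_self_sqrt (hdpos i).le
    have h2 : Real.sqrt (d i) ≠ 0 := (Real.sqrt_pos.2 (hdpos i)).ne'
    rw [hr]
    field_simp
    rw [sq, h1]
  set Y := T * Matrix.diagonal r * T.transpose with hY
  have hYs : Y.transpose = Y := by
    rw [hY]
    simp only [Matrix.transpose_mul, Matrix.transpose_transpose, Matrix.diagonal_transpose,
      Matrix.mul_assoc]
  have hYXY : Y * (X.transpose * X) * Y = 1 := by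
    rw [hd, hY]
    calc _ = T * Matrix.diagonal r * (T.transpose * T) * Matrix.diagonal d * (T.transpose * T) *
          Matrix.diagonal r * T.transpose := by simp only [Matrix.mul_assoc]
      _ = T * (Matrix.diagonal r * Matrix.diagonal d * Matrix.diagonal r) * T.transpose := by
          rw [hT2]; simp only [Matrix.mul_assoc, Matrix.one_mul]
      _ = 1 := by
          rw [Matrix.diagonal_mul_diagonal, Matrix.diagonal_mul_diagonal]
          simp only [hrd, Matrix.diagonal_one, mul_one, hT1]
  have hP : X * Y ∈ Matrix.orthogonalGroup n ℝ := by
    rw [Matrix.mem_orthogonalGroup_iff']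
    rw [← hYXY]
    have : (X * Y).transpose = Y * X.transpose := by rw [Matrix.transpose_mul, hYs]
    show (X * Y).transpose * (X * Y) = _
    rw [this]; simp only [Matrix.mul_assoc]
  refine ⟨X * Y, hP, fun m => ?_⟩
  -- Transposing X A = B X gives A Xᵀ = Xᵀ B; this is where the symmetry of both tuples enters.
  have hcomm : X.transpose * X * A m = A m * (X.transpose * X) := by
    have h1 := congrArg Matrix.transpose (h m)
    rw [Matrix.transpose_mul, Matrix.transpose_mul, (hA m).eq, (hB m).eq] at h1
    rw [Matrix.mul_assoc, h m, ← Matrix.mul_assoc, ← h1, Matrix.mul_assoc]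
  have hYc : Y * A m = A m * Y := by
    set C := T.transpose * A m * T with hC
    have hdC : Matrix.diagonal d * C = C * Matrix.diagonal d := by
      have e1 : T.transpose * (X.transpose * X) * T = Matrix.diagonal d := by
        rw [hd]
        calc _ = (T.transpose * T) * Matrix.diagonal d * (T.transpose * T) := by
              simp only [Matrix.mul_assoc]
          _ = _ := by rw [hT2, Matrix.one_mul, Matrix.mul_one]
      rw [← e1, hC]
      calc _ = T.transpose * (X.transpose * X) * (T * T.transpose) * A m * T := by
            simp only [Matrix.mul_assoc]
        _ = T.transpose * (X.transpose * X * A m) * T := by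
            rw [hT1, Matrix.mul_one]; simp only [Matrix.mul_assoc]
        _ = T.transpose * A m * (T * T.transpose) * (X.transpose * X) * T := by
            rw [hcomm, hT1, Matrix.mul_one]; simp only [Matrix.mul_assoc]
        _ = _ := by simp only [Matrix.mul_assoc]
    -- Commuting with `diagonal d` forces C to vanish between different eigenvalues, so C commutes
    -- with any function of d.
    have hrC : Matrix.diagonal r * C = C * Matrix.diagonal r := by
      ext i j
      have := congrFun (congrFun hdC i) j
      rw [Matrix.diagonal_mul, Matrix.mul_diagonal] at this ⊢
      by_cases hij : d i = d j
      · rw [hr]; simp only [hij]; ring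
      · have : C i j = 0 := by
          have : (d i - d j) * C i j = 0 := by linarith
          exact (mul_eq_zero.1 this).resolve_left (sub_ne_zero.2 hij)
        rw [this]; ring
    have hAC : A m = T * C * T.transpose := by
      rw [hC]
      calc A m = (T * T.transpose) * A m * (T * T.transpose) := by
            rw [hT1, Matrix.one_mul, Matrix.mul_one]
        _ = _ := by simp only [Matrix.mul_assoc]
    rw [hAC, hY]
    calc _ = T * Matrix.diagonal r * (T.transpose * T) * C * T.transpose := by
          simp only [Matrix.mul_assoc]
      _ = T * (Matrix.diagonal r * C) * T.transpose := by
          rw [hT2, Matrix.mul_one]; simp only [Matrix.mul_assoc]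
      _ = T * C * (T.transpose * T) * Matrix.diagonal r * T.transpose := by
          rw [hrC, hT2, Matrix.mul_one]; simp only [Matrix.mul_assoc]
      _ = _ := by simp only [Matrix.mul_assoc]
  rw [Matrix.mul_assoc X, hYc, ← Matrix.mul_assoc, h m, Matrix.mul_assoc (B m), Matrix.mul_assoc,
    Matrix.mul_assoc]
  have := orthogonal_mul_transpose hP
  rw [Matrix.mul_assoc] at this
  rw [this, Matrix.mul_one]

/-- `ℝ^n` with the free algebra on `κ` acting by a given tuple of matrices. -/
def TupleModule {κ : Type} (_A : κ → Matrix n n ℝ) : Type := n → ℝ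

namespace TupleModule

variable {κ : Type} (A : κ → Matrix n n ℝ)

instance : AddCommGroup (TupleModule A) := inferInstanceAs (AddCommGroup (n → ℝ))
instance : Module ℝ (TupleModule A) := inferInstanceAs (Module ℝ (n → ℝ))
instance : FiniteDimensional ℝ (TupleModule A) := inferInstanceAs (FiniteDimensional ℝ (n → ℝ))

/-- The action of the free algebra. -/
def action : FreeAlgebra ℝ κ →ₐ[ℝ] Module.End ℝ (TupleModule A) :=
  FreeAlgebra.lift ℝ (A := Module.End ℝ (TupleModule A))
    fun m => (Matrix.toLin' (A m) : (n → ℝ) →ₗ[ℝ] (n → ℝ))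

instance : Module (FreeAlgebra ℝ κ) (TupleModule A) :=
  Module.compHom (TupleModule A) (action A).toRingHom

theorem smul_def (a : FreeAlgebra ℝ κ) (v : TupleModule A) : a • v = action A a v := rfl

instance : IsScalarTower ℝ (FreeAlgebra ℝ κ) (TupleModule A) :=
  ⟨fun c a v => by rw [smul_def, smul_def, map_smul]; rfl⟩

theorem ι_smul (m : κ) (v : TupleModule A) :
    FreeAlgebra.ι ℝ m • v = ((A m).mulVec v : n → ℝ) := by
  have h : action A (FreeAlgebra.ι ℝ m) = (Matrix.toLin' (A m) : (n → ℝ) →ₗ[ℝ] (n → ℝ)) :=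
    FreeAlgebra.lift_ι_apply (A := Module.End ℝ (TupleModule A)) _ m
  rw [smul_def, h]
  exact Matrix.toLin'_apply _ _

/-- A real-linear map commuting with the generators is linear over the free algebra. -/
theorem map_smul_of_generators {V W : Type} [AddCommGroup V] [Module ℝ V]
    [Module (FreeAlgebra ℝ κ) V] [IsScalarTower ℝ (FreeAlgebra ℝ κ) V] [AddCommGroup W] [Module ℝ W]
    [Module (FreeAlgebra ℝ κ) W] [IsScalarTower ℝ (FreeAlgebra ℝ κ) W] (f : V →ₗ[ℝ] W)
    (hf : ∀ (m : κ) (v : V), f (FreeAlgebra.ι ℝ m • v) = FreeAlgebra.ι ℝ m • f v) (a : FreeAlgebra ℝ κ)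
    (v : V) : f (a • v) = a • f v := by
  induction a using FreeAlgebra.induction generalizing v with
  | grade0 r => rw [algebraMap_smul, algebraMap_smul, map_smul]
  | grade1 m => exact hf m v
  | mul a b ha hb => rw [mul_smul, ha, hb, mul_smul]
  | add a b ha hb => rw [add_smul, map_add, ha, hb, add_smul]

/-- The generators are self-adjoint for the dot product, so the orthogonal complement of a submodule
is again a submodule. -/
theorem isSemisimpleModule (hA : ∀ m, (A m).IsSymm) :
    IsSemisimpleModule (FreeAlgebra ℝ κ) (TupleModule A) := by
  suffices hc : ComplementedLattice (Submodule (FreeAlgebra ℝ κ) (TupleModule A)) by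
    exact { toComplementedLattice := hc }
  refine ⟨fun p => ?_⟩
  let B : LinearMap.BilinForm ℝ (n → ℝ) := dotProductBilin ℝ ℝ
  let p' : Submodule ℝ (n → ℝ) := p.restrictScalars ℝ
  have hBr : B.IsRefl := fun x y h => by
    have : x ⬝ᵥ y = 0 := h
    show y ⬝ᵥ x = 0
    rw [dotProduct_comm]; exact this
  have hc : IsCompl p' (B.orthogonal p') := by
    refine LinearMap.BilinForm.isCompl_orthogonal_of_restrict_nondegenerate hBr ?_
    refine (LinearMap.BilinForm.nondegenerate_restrict_of_disjoint_orthogonal _ hBr ?_)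
    rw [Submodule.disjoint_def]
    intro x hx hx'
    have h0 : x ⬝ᵥ x = 0 := hx' x hx
    exact dotProduct_self_eq_zero.1 h0
  let q : Submodule (FreeAlgebra ℝ κ) (TupleModule A) :=
    { carrier := ((B.orthogonal p' : Submodule ℝ (n → ℝ)) : Set (n → ℝ))
      add_mem' := fun ha hb => (B.orthogonal p').add_mem ha hb
      zero_mem' := (B.orthogonal p').zero_mem
      smul_mem' := by
        intro a v hv
        have key : ∀ (a : FreeAlgebra ℝ κ) (v : TupleModule A), v ∈ B.orthogonal p' →
            a • v ∈ B.orthogonal p' := by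
          intro a
          induction a using FreeAlgebra.induction with
          | grade0 r =>
            intro v hv
            rw [algebraMap_smul]
            exact (B.orthogonal p').smul_mem r hv
          | grade1 m =>
            intro v hv u hu
            rw [ι_smul]
            have h1 : ((A m).mulVec u : n → ℝ) ∈ p' := by
              have h1 : ∀ w : TupleModule A, w ∈ p → ((A m).mulVec (w : n → ℝ) : n → ℝ) ∈ p' := by
                intro w hw
                have h2 := p.smul_mem (FreeAlgebra.ι ℝ m) hw
                rw [ι_smul] at h2
                exact h2
              exact h1 u hu
            have h2 : (A m).mulVec u ⬝ᵥ (v : n → ℝ) = 0 := hv _ h1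
            have h3 : ∀ w : n → ℝ, u ⬝ᵥ (A m).mulVec w = (A m).mulVec u ⬝ᵥ w := fun w => by
              rw [Matrix.dotProduct_mulVec, ← Matrix.mulVec_transpose, (hA m).eq]
            exact (h3 v).trans h2
          | mul a b ha hb =>
            intro v hv
            rw [mul_smul]; exact ha _ (hb _ hv)
          | add a b ha hb =>
            intro v hv
            rw [add_smul]; exact (B.orthogonal p').add_mem (ha _ hv) (hb _ hv)
        exact key a v hv }
  refine ⟨q, ?_⟩
  rw [isCompl_iff] at hc ⊢
  constructor
  · rw [Submodule.disjoint_def] at hc ⊢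
    exact hc.1
  · rw [codisjoint_iff] at hc ⊢
    rw [eq_top_iff] at hc ⊢
    intro x _
    obtain ⟨y, hy, z, hz, hyz⟩ := Submodule.mem_sup.1 (hc.2 (x := x) trivial)
    exact Submodule.mem_sup.2 ⟨y, hy, z, hz, hyz⟩

end TupleModule

/-- If `N` copies of two tuples of symmetric matrices are orthogonally equivalent, so are the
tuples. -/
theorem exists_orthogonal_of_kronecker {κ : Type} {A B : κ → Matrix n n ℝ}
    (hA : ∀ m, (A m).IsSymm) (hB : ∀ m, (B m).IsSymm) {N : ℕ} (hN : 1 ≤ N)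
    {Q : Matrix (Fin N × n) (Fin N × n) ℝ} (hQ : Q ∈ Matrix.orthogonalGroup (Fin N × n) ℝ)
    (h : ∀ m, Q.transpose * ((1 : Matrix (Fin N) (Fin N) ℝ) ⊗ₖ B m) * Q =
      (1 : Matrix (Fin N) (Fin N) ℝ) ⊗ₖ A m) :
    ∃ P ∈ Matrix.orthogonalGroup n ℝ, ∀ m, P * A m * P.transpose = B m := by
  have hQ1 := orthogonal_mul_transpose hQ
  have hQ2 := orthogonal_transpose_mul hQ
  have hs1 := TupleModule.isSemisimpleModule A hA
  have hs2 := TupleModule.isSemisimpleModule B hB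
  let cur : (Fin N × n → ℝ) ≃ₗ[ℝ] (Fin N → n → ℝ) := LinearEquiv.curry ℝ ℝ (Fin N) n
  let q : (Fin N × n → ℝ) ≃ₗ[ℝ] (Fin N × n → ℝ) :=
    Matrix.toLin'OfInv hQ2 hQ1
  -- After currying, Q is a map of N-fold powers; Q (1 ⊗ A) = (1 ⊗ B) Q says that it is linear over
  -- the free algebra.
  let e0 : (Fin N → TupleModule A) ≃ₗ[ℝ] (Fin N → TupleModule B) := (cur.symm.trans q).trans cur
  have hkr : ∀ (C : Matrix n n ℝ) (v : Fin N → n → ℝ),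
      ((1 : Matrix (Fin N) (Fin N) ℝ) ⊗ₖ C).mulVec (cur.symm v) =
        cur.symm fun i => C.mulVec (v i) := by
    intro C v
    ext ⟨i, k⟩
    simp only [cur, Matrix.mulVec, dotProduct, Fintype.sum_prod_type, Matrix.kroneckerMap_apply,
      Matrix.one_apply, ite_mul, one_mul, zero_mul]
    rw [Finset.sum_eq_single i]
    · simp [LinearEquiv.curry, Matrix.mulVec, dotProduct]
    · intro j _ hj
      simp [Ne.symm hj]
    · simp
  have hqm : ∀ m, Q * ((1 : Matrix (Fin N) (Fin N) ℝ) ⊗ₖ A m) =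
      ((1 : Matrix (Fin N) (Fin N) ℝ) ⊗ₖ B m) * Q := fun m => by
    rw [← h m, ← Matrix.mul_assoc, ← Matrix.mul_assoc, hQ1, Matrix.one_mul]
  have he1 : ∀ (m : κ) (v : Fin N → n → ℝ),
      cur (Q.mulVec (cur.symm fun i => (A m).mulVec (v i))) =
        fun i => (B m).mulVec (cur (Q.mulVec (cur.symm v)) i) := by
    intro m v
    rw [← hkr, Matrix.mulVec_mulVec, hqm, ← Matrix.mulVec_mulVec]
    have h3 : Q.mulVec (cur.symm v) = cur.symm (cur (Q.mulVec (cur.symm v))) := by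
      rw [LinearEquiv.symm_apply_apply]
    rw [h3, hkr, LinearEquiv.apply_symm_apply, ← h3]
  have he0 : ∀ (m : κ) (v : Fin N → TupleModule A), e0 (FreeAlgebra.ι ℝ m • v) = FreeAlgebra.ι ℝ m • e0 v := by
    intro m v
    have h1 : FreeAlgebra.ι ℝ m • v = (fun i => (A m).mulVec (v i) : Fin N → n → ℝ) :=
      funext fun i => TupleModule.ι_smul A m (v i)
    have h2 : FreeAlgebra.ι ℝ m • e0 v = (fun i => (B m).mulVec (e0 v i) : Fin N → n → ℝ) :=
      funext fun i => TupleModule.ι_smul B m (e0 v i)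
    rw [h2, h1]
    exact he1 m v
  let e : (Fin N → TupleModule A) ≃ₗ[FreeAlgebra ℝ κ] (Fin N → TupleModule B) :=
    { e0 with
      map_smul' := fun a v =>
        TupleModule.map_smul_of_generators e0.toLinearMap he0 a v }
  obtain ⟨f⟩ := nonempty_linearEquiv_of_pi hN (TupleModule A) (TupleModule B) e
  let fl : (n → ℝ) ≃ₗ[ℝ] (n → ℝ) := f.restrictScalars ℝ
  have hfl : ∀ m v, fl ((A m).mulVec v) = (B m).mulVec (fl v) := by
    intro m v
    have h1 : ∀ w : TupleModule A, f ((A m).mulVec (w : n → ℝ) : n → ℝ) =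
        ((B m).mulVec (f w : n → ℝ) : n → ℝ) := fun w => by
      have h2 := f.map_smul (FreeAlgebra.ι ℝ m) w
      rw [TupleModule.ι_smul, TupleModule.ι_smul] at h2
      exact h2
    exact h1 v
  refine exists_orthogonal_of_similar hA hB (X := LinearMap.toMatrix' fl.toLinearMap) ?_ ?_
  · have : LinearMap.det fl.toLinearMap = (LinearMap.toMatrix' fl.toLinearMap).det :=
      (LinearMap.det_toMatrix' _).symm
    rw [← this]
    exact LinearEquiv.isUnit_det' fl
  · intro m
    apply Matrix.toLin'.injective
    rw [Matrix.toLin'_mul, Matrix.toLin'_mul, Matrix.toLin'_toMatrix']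
    refine LinearMap.ext fun v => ?_
    simp only [LinearMap.comp_apply, Matrix.toLin'_apply, LinearEquiv.coe_coe]
    exact hfl m v

end Cancellation

end GNY
end

noncomputable section
namespace GNY

/-! ### Yukawa matrices as linear maps; rotation-invariant tuples -/

namespace Yukawa

variable {M : ℕ} (R : Yukawa M)

theorem at_add (φ ψ : Fin M → ℝ) : R.at (φ + ψ) = R.at φ + R.at ψ := by
  simp [Yukawa.at, add_smul, Finset.sum_add_distrib]

theorem at_smul (c : ℝ) (φ : Fin M → ℝ) : R.at (c • φ) = c • R.at φ := by
  simp [Yukawa.at, mul_smul, Finset.smul_sum]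

theorem at_sub (φ ψ : Fin M → ℝ) : R.at (φ - ψ) = R.at φ - R.at ψ := by
  simp [Yukawa.at, sub_smul, Finset.sum_sub_distrib]

@[simp]
theorem at_single (m : Fin M) : R.at (Pi.single m 1) = R m := by
  rw [Yukawa.at, Finset.sum_eq_single m]
  · simp
  · intro j _ hj
    simp [hj]
  · simp

theorem add_at (S : Yukawa M) (φ : Fin M → ℝ) : Yukawa.at (R + S) φ = R.at φ + S.at φ := by
  simp [Yukawa.at, Finset.sum_add_distrib]

theorem smul_at (c : ℝ) (φ : Fin M → ℝ) : Yukawa.at (c • R) φ = c • R.at φ := by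
  simp [Yukawa.at, Finset.smul_sum, smul_comm c]

theorem at_isSymm (hR : ∀ m, (R m).IsSymm) (φ : Fin M → ℝ) : (R.at φ).IsSymm := by
  rw [Matrix.IsSymm, Yukawa.at, Matrix.transpose_sum]
  refine Finset.sum_congr rfl fun m _ => ?_
  rw [Matrix.transpose_smul, (hR m).eq]

theorem at_linear {f : (Fin M → ℝ) → Matrix (Fin 4) (Fin 4) ℝ}
    (hf : IsLinearMap ℝ f) (h : ∀ m, R m = f (Pi.single m 1)) (φ : Fin M → ℝ) : R.at φ = f φ := by
  have : φ = ∑ m, φ m • (Pi.single m 1 : Fin M → ℝ) := by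
    ext i
    simp [Finset.sum_apply, Pi.single_apply]
  conv_rhs => rw [this]
  rw [Yukawa.at, show f = hf.mk' f from rfl, map_sum]
  refine Finset.sum_congr rfl fun m _ => ?_
  rw [map_smul, h m]; rfl

/-- Change of basis. -/
def conj (T : Matrix (Fin 4) (Fin 4) ℝ) : Yukawa M := fun m => T * R m * T.transpose

theorem conj_at (T : Matrix (Fin 4) (Fin 4) ℝ) (φ : Fin M → ℝ) :
    (R.conj T).at φ = T * R.at φ * T.transpose := by
  simp [Yukawa.at, conj, Finset.mul_sum, Finset.sum_mul]

theorem conj_isSymm (hR : ∀ m, (R m).IsSymm) (T : Matrix (Fin 4) (Fin 4) ℝ) (m : Fin M) :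
    (R.conj T m).IsSymm := by
  rw [Matrix.IsSymm, conj, Matrix.transpose_mul, Matrix.transpose_mul, Matrix.transpose_transpose,
    (hR m).eq, Matrix.mul_assoc]

end Yukawa

section RotInvariant

variable {M : ℕ}

theorem yukawaEquiv_conj (R : Yukawa M) {T : Matrix (Fin 4) (Fin 4) ℝ}
    (hT : T ∈ Matrix.orthogonalGroup (Fin 4) ℝ) : YukawaEquiv R (R.conj T) :=
  ⟨T, hT, fun _ => rfl⟩

theorem YukawaEquiv.refl (R : Yukawa M) : YukawaEquiv R R :=
  ⟨1, one_mem _, fun m => by simp⟩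

theorem YukawaEquiv.symm {R S : Yukawa M} (h : YukawaEquiv R S) : YukawaEquiv S R := by
  obtain ⟨P, hP, h⟩ := h
  refine ⟨P.transpose, transpose_mem_orthogonal hP, fun m => ?_⟩
  have h1 := orthogonal_transpose_mul hP
  rw [← h m, Matrix.transpose_transpose]
  calc _ = (P.transpose * P) * R m * (P.transpose * P) := by simp only [Matrix.mul_assoc]
    _ = _ := by rw [h1, Matrix.one_mul, Matrix.mul_one]

theorem YukawaEquiv.trans {R S U : Yukawa M} (h : YukawaEquiv R S) (h' : YukawaEquiv S U) :
    YukawaEquiv R U := by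
  obtain ⟨P, hP, h⟩ := h
  obtain ⟨P', hP', h'⟩ := h'
  refine ⟨P' * P, mul_mem hP' hP, fun m => ?_⟩
  rw [← h' m, ← h m, Matrix.transpose_mul]
  simp only [Matrix.mul_assoc]

theorem YukawaEquiv.smul {R S : Yukawa M} (h : YukawaEquiv R S) (c : ℝ) :
    YukawaEquiv (c • R) (c • S) := by
  obtain ⟨P, hP, h⟩ := h
  refine ⟨P, hP, fun m => ?_⟩
  rw [Pi.smul_apply, Pi.smul_apply, ← h m]
  simp

/-- Every rotation of the scalars extends to a symmetry acting on one copy of `ℝ⁴`. -/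
def RotInvariant (R : Yukawa M) : Prop :=
  ∀ Ω ∈ Matrix.specialOrthogonalGroup (Fin M) ℝ, ∃ P ∈ Matrix.orthogonalGroup (Fin 4) ℝ,
    ∀ φ, P * R.at φ * P.transpose = R.at (Ω.mulVec φ)

/-- For fixed Ω, the tuples R and m ↦ R(Ω eₘ) are symmetric and become orthogonally equivalent after
taking `N` copies, so they are equivalent already on ℝ⁴. -/
theorem RotInvariant.of_soUnbroken {N : ℕ} (hN : 1 ≤ N) {R : Yukawa M} (hR : ∀ m, (R m).IsSymm)
    (h : SOUnbroken N R) : RotInvariant R := by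
  intro Ω hΩ
  obtain ⟨Q, hQ, hs⟩ := h Ω hΩ
  obtain ⟨P, hP, h1⟩ := exists_orthogonal_of_kronecker (A := R)
    (B := fun m => R.at (Ω.mulVec (Pi.single m 1))) hR (fun m => R.at_isSymm hR _) hN hQ
    (fun m => by rw [hs, R.at_single])
  refine ⟨P, hP, fun φ => ?_⟩
  have hlin : IsLinearMap ℝ fun φ => R.at (Ω.mulVec φ) :=
    ⟨fun φ ψ => by rw [Matrix.mulVec_add, R.at_add], fun c φ => by
      rw [Matrix.mulVec_smul, R.at_smul]⟩
  rw [← R.conj_at]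
  exact Yukawa.at_linear (R.conj P) hlin (fun m => h1 m) φ

theorem RotInvariant.of_transformsAsVec {ρ : SpinRep M} {R : Yukawa M}
    (h : TransformsAsVec ρ R) : RotInvariant R := by
  intro Ω hΩ
  obtain ⟨x, hx⟩ := exists_vec_eq hΩ
  exact ⟨ρ.mat x, (ρ.toHom x).2, fun φ => by rw [h x φ, hx]⟩

theorem soUnbroken_of_transformsAsVec {ρ : SpinRep M} {R : Yukawa M} (N : ℕ)
    (h : TransformsAsVec ρ R) : SOUnbroken N R := by
  intro Ω hΩ
  obtain ⟨P, hP, hPR⟩ := RotInvariant.of_transformsAsVec h Ω hΩ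
  have h1 := orthogonal_transpose_mul hP
  have h2 := orthogonal_mul_transpose hP
  have ht : ((1 : Matrix (Fin N) (Fin N) ℝ) ⊗ₖ P).transpose =
      (1 : Matrix (Fin N) (Fin N) ℝ) ⊗ₖ P.transpose := by
    rw [← Matrix.kroneckerMap_transpose, Matrix.transpose_one]
  refine ⟨(1 : Matrix (Fin N) (Fin N) ℝ) ⊗ₖ P, ?_, fun φ => ?_⟩
  · rw [Matrix.mem_orthogonalGroup_iff]
    show _ * ((1 : Matrix (Fin N) (Fin N) ℝ) ⊗ₖ P).transpose = 1
    rw [ht, ← Matrix.mul_kronecker_mul, h2, mul_one, Matrix.one_kronecker_one]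
  · rw [ht, ← Matrix.mul_kronecker_mul, ← Matrix.mul_kronecker_mul, ← hPR φ]
    congr 1
    · simp
    · calc _ = (P.transpose * P) * R.at φ * (P.transpose * P) := by simp only [Matrix.mul_assoc]
        _ = _ := by rw [h1, Matrix.one_mul, Matrix.mul_one]

theorem RotInvariant.conj {R : Yukawa M} (h : RotInvariant R) {T : Matrix (Fin 4) (Fin 4) ℝ}
    (hT : T ∈ Matrix.orthogonalGroup (Fin 4) ℝ) : RotInvariant (R.conj T) := by
  intro Ω hΩ
  obtain ⟨P, hP, hPR⟩ := h Ω hΩ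
  have h1 := orthogonal_transpose_mul hT
  refine ⟨T * P * T.transpose, mul_mem (mul_mem hT hP) (transpose_mem_orthogonal hT), fun φ => ?_⟩
  rw [R.conj_at, R.conj_at, ← hPR]
  simp only [Matrix.transpose_mul, Matrix.transpose_transpose]
  calc _ = T * P * (T.transpose * T) * R.at φ * (T.transpose * T) * P.transpose * T.transpose := by
        simp only [Matrix.mul_assoc]
    _ = _ := by rw [h1, Matrix.mul_one, Matrix.mul_one]; simp only [Matrix.mul_assoc]

theorem single_dotProduct_single (i : Fin M) :
    (Pi.single i 1 : Fin M → ℝ) ⬝ᵥ Pi.single i 1 = 1 := by simp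

/-- All matrices `R(φ)` with `φ` a unit vector are orthogonally equivalent. -/
theorem RotInvariant.exists_conj_unit {R : Yukawa M} (h : RotInvariant R) (hM : 2 ≤ M)
    {u w : Fin M → ℝ} (hu : u ⬝ᵥ u = 1) (hw : w ⬝ᵥ w = 1) :
    ∃ P ∈ Matrix.orthogonalGroup (Fin 4) ℝ, P * R.at u * P.transpose = R.at w := by
  obtain ⟨Ω, hΩ, h1⟩ := exists_rotation_of_two_le hM hu hw
  obtain ⟨P, hP, h2⟩ := h Ω hΩ
  exact ⟨P, hP, by rw [h2, h1]⟩

theorem exists_smul_unit (φ : Fin M → ℝ) (hφ : φ ≠ 0) :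
    ∃ (r : ℝ) (u : Fin M → ℝ), u ⬝ᵥ u = 1 ∧ φ = r • u ∧ r ^ 2 = φ ⬝ᵥ φ := by
  have hp : 0 < φ ⬝ᵥ φ := by
    have := Matrix.dotProduct_star_self_pos_iff (v := φ)
    simpa using this.2 hφ
  refine ⟨Real.sqrt (φ ⬝ᵥ φ), (Real.sqrt (φ ⬝ᵥ φ))⁻¹ • φ, ?_, ?_, Real.sq_sqrt hp.le⟩
  · rw [smul_dotProduct, dotProduct_smul, smul_smul, smul_eq_mul, ← mul_inv,
      Real.mul_self_sqrt hp.le, inv_mul_cancel₀ hp.ne']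
  · rw [smul_smul, mul_inv_cancel₀ (Real.sqrt_pos.2 hp).ne', one_smul]

/-- A polynomial identity for one unit vector holds for all. -/
theorem RotInvariant.sq_eq {R : Yukawa M} (h : RotInvariant R) (hM : 2 ≤ M) {i : Fin M} {c : ℝ}
    (hi : R i * R i = c • (1 : Matrix (Fin 4) (Fin 4) ℝ)) (φ : Fin M → ℝ) :
    R.at φ * R.at φ = (c * (φ ⬝ᵥ φ)) • (1 : Matrix (Fin 4) (Fin 4) ℝ) := by
  by_cases hφ : φ = 0
  · subst hφ
    simp [Yukawa.at]
  obtain ⟨r, u, hu, hru, hr⟩ := exists_smul_unit φ hφ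
  obtain ⟨P, hP, hPu⟩ := h.exists_conj_unit hM (single_dotProduct_single i) hu
  have h1 := orthogonal_transpose_mul hP
  have h2 := orthogonal_mul_transpose hP
  rw [R.at_single] at hPu
  rw [← hr, hru, R.at_smul, ← hPu]
  have : P * R i * P.transpose * (P * R i * P.transpose) = c • (1 : Matrix (Fin 4) (Fin 4) ℝ) := by
    calc _ = P * R i * (P.transpose * P) * R i * P.transpose := by simp only [Matrix.mul_assoc]
      _ = P * (R i * R i) * P.transpose := by
        rw [h1, Matrix.mul_one]; simp only [Matrix.mul_assoc]
      _ = _ := by rw [hi, Matrix.mul_smul, Matrix.smul_mul, Matrix.mul_one, h2]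
  rw [Matrix.smul_mul, Matrix.mul_smul, this, smul_smul, smul_smul]
  congr 1
  ring

/-- All unit vectors give similar matrices, so the identity passes from one direction to all of
them; homogeneity supplies the factor |φ|². -/
theorem RotInvariant.cube_eq {R : Yukawa M} (h : RotInvariant R) (hM : 2 ≤ M) {i : Fin M} {c : ℝ}
    (hi : R i * R i * R i = c • R i) (φ : Fin M → ℝ) :
    R.at φ * R.at φ * R.at φ = (c * (φ ⬝ᵥ φ)) • R.at φ := by
  by_cases hφ : φ = 0
  · subst hφ
    simp [Yukawa.at]
  obtain ⟨r, u, hu, hru, hr⟩ := exists_smul_unit φ hφ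
  obtain ⟨P, hP, hPu⟩ := h.exists_conj_unit hM (single_dotProduct_single i) hu
  have h1 := orthogonal_transpose_mul hP
  rw [R.at_single] at hPu
  rw [← hr, hru, R.at_smul, ← hPu]
  have : P * R i * P.transpose * (P * R i * P.transpose) * (P * R i * P.transpose) =
      c • (P * R i * P.transpose) := by
    calc _ = P * R i * (P.transpose * P) * R i * (P.transpose * P) * R i * P.transpose := by
          simp only [Matrix.mul_assoc]
      _ = P * (R i * R i * R i) * P.transpose := by
        rw [h1, Matrix.mul_one, Matrix.mul_one]; simp only [Matrix.mul_assoc]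
      _ = _ := by rw [hi, Matrix.mul_smul, Matrix.smul_mul]
  simp only [Matrix.smul_mul, Matrix.mul_smul, smul_smul]
  rw [this, smul_smul]
  congr 1
  ring

/-- For M ≥ 2 some rotation takes the i-th basis vector to its negative, so R i is similar to -R i
and the traces of its odd powers vanish. -/
theorem RotInvariant.trace_eq_zero {R : Yukawa M} (h : RotInvariant R) (hM : 2 ≤ M)
    (i : Fin M) : (R i).trace = 0 ∧ (R i * R i * R i).trace = 0 := by
  have hn : (-Pi.single i 1 : Fin M → ℝ) ⬝ᵥ -Pi.single i 1 = 1 := by simp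
  obtain ⟨P, hP, hPu⟩ := h.exists_conj_unit hM (single_dotProduct_single i) hn
  have h1 := orthogonal_transpose_mul hP
  have h2 : R.at (-Pi.single i 1 : Fin M → ℝ) = - R i := by
    rw [show (-Pi.single i 1 : Fin M → ℝ) = (-1 : ℝ) • Pi.single i 1 by simp, R.at_smul,
      R.at_single, neg_one_smul]
  rw [R.at_single, h2] at hPu
  constructor
  · have := congrArg Matrix.trace hPu
    rw [Matrix.trace_mul_comm, ← Matrix.mul_assoc, h1, Matrix.one_mul, Matrix.trace_neg] at this
    linarith
  · have h3 : P * (R i * R i * R i) * P.transpose = - (R i * R i * R i) := by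
      calc _ = (P * R i * P.transpose) * (P * R i * P.transpose) * (P * R i * P.transpose) := by
            symm
            calc _ = P * R i * (P.transpose * P) * R i * (P.transpose * P) * R i * P.transpose := by
                  simp only [Matrix.mul_assoc]
              _ = _ := by rw [h1, Matrix.mul_one, Matrix.mul_one]; simp only [Matrix.mul_assoc]
        _ = _ := by rw [hPu]; simp
    have := congrArg Matrix.trace h3
    rw [Matrix.trace_mul_comm, ← Matrix.mul_assoc, h1, Matrix.one_mul, Matrix.trace_neg] at this
    linarith

theorem submatrix_perm_mem_orthogonal {T : Matrix (Fin 4) (Fin 4) ℝ}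
    (hT : T ∈ Matrix.orthogonalGroup (Fin 4) ℝ) (σ : Equiv.Perm (Fin 4)) :
    T.submatrix σ id ∈ Matrix.orthogonalGroup (Fin 4) ℝ := by
  rw [Matrix.mem_orthogonalGroup_iff]
  show T.submatrix σ id * (T.submatrix σ id).transpose = 1
  rw [Matrix.transpose_submatrix, ← Matrix.submatrix_mul T T.transpose σ id σ
    Function.bijective_id, orthogonal_mul_transpose hT, Matrix.submatrix_one_equiv]

/-- When the sum vanishes, the sum of cubes equals 3 (d₀ + d₁)(d₀ + d₂)(d₀ + d₃), so d₀ cancels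
another entry, and the remaining two cancel each other. The last clause is a normalization: x
vanishes only if all entries do. -/
theorem exists_perm_pairs (d : Fin 4 → ℝ) (h1 : ∑ i, d i = 0) (h3 : ∑ i, d i ^ 3 = 0) :
    ∃ (σ : Equiv.Perm (Fin 4)) (x y : ℝ), d ∘ σ = ![x, -x, y, -y] ∧ (x = 0 → y = 0) := by
  have main : ∃ (σ : Equiv.Perm (Fin 4)) (x y : ℝ), d ∘ σ = ![x, -x, y, -y] := by
    rw [Fin.sum_univ_four] at h1 h3
    have hp : (d 0 + d 1) * ((d 0 + d 2) * (d 0 + d 3)) = 0 := by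
      have : d 3 = -(d 0 + d 1 + d 2) := by linarith
      rw [this] at h3 ⊢
      nlinarith
    rcases mul_eq_zero.1 hp with h | h
    · refine ⟨1, d 0, d 2, funext fun i => ?_⟩
      fin_cases i <;> simp <;> linarith
    rcases mul_eq_zero.1 h with h | h
    · refine ⟨Equiv.swap 1 2, d 0, d 1, funext fun i => ?_⟩
      have e3 : (Equiv.swap 1 2 : Equiv.Perm (Fin 4)) 3 = 3 := by decide
      have e0 : (Equiv.swap 1 2 : Equiv.Perm (Fin 4)) 0 = 0 := by decide
      fin_cases i <;> simp [e3, e0] <;> linarith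
    · refine ⟨Equiv.swap 1 3, d 0, d 2, funext fun i => ?_⟩
      have e3 : (Equiv.swap 1 3 : Equiv.Perm (Fin 4)) 2 = 2 := by decide
      have e0 : (Equiv.swap 1 3 : Equiv.Perm (Fin 4)) 0 = 0 := by decide
      fin_cases i <;> simp [e3, e0] <;> linarith
  obtain ⟨σ, x, y, h⟩ := main
  by_cases hx : x = 0
  · refine ⟨(Equiv.swap 0 2 * Equiv.swap 1 3 : Equiv.Perm (Fin 4)).trans σ, y, x, ?_,
      fun _ => hx⟩
    have e : ∀ i, d (σ i) = ![x, -x, y, -y] i := fun i => congrFun h i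
    have e0 : (Equiv.swap 0 2 * Equiv.swap 1 3 : Equiv.Perm (Fin 4)) 0 = 2 := by decide
    have e1 : (Equiv.swap 0 2 * Equiv.swap 1 3 : Equiv.Perm (Fin 4)) 1 = 3 := by decide
    have e2 : (Equiv.swap 0 2 * Equiv.swap 1 3 : Equiv.Perm (Fin 4)) 2 = 0 := by decide
    have e3 : (Equiv.swap 0 2 * Equiv.swap 1 3 : Equiv.Perm (Fin 4)) 3 = 1 := by decide
    funext i
    rw [Function.comp_apply, Equiv.trans_apply, e]
    fin_cases i
    · simp only [Fin.zero_eta, e0]; simp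
    · simp only [Fin.mk_one, e1]; simp
    · simp only [Fin.reduceFinMk, e2]; simp
    · simp only [Fin.reduceFinMk, e3]; simp
  · exact ⟨σ, x, y, h, fun h0 => absurd h0 hx⟩

/-- The spectrum of `R(φ)` is symmetric about zero. -/
theorem RotInvariant.exists_diagonal {R : Yukawa M} (h : RotInvariant R) (hM : 2 ≤ M)
    (hR : ∀ m, (R m).IsSymm) (i : Fin M) :
    ∃ T ∈ Matrix.orthogonalGroup (Fin 4) ℝ, ∃ x y : ℝ, (x = 0 → y = 0) ∧
      R.conj T i = Matrix.diagonal ![x, -x, y, -y] := by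
  obtain ⟨T, hT, d, hd⟩ := exists_diagonalization (hR i)
  obtain ⟨t1, t3⟩ := h.trace_eq_zero hM i
  have h1 := orthogonal_transpose_mul hT
  have hd1 : ∑ i, d i = 0 := by
    rw [hd, Matrix.trace_mul_comm, ← Matrix.mul_assoc, h1, Matrix.one_mul,
      Matrix.trace_diagonal] at t1
    exact t1
  have hd3 : ∑ i, d i ^ 3 = 0 := by
    have : R i * R i * R i = T * Matrix.diagonal (fun i => d i ^ 3) * T.transpose := by
      rw [hd]
      calc _ = T * Matrix.diagonal d * (T.transpose * T) * Matrix.diagonal d * (T.transpose * T) *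
            Matrix.diagonal d * T.transpose := by simp only [Matrix.mul_assoc]
        _ = T * (Matrix.diagonal d * Matrix.diagonal d * Matrix.diagonal d) * T.transpose := by
            rw [h1, Matrix.mul_one, Matrix.mul_one]; simp only [Matrix.mul_assoc]
        _ = _ := by
            rw [Matrix.diagonal_mul_diagonal, Matrix.diagonal_mul_diagonal]
            congr 3
            funext i
            ring
    rw [this, Matrix.trace_mul_comm, ← Matrix.mul_assoc, h1, Matrix.one_mul,
      Matrix.trace_diagonal] at t3
    exact t3
  obtain ⟨σ, x, y, hσ, hxy⟩ := exists_perm_pairs d hd1 hd3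
  refine ⟨T.transpose.submatrix σ id,
    submatrix_perm_mem_orthogonal (transpose_mem_orthogonal hT) σ, x, y, hxy, ?_⟩
  rw [Yukawa.conj, ← hσ, Matrix.transpose_submatrix, Matrix.transpose_transpose]
  have : T.transpose.submatrix σ id * R i * T.submatrix id σ =
      (T.transpose * R i * T).submatrix σ σ := by
    ext a b
    simp [Matrix.mul_apply]
  rw [this, hd]
  have : T.transpose * (T * Matrix.diagonal d * T.transpose) * T = Matrix.diagonal d := by
    calc _ = (T.transpose * T) * Matrix.diagonal d * (T.transpose * T) := by
          simp only [Matrix.mul_assoc]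
      _ = _ := by rw [h1, Matrix.one_mul, Matrix.mul_one]
  rw [this]
  ext a b
  simp [Matrix.diagonal_apply]

theorem RotInvariant.eq_zero_of_apply_eq_zero {R : Yukawa M} (h : RotInvariant R) (hM : 2 ≤ M)
    {i : Fin M} (hi : R i = 0) : R = 0 := by
  funext j
  obtain ⟨P, hP, hPu⟩ := h.exists_conj_unit hM (single_dotProduct_single i)
    (single_dotProduct_single j)
  rw [R.at_single, R.at_single, hi] at hPu
  rw [← hPu]; simp

/-- For `M ≥ 3` the matrices `R(φ)` have degenerate eigenvalues. -/
theorem RotInvariant.not_injective_diagonal {R : Yukawa M} (h : RotInvariant R)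
    {i j k : Fin M} (hij : i ≠ j) (hik : i ≠ k) (hjk : j ≠ k) {d : Fin 4 → ℝ}
    (hd : R i = Matrix.diagonal d) : ¬ Function.Injective d := by
  intro hinj
  -- A rotation fixing the i-th direction lifts to a matrix commuting with a diagonal matrix with
  -- distinct entries, hence to a diagonal matrix of signs. The squares of the entries of R(w)
  -- therefore do not change along the sphere orthogonal to that direction.
  have key : ∀ w w' : Fin M → ℝ, w ⬝ᵥ w = 1 → w' ⬝ᵥ w' = 1 → w i = 0 → w' i = 0 → w + w' ≠ 0 →
      ∀ a b, (R.at w' a b) ^ 2 = (R.at w a b) ^ 2 := by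
    intro w w' hw hw' hwi hwi' hne a b
    obtain ⟨Ω, hΩ, h1, h2⟩ := exists_rotation hw hw' hne
    obtain ⟨P, hP, hPR⟩ := h Ω hΩ
    have hp1 := orthogonal_transpose_mul hP
    have hp2 := orthogonal_mul_transpose hP
    have hfix : P * R i = R i * P := by
      have := hPR (Pi.single i 1)
      rw [h2 _ (by simpa using hwi) (by simpa using hwi'), R.at_single] at this
      calc P * R i = P * R i * (P.transpose * P) := by rw [hp1, Matrix.mul_one]
        _ = (P * R i * P.transpose) * P := by simp only [Matrix.mul_assoc]
        _ = _ := by rw [this]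
    have hoff : ∀ a b, a ≠ b → P a b = 0 := by
      intro a b hab
      have := congrFun (congrFun hfix a) b
      rw [hd, Matrix.mul_diagonal, Matrix.diagonal_mul] at this
      have h0 : (d b - d a) * P a b = 0 := by linarith
      exact (mul_eq_zero.1 h0).resolve_left (sub_ne_zero.2 fun h' => hab (hinj h'.symm))
    have hPd : P = Matrix.diagonal fun a => P a a := by
      ext a b
      by_cases hab : a = b
      · subst hab; simp
      · rw [hoff a b hab, Matrix.diagonal_apply_ne _ hab]
    have hsq : ∀ a, P a a ^ 2 = 1 := by
      intro a
      have := congrFun (congrFun hp2 a) a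
      rw [hPd, Matrix.diagonal_transpose, Matrix.diagonal_mul_diagonal] at this
      simp at this
      nlinarith
    have hw2 := congrFun (congrFun (hPR w) a) b
    rw [h1, hPd, Matrix.diagonal_transpose, Matrix.mul_diagonal, Matrix.diagonal_mul] at hw2
    rw [← hw2, mul_pow, mul_pow, hsq, hsq]
    ring
  have hjk' : (Pi.single j 1 : Fin M → ℝ) ⬝ᵥ Pi.single k 1 = 0 := by simp [hjk]
  set s : ℝ := (Real.sqrt 2)⁻¹ with hs
  have hss : s * s = 1 / 2 := by
    rw [hs, ← mul_inv, Real.mul_self_sqrt (by norm_num)]; norm_num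
  have hspos : 0 < s := by positivity
  -- Comparing the entries of R at eⱼ, eₖ and (eⱼ + eₖ)/√2, the cross term must vanish while the
  -- squares agree, so R j = 0.
  set w : Fin M → ℝ := s • (Pi.single j 1 + Pi.single k 1) with hw
  have hw1 : w ⬝ᵥ w = 1 := by
    rw [hw, smul_dotProduct, dotProduct_smul, smul_smul, hss]
    simp [hjk, hjk.symm]
    norm_num
  have hRj : R j = 0 := by
    ext a b
    have e1 := key (Pi.single j 1) (Pi.single k 1) (by simp) (by simp) (by simp [hij])
      (by simp [hik]) (fun h0 => by
        have := congrFun h0 j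
        simp [hjk] at this) a b
    have e2 := key (Pi.single j 1) w (by simp) hw1 (by simp [hij])
      (by simp [hw, hik, hij]) (fun h0 => by
        have := congrFun h0 j
        simp [hw, hjk] at this
        linarith) a b
    rw [R.at_single, R.at_single] at e1
    rw [hw, R.at_smul, R.at_add, R.at_single, R.at_single] at e2
    simp only [Matrix.smul_apply, Matrix.add_apply, smul_eq_mul, mul_pow] at e2
    rw [sq s, hss] at e2
    have e3 : R j a b * R k a b = 0 := by nlinarith
    rcases mul_eq_zero.1 e3 with h' | h'
    · simpa using h'
    · rw [h'] at e1
      have : R j a b = 0 := by nlinarith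
      simpa using this
  have hM2 : 2 ≤ M := by
    by_contra hlt
    have := i.2; have := j.2
    exact hij (Fin.ext (by omega))
  have h0 := h.eq_zero_of_apply_eq_zero hM2 hRj
  have : Matrix.diagonal d = 0 := by rw [← hd, h0]; rfl
  have h01 : d 0 = d 1 := by
    have a0 := congrFun (congrFun this 0) 0
    have a1 := congrFun (congrFun this 1) 1
    simp at a0 a1
    rw [a0, a1]
  exact absurd (hinj h01) (by decide)

end RotInvariant

end GNY
end

noncomputable section
namespace GNY

/-! ### Classification for `M ≥ 3` -/

section Classification

variable {M : ℕ}

/-- The tuple with `R(φ)` exchanging a fixed unit vector and `φ`, for `ℝ⁴ = ℝ ⊕ ℝ³`. -/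
def mixedYukawa : Yukawa 3 :=
  ![!![0, 1, 0, 0; 1, 0, 0, 0; 0, 0, 0, 0; 0, 0, 0, 0],
    !![0, 0, 1, 0; 0, 0, 0, 0; 1, 0, 0, 0; 0, 0, 0, 0],
    !![0, 0, 0, 1; 0, 0, 0, 0; 0, 0, 0, 0; 1, 0, 0, 0]]

/-- The tuple of real symmetric Pauli-type matrices on `ℝ⁴`. -/
def diracYukawa : Yukawa 3 :=
  ![!![1, 0, 0, 0; 0, -1, 0, 0; 0, 0, -1, 0; 0, 0, 0, 1],
    !![0, 1, 0, 0; 1, 0, 0, 0; 0, 0, 0, 1; 0, 0, 1, 0],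
    !![0, 0, 1, 0; 0, 0, 0, -1; 1, 0, 0, 0; 0, -1, 0, 0]]

theorem YukawaEquiv.of_frame {R S : Yukawa M} {W : Matrix (Fin 4) (Fin 4) ℝ}
    (hW : W.transpose * W = 1) (h : ∀ m, R m * W = W * S m) : YukawaEquiv R S := by
  refine ⟨W.transpose, transpose_mem_orthogonal ((Matrix.mem_orthogonalGroup_iff' _ _).2 hW),
    fun m => ?_⟩
  rw [Matrix.transpose_transpose, Matrix.mul_assoc, h m, ← Matrix.mul_assoc, hW, Matrix.one_mul]

/-- Consequences of `R(φ)³ = x²|φ|² R(φ)` for the components orthogonal to the `i`-th. -/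
theorem cube_polarization {R : Yukawa M} {i : Fin M} {c : ℝ}
    (h : ∀ φ, R.at φ * R.at φ * R.at φ = (c * (φ ⬝ᵥ φ)) • R.at φ) (ψ : Fin M → ℝ)
    (hψ : ψ i = 0) :
    R i * R i * R.at ψ + R i * R.at ψ * R i + R.at ψ * R i * R i = c • R.at ψ ∧
    R i * R.at ψ * R.at ψ + R.at ψ * R i * R.at ψ + R.at ψ * R.at ψ * R i =
      (c * (ψ ⬝ᵥ ψ)) • R i := by
  have h0 := h (Pi.single i 1)
  have h1 := h ψ
  have h2 := h (Pi.single i 1 + ψ)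
  have h3 := h (Pi.single i 1 - ψ)
  have d2 : (Pi.single i 1 + ψ : Fin M → ℝ) ⬝ᵥ (Pi.single i 1 + ψ) = 1 + ψ ⬝ᵥ ψ := by
    simp [hψ]
  have d3 : (Pi.single i 1 - ψ : Fin M → ℝ) ⬝ᵥ (Pi.single i 1 - ψ) = 1 + ψ ⬝ᵥ ψ := by
    simp [hψ, sub_eq_add_neg]
  rw [d2, R.at_add, R.at_single] at h2
  rw [d3, R.at_sub, R.at_single] at h3
  rw [R.at_single, single_dotProduct_single, mul_one] at h0
  set A := R i
  set X := R.at ψ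
  set q := ψ ⬝ᵥ ψ
  constructor
  -- The difference of the cubes of A ± X isolates the odd degrees in X; below, the sum isolates the
  -- even ones.
  · have e : (2 : ℝ) • (A * A * X + A * X * A + X * A * A) + (2 : ℝ) • (X * X * X) =
        (A + X) * (A + X) * (A + X) - (A - X) * (A - X) * (A - X) := by
      simp only [two_smul]; noncomm_ring
    rw [h1, h2, h3] at e
    have e' : (2 : ℝ) • (A * A * X + A * X * A + X * A * A) = (2 : ℝ) • (c • X) := by
      rw [eq_sub_of_add_eq e]; module
    exact smul_right_injective _ (two_ne_zero) e'
  · have e : (2 : ℝ) • (A * X * X + X * A * X + X * X * A) + (2 : ℝ) • (A * A * A) =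
        (A + X) * (A + X) * (A + X) + (A - X) * (A - X) * (A - X) := by
      simp only [two_smul]; noncomm_ring
    rw [h0, h2, h3] at e
    have e' : (2 : ℝ) • (A * X * X + X * A * X + X * X * A) = (2 : ℝ) • ((c * q) • A) := by
      rw [eq_sub_of_add_eq e]; module
    exact smul_right_injective _ (two_ne_zero) e'

/-- The shape of `R(ψ)`, `ψ` orthogonal to the direction `i` in which `R` is
`diag(x, -x, 0, 0)`. -/
theorem entries_of_cube {A X : Matrix (Fin 4) (Fin 4) ℝ} {x q : ℝ} (hx : x ≠ 0)
    (hA : A = Matrix.diagonal ![x, -x, 0, 0]) (hX : X.IsSymm)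
    (h1 : A * A * X + A * X * A + X * A * A = x ^ 2 • X)
    (h2 : A * X * X + X * A * X + X * X * A = (x ^ 2 * q) • A)
    (h3 : (X * X * X).trace = 0) :
    X 0 0 = 0 ∧ X 1 1 = 0 ∧ X 2 2 = 0 ∧ X 2 3 = 0 ∧ X 3 3 = 0 ∧
      X 0 1 ^ 2 + 2 * (X 0 2 ^ 2 + X 0 3 ^ 2) = x ^ 2 * q ∧
      X 0 2 ^ 2 = X 1 2 ^ 2 ∧ X 0 2 * X 0 3 = X 1 2 * X 1 3 ∧ X 0 3 ^ 2 = X 1 3 ^ 2 ∧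
      (X 0 1 = 0 ∨ (X 0 2 = 0 ∧ X 0 3 = 0)) := by
  have s : ∀ a b, X a b = X b a := fun a b => (congrFun (congrFun hX b) a)
  have hx2 : x ^ 2 ≠ 0 := pow_ne_zero 2 hx
  have E1 : ∀ a b, (A * A * X + A * X * A + X * A * A) a b = x ^ 2 * X a b := fun a b => by
    rw [h1]; rfl
  have E2 : ∀ a b, (A * X * X + X * A * X + X * X * A) a b = (x ^ 2 * q) * A a b := fun a b => by
    rw [h2]; rfl
  subst hA
  -- Entrywise, (dₐ² + dₐ d_b + d_b²) X_ab = x² X_ab for the eigenvalues d of A. The factor is 3x²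
  -- at (0,0) and (1,1) and zero on the kernel of A, so those entries of X vanish; at the other
  -- places it is x² and gives nothing.
  have f : ∀ a b, (![x, -x, 0, 0] a * ![x, -x, 0, 0] a + ![x, -x, 0, 0] a * ![x, -x, 0, 0] b +
      ![x, -x, 0, 0] b * ![x, -x, 0, 0] b) * X a b = x ^ 2 * X a b := by
    intro a b
    rw [← E1 a b]
    simp only [Matrix.add_apply, Matrix.mul_diagonal, Matrix.diagonal_mul_diagonal,
      Matrix.diagonal_mul]
    ring
  have x00 : X 0 0 = 0 := by
    have := f 0 0
    simp at this
    rcases this with h | h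
    · exact absurd (show x ^ 2 = 0 by nlinarith) hx2
    · exact h
  have x11 : X 1 1 = 0 := by
    have := f 1 1
    simp at this
    rcases this with h | h
    · exact absurd (show x ^ 2 = 0 by nlinarith) hx2
    · exact h
  have z : ∀ a b, ![x, -x, 0, 0] a = 0 → ![x, -x, 0, 0] b = 0 → X a b = 0 := by
    intro a b ha hb
    have := f a b
    rw [ha, hb] at this
    have h : x ^ 2 * X a b = 0 := by linarith
    exact (mul_eq_zero.1 h).resolve_left hx2
  have x22 : X 2 2 = 0 := z 2 2 rfl rfl
  have x23 : X 2 3 = 0 := z 2 3 rfl rfl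
  have x33 : X 3 3 = 0 := z 3 3 rfl rfl
  have g : ∀ a b, (![x, -x, 0, 0] a + ![x, -x, 0, 0] b) *
      (X a 0 * X 0 b + X a 1 * X 1 b + X a 2 * X 2 b + X a 3 * X 3 b) +
      x * (X a 0 * X 0 b - X a 1 * X 1 b) =
        x ^ 2 * q * Matrix.diagonal ![x, -x, 0, 0] a b := by
    intro a b
    rw [← E2 a b]
    simp only [Matrix.add_apply, Matrix.mul_assoc, Matrix.diagonal_mul]
    simp only [← Matrix.mul_assoc, Matrix.mul_diagonal]
    simp only [Matrix.mul_apply, Fin.sum_univ_four]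
    simp
    ring
  have cancel : ∀ u v : ℝ, x * u = x * v → u = v := fun u v h => mul_left_cancel₀ hx h
  have g00 : X 0 1 ^ 2 + 2 * (X 0 2 ^ 2 + X 0 3 ^ 2) = x ^ 2 * q := by
    have := g 0 0
    simp [x00, s 1 0, s 2 0, s 3 0] at this
    apply cancel
    linarith
  have g22 : X 0 2 ^ 2 = X 1 2 ^ 2 := by
    have := g 2 2
    simp [s 2 0, s 2 1, hx] at this
    linarith
  have g33 : X 0 3 ^ 2 = X 1 3 ^ 2 := by
    have := g 3 3
    simp [s 3 0, s 3 1, hx] at this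
    linarith
  have g23 : X 0 2 * X 0 3 = X 1 2 * X 1 3 := by
    have := g 2 3
    simp [s 2 0, s 2 1, hx] at this
    linarith
  -- The trace of X³ is 6 X₀₁ times the inner product of the two off-diagonal rows. The rows have
  -- the same products, so their inner product vanishes only if they do.
  have htr : X 0 1 * (X 0 2 * X 1 2 + X 0 3 * X 1 3) = 0 := by
    simp [Matrix.trace, Matrix.mul_apply, Fin.sum_univ_four, x00, x11, x22, x23, x33, s 1 0, s 2 0,
      s 3 0, s 2 1, s 3 1, s 3 2] at h3
    linarith
  refine ⟨x00, x11, x22, x23, x33, g00, g22, g23, g33, ?_⟩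
  rcases mul_eq_zero.1 htr with h | h
  · exact Or.inl h
  · right
    have h4 : (X 0 2 ^ 2 + X 0 3 ^ 2) ^ 2 = (X 0 2 * X 1 2 + X 0 3 * X 1 3) ^ 2 := by
      have : (X 0 2 * X 1 2 + X 0 3 * X 1 3) ^ 2 = X 0 2 ^ 2 * X 1 2 ^ 2 +
        2 * (X 0 2 * X 0 3) * (X 1 2 * X 1 3) + X 0 3 ^ 2 * X 1 3 ^ 2 := by ring
      rw [this, ← g22, ← g33, ← g23]; ring
    rw [h] at h4
    have h5 : X 0 2 ^ 2 + X 0 3 ^ 2 = 0 := by nlinarith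
    constructor <;> nlinarith [sq_nonneg (X 0 2), sq_nonneg (X 0 3)]

/-- Plane vectors with the same squares and product of coordinates agree up to sign. If the signs
were opposite for the two pairs, the condition on the sums would annihilate the symmetric product of
(p, q) and (p', q'), which is impossible for nonzero vectors. -/
theorem same_sign {p q r s p' q' r' s' : ℝ} (hp : p ^ 2 = r ^ 2) (hpq : p * q = r * s)
    (hq : q ^ 2 = s ^ 2) (hp' : p' ^ 2 = r' ^ 2) (hpq' : p' * q' = r' * s')
    (hq' : q' ^ 2 = s' ^ 2) (hne : p ^ 2 + q ^ 2 ≠ 0) (hne' : p' ^ 2 + q' ^ 2 ≠ 0)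
    (h1 : (p + p') ^ 2 = (r + r') ^ 2) (h2 : (p + p') * (q + q') = (r + r') * (s + s'))
    (h3 : (q + q') ^ 2 = (s + s') ^ 2) :
    (r = p ∧ s = q ∧ r' = p' ∧ s' = q') ∨ (r = -p ∧ s = -q ∧ r' = -p' ∧ s' = -q') := by
  have sgn : ∀ p q r s : ℝ, p ^ 2 = r ^ 2 → p * q = r * s → q ^ 2 = s ^ 2 →
      (r = p ∧ s = q) ∨ (r = -p ∧ s = -q) := by
    intro p q r s hp hpq hq
    rcases sq_eq_sq_iff_eq_or_eq_neg.1 hp.symm with h | h <;>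
      rcases sq_eq_sq_iff_eq_or_eq_neg.1 hq.symm with h' | h'
    · exact Or.inl ⟨h, h'⟩
    · have : p * q = 0 := by rw [h, h'] at hpq; linarith
      rcases mul_eq_zero.1 this with h0 | h0
      · right; exact ⟨by rw [h, h0]; simp, h'⟩
      · left; exact ⟨h, by rw [h', h0]; simp⟩
    · have : p * q = 0 := by rw [h, h'] at hpq; linarith
      rcases mul_eq_zero.1 this with h0 | h0
      · left; exact ⟨by rw [h, h0]; simp, h'⟩
      · right; exact ⟨h, by rw [h', h0]; simp⟩
    · exact Or.inr ⟨h, h'⟩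
  rcases sgn p q r s hp hpq hq with ⟨e1, e2⟩ | ⟨e1, e2⟩ <;>
    rcases sgn p' q' r' s' hp' hpq' hq' with ⟨e3, e4⟩ | ⟨e3, e4⟩
  · exact Or.inl ⟨e1, e2, e3, e4⟩
  · exfalso
    subst e1 e2 e3 e4
    have a1 : r * p' = 0 := by nlinarith
    have a2 : s * q' = 0 := by nlinarith
    have a3 : r * q' + p' * s = 0 := by nlinarith
    have : (r ^ 2 + s ^ 2) * (p' ^ 2 + q' ^ 2) = 0 := by
      have : (r ^ 2 + s ^ 2) * (p' ^ 2 + q' ^ 2) = (r * p') ^ 2 + (s * q') ^ 2 +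
        (r * q' + p' * s) ^ 2 - 2 * (r * p') * (s * q') := by ring
      rw [this, a1, a2, a3]; ring
    exact (mul_ne_zero hne hne') this
  · exfalso
    subst e1 e2 e3 e4
    have a1 : p * r' = 0 := by nlinarith
    have a2 : q * s' = 0 := by nlinarith
    have a3 : p * s' + r' * q = 0 := by nlinarith
    have : (p ^ 2 + q ^ 2) * (r' ^ 2 + s' ^ 2) = 0 := by
      have : (p ^ 2 + q ^ 2) * (r' ^ 2 + s' ^ 2) = (p * r') ^ 2 + (q * s') ^ 2 +
        (p * s' + r' * q) ^ 2 - 2 * (p * r') * (q * s') := by ring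
      rw [this, a1, a2, a3]; ring
    exact (mul_ne_zero hne hne') this
  · exact Or.inr ⟨e1, e2, e3, e4⟩

/-- Here t stands for the entry X₀₁ and (u, v) for the off-diagonal row, in two orthogonal
directions. If t ≠ 0, the alternatives for the second direction and for the sum force (u', v') = 0
and then t' = 0, contradicting the norm of the second direction. -/
theorem eq_zero_of_pair {x t t' u v u' v' : ℝ} (hx2 : 0 < x ^ 2)
    (n1 : t ^ 2 + 2 * (u ^ 2 + v ^ 2) = x ^ 2 * 1)
    (n2 : t' ^ 2 + 2 * (u' ^ 2 + v' ^ 2) = x ^ 2 * 1)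
    (n3 : (t + t') ^ 2 + 2 * ((u + u') ^ 2 + (v + v') ^ 2) = x ^ 2 * 2)
    (o1 : t = 0 ∨ u = 0 ∧ v = 0) (o2 : t' = 0 ∨ u' = 0 ∧ v' = 0)
    (o3 : t + t' = 0 ∨ u + u' = 0 ∧ v + v' = 0) : t = 0 := by
  by_contra ht
  obtain ⟨hu, hv⟩ := o1.resolve_left ht
  subst hu hv
  rcases o2 with h0 | ⟨hu, hv⟩
  · subst h0
    obtain ⟨hu', hv'⟩ := o3.resolve_left (by simpa using ht)
    have e1 : u' = 0 := by linarith
    have e2 : v' = 0 := by linarith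
    subst e1 e2
    nlinarith
  · subst hu hv
    have htt : t * t' = 0 := by linarith [show (t + t') ^ 2 = t ^ 2 + 2 * (t * t') + t' ^ 2 by ring]
    have ht' : t' = 0 := (mul_eq_zero.1 htt).resolve_left ht
    subst ht'
    linarith

/-- The block form of a symmetric matrix without diagonal blocks and with proportional rows. -/
theorem eq_fin_four_of_entries {X : Matrix (Fin 4) (Fin 4) ℝ} {ε : ℝ} (hX : X.IsSymm)
    (h00 : X 0 0 = 0) (h11 : X 1 1 = 0) (h22 : X 2 2 = 0) (h23 : X 2 3 = 0) (h33 : X 3 3 = 0)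
    (h01 : X 0 1 = 0) (h12 : X 1 2 = ε * X 0 2) (h13 : X 1 3 = ε * X 0 3) :
    X = !![0, 0, X 0 2, X 0 3; 0, 0, ε * X 0 2, ε * X 0 3; X 0 2, ε * X 0 2, 0, 0;
      X 0 3, ε * X 0 3, 0, 0] := by
  have s : ∀ a b, X a b = X b a := fun a b => congrFun (congrFun hX b) a
  have s10 := s 1 0
  have s20 := s 2 0
  have s21 := s 2 1
  have s30 := s 3 0
  have s31 := s 3 1
  have s32 := s 3 2
  rw [h01] at s10
  rw [h12] at s21
  rw [h13] at s31
  rw [h23] at s32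
  ext a b
  fin_cases a <;> fin_cases b <;> simp only [Fin.zero_eta, Fin.mk_one, Fin.reduceFinMk] <;>
    first | exact h00 | exact h11 | exact h22 | exact h23 | exact h33 | exact h01 | exact h12
          | exact h13 | exact s10 | exact s20 | exact s21 | exact s30 | exact s31 | exact s32 | rfl

/-- The components `j, k ≠ i` when `R i = diag(x, -x, 0, 0)`. -/
theorem RotInvariant.rank_two_pair {R : Yukawa M} (h : RotInvariant R)
    (hR : ∀ m, (R m).IsSymm) {i j k : Fin M} (hij : i ≠ j) (hik : i ≠ k) (hjk : j ≠ k) {x : ℝ}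
    (hx : x ≠ 0) (hi : R i = Matrix.diagonal ![x, -x, 0, 0]) :
    ∃ ε p q r s : ℝ, (ε = 1 ∨ ε = -1) ∧
      R j = !![0, 0, p, q; 0, 0, ε * p, ε * q; p, ε * p, 0, 0; q, ε * q, 0, 0] ∧
      R k = !![0, 0, r, s; 0, 0, ε * r, ε * s; r, ε * r, 0, 0; s, ε * s, 0, 0] ∧
      2 * (p ^ 2 + q ^ 2) = x ^ 2 ∧ 2 * (r ^ 2 + s ^ 2) = x ^ 2 ∧ p * r + q * s = 0 := by
  have hM : 2 ≤ M := by
    by_contra hlt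
    have := i.2; have := j.2
    exact hij (Fin.ext (by omega))
  have hx2 : 0 < x ^ 2 := by positivity
  have hcube : R i * R i * R i = x ^ 2 • R i := by
    rw [hi, Matrix.diagonal_mul_diagonal, Matrix.diagonal_mul_diagonal, ← Matrix.diagonal_smul]
    congr 1
    funext a
    fin_cases a <;> simp [pow_two, mul_assoc]
  have hc := h.cube_eq hM hcube
  have htr : ∀ ψ, (R.at ψ * R.at ψ * R.at ψ).trace = 0 := by
    intro ψ
    rw [hc, Matrix.trace_smul]
    have : (R.at ψ).trace = 0 := by
      rw [Yukawa.at, Matrix.trace_sum]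
      refine Finset.sum_eq_zero fun m _ => ?_
      rw [Matrix.trace_smul, (h.trace_eq_zero hM m).1, smul_zero]
    rw [this, smul_zero]
  have ent := fun (ψ : Fin M → ℝ) (hψ : ψ i = 0) =>
    entries_of_cube hx hi (R.at_isSymm hR ψ) (cube_polarization hc ψ hψ).1
      (cube_polarization hc ψ hψ).2 (htr ψ)
  have Ej := ent (Pi.single j 1) (by simp [hij])
  have Ek := ent (Pi.single k 1) (by simp [hik])
  have Ep := ent (Pi.single j 1 + Pi.single k 1) (by simp [hij, hik])
  have dp : (Pi.single j 1 + Pi.single k 1 : Fin M → ℝ) ⬝ᵥ (Pi.single j 1 + Pi.single k 1) = 2 := by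
    simp [hjk, hjk.symm]; norm_num
  rw [dp, R.at_add, R.at_single, R.at_single] at Ep
  rw [R.at_single, single_dotProduct_single] at Ej Ek
  simp only [Matrix.add_apply] at Ep
  obtain ⟨j00, j11, j22, j23, j33, jn, ja, jb, jc, jo⟩ := Ej
  obtain ⟨k00, k11, k22, k23, k33, kn, ka, kb, kc, ko⟩ := Ek
  obtain ⟨-, -, -, -, -, pn, pa, pb, pc, po⟩ := Ep
  have j01 : R j 0 1 = 0 := eq_zero_of_pair hx2 jn kn pn jo ko po
  have k01 : R k 0 1 = 0 := by
    refine eq_zero_of_pair hx2 kn jn ?_ ko jo ?_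
    · rw [← pn]; ring
    · rw [add_comm (R k 0 1), add_comm (R k 0 2), add_comm (R k 0 3)]; exact po
  rw [j01] at jn
  rw [k01] at kn
  rw [j01, k01] at pn
  -- Polarization: the norm identities at eⱼ, eₖ and eⱼ + eₖ.
  have horth : R j 0 2 * R k 0 2 + R j 0 3 * R k 0 3 = 0 := by
    linarith [show (0 + 0 : ℝ) ^ 2 + 2 * ((R j 0 2 + R k 0 2) ^ 2 + (R j 0 3 + R k 0 3) ^ 2) =
      2 * (R j 0 2 ^ 2 + R j 0 3 ^ 2) + 2 * (R k 0 2 ^ 2 + R k 0 3 ^ 2) +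
        4 * (R j 0 2 * R k 0 2 + R j 0 3 * R k 0 3) by ring]
  have hs := same_sign ja jb jc ka kb kc (fun h0 => by rw [h0] at jn; linarith)
    (fun h0 => by rw [h0] at kn; linarith) pa pb pc
  rcases hs with ⟨e1, e2, e3, e4⟩ | ⟨e1, e2, e3, e4⟩
  · exact ⟨1, R j 0 2, R j 0 3, R k 0 2, R k 0 3, Or.inl rfl,
      eq_fin_four_of_entries (hR j) j00 j11 j22 j23 j33 j01 (by rw [e1, one_mul])
        (by rw [e2, one_mul]),
      eq_fin_four_of_entries (hR k) k00 k11 k22 k23 k33 k01 (by rw [e3, one_mul])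
        (by rw [e4, one_mul]), by linarith, by linarith, horth⟩
  · exact ⟨-1, R j 0 2, R j 0 3, R k 0 2, R k 0 3, Or.inr rfl,
      eq_fin_four_of_entries (hR j) j00 j11 j22 j23 j33 j01 (by rw [e1]; ring)
        (by rw [e2]; ring),
      eq_fin_four_of_entries (hR k) k00 k11 k22 k23 k33 k01 (by rw [e3]; ring)
        (by rw [e4]; ring), by linarith, by linarith, horth⟩

end Classification

end GNY
end

noncomputable section
namespace GNY

/-! ### Orthonormal frames for the two normal forms -/

section Frames

open Matrix

/-- The fixed unit vector of `mixedYukawa` is w = (1, ε, 0, 0)/√2; the other columns of the frame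
are A w/x, B w/x and C w/x. In the proof t is 1/√2 and y is 1/x. -/
theorem exists_mixed_frame {A B C : Matrix (Fin 4) (Fin 4) ℝ} {x ε p q r s : ℝ} (hx : x ≠ 0)
    (hε : ε = 1 ∨ ε = -1) (hA : A = diagonal ![x, -x, 0, 0])
    (hB : B = !![0, 0, p, q; 0, 0, ε * p, ε * q; p, ε * p, 0, 0; q, ε * q, 0, 0])
    (hC : C = !![0, 0, r, s; 0, 0, ε * r, ε * s; r, ε * r, 0, 0; s, ε * s, 0, 0])
    (h1 : 2 * (p ^ 2 + q ^ 2) = x ^ 2) (h2 : 2 * (r ^ 2 + s ^ 2) = x ^ 2)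
    (h3 : p * r + q * s = 0) :
    ∃ W : Matrix (Fin 4) (Fin 4) ℝ, Wᵀ * W = 1 ∧ A * W = W * (x • mixedYukawa 0) ∧
      B * W = W * (x • mixedYukawa 1) ∧ C * W = W * (x • mixedYukawa 2) := by
  obtain ⟨t, ht⟩ : ∃ t : ℝ, t * t = 1 / 2 :=
    ⟨Real.sqrt (1 / 2), Real.mul_self_sqrt (by norm_num)⟩
  have hεε : ε * ε = 1 := by rcases hε with h | h <;> rw [h] <;> norm_num
  obtain ⟨y, hxy⟩ : ∃ y : ℝ, x * y = 1 := ⟨x⁻¹, mul_inv_cancel₀ hx⟩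
  refine ⟨!![t, t, 0, 0; ε * t, -(ε * t), 0, 0; 0, 0, 2 * t * p * y, 2 * t * r * y;
    0, 0, 2 * t * q * y, 2 * t * s * y], ?_, ?_, ?_, ?_⟩
  · ext a b
    fin_cases a <;> fin_cases b <;> simp [Matrix.mul_apply, Fin.sum_univ_four]
    · linear_combination 2 * ht + t * t * hεε
    · linear_combination -t * t * hεε
    · linear_combination -t * t * hεε
    · linear_combination 2 * ht + t * t * hεε
    · linear_combination (4 * y ^ 2 * (p ^ 2 + q ^ 2)) * ht + y ^ 2 * h1 + (x * y + 1) * hxy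
    · linear_combination (4 * t ^ 2 * y ^ 2) * h3
    · linear_combination (4 * t ^ 2 * y ^ 2) * h3
    · linear_combination (4 * y ^ 2 * (r ^ 2 + s ^ 2)) * ht + y ^ 2 * h2 + (x * y + 1) * hxy
  · subst hA
    ext a b
    fin_cases a <;> fin_cases b <;>
      simp [Matrix.mul_apply, Fin.sum_univ_four, mixedYukawa, Matrix.diagonal_apply] <;> ring
  · subst hB
    ext a b
    fin_cases a <;> fin_cases b <;> simp [Matrix.mul_apply, Fin.sum_univ_four, mixedYukawa]
    · linear_combination t * y * h1 + t * x * hxy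
    · linear_combination 2 * t * y * h3
    · linear_combination ε * (t * y * h1 + t * x * hxy)
    · linear_combination ε * 2 * t * y * h3
    · linear_combination t * p * hεε - 2 * t * p * hxy
    · linear_combination -t * p * hεε
    · linear_combination t * q * hεε - 2 * t * q * hxy
    · linear_combination -t * q * hεε
  · subst hC
    ext a b
    fin_cases a <;> fin_cases b <;> simp [Matrix.mul_apply, Fin.sum_univ_four, mixedYukawa]
    · linear_combination 2 * t * y * h3
    · linear_combination t * y * h2 + t * x * hxy
    · linear_combination ε * 2 * t * y * h3
    · linear_combination ε * (t * y * h2 + t * x * hxy)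
    · linear_combination t * r * hεε - 2 * t * r * hxy
    · linear_combination -t * r * hεε
    · linear_combination t * s * hεε - 2 * t * s * hxy
    · linear_combination -t * s * hεε

theorem dotProduct_mulVec_of_isSymm {n : Type*} [Fintype n] {A : Matrix n n ℝ} (hA : A.IsSymm) (u v : n → ℝ) :
    u ⬝ᵥ A *ᵥ v = A *ᵥ u ⬝ᵥ v := by
  rw [dotProduct_mulVec, ← mulVec_transpose, hA.eq]

/-- Columns `v, Bv, Cv, BCv` for anticommuting symmetric involutions `A, B, C` and `Av = v`. -/
theorem exists_dirac_frame {A B C : Matrix (Fin 4) (Fin 4) ℝ} (hA : A.IsSymm) (hB : B.IsSymm)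
    (hC : C.IsSymm) (hBB : B * B = 1) (hCC : C * C = 1)
    (hAB : A * B = -(B * A)) (hAC : A * C = -(C * A)) (hBC : B * C = -(C * B)) {v : Fin 4 → ℝ}
    (hv : v ⬝ᵥ v = 1) (hAv : A *ᵥ v = v) :
    ∃ W : Matrix (Fin 4) (Fin 4) ℝ, Wᵀ * W = 1 ∧ A * W = W * diracYukawa 0 ∧
      B * W = W * diracYukawa 1 ∧ C * W = W * diracYukawa 2 ∧
      ∀ u, Wᵀ *ᵥ u = ![v ⬝ᵥ u, B *ᵥ v ⬝ᵥ u, C *ᵥ v ⬝ᵥ u, B *ᵥ C *ᵥ v ⬝ᵥ u] := by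
  have ab : ∀ u, A *ᵥ B *ᵥ u = -(B *ᵥ A *ᵥ u) := fun u => by
    rw [mulVec_mulVec, hAB, neg_mulVec, mulVec_mulVec]
  have ac : ∀ u, A *ᵥ C *ᵥ u = -(C *ᵥ A *ᵥ u) := fun u => by
    rw [mulVec_mulVec, hAC, neg_mulVec, mulVec_mulVec]
  have cb : ∀ u, C *ᵥ B *ᵥ u = -(B *ᵥ C *ᵥ u) := fun u => by
    rw [mulVec_mulVec u B C, hBC, neg_mulVec, mulVec_mulVec, neg_neg]
  have bb : ∀ u, B *ᵥ B *ᵥ u = u := fun u => by rw [mulVec_mulVec, hBB, one_mulVec]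
  have cc : ∀ u, C *ᵥ C *ᵥ u = u := fun u => by rw [mulVec_mulVec, hCC, one_mulVec]
  have sA := dotProduct_mulVec_of_isSymm hA
  have sB := dotProduct_mulVec_of_isSymm hB
  have sC := dotProduct_mulVec_of_isSymm hC
  -- Moving an involution across the dot product and anticommuting it reverses the sign; the other
  -- orthogonality relations follow in the same way.
  have d01 : v ⬝ᵥ B *ᵥ v = 0 := by
    have := sA v (B *ᵥ v)
    rw [ab, hAv, dotProduct_neg] at this
    linarith
  have d02 : v ⬝ᵥ C *ᵥ v = 0 := by
    have := sA v (C *ᵥ v)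
    rw [ac, hAv, dotProduct_neg] at this
    linarith
  have d12 : B *ᵥ v ⬝ᵥ C *ᵥ v = 0 := by
    have h1 := sB v (C *ᵥ v)
    have h2 := sC v (B *ᵥ v)
    rw [cb, dotProduct_neg, h1, dotProduct_comm (C *ᵥ v)] at h2
    linarith
  have d03 : v ⬝ᵥ B *ᵥ C *ᵥ v = 0 := by rw [sB, d12]
  have d13 : B *ᵥ v ⬝ᵥ B *ᵥ C *ᵥ v = 0 := by rw [← sB, bb, d02]
  have d23 : C *ᵥ v ⬝ᵥ B *ᵥ C *ᵥ v = 0 := by rw [← sC, cb, cc, dotProduct_neg, d01, neg_zero]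
  have d11 : B *ᵥ v ⬝ᵥ B *ᵥ v = 1 := by rw [← sB, bb, hv]
  have d22 : C *ᵥ v ⬝ᵥ C *ᵥ v = 1 := by rw [← sC, cc, hv]
  have d33 : B *ᵥ C *ᵥ v ⬝ᵥ B *ᵥ C *ᵥ v = 1 := by rw [← sB, bb, d22]
  set w : Fin 4 → Fin 4 → ℝ := ![v, B *ᵥ v, C *ᵥ v, B *ᵥ C *ᵥ v] with hw
  have mulW : ∀ (X : Matrix (Fin 4) (Fin 4) ℝ) (S : Matrix (Fin 4) (Fin 4) ℝ),
      (∀ b, X *ᵥ w b = ∑ c, S c b • w c) → X * (of w)ᵀ = (of w)ᵀ * S := by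
    intro X S h
    ext a b
    have := congrFun (h b) a
    rw [Finset.sum_apply] at this
    simp only [Matrix.mul_apply, transpose_apply, of_apply]
    simp only [mulVec, dotProduct, Pi.smul_apply, smul_eq_mul] at this
    rw [this]
    exact Finset.sum_congr rfl fun c _ => mul_comm _ _
  refine ⟨(of w)ᵀ, ?_, ?_, ?_, ?_, ?_⟩
  · ext a b
    rw [transpose_transpose, Matrix.mul_apply]
    show w a ⬝ᵥ w b = _
    fin_cases a <;> fin_cases b <;>
      simp [-mulVec_mulVec, hw, hv, d01, d02, d03, d11, d12, d13, d22, d23, d33, dotProduct_comm (B *ᵥ v) v,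
        dotProduct_comm (C *ᵥ v) v, dotProduct_comm (B *ᵥ C *ᵥ v) v,
        dotProduct_comm (C *ᵥ v) (B *ᵥ v), dotProduct_comm (B *ᵥ C *ᵥ v) (B *ᵥ v),
        dotProduct_comm (B *ᵥ C *ᵥ v) (C *ᵥ v)]
  · refine mulW _ _ fun b => ?_
    fin_cases b <;> simp [-mulVec_mulVec, hw, diracYukawa, Fin.sum_univ_four, hAv, ab, ac, mulVec_neg]
  · refine mulW _ _ fun b => ?_
    fin_cases b <;> simp [-mulVec_mulVec, hw, diracYukawa, Fin.sum_univ_four, bb]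
  · refine mulW _ _ fun b => ?_
    fin_cases b <;> simp [-mulVec_mulVec, hw, diracYukawa, Fin.sum_univ_four, cb, cc, mulVec_neg]
  · intro u
    rw [transpose_transpose]
    funext b
    fin_cases b <;> rfl

/-- Four anticommuting symmetric involutions do not exist in dimension four. -/
theorem not_four_anticommuting {A B C D : Matrix (Fin 4) (Fin 4) ℝ} (hA : A.IsSymm)
    (hB : B.IsSymm) (hC : C.IsSymm) (hD : D.IsSymm) (hBB : B * B = 1) (hCC : C * C = 1)
    (hDD : D * D = 1) (hAB : A * B = -(B * A)) (hAC : A * C = -(C * A)) (hBC : B * C = -(C * B))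
    (hAD : A * D = -(D * A)) (hBD : B * D = -(D * B)) (hCD : C * D = -(D * C)) {v : Fin 4 → ℝ}
    (hv : v ⬝ᵥ v = 1) (hAv : A *ᵥ v = v) : False := by
  obtain ⟨W, hW, -, -, -, hWu⟩ := exists_dirac_frame hA hB hC hBB hCC hAB hAC hBC hv hAv
  have sA := dotProduct_mulVec_of_isSymm hA
  have sD := dotProduct_mulVec_of_isSymm hD
  have anti : ∀ {X Y : Matrix (Fin 4) (Fin 4) ℝ}, X * Y = -(Y * X) → ∀ u,
      X *ᵥ Y *ᵥ u = -(Y *ᵥ X *ᵥ u) := fun h u => by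
    rw [mulVec_mulVec, h, neg_mulVec, mulVec_mulVec]
  have orth : ∀ {X : Matrix (Fin 4) (Fin 4) ℝ}, X.IsSymm → X * D = -(D * X) →
      X *ᵥ v ⬝ᵥ D *ᵥ v = 0 := by
    intro X hX hXD
    have h1 := dotProduct_mulVec_of_isSymm hX v (D *ᵥ v)
    have h2 := sD v (X *ᵥ v)
    rw [anti hXD, dotProduct_neg, h2, dotProduct_comm] at h1
    linarith
  have h0 : v ⬝ᵥ D *ᵥ v = 0 := by
    have := orth hA hAD
    rwa [hAv] at this
  have h3 : B *ᵥ C *ᵥ v ⬝ᵥ D *ᵥ v = 0 := by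
    have := sA (B *ᵥ C *ᵥ v) (D *ᵥ v)
    rw [anti hAD, anti hAB, anti hAC, hAv, mulVec_neg, neg_neg, dotProduct_neg] at this
    linarith
  -- The vector Dv is orthogonal to the whole frame v, Bv, Cv, BCv; for v and BCv this holds because
  -- A has eigenvalue 1 on them and -1 on Dv. Hence Dv = 0, although D is invertible.
  have hz : Wᵀ *ᵥ (D *ᵥ v) = 0 := by
    rw [hWu, h0, orth hB hBD, orth hC hCD, h3]
    funext b
    fin_cases b <;> rfl
  have hWW : W * Wᵀ = 1 := mul_eq_one_comm.1 hW
  have hz' : D *ᵥ v = 0 := by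
    have := congrArg (W *ᵥ ·) hz
    simpa only [mulVec_mulVec, hWW, one_mulVec, mulVec_zero, ← Matrix.mul_assoc,
      Matrix.one_mul] using this
  have : v = 0 := by
    have := congrArg (D *ᵥ ·) hz'
    simpa only [mulVec_mulVec, hDD, one_mulVec, mulVec_zero] using this
  rw [this, zero_dotProduct] at hv
  exact zero_ne_one hv

end Frames

end GNY
end

noncomputable section
namespace GNY

/-! ### The list of tuples for M ≥ 3, and invariants separating the two families -/

section Types

open Matrix

variable {M : ℕ}

theorem Yukawa.conj_ne_zero {R : Yukawa M} (hne : R ≠ 0) {T : Matrix (Fin 4) (Fin 4) ℝ}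
    (hT : T ∈ Matrix.orthogonalGroup (Fin 4) ℝ) : R.conj T ≠ 0 := by
  intro h0
  apply hne
  obtain ⟨P, hP, h⟩ := (yukawaEquiv_conj R hT).symm
  funext m
  rw [← h m, h0]
  simp

/-- The eigenvalues x, -x, y, -y with x ≠ 0 cannot all be distinct, which leaves y = 0 or y² = x².
-/
theorem RotInvariant.diagonal_cases {R : Yukawa M} (h : RotInvariant R)
    (hR : ∀ m, (R m).IsSymm) {i j k : Fin M} (hij : i ≠ j) (hik : i ≠ k) (hjk : j ≠ k)
    (hne : R ≠ 0) :
    ∃ T ∈ Matrix.orthogonalGroup (Fin 4) ℝ, ∃ x : ℝ, x ≠ 0 ∧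
      (R.conj T i = diagonal ![x, -x, 0, 0] ∨
        ∃ y, y ^ 2 = x ^ 2 ∧ R.conj T i = diagonal ![x, -x, y, -y]) := by
  have hM : 2 ≤ M := by
    by_contra hlt
    have := i.2; have := j.2
    exact hij (Fin.ext (by omega))
  obtain ⟨T, hT, x, y, hxy, hd⟩ := h.exists_diagonal hM hR i
  have hx : x ≠ 0 := by
    intro hx
    refine Yukawa.conj_ne_zero hne hT ((h.conj hT).eq_zero_of_apply_eq_zero hM (i := i) ?_)
    rw [hd, hx, hxy hx]
    ext a b
    fin_cases a <;> fin_cases b <;> simp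
  refine ⟨T, hT, x, hx, ?_⟩
  by_cases hy : y = 0
  · left
    rw [hd, hy, neg_zero]
  right
  refine ⟨y, ?_, hd⟩
  by_contra hsq
  have n1 : x ≠ y := fun e => hsq (by rw [e])
  have n2 : x ≠ -y := fun e => hsq (by rw [e]; ring)
  have n3 : -x ≠ y := fun e => n2 (by rw [← e, neg_neg])
  have n4 : x ≠ -x := fun e => hx (by linarith)
  have n5 : y ≠ -y := fun e => hy (by linarith)
  refine (h.conj hT).not_injective_diagonal hij hik hjk hd ?_
  intro a b hab
  fin_cases a <;> fin_cases b <;> first | rfl | skip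
  all_goals
    exfalso
    simp at hab
    first
    | exact n1 hab | exact n2 hab | exact n3 hab | exact n4 hab | exact n5 hab
    | exact n1 hab.symm | exact n2 hab.symm | exact n3 hab.symm | exact n4 hab.symm
    | exact n5 hab.symm

theorem Yukawa.anticomm_of_sq {R : Yukawa M} {c : ℝ}
    (h : ∀ φ, R.at φ * R.at φ = (c * (φ ⬝ᵥ φ)) • (1 : Matrix (Fin 4) (Fin 4) ℝ)) {i j : Fin M}
    (hij : i ≠ j) : R i * R j = -(R j * R i) := by
  have h1 := h (Pi.single i 1)
  have h2 := h (Pi.single j 1)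
  have h3 := h (Pi.single i 1 + Pi.single j 1)
  have d : (Pi.single i 1 + Pi.single j 1 : Fin M → ℝ) ⬝ᵥ (Pi.single i 1 + Pi.single j 1) =
      1 + 1 := by simp [hij, hij.symm]
  rw [d, R.at_add, R.at_single, R.at_single, mul_add c, add_smul] at h3
  rw [R.at_single, single_dotProduct_single] at h1 h2
  rw [mul_one] at h1 h2 h3
  rw [add_mul, mul_add, mul_add, h1, h2] at h3
  rw [eq_neg_iff_add_eq_zero]
  have e : R i * R j + R j * R i = (c • (1 : Matrix (Fin 4) (Fin 4) ℝ) + R i * R j +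
      (R j * R i + c • 1)) - (c • 1 + c • 1) := by abel
  rw [e, h3, sub_self]

/-- The data of a tuple of type `diag(x, -x, ±x, ∓x)`, rescaled. -/
theorem RotInvariant.clifford {S : Yukawa M} (h : RotInvariant S) (hM : 2 ≤ M) {i : Fin M}
    {x y : ℝ} (hx : x ≠ 0) (hxy : y ^ 2 = x ^ 2) (hd : S i = diagonal ![x, -x, y, -y]) :
    (∀ m, (x⁻¹ • S) m * (x⁻¹ • S) m = 1) ∧
    (∀ m n, m ≠ n → (x⁻¹ • S) m * (x⁻¹ • S) n = -((x⁻¹ • S) n * (x⁻¹ • S) m)) ∧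
    (x⁻¹ • S) i *ᵥ Pi.single 0 1 = Pi.single 0 1 := by
  have hi : S i * S i = (x ^ 2) • (1 : Matrix (Fin 4) (Fin 4) ℝ) := by
    rw [hd, diagonal_mul_diagonal, ← diagonal_one, ← diagonal_smul]
    congr 1
    funext a
    fin_cases a <;> simp [← pow_two, hxy]
  have hs := h.sq_eq hM hi
  have hs' : ∀ φ, Yukawa.at (x⁻¹ • S) φ * Yukawa.at (x⁻¹ • S) φ =
      (1 * (φ ⬝ᵥ φ)) • (1 : Matrix (Fin 4) (Fin 4) ℝ) := by
    intro φ
    rw [Yukawa.smul_at, smul_mul_smul_comm, hs, smul_smul]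
    congr 1
    field_simp
  refine ⟨fun m => ?_, fun m n hmn => Yukawa.anticomm_of_sq hs' hmn, ?_⟩
  · have := hs' (Pi.single m 1)
    rw [Yukawa.at_single, single_dotProduct_single, mul_one, one_smul] at this
    exact this
  · rw [Pi.smul_apply, hd]
    funext a
    fin_cases a <;> simp [mulVec, dotProduct, Fin.sum_univ_four, diagonal_apply, hx]

/-- Nonzero symmetric tuples with unbroken `SO(M)`, `M ≥ 3`, exist for `M = 3` only. -/
theorem RotInvariant.not_four_indices {R : Yukawa M} (h : RotInvariant R)
    (hR : ∀ m, (R m).IsSymm) {i j k l : Fin M} (hij : i ≠ j) (hik : i ≠ k) (hil : i ≠ l)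
    (hjk : j ≠ k) (hjl : j ≠ l) (hkl : k ≠ l) : R = 0 := by
  by_contra hne
  have hM : 2 ≤ M := by
    by_contra hlt
    have := i.2; have := j.2
    exact hij (Fin.ext (by omega))
  obtain ⟨T, hT, x, hx, hd | ⟨y, hxy, hd⟩⟩ := h.diagonal_cases hR hij hik hjk hne
  · have hS := h.conj hT
    have hSs := R.conj_isSymm hR T
    obtain ⟨ε, p, q, r, s, -, ej, ek, n1, n2, o1⟩ := hS.rank_two_pair hSs hij hik hjk hx hd
    obtain ⟨ε', p', q', t, u, -, ej', el, -, n3, o2⟩ := hS.rank_two_pair hSs hij hil hjl hx hd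
    obtain ⟨ε'', r', s', t', u', -, ek', el', -, -, o3⟩ := hS.rank_two_pair hSs hik hil hkl hx hd
    have ent : ∀ {ε p q ε' p' q' : ℝ}, (!![0, 0, p, q; 0, 0, ε * p, ε * q; p, ε * p, 0, 0;
        q, ε * q, 0, 0] : Matrix (Fin 4) (Fin 4) ℝ) = !![0, 0, p', q'; 0, 0, ε' * p', ε' * q';
        p', ε' * p', 0, 0; q', ε' * q', 0, 0] → p = p' ∧ q = q' := fun h =>
      ⟨congrFun (congrFun h 0) 2, congrFun (congrFun h 0) 3⟩
    obtain ⟨rfl, rfl⟩ := ent (ej.symm.trans ej')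
    obtain ⟨rfl, rfl⟩ := ent (ek.symm.trans ek')
    obtain ⟨rfl, rfl⟩ := ent (el.symm.trans el')
    have hx2 : 0 < x ^ 2 := by positivity
    -- In the rank-two case (p, q), (r, s) and (t, u) would be three mutually orthogonal nonzero
    -- vectors of the plane. By Lagrange's identity the determinants formed with the first one have
    -- a vanishing product but nonzero squares.
    have e1 : (p * s - q * r) * (p * u - q * t) = 0 := by
      linear_combination (p ^ 2 + q ^ 2) * o3 - (p * t + q * u) * o1
    have e2 : (p * s - q * r) ^ 2 = (x ^ 2 / 2) ^ 2 := by
      linear_combination (r ^ 2 + s ^ 2) / 2 * n1 + x ^ 2 / 4 * n2 - (p * r + q * s) * o1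
    have e3 : (p * u - q * t) ^ 2 = (x ^ 2 / 2) ^ 2 := by
      linear_combination (t ^ 2 + u ^ 2) / 2 * n1 + x ^ 2 / 4 * n3 - (p * t + q * u) * o2
    have hp : (x ^ 2 / 2) ^ 2 ≠ 0 := by positivity
    rcases mul_eq_zero.1 e1 with h0 | h0
    · rw [h0] at e2; exact hp (by rw [← e2]; ring)
    · rw [h0] at e3; exact hp (by rw [← e3]; ring)
  · obtain ⟨hsq, hac, hv⟩ := (h.conj hT).clifford hM hx hxy hd
    have hs : ∀ m, ((x⁻¹ • R.conj T) m).IsSymm := fun m => by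
      rw [Pi.smul_apply, IsSymm, transpose_smul, (R.conj_isSymm hR T m).eq]
    exact not_four_anticommuting (hs i) (hs j) (hs k) (hs l) (hsq j) (hsq k) (hsq l) (hac _ _ hij)
      (hac _ _ hik) (hac _ _ hjk) (hac _ _ hil) (hac _ _ hjl) (hac _ _ hkl)
      (single_dotProduct_single 0) hv

theorem RotInvariant.eq_zero_of_four_le {R : Yukawa M} (h : RotInvariant R)
    (hR : ∀ m, (R m).IsSymm) (hM : 4 ≤ M) : R = 0 :=
  h.not_four_indices hR (i := ⟨0, by omega⟩) (j := ⟨1, by omega⟩) (k := ⟨2, by omega⟩)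
    (l := ⟨3, by omega⟩) (by simp) (by simp) (by simp) (by simp) (by simp) (by simp)

/-- The two families of nonzero tuples with unbroken `SO(3)`. -/
theorem RotInvariant.classification {R : Yukawa 3} (h : RotInvariant R)
    (hR : ∀ m, (R m).IsSymm) (hne : R ≠ 0) :
    ∃ a : ℝ, a ≠ 0 ∧ (YukawaEquiv R (a • mixedYukawa) ∨ YukawaEquiv R (a • diracYukawa)) := by
  have h01 : (0 : Fin 3) ≠ 1 := by decide
  have h02 : (0 : Fin 3) ≠ 2 := by decide
  have h12 : (1 : Fin 3) ≠ 2 := by decide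
  obtain ⟨T, hT, x, hx, hd | ⟨y, hxy, hd⟩⟩ := h.diagonal_cases hR h01 h02 h12 hne
  · refine ⟨x, hx, Or.inl ((yukawaEquiv_conj R hT).trans ?_)⟩
    obtain ⟨ε, p, q, r, s, hε, ej, ek, n1, n2, o1⟩ :=
      (h.conj hT).rank_two_pair (R.conj_isSymm hR T) h01 h02 h12 hx hd
    obtain ⟨W, hW, w0, w1, w2⟩ := exists_mixed_frame hx hε hd ej ek n1 n2 o1
    refine YukawaEquiv.of_frame hW fun m => ?_
    fin_cases m
    · exact w0
    · exact w1
    · exact w2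
  · refine ⟨x, hx, Or.inr ((yukawaEquiv_conj R hT).trans ?_)⟩
    obtain ⟨hsq, hac, hv⟩ := (h.conj hT).clifford (by norm_num) hx hxy hd
    have hs : ∀ m, ((x⁻¹ • R.conj T) m).IsSymm := fun m => by
      rw [Pi.smul_apply, IsSymm, transpose_smul, (R.conj_isSymm hR T m).eq]
    obtain ⟨W, hW, w0, w1, w2, -⟩ := exists_dirac_frame (hs 0) (hs 1) (hs 2) (hsq 1) (hsq 2)
      (hac _ _ h01) (hac _ _ h02) (hac _ _ h12) (single_dotProduct_single 0) hv
    have e : R.conj T = x • (x⁻¹ • R.conj T) := by rw [smul_smul, mul_inv_cancel₀ hx, one_smul]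
    rw [e]
    refine YukawaEquiv.smul (YukawaEquiv.of_frame hW fun m => ?_) x
    fin_cases m
    · exact w0
    · exact w1
    · exact w2

/-- These invariants tell the families apart: the scale-invariant quotient 16 det / (tr R²)² is 0 on
nonzero multiples of `mixedYukawa` and 1 on those of `diracYukawa`. -/
theorem YukawaEquiv.det_eq {R S : Yukawa M} (h : YukawaEquiv R S) (m : Fin M) :
    (R m).det = (S m).det ∧ (R m * R m).trace = (S m * S m).trace := by
  obtain ⟨P, hP, h⟩ := h
  have h1 := orthogonal_transpose_mul hP
  rw [← h m]
  constructor
  · rw [det_mul, det_mul, mul_right_comm, ← det_mul, mul_eq_one_comm.1 h1, det_one, one_mul]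
  · have : P * R m * P.transpose * (P * R m * P.transpose) = P * (R m * R m) * P.transpose := by
      calc _ = P * R m * (P.transpose * P) * R m * P.transpose := by simp only [Matrix.mul_assoc]
        _ = _ := by rw [h1, Matrix.mul_one]; simp only [Matrix.mul_assoc]
    rw [this, trace_mul_comm (P * (R m * R m)), ← Matrix.mul_assoc, h1, Matrix.one_mul]

theorem det_trace_mixed (a : ℝ) : ((a • mixedYukawa) 0).det = 0 ∧
    ((a • mixedYukawa) 0 * (a • mixedYukawa) 0).trace = 2 * a ^ 2 := by
  constructor
  · apply det_eq_zero_of_row_eq_zero 3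
    intro j
    fin_cases j <;> simp [mixedYukawa]
  · simp [mixedYukawa, trace, Fin.sum_univ_four, Matrix.mul_apply]
    ring

theorem det_trace_dirac (a : ℝ) : ((a • diracYukawa) 0).det = a ^ 4 ∧
    ((a • diracYukawa) 0 * (a • diracYukawa) 0).trace = 4 * a ^ 2 := by
  constructor
  · have : diracYukawa 0 = diagonal ![1, -1, -1, 1] := by
      ext i j
      fin_cases i <;> fin_cases j <;> rfl
    rw [Pi.smul_apply, this, det_smul, det_diagonal, Fin.prod_univ_four]
    simp
  · simp [diracYukawa, trace, Fin.sum_univ_four, Matrix.mul_apply]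
    ring

/-- In a linear space of symmetric tuples with unbroken `SO(3)`, any two nonzero ones agree up to
scale and equivalence. -/
theorem exists_yukawaEquiv_smul (𝓡 : Submodule ℝ (Yukawa 3))
    (h𝓡 : ∀ R ∈ 𝓡, (∀ m, (R m).IsSymm) ∧ RotInvariant R) {R T : Yukawa 3} (hR : R ∈ 𝓡)
    (hT : T ∈ 𝓡) (hR0 : R ≠ 0) (hT0 : T ≠ 0) : ∃ c : ℝ, YukawaEquiv R (c • T) := by
  -- The segment from R to T is used as a connected set of nonzero operators; if it meets 0, the end
  -- points are proportional.
  by_cases hdep : ∃ t ∈ Set.Icc (0 : ℝ) 1, R + t • (T - R) = 0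
  · obtain ⟨t, -, ht⟩ := hdep
    have ht0 : t ≠ 0 := by
      rintro rfl
      exact hR0 (by simpa using ht)
    have ht1 : 1 - t ≠ 0 := by
      intro h1
      have : t = 1 := by linarith
      subst this
      exact hT0 (by simpa using ht)
    refine ⟨-t / (1 - t), ?_⟩
    have e : R = (-t / (1 - t)) • T := by
      have e1 : (1 - t) • R = (-t) • T := by
        rw [← sub_eq_zero, ← ht]; module
      rw [div_eq_inv_mul, mul_smul, ← e1, smul_smul, inv_mul_cancel₀ ht1, one_smul]
    rw [← e]
    exact YukawaEquiv.refl R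
  push Not at hdep
  have hmem : ∀ t : ℝ, R + t • (T - R) ∈ 𝓡 := fun t =>
    𝓡.add_mem hR (𝓡.smul_mem t (𝓡.sub_mem hT hR))
  set D : ℝ → ℝ := fun t => ((R + t • (T - R)) 0).det with hD
  set N : ℝ → ℝ := fun t => ((R + t • (T - R)) 0 * (R + t • (T - R)) 0).trace with hN
  have cD : Continuous D := by
    refine Continuous.matrix_det ?_
    simp only [Pi.add_apply, Pi.smul_apply]
    fun_prop
  have cN : Continuous N := by
    refine Continuous.matrix_trace (Continuous.matrix_mul ?_ ?_) <;>
    · simp only [Pi.add_apply, Pi.smul_apply]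
      fun_prop
  have mixed_iff : ∀ S : Yukawa 3, ∀ a : ℝ, a ≠ 0 → YukawaEquiv S (a • mixedYukawa) →
      (S 0 * S 0).trace ≠ 0 ∧ 16 * (S 0).det / ((S 0 * S 0).trace) ^ 2 = 0 := by
    intro S a ha hS
    obtain ⟨h1, h2⟩ := hS.det_eq 0
    rw [h1, h2, (det_trace_mixed a).1, (det_trace_mixed a).2]
    exact ⟨by positivity, by simp⟩
  have dirac_iff : ∀ S : Yukawa 3, ∀ a : ℝ, a ≠ 0 → YukawaEquiv S (a • diracYukawa) →
      (S 0 * S 0).trace ≠ 0 ∧ 16 * (S 0).det / ((S 0 * S 0).trace) ^ 2 = 1 := by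
    intro S a ha hS
    obtain ⟨h1, h2⟩ := hS.det_eq 0
    rw [h1, h2, (det_trace_dirac a).1, (det_trace_dirac a).2]
    refine ⟨by positivity, ?_⟩
    field_simp
    ring
  have types : ∀ t ∈ Set.Icc (0 : ℝ) 1, N t ≠ 0 ∧ (16 * D t / N t ^ 2 = 0 ∨
      16 * D t / N t ^ 2 = 1) := by
    intro t ht
    obtain ⟨a, ha, h1 | h1⟩ := (h𝓡 _ (hmem t)).2.classification (h𝓡 _ (hmem t)).1 (hdep t ht)
    · exact ⟨(mixed_iff _ a ha h1).1, Or.inl (mixed_iff _ a ha h1).2⟩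
    · exact ⟨(dirac_iff _ a ha h1).1, Or.inr (dirac_iff _ a ha h1).2⟩
  -- A continuous function with values in {0, 1} is constant along the segment, so R and T belong to
  -- the same family.
  have cf : ContinuousOn (fun t => 16 * D t / N t ^ 2) (Set.Icc 0 1) :=
    ContinuousOn.div (by fun_prop) (by fun_prop) fun t ht => pow_ne_zero 2 (types t ht).1
  have half : (1 / 2 : ℝ) ∉ (fun t => 16 * D t / N t ^ 2) '' Set.Icc 0 1 := by
    rintro ⟨t, ht, h1⟩
    rcases (types t ht).2 with h2 | h2 <;> · simp only [h2] at h1; norm_num at h1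
  have e0 : R + (0 : ℝ) • (T - R) = R := by simp
  have e1 : R + (1 : ℝ) • (T - R) = T := by simp
  obtain ⟨a, ha, hRa⟩ := (h𝓡 R hR).2.classification (h𝓡 R hR).1 hR0
  obtain ⟨b, hb, hTb⟩ := (h𝓡 T hT).2.classification (h𝓡 T hT).1 hT0
  have fin : ∀ S : Yukawa 3, YukawaEquiv R (a • S) → YukawaEquiv T (b • S) →
      ∃ c : ℝ, YukawaEquiv R (c • T) := by
    intro S h1 h2
    refine ⟨a / b, h1.trans ?_⟩
    have := (h2.smul (a / b)).symm
    rwa [smul_smul, div_mul_cancel₀ a hb] at this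
  rcases hRa with hRa | hRa <;> rcases hTb with hTb | hTb
  · exact fin _ hRa hTb
  · exfalso
    have v0 : 16 * D 0 / N 0 ^ 2 = 0 := by simpa only [hD, hN, e0] using (mixed_iff R a ha hRa).2
    have v1 : 16 * D 1 / N 1 ^ 2 = 1 := by simpa only [hD, hN, e1] using (dirac_iff T b hb hTb).2
    exact half (intermediate_value_Icc zero_le_one cf (by
      simp only [v0, v1]; constructor <;> norm_num))
  · exfalso
    have v0 : 16 * D 0 / N 0 ^ 2 = 1 := by simpa only [hD, hN, e0] using (dirac_iff R a ha hRa).2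
    have v1 : 16 * D 1 / N 1 ^ 2 = 0 := by simpa only [hD, hN, e1] using (mixed_iff T b hb hTb).2
    exact half (intermediate_value_Icc' zero_le_one cf (by
      simp only [v0, v1]; constructor <;> norm_num))
  · exact fin _ hRa hTb

end Types

end GNY
end

noncomputable section
namespace GNY

/-! ### Orthogonal projections for the dot product -/

section Projection

open Matrix

variable {n : Type*} [Fintype n]

/-- The dot product as a bilinear form. -/
def dotForm (n : Type*) [Fintype n] : LinearMap.BilinForm ℝ (n → ℝ) :=
  LinearMap.mk₂ ℝ (fun u v => u ⬝ᵥ v) add_dotProduct smul_dotProduct dotProduct_add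
    (fun c u v => dotProduct_smul c u v)

theorem dotProduct_self_pos {v : n → ℝ} (hv : v ≠ 0) : 0 < v ⬝ᵥ v := by
  have := Matrix.dotProduct_star_self_pos_iff (v := v)
  simpa using this.2 hv

/-- The orthogonal complement. -/
def perp (K : Submodule ℝ (n → ℝ)) : Submodule ℝ (n → ℝ) := (dotForm n).orthogonal K

theorem mem_perp {K : Submodule ℝ (n → ℝ)} {v : n → ℝ} : v ∈ perp K ↔ ∀ u ∈ K, u ⬝ᵥ v = 0 :=
  Iff.rfl

theorem disjoint_perp (K : Submodule ℝ (n → ℝ)) : Disjoint K (perp K) := by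
  rw [Submodule.disjoint_def]
  intro v hv hv'
  by_contra hne
  exact (dotProduct_self_pos hne).ne' (mem_perp.1 hv' v hv)

theorem isCompl_perp (K : Submodule ℝ (n → ℝ)) : IsCompl K (perp K) :=
  (LinearMap.BilinForm.isCompl_orthogonal_iff_disjoint
    (B := dotForm n) (W := K) (fun u v (h : u ⬝ᵥ v = 0) => by
      show v ⬝ᵥ u = 0
      rw [dotProduct_comm, h])).2 (disjoint_perp K)

theorem exists_proj (K : Submodule ℝ (n → ℝ)) (v : n → ℝ) : ∃ w ∈ K, v - w ∈ perp K := by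
  have : v ∈ K ⊔ perp K := by rw [(isCompl_perp K).sup_eq_top]; trivial
  obtain ⟨w, hw, z, hz, h⟩ := Submodule.mem_sup.1 this
  exact ⟨w, hw, by rw [← h, add_sub_cancel_left]; exact hz⟩

theorem proj_unique {K : Submodule ℝ (n → ℝ)} {v w w' : n → ℝ} (hw : w ∈ K) (hw' : w' ∈ K)
    (h : v - w ∈ perp K) (h' : v - w' ∈ perp K) : w = w' := by
  have h1 : w - w' ∈ perp K := by
    have := (perp K).sub_mem h' h
    rwa [sub_sub_sub_cancel_left] at this
  exact sub_eq_zero.1 ((Submodule.disjoint_def.1 (disjoint_perp K)) _ (K.sub_mem hw hw') h1)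

/-- The orthogonal projection onto `K`. -/
def proj (K : Submodule ℝ (n → ℝ)) : (n → ℝ) →ₗ[ℝ] (n → ℝ) where
  toFun v := (exists_proj K v).choose
  map_add' u v := by
    have hu := (exists_proj K u).choose_spec
    have hv := (exists_proj K v).choose_spec
    have huv := (exists_proj K (u + v)).choose_spec
    refine proj_unique huv.1 (K.add_mem hu.1 hv.1) huv.2 ?_
    rw [add_sub_add_comm]
    exact (perp K).add_mem hu.2 hv.2
  map_smul' c v := by
    have hv := (exists_proj K v).choose_spec
    have hcv := (exists_proj K (c • v)).choose_spec
    refine proj_unique hcv.1 (K.smul_mem c hv.1) hcv.2 ?_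
    rw [RingHom.id_apply, ← smul_sub]
    exact (perp K).smul_mem c hv.2

theorem proj_mem (K : Submodule ℝ (n → ℝ)) (v : n → ℝ) : proj K v ∈ K :=
  (exists_proj K v).choose_spec.1

theorem sub_proj_mem (K : Submodule ℝ (n → ℝ)) (v : n → ℝ) : v - proj K v ∈ perp K :=
  (exists_proj K v).choose_spec.2

theorem proj_eq {K : Submodule ℝ (n → ℝ)} {v w : n → ℝ} (hw : w ∈ K) (h : v - w ∈ perp K) :
    proj K v = w :=
  proj_unique (proj_mem K v) hw (sub_proj_mem K v) h

theorem proj_of_mem {K : Submodule ℝ (n → ℝ)} {v : n → ℝ} (hv : v ∈ K) : proj K v = v :=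
  proj_eq hv (by rw [sub_self]; exact zero_mem _)

theorem proj_of_mem_perp {K : Submodule ℝ (n → ℝ)} {v : n → ℝ} (hv : v ∈ perp K) :
    proj K v = 0 :=
  proj_eq (zero_mem _) (by rwa [sub_zero])

theorem dotProduct_proj {K : Submodule ℝ (n → ℝ)} {u : n → ℝ} (hu : u ∈ K) (v : n → ℝ) :
    u ⬝ᵥ proj K v = u ⬝ᵥ v := by
  have := mem_perp.1 (sub_proj_mem K v) u hu
  rw [dotProduct_sub] at this
  linarith

theorem proj_dotProduct_comm (K : Submodule ℝ (n → ℝ)) (u v : n → ℝ) :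
    proj K u ⬝ᵥ v = u ⬝ᵥ proj K v := by
  rw [← dotProduct_proj (proj_mem K u), dotProduct_comm u, ← dotProduct_proj (proj_mem K v),
    dotProduct_comm]

/-- The matrix of the orthogonal projection. -/
def projMat [DecidableEq n] (K : Submodule ℝ (n → ℝ)) : Matrix n n ℝ := LinearMap.toMatrix' (proj K)

theorem projMat_mulVec [DecidableEq n] (K : Submodule ℝ (n → ℝ)) (v : n → ℝ) :
    projMat K *ᵥ v = proj K v := by
  rw [projMat, LinearMap.toMatrix'_mulVec]

theorem projMat_transpose [DecidableEq n] (K : Submodule ℝ (n → ℝ)) :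
    (projMat K)ᵀ = projMat K := by
  have h : ∀ u v : n → ℝ, u ⬝ᵥ (projMat K)ᵀ *ᵥ v = u ⬝ᵥ projMat K *ᵥ v := by
    intro u v
    rw [mulVec_transpose, dotProduct_comm, ← dotProduct_mulVec, projMat_mulVec, projMat_mulVec,
      dotProduct_comm, proj_dotProduct_comm]
  ext i j
  have := h (Pi.single i 1) (Pi.single j 1)
  simpa using this

theorem sum_projMat {n : Type*} [Fintype n] [DecidableEq n] {ι : Type*} [Fintype ι]
    {K : ι → Submodule ℝ (n → ℝ)}
    (h : ∀ i j, i ≠ j → ∀ u ∈ K i, ∀ v ∈ K j, u ⬝ᵥ v = 0) (htop : ⨆ i, K i = ⊤) :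
    ∑ i, projMat (K i) = 1 := by
  classical
  have key : ∀ v ∈ ⨆ i, K i, ∑ i, proj (K i) v = v := by
    intro v hv
    induction hv using Submodule.iSup_induction' with
    | mem i v hv =>
      rw [Finset.sum_eq_single i, proj_of_mem hv]
      · intro j _ hj
        exact proj_of_mem_perp (mem_perp.2 fun u hu => h j i hj u hu v hv)
      · simp
    | zero => simp
    | add u v _ _ hu hv => simp only [map_add, Finset.sum_add_distrib, hu, hv]
  refine Matrix.ext_of_mulVec_single fun j => ?_
  rw [sum_mulVec, one_mulVec]
  simp only [projMat_mulVec]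
  exact key _ (by rw [htop]; trivial)

end Projection

/-! ### Decomposition of an orthogonal representation -/

section Decompose

open Matrix

variable {n : Type*} [Fintype n] {G : Type*} [Group G] {ρ : Representation ℝ G (n → ℝ)}

/-- The orthogonal complement of a subrepresentation inside another one. -/
def subPerp (hρ : ∀ x u v, ρ x u ⬝ᵥ ρ x v = u ⬝ᵥ v) (W U : Subrepresentation ρ) :
    Subrepresentation ρ where
  toSubmodule := W.toSubmodule ⊓ perp U.toSubmodule
  apply_mem_toSubmodule x v hv := by
    refine ⟨W.apply_mem_toSubmodule x hv.1, mem_perp.2 fun u hu => ?_⟩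
    have h1 := mem_perp.1 hv.2 _ (U.apply_mem_toSubmodule x⁻¹ hu)
    rw [← hρ x, ← Module.End.mul_apply, ← map_mul, mul_inv_cancel, map_one] at h1
    exact h1

theorem sup_subPerp (hρ : ∀ x u v, ρ x u ⬝ᵥ ρ x v = u ⬝ᵥ v) {W U : Subrepresentation ρ}
    (hUW : U.toSubmodule ≤ W.toSubmodule) :
    U.toSubmodule ⊔ (subPerp hρ W U).toSubmodule = W.toSubmodule := by
  refine le_antisymm (sup_le hUW inf_le_left) fun v hv => ?_
  rw [Submodule.mem_sup]
  exact ⟨proj U.toSubmodule v, proj_mem _ _, v - proj U.toSubmodule v,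
    ⟨W.toSubmodule.sub_mem hv (hUW (proj_mem _ _)), sub_proj_mem _ _⟩, by abel⟩

theorem isIrreducible_of_minimal {U : Subrepresentation ρ} (hU : U.toSubmodule ≠ ⊥)
    (hmin : ∀ U' : Subrepresentation ρ, U'.toSubmodule ≠ ⊥ → U'.toSubmodule ≤ U.toSubmodule →
      U'.toSubmodule = U.toSubmodule) : U.toRepresentation.IsIrreducible := by
  have hnt : Nontrivial (Subrepresentation U.toRepresentation) := by
    refine ⟨⟨⊥, ⊤, fun h => hU ?_⟩⟩
    have h' : (⊥ : Submodule ℝ U.toSubmodule) = ⊤ :=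
      congrArg Subrepresentation.toSubmodule h
    rw [eq_bot_iff]
    intro v hv
    have : (⟨v, hv⟩ : U.toSubmodule) ∈ (⊥ : Submodule ℝ U.toSubmodule) := by rw [h']; trivial
    exact congrArg Subtype.val ((Submodule.mem_bot ℝ).1 this)
  refine { toNontrivial := hnt, eq_bot_or_eq_top := fun S => ?_ }
  let U' : Subrepresentation ρ :=
    { toSubmodule := S.toSubmodule.map U.toSubmodule.subtype
      apply_mem_toSubmodule := by
        rintro x _ ⟨w, hw, rfl⟩
        exact ⟨U.toRepresentation x w, S.apply_mem_toSubmodule x hw, rfl⟩ }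
  by_cases hS : S.toSubmodule = ⊥
  · exact Or.inl (Subrepresentation.toSubmodule_injective hS)
  · right
    apply Subrepresentation.toSubmodule_injective
    have h1 : U'.toSubmodule = U.toSubmodule := by
      refine hmin U' (fun h0 => hS ?_) (Submodule.map_subtype_le _ _)
      refine Submodule.map_injective_of_injective U.toSubmodule.injective_subtype ?_
      rw [Submodule.map_bot]
      exact h0
    refine Submodule.map_injective_of_injective U.toSubmodule.injective_subtype ?_
    show U'.toSubmodule = Submodule.map _ (⊤ : Submodule ℝ U.toSubmodule)
    rw [h1, Submodule.map_subtype_top]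

theorem exists_minimal_le {W : Subrepresentation ρ} (hW : W.toSubmodule ≠ ⊥) :
    ∃ U : Subrepresentation ρ, U.toSubmodule ≤ W.toSubmodule ∧ U.toSubmodule ≠ ⊥ ∧
      U.toRepresentation.IsIrreducible := by
  obtain ⟨U, ⟨hU, hUW⟩, hmin⟩ := WellFounded.has_min
    (measure fun U : Subrepresentation ρ => Module.finrank ℝ U.toSubmodule).wf
    {U | U.toSubmodule ≠ ⊥ ∧ U.toSubmodule ≤ W.toSubmodule} ⟨W, hW, le_rfl⟩
  refine ⟨U, hUW, hU, isIrreducible_of_minimal hU fun U' h1 h2 => ?_⟩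
  by_contra hne
  exact hmin U' ⟨h1, h2.trans hUW⟩ (Submodule.finrank_lt_finrank_of_lt (lt_of_le_of_ne h2 hne))

/-- An irreducible piece is split off, and the induction continues in its orthogonal complement,
which is invariant because the group acts by isometries. This keeps the summands mutually
orthogonal. -/
theorem exists_irreducible_family (hρ : ∀ x u v, ρ x u ⬝ᵥ ρ x v = u ⬝ᵥ v) (d : ℕ) :
    ∀ W : Subrepresentation ρ, Module.finrank ℝ W.toSubmodule = d →
    ∃ (ι : Type) (_ : Fintype ι) (s : ι → Subrepresentation ρ),
      (∀ i, (s i).toRepresentation.IsIrreducible) ∧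
      (∀ i j, i ≠ j → ∀ u ∈ (s i).toSubmodule, ∀ v ∈ (s j).toSubmodule, u ⬝ᵥ v = 0) ∧
      ⨆ i, (s i).toSubmodule = W.toSubmodule := by
  induction d using Nat.strong_induction_on with
  | _ d ih =>
    intro W hW
    by_cases h0 : W.toSubmodule = ⊥
    · exact ⟨Empty, inferInstance, Empty.elim, fun i => i.elim, fun i => i.elim, by
        rw [h0, iSup_of_empty]⟩
    obtain ⟨U, hUW, hU, hirr⟩ := exists_minimal_le h0
    have hlt : Module.finrank ℝ (subPerp hρ W U).toSubmodule < d := by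
      rw [← hW]
      refine Submodule.finrank_lt_finrank_of_lt (lt_of_le_of_ne inf_le_left fun he => hU ?_)
      rw [eq_bot_iff]
      intro v hv
      have hv' : v ∈ W.toSubmodule ⊓ perp U.toSubmodule := by
        have := hUW hv
        rw [← he] at this
        exact this
      exact (Submodule.mem_bot ℝ).2 ((Submodule.disjoint_def.1 (disjoint_perp _)) v hv hv'.2)
    obtain ⟨ι, _, s, hs1, hs2, hs3⟩ := ih _ hlt (subPerp hρ W U) rfl
    have hperp : ∀ i, ∀ v ∈ (s i).toSubmodule, v ∈ perp U.toSubmodule := by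
      intro i v hv
      have : v ∈ (subPerp hρ W U).toSubmodule := by
        rw [← hs3]
        exact Submodule.mem_iSup_of_mem i hv
      exact this.2
    refine ⟨Option ι, inferInstance, fun o => o.elim U s, ?_, ?_, ?_⟩
    · rintro (_ | i)
      · exact hirr
      · exact hs1 i
    · rintro (_ | i) (_ | j) hij u hu v hv
      · exact absurd rfl hij
      · exact mem_perp.1 (hperp j v hv) u hu
      · rw [dotProduct_comm]
        exact mem_perp.1 (hperp i u hu) v hv
      · exact hs2 i j (fun h => hij (by rw [h])) u hu v hv
    · rw [iSup_option]
      show U.toSubmodule ⊔ ⨆ i, (s i).toSubmodule = _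
      rw [hs3, sup_subPerp hρ hUW]

theorem isInternal_of_orthogonal {ι : Type*} [Fintype ι] [DecidableEq ι] {K : ι → Submodule ℝ (n → ℝ)}
    (h : ∀ i j, i ≠ j → ∀ u ∈ K i, ∀ v ∈ K j, u ⬝ᵥ v = 0) (htop : ⨆ i, K i = ⊤) :
    DirectSum.IsInternal K := by
  refine DirectSum.isInternal_submodule_of_iSupIndep_of_iSup_eq_top ?_ htop
  intro i
  have hle : ⨆ j, ⨆ (_ : j ≠ i), K j ≤ perp (K i) :=
    iSup₂_le fun j hj v hv => mem_perp.2 fun u hu => h i j hj.symm u hu v hv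
  exact (disjoint_perp (K i)).mono_right hle

/-- Sorting a finite family of irreducible subrepresentations by equivalence classes. -/
theorem exists_irrepDecomposition (hρ : ∀ x u v, ρ x u ⬝ᵥ ρ x v = u ⬝ᵥ v) :
    ∃ D : IrrepDecomposition ρ, ∀ p q, p ≠ q → ∀ u ∈ (D.sub p).toSubmodule,
      ∀ v ∈ (D.sub q).toSubmodule, u ⬝ᵥ v = 0 := by
  classical
  obtain ⟨ι, _, s, hs1, hs2, hs3⟩ := exists_irreducible_family hρ _ (⊤ : Subrepresentation ρ) rfl
  let r : Setoid ι :=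
    { r := fun i j => Nonempty ((s i).toRepresentation.Equiv (s j).toRepresentation)
      iseqv := ⟨fun _ => ⟨.refl _⟩, fun ⟨e⟩ => ⟨e.symm⟩, fun ⟨e⟩ ⟨f⟩ => ⟨e.trans f⟩⟩ }
  let c : Fin (Fintype.card (Quotient r)) ≃ Quotient r := (Fintype.equivFin _).symm
  -- Equivalence classes and the members of each class are enumerated separately, so the first
  -- component of an index is its class.
  let e : (Σ i : Fin (Fintype.card (Quotient r)),
      Fin (Fintype.card {k : ι // (Quotient.mk r k) = c i})) ≃ ι :=
    (Equiv.sigmaCongrRight fun i => (Fintype.equivFin _).symm).trans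
      ((Equiv.sigmaCongrLeft c (β := fun z => {k : ι // (Quotient.mk r k) = z})).trans
        (Equiv.sigmaFiberEquiv (Quotient.mk r)))
  have he : ∀ p, Quotient.mk r (e p) = c p.1 := by
    rintro ⟨i, a⟩
    exact ((Fintype.equivFin {k : ι // (Quotient.mk r k) = c i}).symm a).2
  refine ⟨{
    num := Fintype.card (Quotient r)
    mult := fun i => Fintype.card {k : ι // (Quotient.mk r k) = c i}
    mult_pos := fun i => ?_
    sub := fun p => s (e p)
    irreducible := fun p => hs1 _
    equiv_iff := fun p q => ?_
    isInternal := ?_ }, fun p q hpq => hs2 _ _ (e.injective.ne hpq)⟩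
  · obtain ⟨k, hk⟩ := Quotient.exists_rep (c i)
    exact Fintype.card_pos_iff.2 ⟨⟨k, hk⟩⟩
  · have h1 : Quotient.mk r (e p) = Quotient.mk r (e q) ↔ p.1 = q.1 := by
      rw [he, he]
      exact c.injective.eq_iff
    rw [← h1]
    exact ⟨fun h => Quotient.sound h, fun h => Quotient.exact h⟩
  · refine isInternal_of_orthogonal (fun p q hpq => hs2 _ _ (e.injective.ne hpq)) ?_
    rw [e.iSup_comp (g := fun i => (s i).toSubmodule), hs3]
    rfl

end Decompose

/-! ### Irreducible subrepresentations -/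

section Irreducible

variable {G V : Type*} [Group G] [AddCommGroup V] [Module ℝ V] {ρ : Representation ℝ G V}
  {K : Subrepresentation ρ}

theorem ne_bot_of_isIrreducible (hi : K.toRepresentation.IsIrreducible) : K.toSubmodule ≠ ⊥ := by
  intro h
  obtain ⟨S, T, hST⟩ := hi.toNontrivial
  apply hST
  have hsub : Subsingleton K.toSubmodule := by
    rw [h]; infer_instance
  apply Subrepresentation.toSubmodule_injective
  exact Subsingleton.elim _ _

/-- A subrepresentation of an irreducible one is trivial or everything. -/
theorem minimal_of_isIrreducible (hi : K.toRepresentation.IsIrreducible)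
    (S : Subrepresentation ρ) (hS : S.toSubmodule ≤ K.toSubmodule) :
    S.toSubmodule = ⊥ ∨ S.toSubmodule = K.toSubmodule := by
  let S' : Subrepresentation K.toRepresentation :=
    { toSubmodule := S.toSubmodule.comap K.toSubmodule.subtype
      apply_mem_toSubmodule := fun x v hv => S.apply_mem_toSubmodule x hv }
  have hmap : S'.toSubmodule.map K.toSubmodule.subtype = S.toSubmodule := by
    rw [Submodule.map_comap_eq, Submodule.range_subtype, inf_eq_right.2 hS]
  rcases hi.eq_bot_or_eq_top S' with h | h
  · left
    have : S'.toSubmodule = ⊥ := congrArg Subrepresentation.toSubmodule h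
    rw [← hmap, this, Submodule.map_bot]
  · right
    have : S'.toSubmodule = ⊤ := congrArg Subrepresentation.toSubmodule h
    rw [← hmap, this, Submodule.map_subtype_top]

end Irreducible

end GNY
end

noncomputable section
namespace GNY

/-! ### Matrices as tensors -/

section Tensor

open Matrix

/-- `u ⊗ v ↦ u vᵀ`. -/
def ofTensor : (Fin 4 → ℝ) ⊗[ℝ] (Fin 4 → ℝ) →ₗ[ℝ] Matrix (Fin 4) (Fin 4) ℝ :=
  TensorProduct.lift (LinearMap.mk₂ ℝ (fun u v : Fin 4 → ℝ => vecMulVec u v)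
    (fun u u' v => add_vecMulVec u u' v) (fun c u v => smul_vecMulVec c u v)
    (fun u v v' => vecMulVec_add u v v') (fun c u v => vecMulVec_smul c u v))

@[simp]
theorem ofTensor_tmul (u v : Fin 4 → ℝ) : ofTensor (u ⊗ₜ v) = vecMulVec u v := rfl

/-- The tensor with the given components. -/
def toTensor : Matrix (Fin 4) (Fin 4) ℝ →ₗ[ℝ] (Fin 4 → ℝ) ⊗[ℝ] (Fin 4 → ℝ) where
  toFun X := ∑ k, ∑ l, X k l • (Pi.single k 1 ⊗ₜ Pi.single l 1)
  map_add' X Y := by simp [add_smul, Finset.sum_add_distrib]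
  map_smul' c X := by simp [mul_smul, Finset.smul_sum]

theorem toTensor_vecMulVec (u v : Fin 4 → ℝ) : toTensor (vecMulVec u v) = u ⊗ₜ v := by
  have h : ∀ u : Fin 4 → ℝ, u = ∑ k, u k • (Pi.single k 1 : Fin 4 → ℝ) := fun u => by
    ext i
    simp [Finset.sum_apply, Pi.single_apply]
  conv_rhs => rw [h u, h v, TensorProduct.sum_tmul]
  show ∑ k, ∑ l, vecMulVec u v k l • (Pi.single k (1 : ℝ) : Fin 4 → ℝ) ⊗ₜ[ℝ]
    (Pi.single l (1 : ℝ) : Fin 4 → ℝ) = _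
  refine Finset.sum_congr rfl fun k _ => ?_
  rw [TensorProduct.tmul_sum]
  refine Finset.sum_congr rfl fun l _ => ?_
  rw [TensorProduct.smul_tmul_smul, vecMulVec_apply]

theorem toTensor_ofTensor (t : (Fin 4 → ℝ) ⊗[ℝ] (Fin 4 → ℝ)) : toTensor (ofTensor t) = t := by
  have : toTensor ∘ₗ ofTensor = LinearMap.id :=
    TensorProduct.ext' fun u v => by simp [toTensor_vecMulVec]
  exact LinearMap.congr_fun this t

theorem ofTensor_toTensor (X : Matrix (Fin 4) (Fin 4) ℝ) : ofTensor (toTensor X) = X := by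
  show ofTensor (∑ k, ∑ l, X k l • (Pi.single k 1 ⊗ₜ Pi.single l 1)) = X
  simp only [map_sum, map_smul, ofTensor_tmul, ← single_eq_single_vecMulVec_single]
  conv_rhs => rw [matrix_eq_sum_single X]
  simp

theorem ofTensor_injective : Function.Injective ofTensor :=
  Function.LeftInverse.injective toTensor_ofTensor

theorem toTensor_injective : Function.Injective toTensor :=
  Function.LeftInverse.injective ofTensor_toTensor

/-- With A = B = ρ(x) this identifies the conjugation in `TransformsAsVec` with the action on ℝ⁴ ⊗
ℝ⁴. -/
theorem ofTensor_map (A B : Matrix (Fin 4) (Fin 4) ℝ) (t : (Fin 4 → ℝ) ⊗[ℝ] (Fin 4 → ℝ)) :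
    ofTensor (TensorProduct.map (toLin' A) (toLin' B) t) = A * ofTensor t * Bᵀ := by
  induction t using TensorProduct.induction_on with
  | zero => simp
  | tmul u v =>
    rw [TensorProduct.map_tmul, ofTensor_tmul, ofTensor_tmul, toLin'_apply, toLin'_apply,
      mul_vecMulVec, vecMulVec_mul, vecMul_transpose]
  | add s t hs ht => simp only [map_add, hs, ht, Matrix.mul_add, Matrix.add_mul]

theorem toTensor_mul (A B X : Matrix (Fin 4) (Fin 4) ℝ) :
    toTensor (A * X * Bᵀ) = TensorProduct.map (toLin' A) (toLin' B) (toTensor X) := by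
  apply ofTensor_injective
  rw [ofTensor_map, ofTensor_toTensor, ofTensor_toTensor]

theorem ofTensor_comm (t : (Fin 4 → ℝ) ⊗[ℝ] (Fin 4 → ℝ)) :
    ofTensor (TensorProduct.comm ℝ _ _ t) = (ofTensor t)ᵀ := by
  induction t using TensorProduct.induction_on with
  | zero => simp
  | tmul u v => rw [TensorProduct.comm_tmul, ofTensor_tmul, ofTensor_tmul, transpose_vecMulVec]
  | add s t hs ht => simp only [map_add, hs, ht, transpose_add]

theorem toTensor_transpose (X : Matrix (Fin 4) (Fin 4) ℝ) :
    toTensor Xᵀ = TensorProduct.comm ℝ _ _ (toTensor X) := by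
  apply ofTensor_injective
  rw [ofTensor_comm, ofTensor_toTensor, ofTensor_toTensor]

end Tensor

/-! ### Vector operators and their blocks -/

section Operators

open Matrix

variable {M : ℕ}

/-- The symmetric tuples that transform as `Vec` under `ρ`. -/
def vectorOperators (ρ : SpinRep M) : Submodule ℝ (Yukawa M) where
  carrier := {R | (∀ m, (R m).IsSymm) ∧ TransformsAsVec ρ R}
  add_mem' {R S} hR hS := ⟨fun m => (hR.1 m).add (hS.1 m), fun x φ => by
    rw [Yukawa.add_at, Yukawa.add_at, Matrix.mul_add, Matrix.add_mul, hR.2, hS.2]⟩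
  zero_mem' := ⟨fun m => transpose_zero, fun x φ => by simp [Yukawa.at]⟩
  smul_mem' c R hR := ⟨fun m => (hR.1 m).smul c, fun x φ => by
    rw [Yukawa.smul_at, Yukawa.smul_at, Matrix.mul_smul, Matrix.smul_mul, hR.2]⟩

variable {ρ : SpinRep M}

theorem SpinRep.rep_apply (ρ : SpinRep M) (x : Spin M) (v : Fin 4 → ℝ) :
    ρ.rep x v = ρ.mat x *ᵥ v := rfl

theorem SpinRep.mat_mem (ρ : SpinRep M) (x : Spin M) :
    ρ.mat x ∈ Matrix.orthogonalGroup (Fin 4) ℝ := (ρ.toHom x).2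

theorem SpinRep.rep_dotProduct (ρ : SpinRep M) (x : Spin M) (u v : Fin 4 → ℝ) :
    ρ.rep x u ⬝ᵥ ρ.rep x v = u ⬝ᵥ v := by
  rw [ρ.rep_apply, ρ.rep_apply, dotProduct_mulVec, ← mulVec_transpose, mulVec_mulVec,
    orthogonal_transpose_mul (ρ.mat_mem x), one_mulVec]

theorem proj_rep (K : Subrepresentation ρ.rep) (x : Spin M) (v : Fin 4 → ℝ) :
    proj K.toSubmodule (ρ.rep x v) = ρ.rep x (proj K.toSubmodule v) := by
  refine proj_eq (K.apply_mem_toSubmodule x (proj_mem _ v)) (mem_perp.2 fun u hu => ?_)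
  rw [← map_sub]
  have := mem_perp.1 (sub_proj_mem K.toSubmodule v) _ (K.apply_mem_toSubmodule x⁻¹ hu)
  rw [← ρ.rep_dotProduct x, ← Module.End.mul_apply, ← map_mul, mul_inv_cancel, map_one] at this
  exact this

theorem projMat_mul_mat (K : Subrepresentation ρ.rep) (x : Spin M) :
    projMat K.toSubmodule * ρ.mat x = ρ.mat x * projMat K.toSubmodule := by
  refine Matrix.ext_of_mulVec_single fun j => ?_
  rw [← mulVec_mulVec, ← mulVec_mulVec, projMat_mulVec, projMat_mulVec]
  exact proj_rep K x _

/-- The orthogonal projection as an intertwining map. -/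
def projIntertwining (K : Subrepresentation ρ.rep) :
    ρ.rep.IntertwiningMap K.toRepresentation where
  toLinearMap := (proj K.toSubmodule).codRestrict K.toSubmodule (proj_mem K.toSubmodule)
  isIntertwining' x := LinearMap.ext fun v => Subtype.ext (proj_rep K x v)

/-- `φ ↦ R(φ)` as a linear map. -/
def Yukawa.atLinear (R : Yukawa M) : (Fin M → ℝ) →ₗ[ℝ] Matrix (Fin 4) (Fin 4) ℝ where
  toFun := R.at
  map_add' := R.at_add
  map_smul' := R.at_smul

/-- The map φ ↦ (f ⊗ g)(R(φ)) is equivariant. Its kernel is an invariant subspace of Vec that misses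
one basis vector, hence is zero. General targets `σ` and `τ` allow each summand to be replaced by
the first copy of its irrep. -/
theorem exists_intertwining_vec {V W : Type*} [AddCommGroup V] [Module ℝ V] [AddCommGroup W]
    [Module ℝ W] {σ : Representation ℝ (Spin M) V} {τ : Representation ℝ (Spin M) W}
    (f : ρ.rep.IntertwiningMap σ) (g : ρ.rep.IntertwiningMap τ) {R : Yukawa M}
    (hR : TransformsAsVec ρ R) {m : Fin M}
    (h : TensorProduct.map f.toLinearMap g.toLinearMap (toTensor (R m)) ≠ 0) :
    ∃ Φ : (vec M).IntertwiningMap (σ.tprod τ), Function.Injective Φ ∧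
      ∀ φ, Φ φ = TensorProduct.map f.toLinearMap g.toLinearMap (toTensor (R.at φ)) := by
  obtain ⟨Φ₀, hΦ₀⟩ : ∃ Φ₀ : (Fin M → ℝ) →ₗ[ℝ] V ⊗[ℝ] W,
      ∀ φ, Φ₀ φ = TensorProduct.map f.toLinearMap g.toLinearMap (toTensor (R.at φ)) :=
    ⟨TensorProduct.map f.toLinearMap g.toLinearMap ∘ₗ toTensor ∘ₗ R.atLinear, fun φ => rfl⟩
  have hΦ : ∀ x φ, Φ₀ (vec M x φ) = (σ.tprod τ) x (Φ₀ φ) := by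
    intro x φ
    have e1 : f.toLinearMap ∘ₗ toLin' (ρ.mat x) = σ x ∘ₗ f.toLinearMap := f.isIntertwining' x
    have e2 : g.toLinearMap ∘ₗ toLin' (ρ.mat x) = τ x ∘ₗ g.toLinearMap := g.isIntertwining' x
    rw [hΦ₀, hΦ₀, ← hR x φ, toTensor_mul, Representation.tprod_apply, TensorProduct.map_map,
      TensorProduct.map_map, e1, e2]
  refine ⟨⟨Φ₀, fun x => LinearMap.ext (hΦ x)⟩, ?_, hΦ₀⟩
  have hker : LinearMap.ker Φ₀ = ⊥ := by
    by_contra hne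
    have htop := eq_top_of_vec_invariant (K := LinearMap.ker Φ₀) (fun x φ hφ => by
      rw [LinearMap.mem_ker] at hφ ⊢
      rw [hΦ, hφ, map_zero]) hne
    apply h
    have : (Pi.single m 1 : Fin M → ℝ) ∈ LinearMap.ker Φ₀ := by rw [htop]; trivial
    rwa [LinearMap.mem_ker, hΦ₀, R.at_single] at this
  exact LinearMap.ker_eq_bot.1 hker

variable (D : IrrepDecomposition ρ.rep)

/-- The projection onto a summand. -/
abbrev IrrepDecomposition.P (p : Σ i, Fin (D.mult i)) : Matrix (Fin 4) (Fin 4) ℝ :=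
  projMat (D.sub p).toSubmodule

theorem P_transpose (p : Σ i, Fin (D.mult i)) : (D.P p)ᵀ = D.P p := projMat_transpose _

/-- `R` has a nonvanishing matrix element between the summands `p` and `q`. -/
def HasBlock (p q : Σ i, Fin (D.mult i)) (R : Yukawa M) : Prop :=
  ∃ m, D.P p * R m * D.P q ≠ 0

theorem exists_equiv_irrep (p : Σ i, Fin (D.mult i)) :
    Nonempty ((D.sub p).toRepresentation.Equiv (D.irrep p.1)) :=
  (D.equiv_iff p ⟨p.1, ⟨0, D.mult_pos p.1⟩⟩).2 rfl

/-- Nothing is lost in passing to the first copies: the inverse equivalences followed by the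
inclusions recover the block P_p X P_q. -/
theorem map_proj_ne_zero {p q : Σ i, Fin (D.mult i)}
    (e : (D.sub p).toRepresentation.Equiv (D.irrep p.1))
    (e' : (D.sub q).toRepresentation.Equiv (D.irrep q.1)) {X : Matrix (Fin 4) (Fin 4) ℝ}
    (h : D.P p * X * D.P q ≠ 0) :
    TensorProduct.map (e.toIntertwiningMap.comp (projIntertwining (D.sub p))).toLinearMap
      (e'.toIntertwiningMap.comp (projIntertwining (D.sub q))).toLinearMap (toTensor X) ≠ 0 := by
  intro h0
  apply h
  apply toTensor_injective
  have h2 := toTensor_mul (D.P p) (D.P q) X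
  rw [P_transpose] at h2
  rw [map_zero, h2]
  have h1 : ∀ (s : Σ i, Fin (D.mult i)) (e : (D.sub s).toRepresentation.Equiv (D.irrep s.1)),
      toLin' (D.P s) = ((D.sub s).toSubmodule.subtype ∘ₗ e.symm.toLinearMap) ∘ₗ
      (e.toIntertwiningMap.comp (projIntertwining (D.sub s))).toLinearMap := by
    intro s e
    refine LinearMap.ext fun v => ?_
    rw [toLin'_apply, projMat_mulVec]
    show _ = ((e.symm (e (projIntertwining (D.sub s) v))) : Fin 4 → ℝ)
    rw [e.symm_apply_apply]
    rfl
  rw [h1 p e, h1 q e', TensorProduct.map_comp, LinearMap.comp_apply, h0, map_zero]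

/-- Necessity of the selection rule: a nonzero block embeds Vec by `exists_intertwining_vec`. -/
theorem VecInTensor.of_hasBlock {p q : Σ i, Fin (D.mult i)} {R : Yukawa M}
    (hR : R ∈ vectorOperators ρ) (h : HasBlock D p q R) : VecInTensor D p.1 q.1 := by
  obtain ⟨m, hm⟩ := h
  obtain ⟨e⟩ := exists_equiv_irrep D p
  obtain ⟨e'⟩ := exists_equiv_irrep D q
  obtain ⟨Φ, hΦ, -⟩ := exists_intertwining_vec _ _ hR.2 (map_proj_ne_zero D e e' hm)
  exact ⟨Φ, hΦ⟩

/-- The same equivalence is used on both tensor factors, so that a symmetric matrix yields a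
symmetric tensor. -/
theorem VecInSymSquare.of_hasBlock {p : Σ i, Fin (D.mult i)} {R : Yukawa M}
    (hR : R ∈ vectorOperators ρ) (h : HasBlock D p p R) : VecInSymSquare D p.1 := by
  obtain ⟨m, hm⟩ := h
  obtain ⟨e⟩ := exists_equiv_irrep D p
  obtain ⟨Φ, hΦ, hΦe⟩ := exists_intertwining_vec _ _ hR.2 (map_proj_ne_zero D e e hm)
  have hmem : ∀ φ, Φ.toLinearMap φ ∈ (symSquare (D.irrep p.1)).toSubmodule := by
    intro φ
    show TensorProduct.comm ℝ _ _ (Φ φ) = Φ φ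
    rw [hΦe]
    have hs : toTensor (R.at φ) = TensorProduct.comm ℝ _ _ (toTensor (R.at φ)) := by
      rw [← toTensor_transpose, (R.at_isSymm hR.1 φ).eq]
    conv_rhs => rw [hs]
    rw [TensorProduct.map_comm]
  refine ⟨⟨Φ.toLinearMap.codRestrict _ hmem, fun x => LinearMap.ext fun φ => Subtype.ext ?_⟩, ?_⟩
  · exact LinearMap.congr_fun (Φ.isIntertwining' x) φ
  · intro φ ψ h
    exact hΦ (congrArg Subtype.val h)

/-- The matrices attached to a homomorphism from `Vec` to a tensor product of summands. -/
theorem exists_matrices_of_intertwining {p q : Σ i, Fin (D.mult i)} (hM : 1 ≤ M)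
    (e : (D.sub p).toRepresentation.Equiv (D.irrep p.1))
    (e' : (D.sub q).toRepresentation.Equiv (D.irrep q.1))
    (f : (vec M).IntertwiningMap ((D.irrep p.1).tprod (D.irrep q.1))) (hf : Function.Injective f) :
    ∃ X : Yukawa M, TransformsAsVec ρ X ∧ (∃ m, X m ≠ 0) ∧ (∀ m, D.P p * X m * D.P q = X m) ∧
      ∀ φ, X.at φ = ofTensor (TensorProduct.map
        ((D.sub p).toSubmodule.subtype ∘ₗ e.symm.toLinearMap)
        ((D.sub q).toSubmodule.subtype ∘ₗ e'.symm.toLinearMap) (f φ)) := by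
  set a := (D.sub p).toSubmodule.subtype ∘ₗ e.symm.toLinearMap with ha
  set b := (D.sub q).toSubmodule.subtype ∘ₗ e'.symm.toLinearMap with hb
  have inj : ∀ (s : Σ i, Fin (D.mult i)) (e : (D.sub s).toRepresentation.Equiv (D.irrep s.1)),
      Function.Injective ((D.sub s).toSubmodule.subtype ∘ₗ e.symm.toLinearMap) := fun s e =>
    Subtype.val_injective.comp e.symm.toLinearEquiv.injective
  have comm : ∀ (s : Σ i, Fin (D.mult i)) (e : (D.sub s).toRepresentation.Equiv (D.irrep s.1)) x,
      toLin' (ρ.mat x) ∘ₗ (D.sub s).toSubmodule.subtype ∘ₗ e.symm.toLinearMap =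
      ((D.sub s).toSubmodule.subtype ∘ₗ e.symm.toLinearMap) ∘ₗ D.irrep s.1 x := by
    intro s e x
    have := e.symm.isIntertwining' x
    ext1 v
    have h1 := LinearMap.congr_fun this v
    exact (congrArg Subtype.val h1).symm
  have fixed : ∀ (s : Σ i, Fin (D.mult i)) (e : (D.sub s).toRepresentation.Equiv (D.irrep s.1)),
      toLin' (D.P s) ∘ₗ (D.sub s).toSubmodule.subtype ∘ₗ e.symm.toLinearMap =
      (D.sub s).toSubmodule.subtype ∘ₗ e.symm.toLinearMap := by
    intro s e
    ext1 v
    show D.P s *ᵥ (e.symm v : Fin 4 → ℝ) = (e.symm v : Fin 4 → ℝ)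
    rw [projMat_mulVec, proj_of_mem (e.symm v).2]
  let L : (Fin M → ℝ) →ₗ[ℝ] Matrix (Fin 4) (Fin 4) ℝ :=
    ofTensor ∘ₗ TensorProduct.map a b ∘ₗ f.toLinearMap
  have hL : Function.Injective L :=
    ofTensor_injective.comp ((TensorProduct.map_injective_of_flat_flat a b (inj p e)
      (inj q e')).comp hf)
  let X : Yukawa M := fun m => L (Pi.single m 1)
  have hX : ∀ φ, X.at φ = L φ := Yukawa.at_linear X (f := L) L.isLinear (fun m => rfl)
  refine ⟨X, fun x φ => ?_, ⟨⟨0, hM⟩, fun h => ?_⟩, fun m => ?_, hX⟩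
  · rw [hX, hX]
    show _ * ofTensor (TensorProduct.map a b (f φ)) * _ =
      ofTensor (TensorProduct.map a b (f.toLinearMap (vec M x φ)))
    have h2 : f.toLinearMap (vec M x φ) = (D.irrep p.1).tprod (D.irrep q.1) x (f φ) :=
      LinearMap.congr_fun (f.isIntertwining' x) φ
    rw [← ofTensor_map, h2, TensorProduct.map_map, ha, hb, comm p e, comm q e',
      Representation.tprod_apply, TensorProduct.map_map]
  · have : (Pi.single ⟨0, hM⟩ 1 : Fin M → ℝ) = 0 := hL (by rw [map_zero]; exact h)
    have h1 := congrFun this ⟨0, hM⟩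
    simp at h1
  · show D.P p * ofTensor (TensorProduct.map a b (f (Pi.single m 1))) * D.P q = _
    have h2 := ofTensor_map (D.P p) (D.P q) (TensorProduct.map a b (f (Pi.single m 1)))
    rw [P_transpose] at h2
    rw [← h2, TensorProduct.map_map, ha, hb, fixed p e, fixed q e']
    rfl

variable {D}

theorem P_mul_self (p : Σ i, Fin (D.mult i)) : D.P p * D.P p = D.P p := by
  refine Matrix.ext_of_mulVec_single fun j => ?_
  rw [← mulVec_mulVec, projMat_mulVec, projMat_mulVec, proj_of_mem (proj_mem _ _)]

theorem P_mul_of_ne (hD : IsOrthogonalDecomposition D) {p q : Σ i, Fin (D.mult i)} (hpq : p ≠ q) :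
    D.P p * D.P q = 0 := by
  refine Matrix.ext_of_mulVec_single fun j => ?_
  rw [← mulVec_mulVec, projMat_mulVec, projMat_mulVec, zero_mulVec,
    proj_of_mem_perp (mem_perp.2 fun u hu => hD p q hpq u hu _ (proj_mem _ _))]

theorem sum_P (hD : IsOrthogonalDecomposition D) : ∑ p, D.P p = 1 :=
  sum_projMat hD D.isInternal.submodule_iSup_eq_top

theorem P_mul_mul_eq_zero_iff (p q : Σ i, Fin (D.mult i)) (X : Matrix (Fin 4) (Fin 4) ℝ) :
    D.P p * X * D.P q = 0 ↔
      ∀ u ∈ (D.sub p).toSubmodule, ∀ v ∈ (D.sub q).toSubmodule, u ⬝ᵥ X *ᵥ v = 0 := by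
  constructor
  · intro h u hu v hv
    have h1 : u ⬝ᵥ (D.P p * X * D.P q) *ᵥ v = 0 := by rw [h, zero_mulVec, dotProduct_zero]
    rwa [← mulVec_mulVec, ← mulVec_mulVec, projMat_mulVec, projMat_mulVec, dotProduct_proj hu,
      proj_of_mem hv] at h1
  · intro h
    ext i j
    have h1 := h _ (proj_mem _ (Pi.single i 1)) _ (proj_mem _ (Pi.single j 1))
    rw [proj_dotProduct_comm, ← projMat_mulVec, ← projMat_mulVec, mulVec_mulVec,
      mulVec_mulVec] at h1
    simpa using h1

theorem supportedOn_iff {p q : Σ i, Fin (D.mult i)} {R : Yukawa M} :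
    SupportedOn D p q R ↔
      ∀ a b, (a, b) ≠ (p, q) → (a, b) ≠ (q, p) → ∀ m, D.P a * R m * D.P b = 0 := by
  refine forall₄_congr fun a b _ _ => ?_
  simp only [P_mul_mul_eq_zero_iff]
  exact ⟨fun h m u hu v hv => h u hu v hv m, fun h u hu v hv m => h m u hu v hv⟩

theorem HasBlock.symm {p q : Σ i, Fin (D.mult i)} {R : Yukawa M} (hR : ∀ m, (R m).IsSymm)
    (h : HasBlock D p q R) : HasBlock D q p R := by
  obtain ⟨m, hm⟩ := h
  refine ⟨m, fun h0 => hm ?_⟩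
  have := congrArg transpose h0
  rwa [transpose_mul, transpose_mul, projMat_transpose, projMat_transpose, (hR m).eq,
    transpose_zero, ← Matrix.mul_assoc] at this

theorem exists_hasBlock (hD : IsOrthogonalDecomposition D) {R : Yukawa M} (hR : R ≠ 0) :
    ∃ p q, HasBlock D p q R := by
  by_contra! h
  apply hR
  funext m
  have : R m = ∑ p, ∑ q, D.P p * R m * D.P q := by
    rw [← Finset.sum_comm]
    simp only [← Finset.sum_mul, ← Finset.mul_sum, sum_P hD, Matrix.one_mul, Matrix.mul_one]
  rw [this]
  refine Finset.sum_eq_zero fun p _ => Finset.sum_eq_zero fun q _ => ?_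
  by_contra hne
  exact h p q ⟨m, hne⟩

theorem SupportedOn.hasBlock (hD : IsOrthogonalDecomposition D) {p q : Σ i, Fin (D.mult i)}
    {R : Yukawa M} (hR : ∀ m, (R m).IsSymm) (hR0 : R ≠ 0) (hs : SupportedOn D p q R) :
    HasBlock D p q R := by
  obtain ⟨a, b, hab⟩ := exists_hasBlock hD hR0
  by_cases h1 : (a, b) = (p, q)
  · obtain ⟨rfl, rfl⟩ := Prod.ext_iff.1 h1
    exact hab
  by_cases h2 : (a, b) = (q, p)
  · obtain ⟨rfl, rfl⟩ := Prod.ext_iff.1 h2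
    exact hab.symm hR
  obtain ⟨m, hm⟩ := hab
  exact absurd (supportedOn_iff.1 hs a b h1 h2 m) hm

variable (D)

/-- The part of `R` between the summands `p` and `q`. -/
def blockPart (p q : Σ i, Fin (D.mult i)) (R : Yukawa M) : Yukawa M :=
  fun m => D.P p * R m * D.P q + D.P q * R m * D.P p

variable {D}

theorem blockPart_mem {p q : Σ i, Fin (D.mult i)} {R : Yukawa M} (hR : R ∈ vectorOperators ρ) :
    blockPart D p q R ∈ vectorOperators ρ := by
  refine ⟨fun m => ?_, fun x φ => ?_⟩
  · rw [IsSymm, blockPart, transpose_add, transpose_mul, transpose_mul, transpose_mul,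
      transpose_mul, projMat_transpose, projMat_transpose, (hR.1 m).eq, add_comm]
    simp only [Matrix.mul_assoc]
  · have hat : ∀ φ, (blockPart D p q R).at φ = D.P p * R.at φ * D.P q + D.P q * R.at φ * D.P p := by
      intro φ
      simp [Yukawa.at, blockPart, Finset.mul_sum, Finset.sum_mul, Finset.sum_add_distrib]
    have hc : ∀ s, D.P s * ρ.mat x = ρ.mat x * D.P s := fun s => projMat_mul_mat _ _
    have hc' : ∀ s, D.P s * (ρ.mat x)ᵀ = (ρ.mat x)ᵀ * D.P s := by
      intro s
      have := congrArg transpose (hc s)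
      rw [transpose_mul, transpose_mul, projMat_transpose] at this
      exact this.symm
    have key : ∀ s t, ρ.mat x * (D.P s * R.at φ * D.P t) * (ρ.mat x)ᵀ =
        D.P s * R.at (vec M x φ) * D.P t := by
      intro s t
      rw [← hR.2 x φ]
      calc _ = (ρ.mat x * D.P s) * R.at φ * (D.P t * (ρ.mat x)ᵀ) := by simp only [Matrix.mul_assoc]
        _ = _ := by rw [← hc, hc']; simp only [Matrix.mul_assoc]
    rw [hat, hat, Matrix.mul_add, Matrix.add_mul, key, key]

theorem supportedOn_blockPart (hD : IsOrthogonalDecomposition D) (p q : Σ i, Fin (D.mult i))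
    (R : Yukawa M) : SupportedOn D p q (blockPart D p q R) := by
  rw [supportedOn_iff]
  intro a b h1 h2 m
  have key : ∀ s t, (a, b) ≠ (s, t) → D.P a * (D.P s * R m * D.P t) * D.P b = 0 := by
    intro s t hst
    have e : D.P a * (D.P s * R m * D.P t) * D.P b = (D.P a * D.P s) * R m * (D.P t * D.P b) := by
      simp only [Matrix.mul_assoc]
    rw [e]
    by_cases has : a = s
    · have hbt : t ≠ b := fun h => hst (by rw [has, h])
      rw [P_mul_of_ne hD hbt, Matrix.mul_zero]
    · rw [P_mul_of_ne hD has, Matrix.zero_mul, Matrix.zero_mul]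
  rw [blockPart, Matrix.mul_add, Matrix.add_mul, key p q h1, key q p h2, add_zero]

theorem blockPart_hasBlock (hD : IsOrthogonalDecomposition D) {p q : Σ i, Fin (D.mult i)}
    {R : Yukawa M} (h : HasBlock D p q R) : HasBlock D p q (blockPart D p q R) := by
  obtain ⟨m, hm⟩ := h
  refine ⟨m, ?_⟩
  have e : D.P p * (D.P p * R m * D.P q + D.P q * R m * D.P p) * D.P q =
      (D.P p * D.P p) * R m * (D.P q * D.P q) + (D.P p * D.P q) * R m * (D.P p * D.P q) := by
    rw [Matrix.mul_add, Matrix.add_mul]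
    simp only [Matrix.mul_assoc]
  rw [blockPart, e, P_mul_self, P_mul_self]
  by_cases hpq : p = q
  · subst hpq
    rw [P_mul_self, ← two_smul ℝ]
    exact smul_ne_zero two_ne_zero hm
  · rwa [P_mul_of_ne hD hpq, Matrix.zero_mul, Matrix.zero_mul, add_zero]

theorem HasBlock.ne_zero {p q : Σ i, Fin (D.mult i)} {R : Yukawa M} (h : HasBlock D p q R) :
    R ≠ 0 := by
  rintro rfl
  obtain ⟨m, hm⟩ := h
  simp at hm

/-- The selection rules are sufficient. -/
theorem exists_hasBlock_of_coupling (hM : 1 ≤ M) (hD : IsOrthogonalDecomposition D)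
    (c : CouplingIndex D) :
    ∃ T ∈ vectorOperators ρ, HasBlock D (couplingEnds D c).1 (couplingEnds D c).2 T := by
  -- An embedding of Vec only provides covariant matrices; adding the transpose makes them symmetric
  -- without spoiling covariance. In each case it has to be seen that the block survives this.
  have sym : ∀ X : Yukawa M, TransformsAsVec ρ X →
      (fun m => X m + (X m)ᵀ : Yukawa M) ∈ vectorOperators ρ := by
    intro X hX
    refine ⟨fun m => ?_, fun x φ => ?_⟩
    · rw [IsSymm, transpose_add, transpose_transpose, add_comm]
    · have hat : ∀ φ, Yukawa.at (fun m => X m + (X m)ᵀ : Yukawa M) φ = X.at φ + (X.at φ)ᵀ := by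
        intro φ
        simp [Yukawa.at, Finset.sum_add_distrib, transpose_sum]
      rw [hat, hat, ← hX x φ]
      simp only [transpose_mul, transpose_transpose, Matrix.mul_add, Matrix.add_mul,
        Matrix.mul_assoc]
  rcases c with ⟨⟨p, q⟩, hlt, f, hf⟩ | ⟨p, f, hf⟩
  · obtain ⟨e⟩ := exists_equiv_irrep D p
    obtain ⟨e'⟩ := exists_equiv_irrep D q
    obtain ⟨X, hX, ⟨m, hm⟩, hP, -⟩ := exists_matrices_of_intertwining D hM e e' f hf
    refine ⟨_, sym X hX, m, ?_⟩
    show D.P p * (X m + (X m)ᵀ) * D.P q ≠ 0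
    have hpq : p ≠ q := fun h => (ne_of_lt hlt) (by simp [h])
    -- For different summands the transpose lives in the opposite block and cannot cancel X.
    have e0 : D.P p * (X m)ᵀ = 0 := by
      rw [← hP m, transpose_mul, projMat_transpose, ← Matrix.mul_assoc, P_mul_of_ne hD hpq,
        Matrix.zero_mul]
    rwa [Matrix.mul_add, e0, add_zero, hP]
  · obtain ⟨e⟩ := exists_equiv_irrep D p
    let g : (vec M).IntertwiningMap ((D.irrep p.1).tprod (D.irrep p.1)) :=
      ⟨(symSquare (D.irrep p.1)).toSubmodule.subtype ∘ₗ f.toLinearMap, fun x =>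
        LinearMap.ext fun φ =>
          congrArg Subtype.val (LinearMap.congr_fun (f.isIntertwining' x) φ)⟩
    have hg : Function.Injective g := Subtype.val_injective.comp hf
    obtain ⟨X, hX, ⟨m, hm⟩, hP, hXat⟩ := exists_matrices_of_intertwining D hM e e g hg
    refine ⟨_, sym X hX, m, ?_⟩
    show D.P p * (X m + (X m)ᵀ) * D.P p ≠ 0
    -- An embedding into Sym² gives matrices that are symmetric already, so symmetrisation doubles
    -- them.
    have hs : (X m)ᵀ = X m := by
      rw [← X.at_single m, hXat, ← ofTensor_comm, ← TensorProduct.map_comm]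
      congr 2
      exact (f (Pi.single m 1)).2
    rw [hs, ← two_smul ℝ (X m), Matrix.mul_smul, Matrix.smul_mul, hP]
    exact smul_ne_zero two_ne_zero hm

end Operators

end GNY
end

noncomputable section
namespace GNY

/-! ### From tuples supported on blocks to the linear parametrization by couplings -/

section Couplings

open Matrix

variable {M : ℕ} {ρ : SpinRep M} {D : IrrepDecomposition ρ.rep}

theorem card_couplingIndex (D : IrrepDecomposition ρ.rep) :
    Nat.card (CouplingIndex D) = couplingBound D := by
  classical
  rw [Nat.card_sum, couplingBound]
  congr 1
  · rw [Nat.card_eq_fintype_card, Fintype.card_subtype, Finset.card_filter,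
      Fintype.sum_prod_type, Fintype.sum_sigma]
    refine Finset.sum_congr rfl fun i _ => ?_
    simp only [Fintype.sum_sigma]
    rw [Finset.sum_comm]
    refine Finset.sum_congr rfl fun j _ => ?_
    split_ifs <;> simp
  · rw [Nat.card_eq_fintype_card, Fintype.card_subtype, Finset.card_filter, Fintype.sum_sigma]
    refine Finset.sum_congr rfl fun i _ => ?_
    simp only
    split_ifs <;> simp

theorem couplingEnds_fst_le (c : CouplingIndex D) :
    (couplingEnds D c).1.1 < (couplingEnds D c).2.1 ∨ (couplingEnds D c).1 = (couplingEnds D c).2 := by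
  rcases c with c | p
  · exact Or.inl c.2.1
  · exact Or.inr rfl

theorem couplingEnds_injective : Function.Injective (couplingEnds D) := by
  rintro (c | p) (c' | p') h
  · exact congrArg Sum.inl (Subtype.ext h)
  · have h1 : c.1 = (p'.1, p'.1) := h
    have := c.2.1
    rw [h1] at this
    exact absurd this (lt_irrefl _)
  · have h1 : (p.1, p.1) = c'.1 := h
    have := c'.2.1
    rw [← h1] at this
    exact absurd this (lt_irrefl _)
  · exact congrArg Sum.inr (Subtype.ext (Prod.ext_iff.1 h).1)

/-- Ends are strictly ordered or equal, so no coupling uses the transposed block of another one.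
Together with `couplingEnds_injective`, distinct couplings have disjoint blocks. -/
theorem couplingEnds_swap_ne {c c' : CouplingIndex D} (h : c ≠ c') :
    couplingEnds D c ≠ (couplingEnds D c').swap := by
  intro he
  have e1 : (couplingEnds D c).1 = (couplingEnds D c').2 := congrArg Prod.fst he
  have e2 : (couplingEnds D c).2 = (couplingEnds D c').1 := congrArg Prod.snd he
  rcases couplingEnds_fst_le c' with h1 | h1
  · rcases couplingEnds_fst_le c with h2 | h2
    · rw [e1, e2] at h2
      exact lt_asymm h1 h2
    · rw [← e1, ← e2, h2] at h1
      exact lt_irrefl _ h1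
  · exact h (couplingEnds_injective (by rw [he, Prod.ext_iff]; exact ⟨h1.symm, h1⟩))

/-- The matrix elements of a combination of tuples attached to distinct couplings. -/
theorem exists_couplingMap [Fintype (CouplingIndex D)] (hD : IsOrthogonalDecomposition D)
    (T : CouplingIndex D → Yukawa M) (hT : ∀ c, T c ∈ vectorOperators ρ)
    (hT0 : ∀ c, T c ≠ 0)
    (hTs : ∀ c, SupportedOn D (couplingEnds D c).1 (couplingEnds D c).2 (T c)) :
    ∃ F : (CouplingIndex D → ℝ) →ₗ[ℝ] Yukawa M, (∀ g, F g = ∑ c, g c • T c) ∧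
      Function.Injective F := by
  classical
  let F : (CouplingIndex D → ℝ) →ₗ[ℝ] Yukawa M :=
    { toFun := fun g => ∑ c, g c • T c
      map_add' := fun g h => by simp [add_smul, Finset.sum_add_distrib]
      map_smul' := fun a g => by simp [mul_smul, Finset.smul_sum] }
  refine ⟨F, fun g => rfl, ?_⟩
  rw [injective_iff_map_eq_zero]
  intro g hg
  funext c
  obtain ⟨m, hm⟩ := (hTs c).hasBlock hD (hT c).1 (hT0 c)
  -- Only the term with index c survives between the two projections belonging to c.
  have h0 : D.P (couplingEnds D c).1 * (F g m) * D.P (couplingEnds D c).2 = 0 := by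
    rw [hg]; simp
  have h1 : F g m = ∑ c, g c • T c m := by
    show (∑ c, g c • T c) m = _
    rw [Finset.sum_apply]
    rfl
  rw [h1, Finset.mul_sum, Finset.sum_mul, Finset.sum_eq_single c] at h0
  · rw [Matrix.mul_smul, Matrix.smul_mul] at h0
    exact (smul_eq_zero.1 h0).resolve_right hm
  · intro c' _ hc'
    have := supportedOn_iff.1 (hTs c') (couplingEnds D c).1 (couplingEnds D c).2
      (fun h => hc' (couplingEnds_injective h).symm)
      (fun h => couplingEnds_swap_ne hc'.symm h) m
    rw [Matrix.mul_smul, Matrix.smul_mul, this, smul_zero]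
  · simp

/-- The second part of the theorem for one decomposition. -/
def CouplingNormalForm (N : ℕ) (D : IrrepDecomposition ρ.rep) : Prop :=
  ∃ F : (CouplingIndex D → ℝ) →ₗ[ℝ] Yukawa M,
    Function.Injective F ∧
    (∀ c (t : ℝ), SupportedOn D (couplingEnds D c).1 (couplingEnds D c).2
      (F (Function.update 0 c t))) ∧
    (∀ g, (∀ m, (F g m).IsSymm) ∧ TransformsAsVec ρ (F g) ∧ SOUnbroken N (F g)) ∧
    (∀ R : Yukawa M, (∀ m, (R m).IsSymm) → TransformsAsVec ρ R → ∃ g, YukawaEquiv R (F g))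

theorem SupportedOn.smul {p q : Σ i, Fin (D.mult i)} {R : Yukawa M} (h : SupportedOn D p q R)
    (t : ℝ) : SupportedOn D p q (t • R) := by
  intro a b h1 h2 u hu v hv m
  rw [Pi.smul_apply, smul_mulVec, dotProduct_smul, h a b h1 h2 u hu v hv m, smul_zero]

theorem SupportedOn.symm {p q : Σ i, Fin (D.mult i)} {R : Yukawa M} (h : SupportedOn D p q R) :
    SupportedOn D q p R := fun a b h1 h2 => h a b h2 h1

/-- With F(g) = ∑ g_c T_c every clause but the last is formal; the last says that the span of the
T_c meets every equivalence class of operators. -/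
theorem couplingNormalForm_of (N : ℕ) (hD : IsOrthogonalDecomposition D)
    (T : CouplingIndex D → Yukawa M) (hT : ∀ c, T c ∈ vectorOperators ρ) (hT0 : ∀ c, T c ≠ 0)
    (hTs : ∀ c, SupportedOn D (couplingEnds D c).1 (couplingEnds D c).2 (T c))
    (hR : ∀ R ∈ vectorOperators ρ, ∃ R' ∈ Submodule.span ℝ (Set.range T), YukawaEquiv R R') :
    CouplingNormalForm N D := by
  classical
  obtain ⟨F, hF, hinj⟩ := exists_couplingMap hD T hT hT0 hTs
  have hmem : ∀ g, F g ∈ vectorOperators ρ := by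
    intro g
    rw [hF]
    exact Submodule.sum_mem _ fun c _ => Submodule.smul_mem _ _ (hT c)
  refine ⟨F, hinj, fun c t => ?_, fun g => ⟨(hmem g).1, (hmem g).2,
    soUnbroken_of_transformsAsVec N (hmem g).2⟩, fun R h1 h2 => ?_⟩
  · have : F (Function.update 0 c t) = t • T c := by
      rw [hF, Finset.sum_eq_single c]
      · rw [Function.update_self]
      · intro c' _ hc'
        rw [Function.update_of_ne hc', Pi.zero_apply, zero_smul]
      · simp
    rw [this]
    exact (hTs c).smul t
  · obtain ⟨R', hR', he⟩ := hR R ⟨h1, h2⟩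
    obtain ⟨g, hg⟩ := (Submodule.mem_span_range_iff_exists_fun ℝ).1 hR'
    exact ⟨g, by rwa [hF, hg]⟩

/-- A choice of tuples for all pairs of summands gives the couplings. -/
theorem couplingNormalForm_of_pairs (N : ℕ) (hM : 1 ≤ M) (hD : IsOrthogonalDecomposition D)
    (T : (Σ i, Fin (D.mult i)) → (Σ i, Fin (D.mult i)) → Yukawa M)
    (hT : ∀ p q, T p q ∈ vectorOperators ρ) (hTc : ∀ p q, T p q = T q p)
    (hTs : ∀ p q, SupportedOn D p q (T p q))
    (hT0 : ∀ p q, (p.1 ≠ q.1 ∨ p = q) → ∀ R ∈ vectorOperators ρ, HasBlock D p q R → T p q ≠ 0)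
    (hR : ∀ R ∈ vectorOperators ρ, ∃ R' ∈ Submodule.span ℝ
      {S | ∃ p q, (p.1 ≠ q.1 ∨ p = q) ∧ S = T p q}, YukawaEquiv R R') :
    CouplingNormalForm N D := by
  have hends : ∀ c : CouplingIndex D, (couplingEnds D c).1.1 ≠ (couplingEnds D c).2.1 ∨
      (couplingEnds D c).1 = (couplingEnds D c).2 := fun c =>
    (couplingEnds_fst_le c).imp_left fun h => h.ne
  refine couplingNormalForm_of N hD (fun c => T (couplingEnds D c).1 (couplingEnds D c).2)
    (fun c => hT _ _) (fun c => ?_) (fun c => hTs _ _) fun R hRm => ?_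
  -- A permitted coupling has an operator with a nonzero block there, which makes the chosen tuple
  -- nonzero.
  · obtain ⟨S, hS, hb⟩ := exists_hasBlock_of_coupling hM hD c
    exact hT0 _ _ (hends c) S hS hb
  · obtain ⟨R', hR', he⟩ := hR R hRm
    refine ⟨R', ?_, he⟩
    refine Submodule.span_le.2 ?_ hR'
    rintro _ ⟨p, q, hpq, rfl⟩
    -- Conversely, a nonzero `T p q` has a nonzero block, so its pair satisfies the selection rule
    -- and labels a coupling, up to the order of p and q.
    by_cases h0 : T p q = 0
    · rw [h0]; exact Submodule.zero_mem _
    have hb := (hTs p q).hasBlock hD (hT p q).1 h0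
    have hb' := hb.symm (hT p q).1
    rcases hpq with hpq | rfl
    · rcases lt_or_gt_of_ne hpq with h | h
      · exact Submodule.subset_span ⟨Sum.inl ⟨(p, q), h, VecInTensor.of_hasBlock D (hT p q) hb⟩, rfl⟩
      · exact Submodule.subset_span
          ⟨Sum.inl ⟨(q, p), h, VecInTensor.of_hasBlock D (hT p q) hb'⟩, hTc q p⟩
    · exact Submodule.subset_span ⟨Sum.inr ⟨p, VecInSymSquare.of_hasBlock D (hT p p) hb⟩, rfl⟩

/-- A nonzero tuple between `p` and `q`, if there is one. -/
theorem exists_default_pair (hD : IsOrthogonalDecomposition D) :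
    ∃ T : (Σ i, Fin (D.mult i)) → (Σ i, Fin (D.mult i)) → Yukawa M,
      (∀ p q, T p q ∈ vectorOperators ρ) ∧ (∀ p q, T p q = T q p) ∧
      (∀ p q, SupportedOn D p q (T p q)) ∧
      ∀ p q, ∀ R ∈ vectorOperators ρ, HasBlock D p q R → HasBlock D p q (T p q) := by
  classical
  let ex : (Σ i, Fin (D.mult i)) → (Σ i, Fin (D.mult i)) → Prop := fun p q =>
    ∃ R ∈ vectorOperators ρ, HasBlock D p q R
  have hsym : ∀ p q, ex p q ↔ ex q p := fun p q =>
    ⟨fun ⟨R, h, h'⟩ => ⟨R, h, h'.symm h.1⟩, fun ⟨R, h, h'⟩ => ⟨R, h, h'.symm h.1⟩⟩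
  -- Choosing per unordered pair makes the family symmetric in its two arguments.
  have main : ∀ z : Sym2 (Σ i, Fin (D.mult i)), ∃ S : Yukawa M, S ∈ vectorOperators ρ ∧
      ∀ p q, z = s(p, q) → SupportedOn D p q S ∧ (ex p q → HasBlock D p q S) := by
    intro z
    induction z with
    | _ a b =>
      by_cases h : ex a b
      · obtain ⟨R, hR, hb⟩ := h
        have h1 := supportedOn_blockPart hD a b R
        have h2 := blockPart_hasBlock hD hb
        refine ⟨blockPart D a b R, blockPart_mem hR, fun p q hpq => ?_⟩
        rcases Sym2.eq_iff.1 hpq with ⟨rfl, rfl⟩ | ⟨rfl, rfl⟩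
        · exact ⟨h1, fun _ => h2⟩
        · exact ⟨h1.symm, fun _ => h2.symm (blockPart_mem hR).1⟩
      · refine ⟨0, Submodule.zero_mem _, fun p q hpq => ⟨fun _ _ _ _ _ _ _ _ _ => by simp,
          fun h' => absurd ?_ h⟩⟩
        rcases Sym2.eq_iff.1 hpq with ⟨rfl, rfl⟩ | ⟨rfl, rfl⟩
        · exact h'
        · exact (hsym _ _).1 h'
  choose S hS1 hS2 using main
  exact ⟨fun p q => S s(p, q), fun p q => hS1 _, fun p q => congrArg S Sym2.eq_swap,
    fun p q => (hS2 _ p q rfl).1, fun p q R hR hb => (hS2 _ p q rfl).2 ⟨R, hR, hb⟩⟩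

end Couplings

end GNY
end

noncomputable section
namespace GNY

/-! ### Couplings for `M ≥ 3` -/

section IrrepTools

open Matrix

variable {M : ℕ} {ρ : SpinRep M} {D : IrrepDecomposition ρ.rep}

/-- Equivalent summands are related by matrices that commute with the representation. -/
theorem exists_intertwining_matrix {p q : Σ i, Fin (D.mult i)} (h : p.1 = q.1) :
    ∃ E E' : Matrix (Fin 4) (Fin 4) ℝ, (∀ x, E * ρ.mat x = ρ.mat x * E) ∧
      D.P p * E = E ∧ E' * E = D.P q := by
  obtain ⟨e⟩ := (D.equiv_iff q p).2 h.symm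
  have hcomm : ∀ (s t : Σ i, Fin (D.mult i))
      (e : (D.sub s).toRepresentation.Equiv (D.sub t).toRepresentation) (x : Spin M),
      ((D.sub t).toSubmodule.subtype ∘ₗ e.toLinearMap ∘ₗ (projIntertwining (D.sub s)).toLinearMap) ∘ₗ
        toLin' (ρ.mat x) = toLin' (ρ.mat x) ∘ₗ
        ((D.sub t).toSubmodule.subtype ∘ₗ e.toLinearMap ∘ₗ
          (projIntertwining (D.sub s)).toLinearMap) := by
    intro s t e x
    refine LinearMap.ext fun v => ?_
    have h1 : (projIntertwining (D.sub s)) (ρ.rep x v) =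
        (D.sub s).toRepresentation x (projIntertwining (D.sub s) v) :=
      Representation.IntertwiningMap.isIntertwining _ _ (projIntertwining (D.sub s)) x v
    have h2 : e ((D.sub s).toRepresentation x (projIntertwining (D.sub s) v)) =
        (D.sub t).toRepresentation x (e (projIntertwining (D.sub s) v)) :=
      Representation.IntertwiningMap.isIntertwining _ _ e.toIntertwiningMap x _
    show ((e (projIntertwining (D.sub s) (ρ.rep x v)) : (D.sub t).toSubmodule) : Fin 4 → ℝ) = _
    rw [h1, h2]
    rfl
  set L := (D.sub p).toSubmodule.subtype ∘ₗ e.toLinearMap ∘ₗ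
    (projIntertwining (D.sub q)).toLinearMap with hL
  set L' := (D.sub q).toSubmodule.subtype ∘ₗ e.symm.toLinearMap ∘ₗ
    (projIntertwining (D.sub p)).toLinearMap with hL'
  refine ⟨LinearMap.toMatrix' L, LinearMap.toMatrix' L', fun x => ?_, ?_, ?_⟩
  · apply toLin'.injective
    rw [toLin'_mul, toLin'_mul, toLin'_toMatrix']
    exact hcomm q p e x
  · show LinearMap.toMatrix' (proj (D.sub p).toSubmodule) * _ = _
    rw [← LinearMap.toMatrix'_comp]
    congr 1
    refine LinearMap.ext fun v => ?_
    exact proj_of_mem (e (projIntertwining (D.sub q) v)).2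
  · show _ = LinearMap.toMatrix' (proj (D.sub q).toSubmodule)
    rw [← LinearMap.toMatrix'_comp]
    congr 1
    refine LinearMap.ext fun v => ?_
    have h1 : projIntertwining (D.sub p) (e (projIntertwining (D.sub q) v) : Fin 4 → ℝ) =
        e (projIntertwining (D.sub q) v) :=
      Subtype.ext (proj_of_mem (e (projIntertwining (D.sub q) v)).2)
    show ((e.symm (projIntertwining (D.sub p) (e (projIntertwining (D.sub q) v) : Fin 4 → ℝ)) :
      (D.sub q).toSubmodule) : Fin 4 → ℝ) = proj (D.sub q).toSubmodule v
    rw [h1, e.symm_apply_apply]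
    rfl

theorem finrank_add_le (hD : IsOrthogonalDecomposition D) {p q : Σ i, Fin (D.mult i)}
    (hpq : p ≠ q) : Module.finrank ℝ (D.sub p).toSubmodule +
      Module.finrank ℝ (D.sub q).toSubmodule ≤ 4 := by
  have hd : Disjoint (D.sub p).toSubmodule (D.sub q).toSubmodule := by
    refine (disjoint_perp (D.sub p).toSubmodule).mono_right fun v hv => ?_
    exact mem_perp.2 fun u hu => hD p q hpq u hu v hv
  have h1 := Submodule.finrank_sup_add_finrank_inf_eq (D.sub p).toSubmodule (D.sub q).toSubmodule
  rw [disjoint_iff.1 hd, finrank_bot, add_zero] at h1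
  rw [← h1]
  refine (Submodule.finrank_le _).trans ?_
  simp

theorem finrank_eq_of_fst_eq {p q : Σ i, Fin (D.mult i)} (h : p.1 = q.1) :
    Module.finrank ℝ (D.sub p).toSubmodule = Module.finrank ℝ (D.sub q).toSubmodule := by
  obtain ⟨e⟩ := (D.equiv_iff p q).2 h
  exact e.toLinearEquiv.finrank_eq

theorem exists_spanning_pair {V : Type*} [AddCommGroup V] [Module ℝ V] [FiniteDimensional ℝ V]
    {K : Submodule ℝ V}
    (hK : Module.finrank ℝ K ≤ 2) :
    ∃ u ∈ K, ∃ v ∈ K, ∀ w ∈ K, ∃ a b : ℝ, w = a • u + b • v := by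
  by_cases h0 : K = ⊥
  · refine ⟨0, K.zero_mem, 0, K.zero_mem, fun w hw => ⟨0, 0, ?_⟩⟩
    rw [h0, Submodule.mem_bot] at hw
    simp [hw]
  obtain ⟨u, hu, hu0⟩ := Submodule.exists_mem_ne_zero_of_ne_bot h0
  by_cases h1 : K ≤ Submodule.span ℝ {u}
  · refine ⟨u, hu, 0, K.zero_mem, fun w hw => ?_⟩
    obtain ⟨a, ha⟩ := Submodule.mem_span_singleton.1 (h1 hw)
    exact ⟨a, 0, by rw [← ha]; simp⟩
  obtain ⟨v, hv, hvu⟩ := Set.not_subset.1 h1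
  have hli : LinearIndependent ℝ ![u, v] := by
    rw [LinearIndependent.pair_iff]
    intro s t hst
    have ht : t = 0 := by
      by_contra ht
      apply hvu
      refine Submodule.mem_span_singleton.2 ⟨-(t⁻¹ * s), ?_⟩
      have : t • v = (-s) • u := by rw [neg_smul]; exact eq_neg_of_add_eq_zero_right hst
      calc -(t⁻¹ * s) • u = t⁻¹ • ((-s) • u) := by rw [smul_smul]; congr 1; ring
        _ = v := by rw [← this, smul_smul, inv_mul_cancel₀ ht, one_smul]
    rw [ht, zero_smul, add_zero] at hst
    exact ⟨(smul_eq_zero.1 hst).resolve_right hu0, ht⟩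
  have hspan : Submodule.span ℝ (Set.range ![u, v]) = K := by
    refine Submodule.eq_of_le_of_finrank_le (Submodule.span_le.2 ?_) ?_
    · rintro _ ⟨i, rfl⟩
      fin_cases i
      · exact hu
      · exact hv
    · rw [finrank_span_eq_card hli]
      simpa using hK
  refine ⟨u, hu, v, hv, fun w hw => ?_⟩
  rw [← hspan, Matrix.range_cons, Matrix.range_cons, Matrix.range_empty, Set.union_empty,
    Set.singleton_union, Submodule.mem_span_pair] at hw
  obtain ⟨a, b, h⟩ := hw
  exact ⟨a, b, h.symm⟩

/-- A nonvanishing block between equivalent summands gives one within a summand. -/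
theorem exists_diagonal_block (hM : 2 ≤ M) (hD : IsOrthogonalDecomposition D)
    {p q : Σ i, Fin (D.mult i)} (hpq : p ≠ q) (h : p.1 = q.1) {R : Yukawa M}
    (hR : R ∈ vectorOperators ρ) (hb : HasBlock D p q R) :
    ∃ T ∈ vectorOperators ρ, HasBlock D p p T := by
  obtain ⟨E, E', hE, hPE, hEE⟩ := exists_intertwining_matrix h
  have hEt : ∀ x, Eᵀ * (ρ.mat x)ᵀ = (ρ.mat x)ᵀ * Eᵀ := fun x => by
    rw [← transpose_mul, ← transpose_mul, hE]
  have hEP : Eᵀ * D.P p = Eᵀ := by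
    have := congrArg transpose hPE
    rwa [transpose_mul, P_transpose] at this
  have hPc : ∀ s x, D.P s * ρ.mat x = ρ.mat x * D.P s := fun s x => projMat_mul_mat _ _
  have hPct : ∀ s x, D.P s * (ρ.mat x)ᵀ = (ρ.mat x)ᵀ * D.P s := by
    intro s x
    have := congrArg transpose (hPc s x)
    rw [transpose_mul, transpose_mul, P_transpose] at this
    exact this.symm
  -- The end q of the block is carried to p by the intertwiner of the two copies; X is covariant and
  -- nonzero, but need not be symmetric.
  let X : Yukawa M := fun m => D.P p * R m * D.P q * Eᵀ
  have hXat : ∀ φ, X.at φ = D.P p * R.at φ * D.P q * Eᵀ := by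
    intro φ
    simp [Yukawa.at, X, Finset.mul_sum, Finset.sum_mul]
  have hXt : ∀ x φ, ρ.mat x * X.at φ * (ρ.mat x)ᵀ = X.at (vec M x φ) := by
    intro x φ
    rw [hXat, hXat, ← hR.2 x φ]
    calc _ = (ρ.mat x * D.P p) * R.at φ * D.P q * (Eᵀ * (ρ.mat x)ᵀ) := by
          simp only [Matrix.mul_assoc]
      _ = (D.P p * ρ.mat x) * R.at φ * (D.P q * (ρ.mat x)ᵀ) * Eᵀ := by
          rw [hPc, hEt]; simp only [Matrix.mul_assoc]
      _ = _ := by rw [hPct]; simp only [Matrix.mul_assoc]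
  have hXP : ∀ φ, D.P p * X.at φ * D.P p = X.at φ := by
    intro φ
    rw [hXat]
    calc _ = (D.P p * D.P p) * R.at φ * D.P q * (Eᵀ * D.P p) := by simp only [Matrix.mul_assoc]
      _ = _ := by rw [P_mul_self, hEP]
  obtain ⟨m, hm⟩ := hb
  have hXm : X m ≠ 0 := by
    intro h0
    apply hm
    have : X m * E'ᵀ = D.P p * R m * D.P q := by
      show D.P p * R m * D.P q * Eᵀ * E'ᵀ = _
      rw [Matrix.mul_assoc, ← transpose_mul, hEE, P_transpose, Matrix.mul_assoc, P_mul_self]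
    rw [← this, h0, Matrix.zero_mul]
  let T : Yukawa M := fun m => X m + (X m)ᵀ
  have hTat : ∀ φ, T.at φ = X.at φ + (X.at φ)ᵀ := by
    intro φ
    simp [Yukawa.at, T, Finset.sum_add_distrib, transpose_sum]
  have hT : T ∈ vectorOperators ρ := by
    refine ⟨fun m => ?_, fun x φ => ?_⟩
    · rw [IsSymm, transpose_add, transpose_transpose, add_comm]
    · rw [hTat, hTat, ← hXt x φ]
      simp only [transpose_mul, transpose_transpose, Matrix.mul_add, Matrix.add_mul,
        Matrix.mul_assoc]
  refine ⟨T, hT, ?_⟩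
  -- If X + Xᵀ has no block within p, it vanishes and X is antisymmetric.
  by_contra hno
  have hT0 : ∀ m, X m + (X m)ᵀ = 0 := by
    intro k
    by_contra hne
    apply hno
    refine ⟨k, ?_⟩
    have h1 := hXP (Pi.single k 1)
    rw [X.at_single] at h1
    have h2 := congrArg transpose h1
    rw [transpose_mul, transpose_mul, P_transpose, ← Matrix.mul_assoc] at h2
    show D.P p * (X k + (X k)ᵀ) * D.P p ≠ 0
    rwa [Matrix.mul_add, Matrix.add_mul, h1, h2]
  have hanti : ∀ φ (a : Fin 4 → ℝ) b, a ⬝ᵥ X.at φ *ᵥ b = - (b ⬝ᵥ X.at φ *ᵥ a) := by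
    intro φ a b
    have h1 : (X.at φ)ᵀ = - X.at φ := by
      rw [Yukawa.at, transpose_sum, ← Finset.sum_neg_distrib]
      refine Finset.sum_congr rfl fun k _ => ?_
      rw [transpose_smul, ← smul_neg, eq_neg_of_add_eq_zero_right (hT0 k)]
    have h2 : b ⬝ᵥ X.at φ *ᵥ a = a ⬝ᵥ (X.at φ)ᵀ *ᵥ b := by
      rw [mulVec_transpose, dotProduct_comm a, dotProduct_mulVec]
    rw [h2, h1, neg_mulVec, dotProduct_neg, neg_neg]
  -- Two orthogonal copies fit into ℝ⁴ only if each has dimension at most two. An antisymmetric form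
  -- there is determined by one number, so X(φ) depends on φ through a single linear functional.
  have hdim : Module.finrank ℝ (D.sub p).toSubmodule ≤ 2 := by
    have h1 := finrank_add_le hD hpq
    have h2 := finrank_eq_of_fst_eq h
    omega
  obtain ⟨u, hu, v, hv, huv⟩ := exists_spanning_pair hdim
  let ℓ : Fin M → ℝ := fun k => u ⬝ᵥ X k *ᵥ v
  have hℓ : ∀ φ : Fin M → ℝ, u ⬝ᵥ X.at φ *ᵥ v = φ ⬝ᵥ ℓ := by
    intro φ
    rw [Yukawa.at, sum_mulVec, dotProduct_sum]
    refine Finset.sum_congr rfl fun k _ => ?_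
    rw [smul_mulVec, dotProduct_smul]
    rfl
  -- As M ≥ 2, the functional has a nonzero kernel, found among combinations of two basis vectors.
  -- By irreducibility of Vec, X then vanishes identically.
  obtain ⟨φ, hφ, hφℓ⟩ : ∃ φ : Fin M → ℝ, φ ≠ 0 ∧ φ ⬝ᵥ ℓ = 0 := by
    have h0 : (⟨0, by omega⟩ : Fin M) ≠ ⟨1, by omega⟩ := by simp
    by_cases hl : ℓ ⟨1, by omega⟩ = 0
    · exact ⟨Pi.single ⟨1, by omega⟩ 1, by simp, by simp [hl]⟩
    · refine ⟨Pi.single ⟨0, by omega⟩ (ℓ ⟨1, by omega⟩) - Pi.single ⟨1, by omega⟩ (ℓ ⟨0, by omega⟩),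
        fun hz => hl ?_, ?_⟩
      · have := congrFun hz ⟨0, by omega⟩
        simpa using this
      · rw [sub_dotProduct, single_dotProduct, single_dotProduct]
        ring
  have hXφ : X.at φ = 0 := by
    rw [← hXP, P_mul_mul_eq_zero_iff]
    intro a ha b hb
    obtain ⟨a1, a2, rfl⟩ := huv a ha
    obtain ⟨b1, b2, rfl⟩ := huv b hb
    have h1 := hℓ φ
    rw [hφℓ] at h1
    have h2 := hanti φ v u
    have h3 := hanti φ u u
    have h4 := hanti φ v v
    simp only [mulVec_add, mulVec_smul, dotProduct_add, add_dotProduct, smul_dotProduct,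
      dotProduct_smul, smul_eq_mul]
    rw [h1] at h2 ⊢
    rw [h2]
    have h5 : u ⬝ᵥ X.at φ *ᵥ u = 0 := by linarith
    have h6 : v ⬝ᵥ X.at φ *ᵥ v = 0 := by linarith
    rw [h5, h6]
    ring
  have htop := eq_top_of_vec_invariant (K := LinearMap.ker X.atLinear) (fun x ψ hψ => by
    rw [LinearMap.mem_ker] at hψ ⊢
    show X.at (vec M x ψ) = 0
    rw [← hXt, show X.at ψ = 0 from hψ, Matrix.mul_zero, Matrix.zero_mul]) (fun hbot => hφ (by
      have : φ ∈ LinearMap.ker X.atLinear := hXφ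
      rwa [hbot, Submodule.mem_bot] at this))
  have : (Pi.single m 1 : Fin M → ℝ) ∈ LinearMap.ker X.atLinear := by rw [htop]; trivial
  exact hXm (by rw [← X.at_single m]; exact this)

/-- All nonzero vector operators agree up to scale and equivalence, so one nonzero allowed tuple
suffices. If the only block at hand joins two equivalent copies, where no coupling is attached,
`exists_diagonal_block` provides one within a copy. -/
theorem couplingNormalForm_of_three_le (N : ℕ) (hM : 3 ≤ M) (hD : IsOrthogonalDecomposition D) :
    CouplingNormalForm N D := by
  obtain ⟨T, hT, hTc, hTs, hTb⟩ := exists_default_pair hD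
  refine couplingNormalForm_of_pairs N (by omega) hD T hT hTc hTs
    (fun p q _ R hR hb => (hTb p q R hR hb).ne_zero) fun R hR => ?_
  by_cases hR0 : R = 0
  · exact ⟨0, Submodule.zero_mem _, by rw [hR0]; exact YukawaEquiv.refl 0⟩
  obtain ⟨p, q, hpq, hne⟩ : ∃ p q, (p.1 ≠ q.1 ∨ p = q) ∧ T p q ≠ 0 := by
    obtain ⟨p, q, hb⟩ := exists_hasBlock hD hR0
    by_cases hpq : p.1 ≠ q.1 ∨ p = q
    · exact ⟨p, q, hpq, (hTb p q R hR hb).ne_zero⟩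
    · rw [not_or, not_not] at hpq
      obtain ⟨S, hS, hSb⟩ := exists_diagonal_block (by omega) hD hpq.2 hpq.1 hR hb
      exact ⟨p, p, Or.inr rfl, (hTb p p S hS hSb).ne_zero⟩
  have hinv : ∀ R ∈ vectorOperators ρ, (∀ m, (R m).IsSymm) ∧ RotInvariant R :=
    fun R hR => ⟨hR.1, RotInvariant.of_transformsAsVec hR.2⟩
  obtain rfl : M = 3 := by
    by_contra hM3
    exact hR0 ((hinv R hR).2.eq_zero_of_four_le hR.1 (by omega))
  obtain ⟨c, hc⟩ := exists_yukawaEquiv_smul (vectorOperators ρ) hinv hR (hT p q) hR0 hne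
  exact ⟨c • T p q, Submodule.smul_mem _ _ (Submodule.subset_span ⟨p, q, hpq, rfl⟩), hc⟩

end IrrepTools

end GNY
end

noncomputable section
namespace GNY

/-! ### `M = 1` -/

section SpinOne

open Matrix CliffordAlgebra

theorem ι_mul_ι_one (v w : Fin 1 → ℝ) :
    ι (euclidForm 1) v * ι (euclidForm 1) w = algebraMap ℝ (Cl 1) (v 0 * w 0) := by
  have h : ∀ u : Fin 1 → ℝ, u = u 0 • Pi.single 0 1 := fun u => by
    ext i
    fin_cases i
    simp
  rw [h v, h w, map_smul, map_smul, smul_mul_smul_comm, ι_mul_self, Algebra.algebraMap_eq_smul_one,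
    Algebra.algebraMap_eq_smul_one, smul_smul]
  simp

/-- In one dimension the product of two vectors is a scalar, so the even part of the Clifford
algebra is ℝ. Consequently elements of Spin(1) are central, square to one and act trivially on
vectors. -/
theorem exists_algebraMap_of_spin_one (x : Spin 1) : ∃ r : ℝ, (x : Cl 1) = algebraMap ℝ (Cl 1) r := by
  have key : ∀ y : Cl 1, y ∈ evenOdd (euclidForm 1) 0 → ∃ r : ℝ, y = algebraMap ℝ (Cl 1) r := by
    intro y hy
    induction y, hy using even_induction with
    | algebraMap r => exact ⟨r, rfl⟩
    | add y z _ _ h1 h2 =>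
      obtain ⟨r, rfl⟩ := h1
      obtain ⟨s, rfl⟩ := h2
      exact ⟨r + s, (map_add _ _ _).symm⟩
    | ι_mul_ι_mul v w y _ h =>
      obtain ⟨r, rfl⟩ := h
      exact ⟨v 0 * w 0 * r, by rw [ι_mul_ι_one, ← map_mul]⟩
  exact key x (spinGroup.mem_even x.2)

theorem spin_one_mul_self (x : Spin 1) : x * x = 1 := by
  obtain ⟨r, hr⟩ := exists_algebraMap_of_spin_one x
  have h : (x : Cl 1) * star (x : Cl 1) = 1 := spinGroup.mul_star_self_of_mem x.2
  apply Subtype.ext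
  show (x : Cl 1) * (x : Cl 1) = 1
  rw [hr] at h ⊢
  rwa [star_algebraMap] at h

theorem spin_one_comm (x y : Spin 1) : x * y = y * x := by
  obtain ⟨r, hr⟩ := exists_algebraMap_of_spin_one x
  apply Subtype.ext
  show (x : Cl 1) * (y : Cl 1) = y * x
  rw [hr, Algebra.commutes]

theorem vec_one_apply (x : Spin 1) (φ : Fin 1 → ℝ) : vec 1 x φ = φ := by
  apply ι_injective
  obtain ⟨r, hr⟩ := exists_algebraMap_of_spin_one x
  have h : (x : Cl 1) * star (x : Cl 1) = 1 := spinGroup.mul_star_self_of_mem x.2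
  rw [ι_vec]
  rw [hr, Algebra.commutes, mul_assoc, ← hr, h, mul_one]

theorem exists_spinRep_one (R : Yukawa 1) : ∃ ρ : SpinRep 1, TransformsAsVec ρ R :=
  ⟨⟨1, continuous_const⟩, fun x φ => by
    rw [vec_one_apply]
    simp [SpinRep.mat]⟩

variable {ρ : SpinRep 1} {D : IrrepDecomposition ρ.rep}

/-- The fixed space of a central x within an irreducible summand is a subrepresentation. If it is
zero, then v + ρ(x)v, which is fixed because x² = 1, vanishes. -/
theorem rep_eq_or_neg (p : Σ i, Fin (D.mult i)) (x : Spin 1) :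
    (∀ v ∈ (D.sub p).toSubmodule, ρ.rep x v = v) ∨
      ∀ v ∈ (D.sub p).toSubmodule, ρ.rep x v = -v := by
  have hcomm : ∀ y v, ρ.rep x (ρ.rep y v) = ρ.rep y (ρ.rep x v) := by
    intro y v
    rw [← Module.End.mul_apply, ← Module.End.mul_apply, ← map_mul, ← map_mul, spin_one_comm]
  let S : Subrepresentation ρ.rep :=
    { toSubmodule := (D.sub p).toSubmodule ⊓ LinearMap.eqLocus (ρ.rep x) LinearMap.id
      apply_mem_toSubmodule := fun y v hv => ⟨(D.sub p).apply_mem_toSubmodule y hv.1, by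
        have h2 : ρ.rep x v = v := hv.2
        show ρ.rep x (ρ.rep y v) = ρ.rep y v
        rw [hcomm, h2]⟩ }
  rcases minimal_of_isIrreducible (D.irreducible p) S inf_le_left with h | h
  · right
    intro v hv
    have h1 : v + ρ.rep x v ∈ S.toSubmodule := by
      refine ⟨(D.sub p).toSubmodule.add_mem hv ((D.sub p).apply_mem_toSubmodule x hv), ?_⟩
      show ρ.rep x (v + ρ.rep x v) = v + ρ.rep x v
      rw [map_add, ← Module.End.mul_apply, ← map_mul, spin_one_mul_self, map_one,
        Module.End.one_apply, add_comm]
    rw [h, Submodule.mem_bot] at h1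
    exact eq_neg_of_add_eq_zero_right h1
  · left
    intro v hv
    rw [← h] at hv
    exact hv.2

/-- Acting by signs, the group preserves every line of a summand, so irreducible summands are lines.
-/
theorem exists_unit_P (p : Σ i, Fin (D.mult i)) :
    ∃ u : Fin 4 → ℝ, u ⬝ᵥ u = 1 ∧ D.P p = vecMulVec u u := by
  obtain ⟨v, hv, hv0⟩ := Submodule.exists_mem_ne_zero_of_ne_bot (ne_bot_of_isIrreducible (D.irreducible p))
  obtain ⟨r, u, hu, hvu, -⟩ := exists_smul_unit v hv0
  have hr : r ≠ 0 := by
    rintro rfl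
    exact hv0 (by rw [hvu, zero_smul])
  have huK : u ∈ (D.sub p).toSubmodule := by
    have : u = r⁻¹ • v := by rw [hvu, smul_smul, inv_mul_cancel₀ hr, one_smul]
    rw [this]
    exact (D.sub p).toSubmodule.smul_mem _ hv
  let S : Subrepresentation ρ.rep :=
    { toSubmodule := Submodule.span ℝ {u}
      apply_mem_toSubmodule := fun x w hw => by
        have hle : Submodule.span ℝ {u} ≤ (D.sub p).toSubmodule := by
          rw [Submodule.span_singleton_le_iff_mem]; exact huK
        rcases rep_eq_or_neg p x with h | h
        · rwa [h w (hle hw)]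
        · rw [h w (hle hw)]
          exact Submodule.neg_mem _ hw }
  have hS : S.toSubmodule = (D.sub p).toSubmodule := by
    refine (minimal_of_isIrreducible (D.irreducible p) S ?_).resolve_left fun h => ?_
    · show Submodule.span ℝ {u} ≤ _
      rw [Submodule.span_singleton_le_iff_mem]; exact huK
    · have : u ∈ S.toSubmodule := Submodule.mem_span_singleton_self u
      rw [h, Submodule.mem_bot] at this
      rw [this, zero_dotProduct] at hu
      exact zero_ne_one hu
  refine ⟨u, hu, Matrix.ext_of_mulVec_single fun j => ?_⟩
  rw [projMat_mulVec, vecMulVec_mulVec, op_smul_eq_smul]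
  refine proj_eq ((D.sub p).toSubmodule.smul_mem _ huK) (mem_perp.2 fun w hw => ?_)
  rw [← hS] at hw
  obtain ⟨a, rfl⟩ := Submodule.mem_span_singleton.1 hw
  rw [dotProduct_sub, smul_dotProduct, smul_dotProduct]
  simp [hu]

theorem eq_mul_mul_of_supportedOn {M : ℕ} {ρ : SpinRep M} {D : IrrepDecomposition ρ.rep}
    (hD : IsOrthogonalDecomposition D) {p : Σ i, Fin (D.mult i)} {R : Yukawa M}
    (h : SupportedOn D p p R) (m : Fin M) : R m = D.P p * R m * D.P p := by
  have h1 : R m = ∑ a, ∑ b, D.P a * R m * D.P b := by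
    rw [← Finset.sum_comm]
    simp only [← Finset.sum_mul, ← Finset.mul_sum, sum_P hD, Matrix.one_mul, Matrix.mul_one]
  have h2 : ∑ a, ∑ b, D.P a * R m * D.P b = ∑ b, D.P p * R m * D.P b :=
    Finset.sum_eq_single p (fun a _ ha => Finset.sum_eq_zero fun b _ =>
      supportedOn_iff.1 h a b (by simp [ha]) (by simp [ha]) m) (by simp)
  have h3 : ∑ b, D.P p * R m * D.P b = D.P p * R m * D.P p :=
    Finset.sum_eq_single p (fun b _ hb =>
      supportedOn_iff.1 h p b (by simp [hb]) (by simp [hb]) m) (by simp)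
  rw [← h3, ← h2, ← h1]

/-- Vec is trivial, so each projection `D.P p` is a vector operator and `T p p` is a nonzero
multiple of it. A single symmetric matrix can be diagonalized orthogonally, and its eigenvectors are
moved onto the lines of the decomposition; couplings within the copies are enough. -/
theorem couplingNormalForm_one (N : ℕ) (hD : IsOrthogonalDecomposition D) :
    CouplingNormalForm N D := by
  classical
  obtain ⟨T, hT, hTc, hTs, hTb⟩ := exists_default_pair hD
  choose u hu hP using exists_unit_P (D := D)
  have hPmem : ∀ p, (fun _ => D.P p : Yukawa 1) ∈ vectorOperators ρ := by
    intro p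
    refine ⟨fun _ => P_transpose D p, fun x φ => ?_⟩
    have h1 : Yukawa.at (fun _ => D.P p : Yukawa 1) φ = φ 0 • D.P p := by simp [Yukawa.at]
    rw [vec_one_apply, h1, Matrix.mul_smul, Matrix.smul_mul, ← projMat_mul_mat, Matrix.mul_assoc,
      orthogonal_mul_transpose (ρ.mat_mem x), Matrix.mul_one]
  have hPne : ∀ p, D.P p ≠ 0 := by
    intro p h0
    rw [hP] at h0
    have := congrArg (fun A => A *ᵥ u p) h0
    simp only [vecMulVec_mulVec, hu, zero_mulVec] at this
    have h1 : u p = 0 := by simpa using this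
    have h2 := hu p
    rw [h1, zero_dotProduct] at h2
    exact zero_ne_one h2
  have hTp : ∀ p, ∃ t : ℝ, t ≠ 0 ∧ T p p = fun _ => t • D.P p := by
    intro p
    have hb : HasBlock D p p (T p p) := hTb p p _ (hPmem p) ⟨0, by
      show D.P p * D.P p * D.P p ≠ 0
      rw [P_mul_self, P_mul_self]
      exact hPne p⟩
    have hPTP := eq_mul_mul_of_supportedOn hD (hTs p p) 0
    have hval : T p p 0 = (u p ⬝ᵥ T p p 0 *ᵥ u p) • D.P p := by
      conv_lhs => rw [hPTP]
      rw [hP, vecMulVec_mul, vecMulVec_mul_vecMulVec, ← dotProduct_mulVec, vecMulVec_smul]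
    refine ⟨u p ⬝ᵥ T p p 0 *ᵥ u p, fun h0 => ?_, ?_⟩
    · rw [h0, zero_smul] at hval
      apply hb.ne_zero
      funext m
      rw [Subsingleton.elim m 0]
      exact hval
    · funext m
      rw [Subsingleton.elim m 0]
      exact hval
  refine couplingNormalForm_of_pairs N le_rfl hD T hT hTc hTs
    (fun p q _ R hR hb => (hTb p q R hR hb).ne_zero) fun R hR => ?_
  obtain ⟨U, hU, d, hd⟩ := exists_diagonalization (hR.1 0)
  -- The trace of ∑ P_p = 1 shows that there are four lines.
  have hcard : Fintype.card (Fin 4) = Fintype.card (Σ i, Fin (D.mult i)) := by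
    have h1 := congrArg trace (sum_P hD)
    rw [trace_sum, trace_one] at h1
    simp only [hP, trace_vecMulVec, hu, Finset.sum_const, Finset.card_univ, nsmul_eq_mul,
      mul_one] at h1
    exact_mod_cast h1.symm
  let σ : Fin 4 ≃ (Σ i, Fin (D.mult i)) := Fintype.equivOfCardEq hcard
  let V : Matrix (Fin 4) (Fin 4) ℝ := of fun a b => u (σ b) a
  have hVd : ∀ e : Fin 4 → ℝ, V * diagonal e * Vᵀ = ∑ b, e b • D.P (σ b) := by
    intro e
    ext a a'
    rw [Matrix.mul_apply, Matrix.sum_apply]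
    refine Finset.sum_congr rfl fun b _ => ?_
    rw [mul_diagonal, hP, Matrix.smul_apply, vecMulVec_apply]
    show u (σ b) a * e b * u (σ b) a' = _
    rw [smul_eq_mul]; ring
  have hV : V ∈ Matrix.orthogonalGroup (Fin 4) ℝ := by
    rw [mem_orthogonalGroup_iff]
    have := hVd 1
    have h1 : (diagonal (1 : Fin 4 → ℝ)) = 1 := diagonal_one
    rw [h1, Matrix.mul_one] at this
    show V * Vᵀ = 1
    rw [this, ← sum_P hD, ← σ.sum_comp]
    simp
  refine ⟨fun _ => V * diagonal d * Vᵀ, ?_, V * Uᵀ, mul_mem hV (transpose_mem_orthogonal hU),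
    fun m => ?_⟩
  · have : (fun _ => V * diagonal d * Vᵀ : Yukawa 1) =
        ∑ b, d b • (fun _ => D.P (σ b) : Yukawa 1) := by
      funext m
      rw [hVd, Finset.sum_apply]
      rfl
    rw [this]
    refine Submodule.sum_mem _ fun b _ => Submodule.smul_mem _ _ ?_
    obtain ⟨t, ht, hTt⟩ := hTp (σ b)
    have : (fun _ => D.P (σ b) : Yukawa 1) = t⁻¹ • T (σ b) (σ b) := by
      rw [hTt]
      funext m
      rw [Pi.smul_apply, smul_smul, inv_mul_cancel₀ ht, one_smul]
    rw [this]
    exact Submodule.smul_mem _ _ (Submodule.subset_span ⟨_, _, Or.inr rfl, rfl⟩)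
  · rw [Subsingleton.elim m 0, hd, transpose_mul, transpose_transpose]
    have h1 := orthogonal_transpose_mul hU
    calc _ = V * (Uᵀ * U) * diagonal d * (Uᵀ * U) * Vᵀ := by simp only [Matrix.mul_assoc]
      _ = _ := by rw [h1, Matrix.mul_one, Matrix.mul_one]

end SpinOne

end GNY
end

noncomputable section
namespace GNY

/-! ### Representations from Clifford matrices -/

section CliffordMatrices

open Matrix CliffordAlgebra

variable {M : ℕ} {n : Type*} [Fintype n] [DecidableEq n]

instance : IsModuleTopology ℝ (Cl M) := ⟨rfl⟩

/-- Symmetric Clifford matrices define an orthogonal representation of `Spin(M)`. -/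
theorem exists_spin_hom (γ : (Fin M → ℝ) →ₗ[ℝ] Matrix n n ℝ) (hs : ∀ φ, (γ φ)ᵀ = γ φ)
    (hγ : ∀ φ, γ φ * γ φ = (φ ⬝ᵥ φ) • (1 : Matrix n n ℝ)) :
    ∃ (f : Cl M →ₐ[ℝ] Matrix n n ℝ) (h : Spin M →* Matrix.orthogonalGroup n ℝ), Continuous h ∧
      (∀ φ, f (ι (euclidForm M) φ) = γ φ) ∧ (∀ x, (h x : Matrix n n ℝ) = f x) ∧
      ∀ x φ, (h x : Matrix n n ℝ) * γ φ * (h x : Matrix n n ℝ)ᵀ = γ (vec M x φ) := by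
  let f : Cl M →ₐ[ℝ] Matrix n n ℝ := CliffordAlgebra.lift (euclidForm M) ⟨γ, fun φ => by
    rw [hγ, euclidForm_apply, Algebra.algebraMap_eq_smul_one]⟩
  have hf : ∀ φ, f (ι (euclidForm M) φ) = γ φ := fun φ => CliffordAlgebra.lift_ι_apply _ _ _
  -- Reversal and transposition are both anti-automorphisms that fix the generators, since the γ(φ)
  -- are symmetric.
  have hrev : ∀ y : Cl M, f (reverse y) = (f y)ᵀ := by
    intro y
    induction y using CliffordAlgebra.induction with
    | algebraMap r =>
      rw [reverse.commutes, AlgHom.commutes, Algebra.algebraMap_eq_smul_one, transpose_smul,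
        transpose_one]
    | ι φ => rw [reverse_ι, hf, hs]
    | mul a b ha hb => rw [reverse.map_mul, map_mul, map_mul, transpose_mul, ha, hb]
    | add a b ha hb => rw [map_add, map_add, map_add, transpose_add, ha, hb]
  -- On even elements the star is the reversal, so f maps star to transpose and Spin(M) into
  -- orthogonal matrices.
  have hstar : ∀ x : Spin M, f (star (x : Cl M)) = (f x)ᵀ := by
    intro x
    rw [CliffordAlgebra.star_def, spinGroup.involute_eq x.2, hrev]
  have hmem : ∀ x : Spin M, f x ∈ Matrix.orthogonalGroup n ℝ := by
    intro x
    rw [mem_orthogonalGroup_iff]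
    show f x * (f x)ᵀ = 1
    rw [← hstar, ← map_mul, spinGroup.mul_star_self_of_mem x.2, map_one]
  refine ⟨f, { toFun := fun x => ⟨f x, hmem x⟩
               map_one' := Subtype.ext (map_one f)
               map_mul' := fun x y => Subtype.ext (map_mul f _ _) }, ?_, hf, fun x => rfl, ?_⟩
  · refine Continuous.subtype_mk ?_ _
    -- Linear maps out of a space with the module topology are automatically continuous.
    exact (IsModuleTopology.continuous_of_linearMap f.toLinearMap).comp continuous_subtype_val
  · intro x φ
    show f x * γ φ * (f x)ᵀ = _
    rw [← hstar, ← hf, ← hf, ← map_mul, ← map_mul, ι_vec]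

/-- Transport of a representation along an equivalence. -/
theorem exists_spinRep_of_equiv {R S : Yukawa M} (h : YukawaEquiv R S)
    (hS : ∃ ρ : SpinRep M, TransformsAsVec ρ S) : ∃ ρ : SpinRep M, TransformsAsVec ρ R := by
  obtain ⟨P, hP, hPR⟩ := h.symm
  obtain ⟨ρ, hρ⟩ := hS
  have h1 := orthogonal_transpose_mul hP
  have h2 := orthogonal_mul_transpose hP
  have hat : ∀ φ, R.at φ = P * S.at φ * Pᵀ := by
    intro φ
    rw [← S.conj_at]
    congr 1
    exact funext fun m => (hPR m).symm
  let p : Matrix.orthogonalGroup (Fin 4) ℝ := ⟨P, hP⟩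
  refine ⟨⟨(MulAut.conj p).toMonoidHom.comp ρ.toHom, ?_⟩, fun x φ => ?_⟩
  · show Continuous fun x => p * ρ.toHom x * p⁻¹
    exact (continuous_const.mul ρ.continuous_toHom).mul continuous_const
  · show (P * ρ.mat x * Pᵀ) * R.at φ * (P * ρ.mat x * Pᵀ)ᵀ = _
    rw [hat, hat, ← hρ x φ, transpose_mul, transpose_mul, transpose_transpose]
    calc _ = P * ρ.mat x * (Pᵀ * P) * S.at φ * (Pᵀ * P) * (ρ.mat x)ᵀ * Pᵀ := by
          simp only [Matrix.mul_assoc]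
      _ = _ := by rw [h1, Matrix.mul_one, Matrix.mul_one]; simp only [Matrix.mul_assoc]

theorem TransformsAsVec.smul {ρ : SpinRep M} {R : Yukawa M} (h : TransformsAsVec ρ R) (c : ℝ) :
    TransformsAsVec ρ (c • R) := fun x φ => by
  rw [Yukawa.smul_at, Yukawa.smul_at, Matrix.mul_smul, Matrix.smul_mul, h]

theorem diracYukawa_at (φ : Fin 3 → ℝ) : diracYukawa.at φ =
    !![φ 0, φ 1, φ 2, 0; φ 1, -φ 0, 0, -φ 2; φ 2, 0, -φ 0, φ 1; 0, -φ 2, φ 1, φ 0] := by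
  ext a b
  fin_cases a <;> fin_cases b <;> simp [Yukawa.at, diracYukawa, Fin.sum_univ_three]

theorem mixedYukawa_at (φ : Fin 3 → ℝ) : mixedYukawa.at φ =
    !![0, φ 0, φ 1, φ 2; φ 0, 0, 0, 0; φ 1, 0, 0, 0; φ 2, 0, 0, 0] := by
  ext a b
  fin_cases a <;> fin_cases b <;> simp [Yukawa.at, mixedYukawa, Fin.sum_univ_three]

theorem diracYukawa_sq (φ : Fin 3 → ℝ) :
    diracYukawa.at φ * diracYukawa.at φ = (φ ⬝ᵥ φ) • (1 : Matrix (Fin 4) (Fin 4) ℝ) := by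
  rw [diracYukawa_at]
  ext a b
  fin_cases a <;> fin_cases b <;>
    simp [Matrix.mul_apply, Fin.sum_univ_four, dotProduct, Fin.sum_univ_three] <;> ring

theorem exists_dirac_hom : ∃ h : Spin 3 →* Matrix.orthogonalGroup (Fin 4) ℝ, Continuous h ∧
    ∀ x φ, (h x : Matrix (Fin 4) (Fin 4) ℝ) * diracYukawa.at φ *
      (h x : Matrix (Fin 4) (Fin 4) ℝ)ᵀ = diracYukawa.at (vec 3 x φ) := by
  obtain ⟨-, h, hc, -, -, hv⟩ := exists_spin_hom diracYukawa.atLinear (fun φ => by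
    show (diracYukawa.at φ)ᵀ = _
    rw [diracYukawa_at]
    ext a b
    fin_cases a <;> fin_cases b <;> simp [Yukawa.atLinear, diracYukawa_at]) diracYukawa_sq
  exact ⟨h, hc, hv⟩

theorem exists_spinRep_dirac : ∃ ρ : SpinRep 3, TransformsAsVec ρ diracYukawa := by
  obtain ⟨h, hc, hv⟩ := exists_dirac_hom
  exact ⟨⟨h, hc⟩, hv⟩

/-- The matrix of `x` in the vector representation. -/
def vecMat (M : ℕ) (x : Spin M) : Matrix (Fin M) (Fin M) ℝ := LinearMap.toMatrix' (vec M x)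

theorem vecMat_apply (x : Spin M) (i j : Fin M) : vecMat M x i j = vec M x (Pi.single j 1) i := by
  rw [vecMat, LinearMap.toMatrix'_apply]

theorem vecMat_mulVec (x : Spin M) (φ : Fin M → ℝ) : vecMat M x *ᵥ φ = vec M x φ := by
  rw [vecMat, LinearMap.toMatrix'_mulVec]

theorem vecMat_mul (x y : Spin M) : vecMat M (x * y) = vecMat M x * vecMat M y := by
  rw [vecMat, map_mul, Module.End.mul_eq_comp, LinearMap.toMatrix'_comp]
  rfl

theorem vecMat_one : vecMat M 1 = 1 := by
  rw [vecMat, map_one, Module.End.one_eq_id, LinearMap.toMatrix'_id]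

theorem vecMat_mem (x : Spin M) : vecMat M x ∈ Matrix.orthogonalGroup (Fin M) ℝ := by
  rw [mem_orthogonalGroup_iff']
  show (vecMat M x)ᵀ * vecMat M x = 1
  have hpol : ∀ u v : Fin M → ℝ, vec M x u ⬝ᵥ vec M x v = u ⬝ᵥ v := by
    intro u v
    have h1 := vec_dotProduct x (u + v)
    rw [map_add, add_dotProduct, dotProduct_add, dotProduct_add, add_dotProduct, dotProduct_add,
      dotProduct_add, vec_dotProduct, vec_dotProduct, dotProduct_comm (vec M x v),
      dotProduct_comm v u] at h1
    linarith
  ext i j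
  rw [Matrix.mul_apply]
  have := hpol (Pi.single i 1) (Pi.single j 1)
  simp only [transpose_apply, vecMat_apply]
  rw [show ∑ k, vec M x (Pi.single i 1) k * vec M x (Pi.single j 1) k =
    vec M x (Pi.single i 1) ⬝ᵥ vec M x (Pi.single j 1) from rfl, this]
  simp [Matrix.one_apply, Pi.single_apply, eq_comm]

/-- The rotation matrix is read off from the continuous spinor matrices: since tr(γᵢ γⱼ) = 4δᵢⱼ, its
entries are tr(γᵢ h(x) γⱼ h(x)ᵀ)/4. -/
theorem continuous_vecMat_three : Continuous (vecMat 3) := by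
  obtain ⟨h, hc, hv⟩ := exists_dirac_hom
  have key : ∀ x i j, vecMat 3 x i j = (diracYukawa i * ((h x : Matrix (Fin 4) (Fin 4) ℝ) *
      diracYukawa j * (h x : Matrix (Fin 4) (Fin 4) ℝ)ᵀ)).trace / 4 := by
    intro x i j
    have h1 := hv x (Pi.single j 1)
    rw [diracYukawa.at_single] at h1
    rw [h1, vecMat_apply, diracYukawa_at]
    fin_cases i <;> simp [diracYukawa, trace, Matrix.mul_apply, Fin.sum_univ_four] <;> ring
  have hc' : Continuous fun x => (h x : Matrix (Fin 4) (Fin 4) ℝ) := continuous_subtype_val.comp hc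
  refine continuous_matrix fun i j => ?_
  simp only [key]
  exact ((continuous_const.matrix_mul ((hc'.matrix_mul continuous_const).matrix_mul
    hc'.matrix_transpose)).matrix_trace).div_const 4

/-- `1 ⊕ V`. -/
def oneBlock (V : Matrix (Fin 3) (Fin 3) ℝ) : Matrix (Fin 4) (Fin 4) ℝ :=
  !![1, 0, 0, 0; 0, V 0 0, V 0 1, V 0 2; 0, V 1 0, V 1 1, V 1 2; 0, V 2 0, V 2 1, V 2 2]

theorem oneBlock_mul (V W : Matrix (Fin 3) (Fin 3) ℝ) :
    oneBlock (V * W) = oneBlock V * oneBlock W := by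
  ext a b
  fin_cases a <;> fin_cases b <;>
    simp [oneBlock, Matrix.mul_apply, Fin.sum_univ_four, Fin.sum_univ_three]

theorem oneBlock_one : oneBlock 1 = 1 := by
  ext a b
  fin_cases a <;> fin_cases b <;> simp [oneBlock]

theorem oneBlock_transpose (V : Matrix (Fin 3) (Fin 3) ℝ) : (oneBlock V)ᵀ = oneBlock Vᵀ := by
  ext a b
  fin_cases a <;> fin_cases b <;> simp [oneBlock]

theorem oneBlock_mul_mixedYukawa (V : Matrix (Fin 3) (Fin 3) ℝ) (φ : Fin 3 → ℝ) :
    oneBlock V * mixedYukawa.at φ * (oneBlock V)ᵀ = mixedYukawa.at (V *ᵥ φ) := by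
  rw [mixedYukawa_at, mixedYukawa_at]
  ext a b
  fin_cases a <;> fin_cases b <;>
    simp [oneBlock, Matrix.mul_apply, Fin.sum_univ_four, mulVec, dotProduct, Fin.sum_univ_three,
      Matrix.vecMul] <;> ring

/-- The representation is 1 ⊕ Vec, for which the exchange of the fixed vector with φ is covariant.
-/
theorem exists_spinRep_mixed : ∃ ρ : SpinRep 3, TransformsAsVec ρ mixedYukawa := by
  have hmem : ∀ x, oneBlock (vecMat 3 x) ∈ Matrix.orthogonalGroup (Fin 4) ℝ := by
    intro x
    rw [mem_orthogonalGroup_iff]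
    show oneBlock (vecMat 3 x) * (oneBlock (vecMat 3 x))ᵀ = 1
    rw [oneBlock_transpose, ← oneBlock_mul, orthogonal_mul_transpose (vecMat_mem x), oneBlock_one]
  refine ⟨⟨{ toFun := fun x => ⟨oneBlock (vecMat 3 x), hmem x⟩
             map_one' := Subtype.ext (by
               show oneBlock (vecMat 3 1) = 1
               rw [vecMat_one, oneBlock_one])
             map_mul' := fun x y => Subtype.ext (by
               show oneBlock (vecMat 3 (x * y)) = _
               rw [vecMat_mul, oneBlock_mul]; rfl) }, ?_⟩, fun x φ => ?_⟩
  · refine Continuous.subtype_mk ?_ _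
    have hV : ∀ i j, Continuous fun x => vecMat 3 x i j := fun i j =>
      continuous_vecMat_three.matrix_elem i j
    refine continuous_matrix fun i j => ?_
    fin_cases i <;> fin_cases j <;> first | exact continuous_const | exact hV _ _
  · show oneBlock (vecMat 3 x) * mixedYukawa.at φ * (oneBlock (vecMat 3 x))ᵀ = _
    rw [oneBlock_mul_mixedYukawa, vecMat_mulVec]

theorem exists_spinRep_zero : ∃ ρ : SpinRep M, TransformsAsVec ρ 0 :=
  ⟨⟨1, continuous_const⟩, fun x φ => by simp [Yukawa.at]⟩

theorem exists_spinRep_of_three_le (hM : 3 ≤ M) {R : Yukawa M} (hR : ∀ m, (R m).IsSymm)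
    (h : RotInvariant R) : ∃ ρ : SpinRep M, TransformsAsVec ρ R := by
  by_cases hR0 : R = 0
  · rw [hR0]
    exact exists_spinRep_zero
  obtain rfl : M = 3 := by
    by_contra hM3
    exact hR0 (h.eq_zero_of_four_le hR (by omega))
  obtain ⟨a, -, h1 | h1⟩ := h.classification hR hR0
  · obtain ⟨ρ, hρ⟩ := exists_spinRep_mixed
    exact exists_spinRep_of_equiv h1 ⟨ρ, hρ.smul a⟩
  · obtain ⟨ρ, hρ⟩ := exists_spinRep_dirac
    exact exists_spinRep_of_equiv h1 ⟨ρ, hρ.smul a⟩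

end CliffordMatrices

end GNY
end

noncomputable section
namespace GNY

/-! ### The group `Spin(2)` -/

section SpinTwo

open Matrix CliffordAlgebra ComplexConjugate

/-- The matrix of the multiplication by a complex number. -/
def rotMat (z : ℂ) : Matrix (Fin 2) (Fin 2) ℝ := !![z.re, -z.im; z.im, z.re]

theorem rotMat_mul (z w : ℂ) : rotMat (z * w) = rotMat z * rotMat w := by
  ext a b
  fin_cases a <;> fin_cases b <;> simp [rotMat] <;> ring

/-- The reflection matrices `γ(φ)` of two-dimensional Clifford algebra. -/
def reflMat : (Fin 2 → ℝ) →ₗ[ℝ] Matrix (Fin 2) (Fin 2) ℝ where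
  toFun φ := !![φ 0, φ 1; φ 1, -φ 0]
  map_add' φ ψ := by
    ext a b
    fin_cases a <;> fin_cases b <;> simp <;> ring
  map_smul' c φ := by
    ext a b
    fin_cases a <;> fin_cases b <;> simp

theorem reflMat_apply (φ : Fin 2 → ℝ) : reflMat φ = !![φ 0, φ 1; φ 1, -φ 0] := rfl

/-- The product `e₁ e₀` in the Clifford algebra. -/
def volTwo : Cl 2 :=
  ι (euclidForm 2) (Pi.single 1 1) * ι (euclidForm 2) (Pi.single 0 1)

theorem ι_single_mul_swap : ι (euclidForm 2) (Pi.single 0 1) * ι (euclidForm 2) (Pi.single 1 1) =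
    -volTwo := by
  have := ι_mul_add_mul_swap (M := 2) (Pi.single 0 1) (Pi.single 1 1)
  rw [show (Pi.single 0 1 : Fin 2 → ℝ) ⬝ᵥ Pi.single 1 1 = 0 by simp] at this
  exact eq_neg_of_add_eq_zero_left (by simpa [volTwo] using this)

theorem volTwo_mul_self : volTwo * volTwo = -1 := by
  have h1 := ι_mul_self (M := 2) (Pi.single 0 1)
  have h2 := ι_mul_self (M := 2) (Pi.single 1 1)
  have h3 := ι_single_mul_swap
  calc volTwo * volTwo = ι (euclidForm 2) (Pi.single 1 1) *
        (ι (euclidForm 2) (Pi.single 0 1) * ι (euclidForm 2) (Pi.single 1 1)) *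
          ι (euclidForm 2) (Pi.single 0 1) := by simp only [volTwo, mul_assoc]
    _ = -1 := by
      rw [h3, volTwo, mul_neg, neg_mul, ← mul_assoc, h2, mul_assoc, h1]
      simp

/-- The even part of the Clifford algebra of the plane. -/
def evenTwo : ℂ →ₐ[ℝ] Cl 2 := Complex.lift ⟨volTwo, volTwo_mul_self⟩

theorem evenTwo_apply (z : ℂ) : evenTwo z = algebraMap ℝ (Cl 2) z.re + z.im • volTwo := rfl

/-- Vectors of the plane are read as complex numbers, with e₁e₀ in the role of i; the product of v
and w is then v w̄. -/
theorem ι_mul_ι_two (v w : Fin 2 → ℝ) : ι (euclidForm 2) v * ι (euclidForm 2) w =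
    evenTwo (⟨v 0, v 1⟩ * conj ⟨w 0, w 1⟩) := by
  have h : ∀ u : Fin 2 → ℝ, u = u 0 • Pi.single 0 1 + u 1 • Pi.single 1 1 := fun u => by
    ext i
    fin_cases i <;> simp
  have h1 := ι_mul_self (M := 2) (Pi.single 0 1)
  have h2 := ι_mul_self (M := 2) (Pi.single 1 1)
  rw [evenTwo_apply]
  conv_lhs => rw [h v, h w]
  simp only [map_add, map_smul, add_mul, mul_add, smul_mul_smul_comm, h1, h2, ι_single_mul_swap]
  rw [show ι (euclidForm 2) (Pi.single 1 1) * ι (euclidForm 2) (Pi.single 0 1) = volTwo from rfl]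
  simp only [Algebra.algebraMap_eq_smul_one, Complex.mul_re, Complex.mul_im, Complex.conj_re,
    Complex.conj_im, dotProduct, Fin.sum_univ_two]
  simp
  module

theorem exists_evenTwo (x : Spin 2) : ∃ z : ℂ, (x : Cl 2) = evenTwo z := by
  have key : ∀ y : Cl 2, y ∈ evenOdd (euclidForm 2) 0 → ∃ z : ℂ, y = evenTwo z := by
    intro y hy
    induction y, hy using even_induction with
    | algebraMap r => exact ⟨r, by rw [evenTwo_apply]; simp⟩
    | add y z _ _ h1 h2 =>
      obtain ⟨r, rfl⟩ := h1
      obtain ⟨s, rfl⟩ := h2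
      exact ⟨r + s, (map_add _ _ _).symm⟩
    | ι_mul_ι_mul v w y _ h =>
      obtain ⟨r, rfl⟩ := h
      exact ⟨_, by rw [ι_mul_ι_two, ← map_mul]⟩
  exact key x (spinGroup.mem_even x.2)

/-- Even elements of the Clifford algebra are complex numbers z, and the two-dimensional Clifford
representation turns them into rotation matrices, which shows |z| = 1 and continuity. A unit ζ is
attained as the product of the unit vectors ζ and e₀. Conjugating a vector by z multiplies it by z².
-/
theorem exists_spin_two : ∃ η : Spin 2 →* Circle, Continuous η ∧
    (∀ x : Spin 2, (x : Cl 2) = evenTwo (η x)) ∧ Function.Surjective η ∧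
    ∀ x φ, (⟨vec 2 x φ 0, vec 2 x φ 1⟩ : ℂ) = (η x : ℂ) ^ 2 * ⟨φ 0, φ 1⟩ := by
  obtain ⟨f, h, hc, hι, hf, hv⟩ := exists_spin_hom reflMat (fun φ => by
    rw [reflMat_apply]
    ext a b
    fin_cases a <;> fin_cases b <;> simp) (fun φ => by
    rw [reflMat_apply]
    ext a b
    fin_cases a <;> fin_cases b <;> simp [dotProduct, Fin.sum_univ_two] <;> ring)
  have hfe : ∀ z, f (evenTwo z) = rotMat z := by
    intro z
    rw [evenTwo_apply, map_add, AlgHom.commutes, map_smul, volTwo, map_mul, hι, hι, reflMat_apply,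
      reflMat_apply, Algebra.algebraMap_eq_smul_one]
    ext a b
    fin_cases a <;> fin_cases b <;> simp [rotMat]
  choose z hz using exists_evenTwo
  have hh : ∀ x, (h x : Matrix (Fin 2) (Fin 2) ℝ) = rotMat (z x) := fun x => by
    rw [hf, hz, hfe]
  have hz1 : ∀ x, (z x).re * (z x).re + (z x).im * (z x).im = 1 := by
    intro x
    have h1 := orthogonal_mul_transpose (h x).2
    rw [hh] at h1
    have h2 := congrFun (congrFun h1 0) 0
    simpa [rotMat, Matrix.mul_apply] using h2
  have hrinj : Function.Injective rotMat := fun z w hzw => Complex.ext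
    (by simpa [rotMat] using congrFun (congrFun hzw 0) 0)
    (by simpa [rotMat] using congrFun (congrFun hzw 1) 0)
  have hcirc : ∀ x, z x ∈ Submonoid.unitSphere ℂ := by
    intro x
    show z x ∈ Metric.sphere (0 : ℂ) 1
    rw [mem_sphere_zero_iff_norm, ← sq_eq_sq₀ (norm_nonneg _) zero_le_one, Complex.sq_norm,
      Complex.normSq_apply, hz1, one_pow]
  let η : Spin 2 →* Circle :=
    { toFun := fun x => ⟨z x, hcirc x⟩
      map_one' := Subtype.ext (hrinj (by
        show rotMat (z 1) = rotMat 1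
        rw [← hh, map_one]
        ext a b
        fin_cases a <;> fin_cases b <;> simp [rotMat]))
      map_mul' := fun x y => Subtype.ext (hrinj (by
        show rotMat (z (x * y)) = rotMat (z x * z y)
        rw [rotMat_mul, ← hh, ← hh, ← hh, map_mul]
        rfl)) }
  have hinj : Function.Injective evenTwo := evenTwo.toRingHom.injective
  refine ⟨η, ?_, hz, ?_, ?_⟩
  · refine Continuous.subtype_mk ?_ _
    have hm : ∀ i j, Continuous fun x => (h x : Matrix (Fin 2) (Fin 2) ℝ) i j := fun i j =>
      (continuous_subtype_val.comp hc).matrix_elem i j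
    have : z = fun x => ((h x : Matrix (Fin 2) (Fin 2) ℝ) 0 0 : ℂ) +
        ((h x : Matrix (Fin 2) (Fin 2) ℝ) 1 0 : ℂ) * Complex.I := by
      funext x
      rw [hh]
      apply Complex.ext <;> simp [rotMat]
    rw [this]
    exact (Complex.continuous_ofReal.comp (hm 0 0)).add
      ((Complex.continuous_ofReal.comp (hm 1 0)).mul continuous_const)
  · intro ζ
    have hζ : (ζ : ℂ).re * (ζ : ℂ).re + (ζ : ℂ).im * (ζ : ℂ).im = 1 := by
      rw [← Complex.normSq_apply]; exact Circle.normSq_coe ζ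
    refine ⟨spinPair ![(ζ : ℂ).re, (ζ : ℂ).im] (Pi.single 0 1) (by
      simpa [dotProduct, Fin.sum_univ_two] using hζ) (by simp), Subtype.ext (hinj ?_)⟩
    show evenTwo (z _) = evenTwo (ζ : ℂ)
    rw [← hz]
    show ι (euclidForm 2) _ * ι (euclidForm 2) _ = _
    rw [ι_mul_ι_two]
    congr 1
    apply Complex.ext <;> simp
  · intro x φ
    have h1 := hv x φ
    rw [hh, reflMat_apply, reflMat_apply] at h1
    have h00 := congrFun (congrFun h1 0) 0
    have h10 := congrFun (congrFun h1 1) 0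
    show _ = z x ^ 2 * _
    simp [rotMat, Matrix.mul_apply, Fin.sum_univ_two] at h00 h10
    apply Complex.ext
    · simp only [pow_two, Complex.mul_re, Complex.mul_im]
      linarith
    · simp only [pow_two, Complex.mul_re, Complex.mul_im]
      linarith

/-- The isomorphism of `Spin(2)` with the circle. -/
def spinCircle : Spin 2 →* Circle := exists_spin_two.choose

theorem continuous_spinCircle : Continuous spinCircle := exists_spin_two.choose_spec.1

theorem spinCircle_injective : Function.Injective spinCircle := fun x y h => Subtype.ext (by
  rw [exists_spin_two.choose_spec.2.1 x, exists_spin_two.choose_spec.2.1 y]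
  exact congrArg (fun z : Circle => evenTwo z) h)

theorem spinCircle_surjective : Function.Surjective spinCircle :=
  exists_spin_two.choose_spec.2.2.1

theorem vec_two (x : Spin 2) (φ : Fin 2 → ℝ) :
    (⟨vec 2 x φ 0, vec 2 x φ 1⟩ : ℂ) = ((spinCircle x ^ 2 : Circle) : ℂ) * ⟨φ 0, φ 1⟩ := by
  rw [Circle.coe_pow]
  exact exists_spin_two.choose_spec.2.2.2 x φ

theorem exists_circle_sq (z : Circle) : ∃ w : Circle, w ^ 2 = z := by
  obtain ⟨t, rfl⟩ := Circle.exp_surjective z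
  exact ⟨Circle.exp (t / 2), by rw [pow_two, ← Circle.exp_add, add_halves]⟩

/-- Divisibility of the circle: what holds for squares holds for all elements, and a sign character
of Spin(2) is trivial. -/
theorem exists_spin_two_sq (x : Spin 2) : ∃ y : Spin 2, y ^ 2 = x := by
  obtain ⟨w, hw⟩ := exists_circle_sq (spinCircle x)
  obtain ⟨y, rfl⟩ := spinCircle_surjective w
  exact ⟨y, spinCircle_injective (by rw [map_pow, hw])⟩

theorem spin_two_comm (x y : Spin 2) : x * y = y * x :=
  spinCircle_injective (by rw [map_mul, map_mul, mul_comm])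

end SpinTwo

end GNY
end

noncomputable section
namespace GNY

/-! ### Orthogonal irreps of commutative groups -/

section Commutative

open Matrix

variable {n : Type} [Fintype n] [DecidableEq n] {G : Type*} [Group G]
  {ρ : Representation ℝ G (n → ℝ)}

theorem rep_dotProduct_inv (hρ : ∀ x u v, ρ x u ⬝ᵥ ρ x v = u ⬝ᵥ v) (x : G) (u v : n → ℝ) :
    ρ x u ⬝ᵥ v = u ⬝ᵥ ρ x⁻¹ v := by
  rw [← hρ x⁻¹ (ρ x u) v, ← Module.End.mul_apply, ← map_mul, inv_mul_cancel, map_one,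
    Module.End.one_apply]

/-- Schur's lemma for symmetric operators. -/
theorem exists_eigenvalue_of_minimal {K : Subrepresentation ρ} (hK : K.toSubmodule ≠ ⊥)
    (hmin : ∀ S : Subrepresentation ρ, S.toSubmodule ≤ K.toSubmodule →
      S.toSubmodule = ⊥ ∨ S.toSubmodule = K.toSubmodule)
    {L : (n → ℝ) →ₗ[ℝ] (n → ℝ)} (hL : ∀ u v, L u ⬝ᵥ v = u ⬝ᵥ L v)
    (hcomm : ∀ x v, L (ρ x v) = ρ x (L v)) (hLK : ∀ v ∈ K.toSubmodule, L v ∈ K.toSubmodule) :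
    ∃ c : ℝ, ∀ v ∈ K.toSubmodule, L v = c • v := by
  -- L is compressed to K, so that the spectral theorem for matrices applies.
  let p := proj K.toSubmodule
  let B := LinearMap.toMatrix' (p ∘ₗ L ∘ₗ p)
  have hBv : ∀ v, B *ᵥ v = p (L (p v)) := fun v => LinearMap.toMatrix'_mulVec _ _
  have hB : B.IsSymm := by
    have h : ∀ u v, u ⬝ᵥ Bᵀ *ᵥ v = u ⬝ᵥ B *ᵥ v := by
      intro u v
      rw [mulVec_transpose, dotProduct_comm, ← dotProduct_mulVec, hBv, hBv,
        ← proj_dotProduct_comm, ← hL, ← proj_dotProduct_comm, dotProduct_comm]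
    ext i j
    have := h (Pi.single i 1) (Pi.single j 1)
    simpa using this
  obtain ⟨T, hT, d, hd⟩ := exists_diagonalization hB
  -- The eigenvectors of the compression span ℝⁿ, so they cannot all project to zero in K ≠ 0.
  obtain ⟨i, hi⟩ : ∃ i, p (T *ᵥ Pi.single i 1) ≠ 0 := by
    by_contra! h
    have h0 : projMat K.toSubmodule * T = 0 := Matrix.ext_of_mulVec_single fun j => by
      rw [← mulVec_mulVec, projMat_mulVec, zero_mulVec]
      exact h j
    have h1 : projMat K.toSubmodule = 0 := by
      rw [← Matrix.mul_one (projMat K.toSubmodule), ← orthogonal_mul_transpose hT,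
        ← Matrix.mul_assoc, h0, Matrix.zero_mul]
    refine hK ((Submodule.eq_bot_iff _).2 fun v hv => ?_)
    rw [← proj_of_mem hv, ← projMat_mulVec, h1, zero_mulVec]
  set t := T *ᵥ Pi.single i 1 with ht
  have hBt : B *ᵥ t = d i • t := by
    rw [hd, ht, mulVec_mulVec, Matrix.mul_assoc, orthogonal_transpose_mul hT, Matrix.mul_one,
      ← mulVec_mulVec, diagonal_mulVec_single, mul_one, ← mulVec_smul]
    congr 1
    ext j
    simp [Pi.single_apply]
  have hw : p t ∈ K.toSubmodule := proj_mem _ _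
  -- As L preserves K, L(p t) equals the compression applied to t, that is d t; projecting once more
  -- gives an eigenvector inside K.
  have hLw : L (p t) = d i • p t := by
    have h1 : L (p t) = d i • t := by
      rw [← hBt, hBv]
      exact (proj_of_mem (hLK _ hw)).symm
    rw [← map_smul, ← h1]
    exact (proj_of_mem (hLK _ hw)).symm
  let S : Subrepresentation ρ :=
    { toSubmodule := K.toSubmodule ⊓ LinearMap.eqLocus L (d i • LinearMap.id)
      apply_mem_toSubmodule := fun x v hv => ⟨K.apply_mem_toSubmodule x hv.1, by
        have h2 : L v = d i • v := hv.2
        show L (ρ x v) = d i • ρ x v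
        rw [hcomm, h2, map_smul]⟩ }
  have hS : S.toSubmodule = K.toSubmodule := by
    refine (hmin S inf_le_left).resolve_left fun h => hi ?_
    have : p t ∈ S.toSubmodule := ⟨hw, hLw⟩
    rwa [h, Submodule.mem_bot] at this
  refine ⟨d i, fun v hv => ?_⟩
  rw [← hS] at hv
  exact hv.2

/-- A line on which the group acts by signs. -/
def IsSignLine (K : Subrepresentation ρ) (u : n → ℝ) : Prop :=
  u ⬝ᵥ u = 1 ∧ K.toSubmodule = Submodule.span ℝ {u} ∧ ∀ x, ρ x u = u ∨ ρ x u = -u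

/-- A plane on which the group acts by rotations. -/
def IsRotationPlane (K : Subrepresentation ρ) (u v : n → ℝ) (a : G → Circle) : Prop :=
  (u ⬝ᵥ u = 1 ∧ v ⬝ᵥ v = 1 ∧ u ⬝ᵥ v = 0) ∧ K.toSubmodule = Submodule.span ℝ {u, v} ∧
    ∀ x, ρ x u = (a x : ℂ).re • u + (a x : ℂ).im • v ∧
      ρ x v = -(a x : ℂ).im • u + (a x : ℂ).re • v

theorem exists_unit_mem {K : Submodule ℝ (n → ℝ)} (hK : K ≠ ⊥) : ∃ u ∈ K, u ⬝ᵥ u = 1 := by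
  obtain ⟨v, hv, hv0⟩ := Submodule.exists_mem_ne_zero_of_ne_bot hK
  have h := dotProduct_self_pos hv0
  refine ⟨(√(v ⬝ᵥ v))⁻¹ • v, K.smul_mem _ hv, ?_⟩
  rw [smul_dotProduct, dotProduct_smul, smul_eq_mul, smul_eq_mul, ← mul_assoc, ← mul_inv,
    Real.mul_self_sqrt h.le, inv_mul_cancel₀ h.ne']

/-- Irreps of commutative groups are lines and planes. -/
theorem isSignLine_or_isRotationPlane (hρ : ∀ x u v, ρ x u ⬝ᵥ ρ x v = u ⬝ᵥ v)
    (hc : ∀ x y : G, x * y = y * x) {K : Subrepresentation ρ} (hK : K.toSubmodule ≠ ⊥)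
    (hmin : ∀ S : Subrepresentation ρ, S.toSubmodule ≤ K.toSubmodule →
      S.toSubmodule = ⊥ ∨ S.toSubmodule = K.toSubmodule) :
    (∃ u, IsSignLine K u) ∨
      ∃ u v a, IsRotationPlane K u v a ∧ ∃ x, (a x : ℂ).im ≠ 0 := by
  have hcomm : ∀ x y v, ρ x (ρ y v) = ρ y (ρ x v) := fun x y v => by
    rw [← Module.End.mul_apply, ← Module.End.mul_apply, ← map_mul, ← map_mul, hc]
  have hadj := rep_dotProduct_inv hρ
  have hinv : ∀ x v, ρ x (ρ x⁻¹ v) = v := fun x v => by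
    rw [← Module.End.mul_apply, ← map_mul, mul_inv_cancel, map_one, Module.End.one_apply]
  have hKx : ∀ x, ∀ v ∈ K.toSubmodule, ρ x v ∈ K.toSubmodule := fun x v hv =>
    K.apply_mem_toSubmodule x hv
  obtain ⟨u, huK, hu⟩ := exists_unit_mem hK
  have hu0 : u ≠ 0 := by
    rintro rfl
    simp at hu
  have hspan : ∀ S : Submodule ℝ (n → ℝ), u ∈ S → S ≤ K.toSubmodule →
      (∀ x, ∀ v ∈ S, ρ x v ∈ S) → K.toSubmodule = S := by
    intro S h1 h2 h3
    have := hmin ⟨S, fun x v hv => h3 x v hv⟩ h2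
    refine (this.resolve_left fun h => hu0 ?_).symm
    have h4 : u ∈ S := h1
    rw [show S = ⊥ from h] at h4
    exact (Submodule.mem_bot ℝ).1 h4
  -- The adjoint of ρ(x) is ρ(x⁻¹), so the sum is symmetric and Schur's lemma makes it a scalar on
  -- K.
  have hsum : ∀ x, ∃ c : ℝ, ∀ v ∈ K.toSubmodule, ρ x v + ρ x⁻¹ v = c • v := by
    intro x
    refine exists_eigenvalue_of_minimal hK hmin (L := ρ x + ρ x⁻¹) (fun u v => ?_) (fun y v => ?_)
      (fun v hv => K.toSubmodule.add_mem (hKx _ _ hv) (hKx _ _ hv))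
    · rw [LinearMap.add_apply, LinearMap.add_apply, add_dotProduct, dotProduct_add, hadj, hadj,
        inv_inv, add_comm]
    · rw [LinearMap.add_apply, LinearMap.add_apply, map_add, hcomm x y, hcomm x⁻¹ y]
  choose c hc' using hsum
  -- If every x acts on K like its inverse, it acts by a scalar and hence by a sign. Otherwise some
  -- ρ(y) - ρ(y⁻¹) yields a complex structure.
  by_cases hA : ∀ x, ∀ v ∈ K.toSubmodule, ρ x v = ρ x⁻¹ v
  · left
    have hval : ∀ x, ρ x u = (c x / 2) • u := fun x => by
      have h1 := hc' x u huK
      rw [← hA x u huK, ← two_smul ℝ] at h1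
      rw [div_eq_inv_mul, mul_smul, ← h1, smul_smul]
      norm_num
    have hsign : ∀ x, ρ x u = u ∨ ρ x u = -u := by
      intro x
      have h1 := hρ x u u
      rw [hval, smul_dotProduct, dotProduct_smul, hu, smul_eq_mul, smul_eq_mul, mul_one] at h1
      rcases mul_self_eq_one_iff.1 h1 with h2 | h2
      · left; rw [hval, h2, one_smul]
      · right; rw [hval, h2, neg_one_smul]
    refine ⟨u, hu, hspan _ (Submodule.mem_span_singleton_self u) ?_ ?_, hsign⟩
    · rwa [Submodule.span_singleton_le_iff_mem]
    · intro x v hv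
      obtain ⟨r, rfl⟩ := Submodule.mem_span_singleton.1 hv
      rw [map_smul, hval, smul_smul]
      exact Submodule.smul_mem _ _ (Submodule.mem_span_singleton_self u)
  · right
    push Not at hA
    obtain ⟨y, v₀, hv₀, hne⟩ := hA
    -- B is antisymmetric, and its square on K is the scalar c² - 4, where c is the scalar value of
    -- ρ(y) + ρ(y⁻¹).
    let B : (n → ℝ) →ₗ[ℝ] (n → ℝ) := ρ y - ρ y⁻¹
    have hBdef : ∀ v, B v = ρ y v - ρ y⁻¹ v := fun v => rfl
    have hBB : ∀ v ∈ K.toSubmodule, B (B v) = (c y ^ 2 - 4) • v := by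
      intro v hv
      have h1 := hc' y v hv
      have h2 := congrArg (fun w => ρ y w + ρ y⁻¹ w) h1
      have h3 := hinv y v
      have h4 := hinv y⁻¹ v
      rw [inv_inv] at h4
      simp only [map_add, map_smul, h3, h4] at h2
      rw [← smul_add, h1, smul_smul] at h2
      rw [hBdef, hBdef, map_sub, map_sub, h3, h4, sub_smul, pow_two, ← h2]
      module
    have hBanti : ∀ u v, B u ⬝ᵥ v = -(u ⬝ᵥ B v) := by
      intro u v
      rw [hBdef, hBdef, sub_dotProduct, dotProduct_sub, hadj, hadj, inv_inv]
      ring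
    have hpos : 0 < 4 - c y ^ 2 := by
      have h1 : 0 < B v₀ ⬝ᵥ B v₀ := dotProduct_self_pos (sub_ne_zero.2 hne)
      rw [hBanti, hBB _ hv₀, dotProduct_smul, smul_eq_mul, ← neg_mul] at h1
      have h2 : 0 ≤ v₀ ⬝ᵥ v₀ := by
        by_cases h : v₀ = 0
        · simp [h]
        · exact (dotProduct_self_pos h).le
      nlinarith [pos_of_mul_pos_left h1 h2]
    set r := √(4 - c y ^ 2) with hr
    have hr0 : r ≠ 0 := (Real.sqrt_pos.2 hpos).ne'
    have hrr : r * r = 4 - c y ^ 2 := Real.mul_self_sqrt hpos.le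
    let J : (n → ℝ) →ₗ[ℝ] (n → ℝ) := r⁻¹ • B
    have hJdef : ∀ v, J v = r⁻¹ • B v := fun v => rfl
    have hJK : ∀ v ∈ K.toSubmodule, J v ∈ K.toSubmodule := fun v hv =>
      K.toSubmodule.smul_mem _ (K.toSubmodule.sub_mem (hKx _ _ hv) (hKx _ _ hv))
    have hJJ : ∀ v ∈ K.toSubmodule, J (J v) = -v := by
      intro v hv
      rw [hJdef, hJdef, map_smul, hBB v hv, smul_smul, smul_smul, ← neg_one_smul ℝ v]
      congr 1
      field_simp
      rw [pow_two r, hrr]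
      ring
    have hJanti : ∀ u v, J u ⬝ᵥ v = -(u ⬝ᵥ J v) := by
      intro u v
      rw [hJdef, hJdef, smul_dotProduct, dotProduct_smul, hBanti, smul_neg]
    have hJx : ∀ x v, J (ρ x v) = ρ x (J v) := by
      intro x v
      rw [hJdef, hJdef, hBdef, hBdef, map_smul, map_sub, hcomm y x, hcomm y⁻¹ x]
    -- ρ(x) - ρ(x⁻¹) and J are commuting antisymmetric operators on K, so their product is symmetric
    -- and again a scalar. Thus ρ(x) is a combination of 1 and J, and u, Ju span an invariant plane.
    have hdiff : ∀ x, ∃ s : ℝ, ∀ v ∈ K.toSubmodule, ρ x v - ρ x⁻¹ v = s • J v := by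
      intro x
      obtain ⟨e, he⟩ := exists_eigenvalue_of_minimal hK hmin (L := (ρ x - ρ x⁻¹) ∘ₗ J)
        (fun u v => by
          simp only [LinearMap.comp_apply, LinearMap.sub_apply]
          rw [sub_dotProduct, dotProduct_sub, hadj, hadj, inv_inv, hJanti, hJanti, hJx, hJx]
          ring)
        (fun z v => by
          simp only [LinearMap.comp_apply, LinearMap.sub_apply]
          rw [hJx, map_sub, hcomm x z, hcomm x⁻¹ z])
        (fun v hv => K.toSubmodule.sub_mem (hKx _ _ (hJK v hv)) (hKx _ _ (hJK v hv)))
      refine ⟨-e, fun v hv => ?_⟩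
      have h1 := he (J v) (hJK v hv)
      simp only [LinearMap.comp_apply, LinearMap.sub_apply, hJJ v hv, map_neg] at h1
      rw [neg_smul, ← h1]
      abel
    choose s hs using hdiff
    have hrot : ∀ x, ∀ v ∈ K.toSubmodule, ρ x v = (c x / 2) • v + (s x / 2) • J v := by
      intro x v hv
      have h1 := hc' x v hv
      have h2 := hs x v hv
      rw [div_eq_inv_mul, div_eq_inv_mul, mul_smul, mul_smul, ← h1, ← h2]
      module
    have huJ : u ⬝ᵥ J u = 0 := by
      have := hJanti u u
      rw [dotProduct_comm] at this
      linarith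
    have hJuJ : J u ⬝ᵥ J u = 1 := by
      rw [hJanti, hJJ u huK, dotProduct_neg, neg_neg, hu]
    have hnorm : ∀ x, (c x / 2) * (c x / 2) + (s x / 2) * (s x / 2) = 1 := by
      intro x
      have h1 := hρ x u u
      rw [hrot x u huK] at h1
      simp only [add_dotProduct, dotProduct_add, smul_dotProduct, dotProduct_smul, hu, hJuJ, huJ,
        dotProduct_comm (J u) u, smul_eq_mul] at h1
      linarith
    refine ⟨u, J u, fun x => ⟨⟨c x / 2, s x / 2⟩, ?_⟩, ⟨⟨hu, hJuJ, huJ⟩, ?_, fun x => ⟨?_, ?_⟩⟩,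
      y, ?_⟩
    · show (⟨c x / 2, s x / 2⟩ : ℂ) ∈ Metric.sphere (0 : ℂ) 1
      rw [mem_sphere_zero_iff_norm, ← sq_eq_sq₀ (norm_nonneg _) zero_le_one, Complex.sq_norm,
        Complex.normSq_apply, hnorm, one_pow]
    · refine hspan _ (Submodule.subset_span (by simp)) ?_ ?_
      · rw [Submodule.span_le]
        rintro w (rfl | rfl)
        · exact huK
        · exact hJK u huK
      · intro x w hw
        have hw' : w ∈ K.toSubmodule := by
          refine Submodule.span_le.2 ?_ hw
          rintro w (rfl | rfl)
          · exact huK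
          · exact hJK u huK
        obtain ⟨α, β, rfl⟩ := Submodule.mem_span_pair.1 hw
        rw [hrot x _ hw', map_add, map_smul, map_smul, hJJ u huK]
        refine Submodule.mem_span_pair.2 ⟨c x / 2 * α - s x / 2 * β, c x / 2 * β + s x / 2 * α, ?_⟩
        module
    · exact hrot x u huK
    · show ρ x (J u) = -(s x / 2) • u + (c x / 2) • J u
      rw [hrot x _ (hJK u huK), hJJ u huK]
      module
    · show s y / 2 ≠ 0
      intro h0
      have hs0 : s y = 0 := by linarith
      have := hs y v₀ hv₀
      rw [hs0, zero_smul] at this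
      exact hne (sub_eq_zero.1 this)

end Commutative

end GNY
end

noncomputable section
namespace GNY

/-! ### Symmetric matrices on `ℂ²` -/

section ComplexBlocks

open Matrix

/-- The rotation of `ℝ⁴ = ℂ²` by a pair of phases. -/
def rotBlk (a b : Circle) : Matrix (Fin 4) (Fin 4) ℝ :=
  !![(a : ℂ).re, -(a : ℂ).im, 0, 0; (a : ℂ).im, (a : ℂ).re, 0, 0;
     0, 0, (b : ℂ).re, -(b : ℂ).im; 0, 0, (b : ℂ).im, (b : ℂ).re]

theorem circle_re_im (a : Circle) : (a : ℂ).re * (a : ℂ).re + (a : ℂ).im * (a : ℂ).im = 1 := by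
  rw [← Complex.normSq_apply]; exact Circle.normSq_coe a

theorem rotBlk_mul (a b a' b' : Circle) :
    rotBlk (a * a') (b * b') = rotBlk a b * rotBlk a' b' := by
  ext i j
  fin_cases i <;> fin_cases j <;> simp [rotBlk, Matrix.mul_apply, Fin.sum_univ_four] <;> ring

theorem rotBlk_one : rotBlk 1 1 = 1 := by
  ext i j
  fin_cases i <;> fin_cases j <;> simp [rotBlk]

theorem rotBlk_transpose (a b : Circle) : (rotBlk a b)ᵀ = rotBlk a⁻¹ b⁻¹ := by
  ext i j
  fin_cases i <;> fin_cases j <;> simp [rotBlk, Circle.coe_inv_eq_conj]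

theorem rotBlk_mem (a b : Circle) : rotBlk a b ∈ Matrix.orthogonalGroup (Fin 4) ℝ := by
  rw [mem_orthogonalGroup_iff]
  show rotBlk a b * (rotBlk a b)ᵀ = 1
  rw [rotBlk_transpose, ← rotBlk_mul, mul_inv_cancel, mul_inv_cancel, rotBlk_one]

theorem rotBlk_injective {a b a' b' : Circle} (h : rotBlk a b = rotBlk a' b') :
    a = a' ∧ b = b' := by
  constructor
  · exact Circle.ext (Complex.ext (by simpa [rotBlk] using congrFun (congrFun h 0) 0)
      (by simpa [rotBlk] using congrFun (congrFun h 1) 0))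
  · exact Circle.ext (Complex.ext (by simpa [rotBlk] using congrFun (congrFun h 2) 2)
      (by simpa [rotBlk] using congrFun (congrFun h 3) 2))

/-- The symmetric matrix of the real quadratic form on `ℂ²` with the coefficients `t` of `v v̄` and
`c` of `v₁²`, `v₂²`, `v₁ v̄₂` and `v₁ v₂`. -/
def blk (t : Fin 2 → ℝ) (c : Fin 4 → ℂ) : Matrix (Fin 4) (Fin 4) ℝ :=
  !![t 0 + (c 0).re, (c 0).im, (c 2).re + (c 3).re, (c 3).im - (c 2).im;
     (c 0).im, t 0 - (c 0).re, (c 2).im + (c 3).im, (c 2).re - (c 3).re;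
     (c 2).re + (c 3).re, (c 2).im + (c 3).im, t 1 + (c 1).re, (c 1).im;
     (c 3).im - (c 2).im, (c 2).re - (c 3).re, (c 1).im, t 1 - (c 1).re]

theorem exists_blk {A : Matrix (Fin 4) (Fin 4) ℝ} (hA : A.IsSymm) : ∃ t c, A = blk t c := by
  refine ⟨![(A 0 0 + A 1 1) / 2, (A 2 2 + A 3 3) / 2],
    ![⟨(A 0 0 - A 1 1) / 2, A 0 1⟩, ⟨(A 2 2 - A 3 3) / 2, A 2 3⟩,
      ⟨(A 0 2 + A 1 3) / 2, (A 1 2 - A 0 3) / 2⟩, ⟨(A 0 2 - A 1 3) / 2, (A 1 2 + A 0 3) / 2⟩], ?_⟩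
  have h := fun i j => hA.apply i j
  ext i j
  fin_cases i <;> fin_cases j <;> simp [blk] <;>
    linarith [h 0 1, h 0 2, h 0 3, h 1 2, h 1 3, h 2 3]

theorem blk_isSymm (t : Fin 2 → ℝ) (c : Fin 4 → ℂ) : (blk t c).IsSymm := by
  ext i j
  fin_cases i <;> fin_cases j <;> simp [blk]

theorem blk_injective {t t' : Fin 2 → ℝ} {c c' : Fin 4 → ℂ} (h : blk t c = blk t' c') :
    t = t' ∧ c = c' := by
  have e := fun i j => congrFun (congrFun h i) j
  have e00 := e 0 0
  have e01 := e 0 1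
  have e02 := e 0 2
  have e03 := e 0 3
  have e11 := e 1 1
  have e12 := e 1 2
  have e13 := e 1 3
  have e22 := e 2 2
  have e23 := e 2 3
  have e33 := e 3 3
  simp [blk] at e00 e01 e02 e03 e11 e12 e13 e22 e23 e33
  constructor
  · funext i
    fin_cases i <;> simp <;> linarith
  · funext i
    fin_cases i <;> simp <;> apply Complex.ext <;> linarith

theorem blk_add (t t' : Fin 2 → ℝ) (c c' : Fin 4 → ℂ) :
    blk (t + t') (c + c') = blk t c + blk t' c' := by
  ext i j
  fin_cases i <;> fin_cases j <;> simp [blk] <;> ring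

theorem blk_smul (r : ℝ) (t : Fin 2 → ℝ) (c : Fin 4 → ℂ) :
    blk (r • t) (r • c) = r • blk t c := by
  ext i j
  fin_cases i <;> fin_cases j <;> simp [blk] <;> ring

/-- The phases by which a rotation multiplies the coefficients of `blk`. -/
def blkChar (a b : Circle) : Fin 4 → Circle := ![a ^ 2, b ^ 2, a * b⁻¹, a * b]

theorem rotBlk_conj (a b : Circle) (t : Fin 2 → ℝ) (c : Fin 4 → ℂ) :
    rotBlk a b * blk t c * (rotBlk a b)ᵀ = blk t fun i => blkChar a b i * c i := by
  have ha := circle_re_im a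
  have hb := circle_re_im b
  ext i j
  fin_cases i <;> fin_cases j <;>
    simp [rotBlk, blk, blkChar, Matrix.mul_apply, Fin.sum_univ_four, pow_two,
      Circle.coe_inv_eq_conj] <;>
    first
    | ring1
    | linear_combination t 0 * ha
    | linear_combination t 1 * hb

/-- The equation that covariance under a rotation imposes on one pair of coefficients. -/
def SlotEq (χ ν : Circle) (c d : ℂ) : Prop :=
  χ * c = (ν : ℂ).re * c + (ν : ℂ).im * d ∧ χ * d = -(ν : ℂ).im * c + (ν : ℂ).re * d

theorem slotEq_zero (χ ν : Circle) : SlotEq χ ν 0 0 := by simp [SlotEq]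

theorem slotEq_I (ν : Circle) (c : ℂ) : SlotEq ν ν c (Complex.I * c) := by
  constructor <;> conv_lhs => rw [← Complex.re_add_im (ν : ℂ)]
  · ring
  · linear_combination ((ν : ℂ).im * c) * Complex.I_mul_I

theorem slotEq_neg_I (ν : Circle) (c : ℂ) : SlotEq ν⁻¹ ν c (-Complex.I * c) := by
  have h : ((ν⁻¹ : Circle) : ℂ) = (ν : ℂ).re - (ν : ℂ).im * Complex.I := by
    rw [Circle.coe_inv_eq_conj]
    apply Complex.ext <;> simp
  constructor <;> rw [h]
  · ring
  · linear_combination ((ν : ℂ).im * c) * Complex.I_mul_I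

/-- The combinations c - i d and c + i d are eigenvectors of the rotation mixing c and d, with
eigenvalues ν and ν⁻¹. -/
theorem SlotEq.eigen {χ ν : Circle} {c d : ℂ} (h : SlotEq χ ν c d) :
    (c - Complex.I * d ≠ 0 → χ = ν) ∧ (c + Complex.I * d ≠ 0 → χ = ν⁻¹) := by
  obtain ⟨h1, h2⟩ := h
  constructor
  · intro h0
    refine Circle.ext (mul_right_cancel₀ h0 ?_)
    conv_rhs => rw [← Complex.re_add_im (ν : ℂ)]
    linear_combination h1 - Complex.I * h2 + ((ν : ℂ).im * d) * Complex.I_mul_I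
  · intro h0
    refine Circle.ext (mul_right_cancel₀ h0 ?_)
    have h : ((ν⁻¹ : Circle) : ℂ) = (ν : ℂ).re - (ν : ℂ).im * Complex.I := by
      rw [Circle.coe_inv_eq_conj]
      apply Complex.ext <;> simp
    rw [h]
    linear_combination h1 + Complex.I * h2 + ((ν : ℂ).im * d) * Complex.I_mul_I

open Classical in
/-- The ratio of the coefficients in `R₁` and in `R₀` that covariance allows. -/
def slotSign {X : Type*} (χ ν : X → Circle) : ℂ :=
  if χ = ν then Complex.I else if χ = ν⁻¹ then -Complex.I else 0

theorem slotSign_cases {X : Type*} (χ ν : X → Circle) :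
    (χ = ν ∧ slotSign χ ν = Complex.I) ∨ (χ = ν⁻¹ ∧ slotSign χ ν = -Complex.I) ∨
      (χ ≠ ν ∧ χ ≠ ν⁻¹ ∧ slotSign χ ν = 0) := by
  unfold slotSign
  split_ifs with h1 h2
  · exact Or.inl ⟨h1, rfl⟩
  · exact Or.inr (Or.inl ⟨h2, rfl⟩)
  · exact Or.inr (Or.inr ⟨h1, h2, rfl⟩)

/-- Because the characters ν and ν⁻¹ differ, χ can match at most one of them, so at least one of c -
i d and c + i d vanishes. -/
theorem SlotEq.eq_slotSign {X : Type*} {χ ν : X → Circle} (hν : ν ≠ ν⁻¹) {c d : ℂ}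
    (h : ∀ x, SlotEq (χ x) (ν x) c d) :
    d = slotSign χ ν * c ∧ (slotSign χ ν = 0 → c = 0) := by
  have h1 : χ ≠ ν → c - Complex.I * d = 0 := fun hne => by
    by_contra h0
    exact hne (funext fun x => (h x).eigen.1 h0)
  have h2 : χ ≠ ν⁻¹ → c + Complex.I * d = 0 := fun hne => by
    by_contra h0
    exact hne (funext fun x => (h x).eigen.2 h0)
  rcases slotSign_cases χ ν with ⟨hχ, hs⟩ | ⟨hχ, hs⟩ | ⟨hχ, hχ', hs⟩
  · rw [hs]
    have h3 := h2 (by rw [hχ]; exact hν)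
    exact ⟨by linear_combination -Complex.I * h3 + d * Complex.I_mul_I, fun h => absurd h Complex.I_ne_zero⟩
  · rw [hs]
    have h3 := h1 (by rw [hχ]; exact hν.symm)
    exact ⟨by linear_combination Complex.I * h3 + d * Complex.I_mul_I,
      fun h => absurd (neg_eq_zero.1 h) Complex.I_ne_zero⟩
  · rw [hs]
    have h3 := h1 hχ
    have h4 := h2 hχ'
    have hc : c = 0 := by linear_combination (h3 + h4) / 2
    refine ⟨?_, fun _ => hc⟩
    rw [hc] at h3
    rw [zero_mul]
    have : Complex.I * d = 0 := by linear_combination -h3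
    exact (mul_eq_zero.1 this).resolve_left Complex.I_ne_zero

theorem slotEq_slotSign {X : Type*} {χ ν : X → Circle} {c : ℂ} (h : slotSign χ ν = 0 → c = 0)
    (x : X) : SlotEq (χ x) (ν x) c (slotSign χ ν * c) := by
  rcases slotSign_cases χ ν with ⟨hχ, hs⟩ | ⟨hχ, hs⟩ | ⟨hχ, hχ', hs⟩
  · rw [hs, hχ]; exact slotEq_I _ _
  · rw [hs, hχ]; exact slotEq_neg_I _ _
  · rw [h hs, mul_zero]; exact slotEq_zero _ _

/-- The pair of matrices with coefficients `c` and `σ c`. -/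
def pairTuple (σ c : Fin 4 → ℂ) : Yukawa 2 := ![blk 0 c, blk 0 (σ * c)]

theorem pairTuple_isSymm (σ c : Fin 4 → ℂ) (m : Fin 2) : (pairTuple σ c m).IsSymm := by
  fin_cases m <;> exact blk_isSymm _ _

theorem pairTuple_add (σ c d : Fin 4 → ℂ) :
    pairTuple σ (c + d) = pairTuple σ c + pairTuple σ d := by
  funext m
  fin_cases m
  · show blk 0 _ = blk 0 _ + blk 0 _
    rw [← blk_add, add_zero]
  · show blk 0 _ = blk 0 _ + blk 0 _
    rw [← blk_add, add_zero, mul_add]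

theorem pairTuple_smul (σ c : Fin 4 → ℂ) (r : ℝ) : pairTuple σ (r • c) = r • pairTuple σ c := by
  funext m
  fin_cases m
  · show blk 0 _ = r • blk 0 _
    rw [← blk_smul, smul_zero]
  · show blk 0 _ = r • blk 0 _
    rw [← blk_smul, smul_zero, mul_smul_comm]

theorem pairTuple_zero (σ : Fin 4 → ℂ) : pairTuple σ 0 = 0 := by
  have := pairTuple_smul σ 0 0
  rwa [zero_smul, zero_smul] at this

theorem pairTuple_conj (σ c : Fin 4 → ℂ) (s t : Circle) :
    (pairTuple σ c).conj (rotBlk s t) = pairTuple σ fun i => blkChar s t i * c i := by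
  funext m
  fin_cases m
  · exact rotBlk_conj s t _ _
  · refine (rotBlk_conj s t _ _).trans ?_
    show blk _ _ = blk _ _
    congr 1
    funext i
    simp only [Pi.mul_apply]
    ring

/-- Covariance under a rotation by the phase `ν`. -/
def CircleCovariant (a b ν : Circle) (S : Yukawa 2) : Prop :=
  ∀ φ : Fin 2 → ℝ, rotBlk a b * S.at φ * (rotBlk a b)ᵀ =
    S.at ![((ν : ℂ) * ⟨φ 0, φ 1⟩).re, ((ν : ℂ) * ⟨φ 0, φ 1⟩).im]

theorem at_two (S : Yukawa 2) (φ : Fin 2 → ℝ) : S.at φ = φ 0 • S 0 + φ 1 • S 1 := by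
  rw [Yukawa.at, Fin.sum_univ_two]

theorem CircleCovariant.slotEq {a b ν : Circle} {S : Yukawa 2} (h : CircleCovariant a b ν S)
    {t t' : Fin 2 → ℝ} {c c' : Fin 4 → ℂ} (h0 : S 0 = blk t c) (h1 : S 1 = blk t' c') :
    (∀ i, SlotEq (blkChar a b i) ν (c i) (c' i)) ∧ ∀ i, SlotEq 1 ν (t i) (t' i) := by
  have e0 := h ![1, 0]
  have e1 := h ![0, 1]
  simp only [at_two, h0, h1] at e0 e1
  simp only [cons_val_zero, cons_val_one, one_smul, zero_smul, add_zero, zero_add, rotBlk_conj,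
    Complex.mul_re, Complex.mul_im, mul_one, mul_zero, sub_zero, zero_sub, ← blk_smul,
    ← blk_add] at e0 e1
  obtain ⟨f0, g0⟩ := blk_injective e0
  obtain ⟨f1, g1⟩ := blk_injective e1
  constructor
  · intro i
    have p := congrFun g0 i
    have q := congrFun g1 i
    simp only [Pi.add_apply, Pi.smul_apply, Complex.real_smul] at p q
    exact ⟨p, by rw [q]; push_cast; ring⟩
  · intro i
    have p := congrFun f0 i
    have q := congrFun f1 i
    simp only [Pi.add_apply, Pi.smul_apply, smul_eq_mul] at p q
    refine ⟨?_, ?_⟩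
    · rw [Circle.coe_one, one_mul]
      exact_mod_cast p
    · rw [Circle.coe_one, one_mul]
      exact_mod_cast q

theorem circleCovariant_pairTuple {a b ν : Circle} {σ c : Fin 4 → ℂ}
    (h : ∀ i, SlotEq (blkChar a b i) ν (c i) (σ i * c i)) :
    CircleCovariant a b ν (pairTuple σ c) := by
  intro φ
  rw [at_two, at_two]
  show rotBlk a b * (φ 0 • blk 0 c + φ 1 • blk 0 (σ * c)) * (rotBlk a b)ᵀ =
    _ • blk 0 c + _ • blk 0 (σ * c)
  rw [← blk_smul, ← blk_smul, ← blk_add, ← blk_smul, ← blk_smul, ← blk_add, rotBlk_conj]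
  simp only [smul_zero, add_zero]
  congr 1
  funext i
  obtain ⟨p, q⟩ := h i
  simp only [Pi.add_apply, Pi.smul_apply, Pi.mul_apply, Complex.real_smul, cons_val_zero,
    cons_val_one, Complex.mul_re, Complex.mul_im]
  push_cast
  linear_combination (φ 0 : ℂ) * p + (φ 1 : ℂ) * q

/-- The normal form of covariant pairs of symmetric matrices. -/
theorem exists_eq_pairTuple {X : Type*} {a b ν : X → Circle} (hν : ν ≠ ν⁻¹) {S : Yukawa 2}
    (hS : ∀ m, (S m).IsSymm) (h : ∀ x, CircleCovariant (a x) (b x) (ν x) S) :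
    ∃ c : Fin 4 → ℂ, S = pairTuple (fun i => slotSign (fun x => blkChar (a x) (b x) i) ν) c ∧
      ∀ i, slotSign (fun x => blkChar (a x) (b x) i) ν = 0 → c i = 0 := by
  obtain ⟨t, c, h0⟩ := exists_blk (hS 0)
  obtain ⟨t', c', h1⟩ := exists_blk (hS 1)
  have hs := fun i => SlotEq.eq_slotSign hν fun x => ((h x).slotEq h0 h1).1 i
  -- The Hermitian coefficients are invariant under phases, whereas the vector carries a nontrivial
  -- character; so they vanish.
  have hone : slotSign (fun _ : X => (1 : Circle)) ν = 0 := by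
    rcases slotSign_cases (fun _ : X => (1 : Circle)) ν with ⟨hχ, -⟩ | ⟨hχ, -⟩ | ⟨-, -, hs⟩
    · refine absurd ?_ hν
      rw [← hχ]
      funext x
      simp
    · refine absurd ?_ hν
      have : ν = fun _ => 1 := by rw [← inv_inv ν, ← hχ]; funext x; simp
      rw [← hχ, this]
    · exact hs
  have ht := fun i => SlotEq.eq_slotSign hν fun x => ((h x).slotEq h0 h1).2 i
  have ht0 : t = 0 := funext fun i => by
    have := (ht i).2 hone
    exact_mod_cast this
  have ht1 : t' = 0 := funext fun i => by
    have := (ht i).1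
    rw [hone, zero_mul] at this
    exact_mod_cast this
  refine ⟨c, funext fun m => ?_, fun i => (hs i).2⟩
  fin_cases m
  · show S 0 = blk 0 c
    rw [h0, ht0]
  · show S 1 = blk 0 _
    rw [h1, ht1]
    congr 1
    exact funext fun i => (hs i).1

/-- Two coefficients can be made nonnegative by a choice of phases. -/
theorem exists_circle_mul_eq_norm (c : ℂ) : ∃ s : Circle, s * c = ‖c‖ := by
  by_cases h : c = 0
  · exact ⟨1, by simp [h]⟩
  · have hn : (‖c‖ : ℂ) ≠ 0 := by exact_mod_cast norm_ne_zero_iff.2 h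
    refine ⟨⟨‖c‖ / c, ?_⟩, ?_⟩
    · show _ ∈ Metric.sphere (0 : ℂ) 1
      rw [mem_sphere_zero_iff_norm, norm_div]
      simp [h]
    · show (‖c‖ / c : ℂ) * c = _
      field_simp

end ComplexBlocks

end GNY
end

noncomputable section
namespace GNY

/-! ### Frames of commuting rotations of `ℝ⁴` -/

section Frames

open Matrix

variable {n : Type} [Fintype n] [DecidableEq n] {G : Type*} [Group G]
  {ρ : Representation ℝ G (n → ℝ)} {K : Subrepresentation ρ} {u v : n → ℝ} {a : G → Circle}

theorem IsSignLine.projMat_eq (h : IsSignLine K u) : projMat K.toSubmodule = vecMulVec u u := by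
  obtain ⟨hu, hK, -⟩ := h
  refine Matrix.ext_of_mulVec_single fun j => ?_
  rw [projMat_mulVec, vecMulVec_mulVec, op_smul_eq_smul, hK]
  refine proj_eq (Submodule.smul_mem _ _ (Submodule.mem_span_singleton_self u))
    (mem_perp.2 fun w hw => ?_)
  obtain ⟨r, rfl⟩ := Submodule.mem_span_singleton.1 hw
  rw [dotProduct_sub, smul_dotProduct, smul_dotProduct, dotProduct_smul, hu]
  simp

theorem IsRotationPlane.projMat_eq (h : IsRotationPlane K u v a) :
    projMat K.toSubmodule = vecMulVec u u + vecMulVec v v := by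
  obtain ⟨⟨hu, hv, huv⟩, hK, -⟩ := h
  refine Matrix.ext_of_mulVec_single fun j => ?_
  rw [projMat_mulVec, add_mulVec, vecMulVec_mulVec, vecMulVec_mulVec, op_smul_eq_smul,
    op_smul_eq_smul, hK]
  refine proj_eq (Submodule.mem_span_pair.2 ⟨_, _, rfl⟩) (mem_perp.2 fun w hw => ?_)
  obtain ⟨r, s, rfl⟩ := Submodule.mem_span_pair.1 hw
  simp only [dotProduct_sub, add_dotProduct, dotProduct_add, smul_dotProduct, dotProduct_smul, hu,
    hv, huv, dotProduct_comm v u, smul_eq_mul]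
  ring

theorem IsSignLine.mem (h : IsSignLine K u) : u ∈ K.toSubmodule := by
  rw [h.2.1]; exact Submodule.mem_span_singleton_self u

theorem IsSignLine.sq_apply (h : IsSignLine K u) (x : G) : ρ (x * x) u = u := by
  rw [map_mul, Module.End.mul_apply]
  rcases h.2.2 x with h1 | h1
  · rw [h1, h1]
  · rw [h1, map_neg, h1, neg_neg]

theorem IsRotationPlane.mem_left (h : IsRotationPlane K u v a) : u ∈ K.toSubmodule := by
  rw [h.2.1]; exact Submodule.subset_span (by simp)

theorem IsRotationPlane.mem_right (h : IsRotationPlane K u v a) : v ∈ K.toSubmodule := by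
  rw [h.2.1]; exact Submodule.subset_span (by simp)

/-- The matrix with the given columns. -/
def frame (u v w z : Fin 4 → ℝ) : Matrix (Fin 4) (Fin 4) ℝ := (of ![u, v, w, z])ᵀ

theorem frame_mem {u v w z : Fin 4 → ℝ} (huu : u ⬝ᵥ u = 1) (hvv : v ⬝ᵥ v = 1) (hww : w ⬝ᵥ w = 1)
    (hzz : z ⬝ᵥ z = 1) (huv : u ⬝ᵥ v = 0) (huw : u ⬝ᵥ w = 0) (huz : u ⬝ᵥ z = 0)
    (hvw : v ⬝ᵥ w = 0) (hvz : v ⬝ᵥ z = 0) (hwz : w ⬝ᵥ z = 0) :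
    frame u v w z ∈ Matrix.orthogonalGroup (Fin 4) ℝ := by
  rw [mem_orthogonalGroup_iff']
  show (frame u v w z)ᵀ * frame u v w z = 1
  have h : ∀ i j, ((frame u v w z)ᵀ * frame u v w z) i j =
      (![u, v, w, z] i) ⬝ᵥ (![u, v, w, z] j) := fun i j => rfl
  ext i j
  rw [h]
  fin_cases i <;> fin_cases j <;>
    simp [huu, hvv, hww, hzz, huv, huw, huz, hvw, hvz, hwz, dotProduct_comm v u,
      dotProduct_comm w u, dotProduct_comm w v, dotProduct_comm z u, dotProduct_comm z v,
      dotProduct_comm z w]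

theorem frame_diagonal (u v w z d : Fin 4 → ℝ) :
    frame u v w z * diagonal d * (frame u v w z)ᵀ = d 0 • vecMulVec u u + d 1 • vecMulVec v v +
      d 2 • vecMulVec w w + d 3 • vecMulVec z z := by
  ext i j
  rw [Matrix.mul_apply, Fin.sum_univ_four]
  simp [frame, mul_diagonal, vecMulVec_apply]
  ring

theorem mul_frame {A : Matrix (Fin 4) (Fin 4) ℝ} {u v w z : Fin 4 → ℝ} {a b : Circle}
    (hu : A *ᵥ u = (a : ℂ).re • u + (a : ℂ).im • v) (hv : A *ᵥ v = -(a : ℂ).im • u + (a : ℂ).re • v)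
    (hw : A *ᵥ w = (b : ℂ).re • w + (b : ℂ).im • z)
    (hz : A *ᵥ z = -(b : ℂ).im • w + (b : ℂ).re • z) :
    A * frame u v w z = frame u v w z * rotBlk a b := by
  have h : ∀ i j, (A * frame u v w z) i j = (A *ᵥ (![u, v, w, z] j)) i := fun i j => rfl
  ext i j
  rw [h, Matrix.mul_apply, Fin.sum_univ_four]
  fin_cases j <;> simp [hu, hv, hw, hz, frame, rotBlk] <;> ring

/-- The irreducible summands are lines and planes, and the traces of their projections add up to
four. Without a plane, all squares act trivially; otherwise there are one plane and two lines, or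
two planes. Where lines occur the statement concerns squares, as these remove the signs. -/
theorem exists_frame {ρ : Representation ℝ G (Fin 4 → ℝ)}
    (hρ : ∀ x u v, ρ x u ⬝ᵥ ρ x v = u ⬝ᵥ v) (hc : ∀ x y : G, x * y = y * x)
    {ι : Type*} [Fintype ι] [DecidableEq ι] {s : ι → Subrepresentation ρ}
    (hne : ∀ i, (s i).toSubmodule ≠ ⊥)
    (hmin : ∀ i, ∀ S : Subrepresentation ρ, S.toSubmodule ≤ (s i).toSubmodule →
      S.toSubmodule = ⊥ ∨ S.toSubmodule = (s i).toSubmodule)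
    (horth : ∀ i j, i ≠ j → ∀ u ∈ (s i).toSubmodule, ∀ v ∈ (s j).toSubmodule, u ⬝ᵥ v = 0)
    (htop : ⨆ i, (s i).toSubmodule = ⊤) :
    (∀ x v, ρ (x * x) v = v) ∨
    (∃ p q r, p ≠ q ∧ p ≠ r ∧ q ≠ r ∧ Finset.univ = {p, q, r} ∧
      ∃ W ∈ Matrix.orthogonalGroup (Fin 4) ℝ, ∃ a : G → Circle,
        projMat (s p).toSubmodule = W * diagonal ![1, 1, 0, 0] * Wᵀ ∧
        projMat (s q).toSubmodule = W * diagonal ![0, 0, 1, 0] * Wᵀ ∧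
        projMat (s r).toSubmodule = W * diagonal ![0, 0, 0, 1] * Wᵀ ∧
        ∀ x, LinearMap.toMatrix' (ρ (x * x)) * W = W * rotBlk (a (x * x)) 1) ∨
    (∃ p q, p ≠ q ∧ Finset.univ = {p, q} ∧
      ∃ W ∈ Matrix.orthogonalGroup (Fin 4) ℝ, ∃ a b : G → Circle,
        projMat (s p).toSubmodule = W * diagonal ![1, 1, 0, 0] * Wᵀ ∧
        projMat (s q).toSubmodule = W * diagonal ![0, 0, 1, 1] * Wᵀ ∧
        (∀ x, LinearMap.toMatrix' (ρ x) * W = W * rotBlk (a x) (b x)) ∧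
        (∃ x, (a x : ℂ).im ≠ 0) ∧ ∃ x, (b x : ℂ).im ≠ 0) := by
  classical
  have hcl := fun i => isSignLine_or_isRotationPlane hρ hc (hne i) (hmin i)
  have htr : ∑ i, (projMat (s i).toSubmodule).trace = 4 := by
    rw [← trace_sum, sum_projMat horth htop, trace_one]
    simp
  have hline : ∀ {i u}, IsSignLine (s i) u → (projMat (s i).toSubmodule).trace = 1 :=
    fun h => by rw [h.projMat_eq, trace_vecMulVec, h.1]
  have hplane : ∀ {i u v a}, IsRotationPlane (s i) u v a →
      (projMat (s i).toSubmodule).trace = 2 := fun h => by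
    rw [h.projMat_eq, trace_add, trace_vecMulVec, trace_vecMulVec, h.1.1, h.1.2.1]
    norm_num
  have hge : ∀ i, 1 ≤ (projMat (s i).toSubmodule).trace := by
    intro i
    rcases hcl i with ⟨u, h⟩ | ⟨u, v, a, h, -⟩
    · rw [hline h]
    · rw [hplane h]; norm_num
  by_cases hno : ∀ i, ∃ u, IsSignLine (s i) u
  · left
    intro x v
    have : v ∈ ⨆ i, (s i).toSubmodule := by rw [htop]; trivial
    induction this using Submodule.iSup_induction' with
    | mem i v hv =>
      obtain ⟨u, h⟩ := hno i
      rw [h.2.1] at hv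
      obtain ⟨r, rfl⟩ := Submodule.mem_span_singleton.1 hv
      rw [map_smul, h.sq_apply]
    | zero => simp
    | add u v _ _ hu hv => rw [map_add, hu, hv]
  right
  push Not at hno
  obtain ⟨p, hp⟩ := hno
  obtain ⟨u, v, a, hpa, ha⟩ := (hcl p).resolve_left fun ⟨u, h⟩ => hp u h
  have hrest : ∑ i ∈ Finset.univ.erase p, (projMat (s i).toSubmodule).trace = 2 := by
    have := Finset.add_sum_erase Finset.univ (fun i => (projMat (s i).toSubmodule).trace)
      (Finset.mem_univ p)
    rw [hplane hpa, htr] at this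
    linarith
  by_cases hno' : ∀ i ≠ p, ∃ u, IsSignLine (s i) u
  · left
    have hcard : (Finset.univ.erase p).card = 2 := by
      rw [Finset.sum_congr rfl fun i hi => hline (hno' i (Finset.ne_of_mem_erase hi)).choose_spec]
        at hrest
      simp only [Finset.sum_const, nsmul_eq_mul, mul_one] at hrest
      exact_mod_cast hrest
    obtain ⟨q, r, hqr, he⟩ := Finset.card_eq_two.1 hcard
    have hqp : q ≠ p := Finset.ne_of_mem_erase (s := Finset.univ) (by rw [he]; simp)
    have hrp : r ≠ p := Finset.ne_of_mem_erase (s := Finset.univ) (by rw [he]; simp)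
    obtain ⟨w, hw⟩ := hno' q hqp
    obtain ⟨z, hz⟩ := hno' r hrp
    refine ⟨p, q, r, hqp.symm, hrp.symm, hqr, ?_, frame u v w z, ?_, a, ?_, ?_, ?_, fun x => ?_⟩
    · rw [← he, Finset.insert_erase (Finset.mem_univ p)]
    · exact frame_mem hpa.1.1 hpa.1.2.1 hw.1 hz.1 hpa.1.2.2
        (horth p q hqp.symm _ hpa.mem_left _ hw.mem) (horth p r hrp.symm _ hpa.mem_left _ hz.mem)
        (horth p q hqp.symm _ hpa.mem_right _ hw.mem) (horth p r hrp.symm _ hpa.mem_right _ hz.mem)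
        (horth q r hqr _ hw.mem _ hz.mem)
    · rw [frame_diagonal, hpa.projMat_eq]; simp
    · rw [frame_diagonal, hw.projMat_eq]; simp
    · rw [frame_diagonal, hz.projMat_eq]; simp
    · refine mul_frame ?_ ?_ ?_ ?_ <;> rw [LinearMap.toMatrix'_mulVec]
      · exact (hpa.2.2 _).1
      · exact (hpa.2.2 _).2
      · rw [hw.sq_apply]; simp
      · rw [hz.sq_apply]; simp
  · right
    push Not at hno'
    obtain ⟨q, hqp, hq⟩ := hno'
    obtain ⟨w, z, b, hqb, hb⟩ := (hcl q).resolve_left fun ⟨u, h⟩ => hq u h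
    have hempty : (Finset.univ.erase p).erase q = ∅ := by
      have h1 := Finset.add_sum_erase (Finset.univ.erase p)
        (fun i => (projMat (s i).toSubmodule).trace)
        (Finset.mem_erase.2 ⟨hqp, Finset.mem_univ q⟩)
      rw [hplane hqb, hrest] at h1
      by_contra hemp
      obtain ⟨i, hi⟩ := Finset.nonempty_iff_ne_empty.2 hemp
      have h2 := Finset.single_le_sum (f := fun i => (projMat (s i).toSubmodule).trace)
        (fun i _ => zero_le_one.trans (hge i)) hi
      have h3 := hge i
      linarith
    refine ⟨p, q, hqp.symm, ?_, frame u v w z, ?_, a, b, ?_, ?_, fun x => ?_, ha, hb⟩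
    · rw [← Finset.insert_erase (Finset.mem_univ p),
        ← Finset.insert_erase (Finset.mem_erase.2 ⟨hqp, Finset.mem_univ q⟩), hempty]
      rfl
    · exact frame_mem hpa.1.1 hpa.1.2.1 hqb.1.1 hqb.1.2.1 hpa.1.2.2
        (horth p q hqp.symm _ hpa.mem_left _ hqb.mem_left)
        (horth p q hqp.symm _ hpa.mem_left _ hqb.mem_right)
        (horth p q hqp.symm _ hpa.mem_right _ hqb.mem_left)
        (horth p q hqp.symm _ hpa.mem_right _ hqb.mem_right) hqb.1.2.2
    · rw [frame_diagonal, hpa.projMat_eq]; simp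
    · rw [frame_diagonal, hqb.projMat_eq]; simp
    · refine mul_frame ?_ ?_ ?_ ?_ <;> rw [LinearMap.toMatrix'_mulVec]
      · exact (hpa.2.2 _).1
      · exact (hpa.2.2 _).2
      · exact (hqb.2.2 _).1
      · exact (hqb.2.2 _).2

end Frames

end GNY
end

noncomputable section
namespace GNY

/-! ### Rotation invariant pairs of matrices -/

section RotInvariantTwo

open Matrix

/-- The charges of the two components, in units of half the charge of the vector. -/
theorem exists_charges {A : Type*} [AddCommGroup A] (a b v : A) (hv : ∀ k : ℤ, k • v = 0 → k = 0) :
    ∃ m n : ℤ, ∀ ε : ℤ, ((2 : ℤ) • a = ε • v → m = ε) ∧ ((2 : ℤ) • b = ε • v → n = ε) ∧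
      (a - b = ε • v → m - n = 2 * ε) ∧ (a + b = ε • v → m + n = 2 * ε) := by
  have hinj : ∀ k l : ℤ, k • v = l • v → k = l := fun k l h => by
    have := hv (k - l) (by rw [sub_smul, h, sub_self])
    omega
  -- Two independent relations express 4a and 4b by v. The factor four absorbs torsion, and since v
  -- has infinite order the integers are then read off from any relation.
  have key : ∀ m n : ℤ, (4 : ℤ) • a = (2 * m) • v → (4 : ℤ) • b = (2 * n) • v →
      ∀ ε : ℤ, ((2 : ℤ) • a = ε • v → m = ε) ∧ ((2 : ℤ) • b = ε • v → n = ε) ∧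
      (a - b = ε • v → m - n = 2 * ε) ∧ (a + b = ε • v → m + n = 2 * ε) := by
    intro m n h1 h2 ε
    refine ⟨fun h => ?_, fun h => ?_, fun h => ?_, fun h => ?_⟩
    · have := hinj (2 * m) (2 * ε) (by linear_combination (norm := module) (2 : ℤ) • h - h1)
      omega
    · have := hinj (2 * n) (2 * ε) (by linear_combination (norm := module) (2 : ℤ) • h - h2)
      omega
    · have := hinj (2 * m - 2 * n) (4 * ε) (by
        linear_combination (norm := module) (4 : ℤ) • h - h1 + h2)
      omega
    · have := hinj (2 * m + 2 * n) (4 * ε) (by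
        linear_combination (norm := module) (4 : ℤ) • h - h1 - h2)
      omega
  by_cases h1 : ∃ ε : ℤ, (2 : ℤ) • a = ε • v
  · obtain ⟨ε₁, h1⟩ := h1
    by_cases h2 : ∃ ε : ℤ, (2 : ℤ) • b = ε • v
    · obtain ⟨ε₂, h2⟩ := h2
      exact ⟨ε₁, ε₂, key _ _ (by linear_combination (norm := module) (2 : ℤ) • h1)
        (by linear_combination (norm := module) (2 : ℤ) • h2)⟩
    by_cases h3 : ∃ ε : ℤ, a - b = ε • v
    · obtain ⟨ε₃, h3⟩ := h3
      exact ⟨ε₁, ε₁ - 2 * ε₃, key _ _ (by linear_combination (norm := module) (2 : ℤ) • h1)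
        (by linear_combination (norm := module) (2 : ℤ) • h1 - (4 : ℤ) • h3)⟩
    by_cases h4 : ∃ ε : ℤ, a + b = ε • v
    · obtain ⟨ε₄, h4⟩ := h4
      exact ⟨ε₁, 2 * ε₄ - ε₁, key _ _ (by linear_combination (norm := module) (2 : ℤ) • h1)
        (by linear_combination (norm := module) (4 : ℤ) • h4 - (2 : ℤ) • h1)⟩
    push Not at h2 h3 h4
    exact ⟨ε₁, 0, fun ε => ⟨fun h => hinj _ _ (h1.symm.trans h), fun h => absurd h (h2 ε),
      fun h => absurd h (h3 ε), fun h => absurd h (h4 ε)⟩⟩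
  by_cases h2 : ∃ ε : ℤ, (2 : ℤ) • b = ε • v
  · obtain ⟨ε₂, h2⟩ := h2
    by_cases h3 : ∃ ε : ℤ, a - b = ε • v
    · obtain ⟨ε₃, h3⟩ := h3
      exact ⟨2 * ε₃ + ε₂, ε₂, key _ _
        (by linear_combination (norm := module) (2 : ℤ) • h2 + (4 : ℤ) • h3)
        (by linear_combination (norm := module) (2 : ℤ) • h2)⟩
    by_cases h4 : ∃ ε : ℤ, a + b = ε • v
    · obtain ⟨ε₄, h4⟩ := h4
      exact ⟨2 * ε₄ - ε₂, ε₂, key _ _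
        (by linear_combination (norm := module) (4 : ℤ) • h4 - (2 : ℤ) • h2)
        (by linear_combination (norm := module) (2 : ℤ) • h2)⟩
    push Not at h1 h3 h4
    exact ⟨0, ε₂, fun ε => ⟨fun h => absurd h (h1 ε), fun h => hinj _ _ (h2.symm.trans h),
      fun h => absurd h (h3 ε), fun h => absurd h (h4 ε)⟩⟩
  -- With no relation for 2a or 2b, the relations for a - b and a + b cannot hold together, since
  -- their sum is one for 2a. So one charge is free and is put to zero.
  by_cases h3 : ∃ ε : ℤ, a - b = ε • v
  · obtain ⟨ε₃, h3⟩ := h3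
    refine ⟨2 * ε₃, 0, fun ε => ⟨fun h => absurd ⟨ε, h⟩ h1, fun h => absurd ⟨ε, h⟩ h2,
      fun h => ?_, fun h => absurd ⟨ε + ε₃, ?_⟩ h1⟩⟩
    · rw [sub_zero, hinj _ _ (h3.symm.trans h)]
    · linear_combination (norm := module) h + h3
  by_cases h4 : ∃ ε : ℤ, a + b = ε • v
  · obtain ⟨ε₄, h4⟩ := h4
    refine ⟨2 * ε₄, 0, fun ε => ⟨fun h => absurd ⟨ε, h⟩ h1, fun h => absurd ⟨ε, h⟩ h2,
      fun h => absurd ⟨ε, h⟩ h3, fun h => ?_⟩⟩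
    rw [add_zero, hinj _ _ (h4.symm.trans h)]
  exact ⟨0, 0, fun ε => ⟨fun h => absurd ⟨ε, h⟩ h1, fun h => absurd ⟨ε, h⟩ h2,
    fun h => absurd ⟨ε, h⟩ h3, fun h => absurd ⟨ε, h⟩ h4⟩⟩

/-- A rotation by one radian has infinite order because π is irrational. -/
theorem circle_exp_one_zpow (k : ℤ) (h : Circle.exp 1 ^ k = 1) : k = 0 := by
  rw [← Circle.exp_zsmul, Circle.exp_eq_one] at h
  obtain ⟨m, hm⟩ := h
  by_contra hk
  have hm0 : m ≠ 0 := by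
    rintro rfl
    simp at hm
    exact hk hm
  apply irrational_pi
  refine ⟨(k : ℚ) / (2 * m), ?_⟩
  have : (m : ℝ) ≠ 0 := by exact_mod_cast hm0
  push_cast
  field_simp
  simp at hm
  linarith

/-- The normal form of the square of an orthogonal matrix. -/
theorem exists_rotBlk_of_mem {P : Matrix (Fin 4) (Fin 4) ℝ}
    (hP : P ∈ Matrix.orthogonalGroup (Fin 4) ℝ) :
    ∃ W ∈ Matrix.orthogonalGroup (Fin 4) ℝ, ∃ a b : Circle, P * P * W = W * rotBlk a b := by
  classical
  let p : Matrix.orthogonalGroup (Fin 4) ℝ := ⟨P, hP⟩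
  -- The cyclic group generated by P is commutative, so `exists_frame` applies to its action on ℝ⁴.
  let ρ : Representation ℝ (Subgroup.zpowers p) (Fin 4 → ℝ) :=
    { toFun := fun x => toLin' (x.1 : Matrix (Fin 4) (Fin 4) ℝ)
      map_one' := by simp [Module.End.one_eq_id]
      map_mul' := fun x y => by simp [Matrix.toLin'_mul, Module.End.mul_eq_comp] }
  have hρ : ∀ x u v, ρ x u ⬝ᵥ ρ x v = u ⬝ᵥ v := by
    intro x u v
    show (x.1 : Matrix (Fin 4) (Fin 4) ℝ) *ᵥ u ⬝ᵥ (x.1 : Matrix (Fin 4) (Fin 4) ℝ) *ᵥ v = _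
    rw [dotProduct_mulVec, ← mulVec_transpose, mulVec_mulVec, orthogonal_transpose_mul x.1.2,
      one_mulVec]
  have hc : ∀ x y : Subgroup.zpowers p, x * y = y * x := by
    rintro ⟨_, k, rfl⟩ ⟨_, l, rfl⟩
    exact Subtype.ext (zpow_mul_comm p k l)
  let x : Subgroup.zpowers p := ⟨p, Subgroup.mem_zpowers p⟩
  have hx : LinearMap.toMatrix' (ρ (x * x)) = P * P := LinearMap.toMatrix'_toLin' _
  obtain ⟨ι, _, s, hs, horth, htop⟩ :=
    exists_irreducible_family hρ _ (⊤ : Subrepresentation ρ) rfl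
  rcases exists_frame hρ hc (fun i => ne_bot_of_isIrreducible (hs i))
    (fun i => minimal_of_isIrreducible (hs i)) horth htop with h | h | h
  · refine ⟨1, one_mem _, 1, 1, ?_⟩
    rw [rotBlk_one, Matrix.mul_one, Matrix.mul_one, ← hx]
    have : ρ (x * x) = LinearMap.id := LinearMap.ext fun v => h x v
    rw [this, LinearMap.toMatrix'_id]
  · obtain ⟨-, -, -, -, -, -, -, W, hW, a, -, -, -, h⟩ := h
    exact ⟨W, hW, a (x * x), 1, by rw [← hx, h]⟩
  · obtain ⟨-, -, -, -, W, hW, a, b, -, -, h, -⟩ := h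
    exact ⟨W, hW, a (x * x), b (x * x), by rw [← hx, h]⟩

theorem continuous_rotBlk : Continuous fun z : Circle × Circle => rotBlk z.1 z.2 := by
  have h1 : Continuous fun z : Circle × Circle => (z.1 : ℂ) :=
    continuous_subtype_val.comp continuous_fst
  have h2 : Continuous fun z : Circle × Circle => (z.2 : ℂ) :=
    continuous_subtype_val.comp continuous_snd
  refine continuous_matrix fun i j => ?_
  fin_cases i <;> fin_cases j <;> first
    | exact continuous_const
    | exact Complex.continuous_re.comp h1
    | exact Complex.continuous_im.comp h1
    | exact (Complex.continuous_im.comp h1).neg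
    | exact Complex.continuous_re.comp h2
    | exact Complex.continuous_im.comp h2
    | exact (Complex.continuous_im.comp h2).neg

/-- The representation of `Spin(2)` with charges `m` and `n`. -/
def chargeRep (m n : ℤ) : SpinRep 2 where
  toHom :=
    { toFun := fun x => ⟨rotBlk (spinCircle x ^ m) (spinCircle x ^ n), rotBlk_mem _ _⟩
      map_one' := Subtype.ext (by simp [rotBlk_one])
      map_mul' := fun x y => Subtype.ext (by
        show rotBlk _ _ = rotBlk _ _ * rotBlk _ _
        rw [map_mul, mul_zpow, mul_zpow, rotBlk_mul]) }
  continuous_toHom := by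
    refine Continuous.subtype_mk ?_ _
    exact continuous_rotBlk.comp
      ((continuous_spinCircle.zpow m).prodMk (continuous_spinCircle.zpow n))

theorem vec_two_eq (x : Spin 2) (φ : Fin 2 → ℝ) : vec 2 x φ =
    ![(((spinCircle x ^ 2 : Circle) : ℂ) * ⟨φ 0, φ 1⟩).re,
      (((spinCircle x ^ 2 : Circle) : ℂ) * ⟨φ 0, φ 1⟩).im] := by
  rw [← vec_two]
  ext i
  fin_cases i <;> rfl

theorem rotMat_mem (ν : Circle) : rotMat ν ∈ Matrix.specialOrthogonalGroup (Fin 2) ℝ := by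
  have h := circle_re_im ν
  rw [Matrix.mem_specialOrthogonalGroup_iff, mem_orthogonalGroup_iff]
  constructor
  · show rotMat ν * (rotMat ν)ᵀ = 1
    ext i j
    fin_cases i <;> fin_cases j <;> simp [rotMat, Matrix.mul_apply, Fin.sum_univ_two] <;> linarith
  · rw [Matrix.det_fin_two]
    simp [rotMat]
    linarith

/-- A single symmetry is enough. Half a radian is taken because `exists_rotBlk_of_mem` controls the
square, which covers the rotation by one radian. Only coefficients whose character is ν or ν⁻¹
survive, and charges m, n that satisfy the same relations make the whole of Spin(2) act correctly on
them. -/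
theorem exists_spinRep_two {R : Yukawa 2} (hR : ∀ m, (R m).IsSymm) (h : RotInvariant R) :
    ∃ ρ : SpinRep 2, TransformsAsVec ρ R := by
  obtain ⟨P, hP, hPR⟩ := h _ (rotMat_mem (Circle.exp (1 / 2)))
  obtain ⟨W, hW, a, b, hab⟩ := exists_rotBlk_of_mem hP
  have hW1 := orthogonal_transpose_mul hW
  have hW2 := orthogonal_mul_transpose hW
  set ν := Circle.exp 1 with hν
  have hνν : rotMat (Circle.exp (1 / 2)) * rotMat (Circle.exp (1 / 2)) = rotMat ν := by
    rw [← rotMat_mul, ← Circle.coe_mul, ← Circle.exp_add, add_halves]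
  have hrot : rotBlk a b = Wᵀ * (P * P) * W := by
    rw [Matrix.mul_assoc, hab, ← Matrix.mul_assoc, hW1, Matrix.one_mul]
  have hcov : CircleCovariant a b ν (R.conj Wᵀ) := by
    intro φ
    rw [R.conj_at, R.conj_at, hrot]
    have h1 : R.at ![((ν : ℂ) * ⟨φ 0, φ 1⟩).re, ((ν : ℂ) * ⟨φ 0, φ 1⟩).im] =
        P * (P * R.at φ * Pᵀ) * Pᵀ := by
      rw [hPR, hPR, mulVec_mulVec, hνν]
      congr 1
      ext i
      fin_cases i <;> simp [rotMat, mulVec, dotProduct, Fin.sum_univ_two] <;> ring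
    rw [h1]
    simp only [transpose_mul, transpose_transpose]
    calc _ = Wᵀ * P * P * (W * Wᵀ) * R.at φ * (W * Wᵀ) * Pᵀ * Pᵀ * W := by
          simp only [Matrix.mul_assoc]
      _ = _ := by rw [hW2, Matrix.mul_one, Matrix.mul_one]; simp only [Matrix.mul_assoc]
  have hne : (fun _ : Unit => ν) ≠ (fun _ : Unit => ν)⁻¹ := by
    intro he
    have h1 : ν = ν⁻¹ := congrFun he ()
    have h2 := circle_exp_one_zpow 2 (by
      rw [_root_.zpow_ofNat, pow_two]
      nth_rw 1 [← hν, h1]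
      rw [inv_mul_cancel])
    omega
  -- The index type has one point since covariance is known for one symmetry only.
  obtain ⟨c, hc, hc0⟩ := exists_eq_pairTuple (X := Unit) (a := fun _ => a) (b := fun _ => b) hne
    (R.conj_isSymm hR _) (fun _ => hcov)
  obtain ⟨m, n, hmn⟩ := exists_charges (Additive.ofMul a) (Additive.ofMul b) (Additive.ofMul ν)
    (fun k hk => circle_exp_one_zpow k hk)
  refine exists_spinRep_of_equiv (yukawaEquiv_conj R (transpose_mem_orthogonal hW))
    ⟨chargeRep m n, fun x φ => ?_⟩
  rw [hc, vec_two_eq]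
  refine circleCovariant_pairTuple (fun i => ?_) φ
  set η := spinCircle x
  have hχ : ∀ ε : ℤ, blkChar a b i = ν ^ ε →
      blkChar (η ^ m) (η ^ n) i = (η ^ 2) ^ ε := by
    intro ε he
    obtain ⟨e1, e2, e3, e4⟩ := hmn ε
    rw [← _root_.zpow_natCast, ← _root_.zpow_mul]
    fin_cases i
    · rw [← e1 he]
      show (η ^ m) ^ 2 = _
      rw [← _root_.zpow_natCast, ← _root_.zpow_mul, mul_comm]
    · rw [← e2 he]
      show (η ^ n) ^ 2 = _
      rw [← _root_.zpow_natCast, ← _root_.zpow_mul, mul_comm]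
    · show η ^ m * (η ^ n)⁻¹ = _
      rw [← _root_.zpow_neg, ← _root_.zpow_add, ← sub_eq_add_neg, e3 ((sub_eq_add_neg _ _).trans he)]
      rfl
    · show η ^ m * η ^ n = _
      rw [← _root_.zpow_add, e4 he]
      rfl
  rcases slotSign_cases (fun _ : Unit => blkChar a b i) (fun _ => ν) with ⟨h1, hs⟩ | ⟨h1, hs⟩ |
    ⟨-, -, hs⟩
  · have := hχ 1 (by rw [_root_.zpow_one]; exact congrFun h1 ())
    rw [_root_.zpow_one] at this
    rw [this, hs]
    exact slotEq_I _ _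
  · have := hχ (-1) (by rw [_root_.zpow_neg_one]; exact congrFun h1 ())
    rw [_root_.zpow_neg_one] at this
    rw [this, hs]
    exact slotEq_neg_I _ _
  · rw [hc0 i hs, mul_zero]
    exact slotEq_zero _ _

end RotInvariantTwo

end GNY
end

noncomputable section
namespace GNY

/-! ### Normal forms of covariant pairs -/

section PairNormalForms

open Matrix

theorem exists_circle_mul_eq (c : ℂ) : ∃ s : Circle, ∃ r : ℝ, s * c = r := by
  obtain ⟨s, hs⟩ := exists_circle_mul_eq_norm c
  exact ⟨s, ‖c‖, hs⟩

/-- The phases of the coefficients can be removed if at most one coefficient of each kind is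
present. -/
theorem exists_real_of_mul_eq_zero {c : Fin 4 → ℂ} (h01 : c 0 = 0 ∨ c 1 = 0)
    (h23 : c 2 = 0 ∨ c 3 = 0) :
    ∃ s t : Circle, ∃ r : Fin 4 → ℝ, ∀ i, blkChar s t i * c i = r i := by
  have key : ∀ s t : Circle, (∃ r : ℝ, ((s ^ 2 : Circle) : ℂ) * c 0 = r) →
      (∃ r : ℝ, ((t ^ 2 : Circle) : ℂ) * c 1 = r) →
      (∃ r : ℝ, ((s * t⁻¹ : Circle) : ℂ) * c 2 = r) → (∃ r : ℝ, ((s * t : Circle) : ℂ) * c 3 = r) →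
      ∃ s t : Circle, ∃ r : Fin 4 → ℝ, ∀ i, blkChar s t i * c i = r i := by
    rintro s t ⟨r0, h0⟩ ⟨r1, h1⟩ ⟨r2, h2⟩ ⟨r3, h3⟩
    refine ⟨s, t, ![r0, r1, r2, r3], fun i => ?_⟩
    fin_cases i
    exacts [h0, h1, h2, h3]
  have hz : ∀ {s : Circle} {x : ℂ}, x = 0 → ∃ r : ℝ, (s : ℂ) * x = r := fun h =>
    ⟨0, by rw [h, mul_zero, Complex.ofReal_zero]⟩
  obtain ⟨u0, hu0⟩ := exists_circle_mul_eq (c 0)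
  obtain ⟨u1, hu1⟩ := exists_circle_mul_eq (c 1)
  obtain ⟨u2, hu2⟩ := exists_circle_mul_eq (c 2)
  obtain ⟨u3, hu3⟩ := exists_circle_mul_eq (c 3)
  obtain ⟨s, rfl⟩ := exists_circle_sq u0
  obtain ⟨t, rfl⟩ := exists_circle_sq u1
  rcases h01 with h | h <;> rcases h23 with h' | h'
  · refine key (u3 * t⁻¹) t (hz h) hu1 (hz h') ?_
    rwa [inv_mul_cancel_right]
  · refine key (u2 * t) t (hz h) hu1 ?_ (hz h')
    rwa [mul_inv_cancel_right]
  · refine key s (s⁻¹ * u3) hu0 (hz h) (hz h') ?_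
    rwa [mul_inv_cancel_left]
  · refine key s (u2⁻¹ * s) hu0 (hz h) ?_ (hz h')
    rwa [_root_.mul_inv_rev, inv_inv, mul_inv_cancel_left]

/-- The phases of the two coefficients that mix the two components can be removed. -/
theorem exists_real_of_eq_zero {c : Fin 4 → ℂ} (h0 : c 0 = 0) (h1 : c 1 = 0) :
    ∃ s t : Circle, ∃ r : Fin 4 → ℝ, ∀ i, blkChar s t i * c i = r i := by
  obtain ⟨u2, r2, hu2⟩ := exists_circle_mul_eq (c 2)
  obtain ⟨u3, r3, hu3⟩ := exists_circle_mul_eq (c 3)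
  -- With t = s⁻¹u₃, the phases s t⁻¹ and s t are exactly the prescribed u₂ and u₃.
  obtain ⟨s, hs⟩ := exists_circle_sq (u2 * u3)
  refine ⟨s, s⁻¹ * u3, ![0, 0, r2, r3], fun i => ?_⟩
  fin_cases i
  · simp [h0]
  · simp [h1]
  · show ((s * (s⁻¹ * u3)⁻¹ : Circle) : ℂ) * c 2 = r2
    rw [_root_.mul_inv_rev, inv_inv, mul_comm u3⁻¹, ← mul_assoc, ← pow_two, hs, mul_inv_cancel_right, hu2]
  · show ((s * (s⁻¹ * u3) : Circle) : ℂ) * c 3 = r3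
    rw [mul_inv_cancel_left, hu3]

theorem yukawaEquiv_pairTuple (σ c : Fin 4 → ℂ) (s t : Circle) :
    YukawaEquiv (pairTuple σ c) (pairTuple σ fun i => blkChar s t i * c i) := by
  rw [← pairTuple_conj]
  exact yukawaEquiv_conj _ (rotBlk_mem s t)

theorem pairTuple_eq_zero {σ c : Fin 4 → ℂ} (h : pairTuple σ c = 0) : c = 0 := by
  have h1 : pairTuple σ c 0 = pairTuple σ 0 0 := by rw [h, pairTuple_zero]
  exact (blk_injective h1).2

/-- The imaginary unit in the circle. -/
def circleI : Circle := ⟨Complex.I, by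
  show _ ∈ Metric.sphere (0 : ℂ) 1
  simp⟩

theorem coe_circleI : (circleI : ℂ) = Complex.I := rfl

/-- Without the coefficients of v v̄ and of v₁ v̄₂ the matrix is antilinear for the complex
structure, and multiplication by i from the left acts on its coefficients. -/
theorem rotBlk_circleI_mul_blk {c : Fin 4 → ℂ} (h2 : c 2 = 0) :
    rotBlk circleI circleI * blk 0 c = blk 0 (Complex.I • c) := by
  ext i j
  fin_cases i <;> fin_cases j <;>
    simp [rotBlk, blk, coe_circleI, Matrix.mul_apply, Fin.sum_univ_four, h2]

/-- The unitary frame of `ℂ²` whose first vector is a given unit vector. -/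
theorem exists_unitary_frame {v : Fin 4 → ℝ} (hv : v ⬝ᵥ v = 1) :
    ∃ U ∈ Matrix.orthogonalGroup (Fin 4) ℝ, U *ᵥ Pi.single 0 1 = v ∧
      rotBlk circleI circleI * U = U * rotBlk circleI circleI := by
  have hv' : v 0 * v 0 + v 1 * v 1 + v 2 * v 2 + v 3 * v 3 = 1 := by
    rw [← hv, dotProduct, Fin.sum_univ_four]
  refine ⟨frame v ![-v 1, v 0, -v 3, v 2] ![-v 2, v 3, v 0, -v 1] ![-v 3, -v 2, v 1, v 0], ?_, ?_,
    ?_⟩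
  · apply frame_mem <;> simp [dotProduct, Fin.sum_univ_four] <;> linarith
  · ext i
    rw [mulVec_single_one]
    rfl
  · apply mul_frame <;> ext i <;> fin_cases i <;>
      simp [rotBlk, coe_circleI, mulVec, dotProduct, Fin.sum_univ_four]

/-- Takagi's factorization of complex symmetric `2 × 2` matrices. -/
theorem exists_diagonal_pairTuple {σ c : Fin 4 → ℂ} {κ : ℝ} (h0 : σ 0 = κ * Complex.I)
    (h1 : σ 1 = κ * Complex.I) (h3 : σ 3 = κ * Complex.I) (hc : c 2 = 0) :
    ∃ c' : Fin 4 → ℂ, c' 2 = 0 ∧ c' 3 = 0 ∧ YukawaEquiv (pairTuple σ c) (pairTuple σ c') := by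
  set J := rotBlk circleI circleI with hJ
  -- The second matrix is κJ times the first, so a change of basis commuting with J reduces both at
  -- once.
  have hσ : ∀ d : Fin 4 → ℂ, d 2 = 0 → blk 0 (σ * d) = κ • (J * blk 0 d) := by
    intro d hd
    rw [hJ, rotBlk_circleI_mul_blk hd, ← blk_smul, smul_zero]
    congr 1
    funext i
    have : ∀ i, i ≠ 2 → σ i = κ * Complex.I := by
      intro i hi
      fin_cases i
      exacts [h0, h1, absurd rfl hi, h3]
    by_cases hi : i = 2
    · rw [hi]; simp [hd]
    · simp [this i hi, mul_assoc]
  -- A real eigenvector is completed to a frame commuting with J; in that frame the first vector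
  -- stays an eigenvector.
  obtain ⟨T, hT, e, he⟩ := exists_diagonalization (blk_isSymm 0 c)
  have hT1 := orthogonal_transpose_mul hT
  have hTv : (T *ᵥ Pi.single 0 1) ⬝ᵥ (T *ᵥ Pi.single 0 1) = 1 := by
    rw [dotProduct_mulVec, ← mulVec_transpose, mulVec_mulVec, hT1, one_mulVec]
    simp
  have heig : blk 0 c *ᵥ (T *ᵥ Pi.single 0 1) = e 0 • (T *ᵥ Pi.single 0 1) := by
    rw [he, mulVec_mulVec, Matrix.mul_assoc, hT1, Matrix.mul_one, ← mulVec_mulVec,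
      diagonal_mulVec_single, mul_one, ← mulVec_smul]
    congr 1
    ext j
    simp [Pi.single_apply]
  obtain ⟨U, hU, hUv, hUJ⟩ := exists_unitary_frame hTv
  rw [← hUv] at heig
  have hU1 := orthogonal_transpose_mul hU
  have hU2 := orthogonal_mul_transpose hU
  have hJU : Uᵀ * J = J * Uᵀ := by
    calc Uᵀ * J = Uᵀ * (J * U) * Uᵀ := by
          rw [Matrix.mul_assoc, Matrix.mul_assoc, hU2, Matrix.mul_one]
      _ = J * Uᵀ := by rw [hUJ, ← Matrix.mul_assoc, hU1, Matrix.one_mul]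
  have hsymm : (Uᵀ * blk 0 c * U).IsSymm := by
    rw [Matrix.IsSymm, transpose_mul, transpose_mul, transpose_transpose, (blk_isSymm 0 c).eq,
      Matrix.mul_assoc]
  obtain ⟨t, c', hS⟩ := exists_blk hsymm
  -- Antilinearity is kept by a change of basis commuting with J, so no Hermitian and no v₁ v̄₂
  -- coefficient appears.
  have hanti : J * blk 0 c * Jᵀ = -blk 0 c := by
    rw [hJ, rotBlk_conj, ← neg_one_smul ℝ (blk 0 c), ← blk_smul, smul_zero]
    congr 1
    funext i
    fin_cases i <;> simp [blkChar, coe_circleI, pow_two, hc]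
  have hanti' : J * blk t c' * Jᵀ = -blk t c' := by
    have hJt : U * Jᵀ = Jᵀ * U := by
      have := congrArg transpose hJU
      simpa [transpose_mul] using this.symm
    rw [← hS]
    calc J * (Uᵀ * blk 0 c * U) * Jᵀ = (J * Uᵀ) * blk 0 c * (U * Jᵀ) := by
          simp only [Matrix.mul_assoc]
      _ = Uᵀ * (J * blk 0 c * Jᵀ) * U := by rw [← hJU, hJt]; simp only [Matrix.mul_assoc]
      _ = _ := by rw [hanti, Matrix.mul_neg, Matrix.neg_mul]
  rw [hJ, rotBlk_conj, ← neg_one_smul ℝ (blk t c'), ← blk_smul] at hanti'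
  obtain ⟨ht, hcc⟩ := blk_injective hanti'
  have ht0 : t = 0 := by
    funext i
    have := congrFun ht i
    simp at this
    rw [Pi.zero_apply]
    linarith
  have hc2 : c' 2 = 0 := by
    have h2 := congrFun hcc 2
    simp [blkChar] at h2
    exact CharZero.eq_neg_self_iff.1 h2
  subst ht0
  have hcol : blk 0 c' *ᵥ Pi.single 0 1 = e 0 • Pi.single 0 1 := by
    rw [← hS, ← mulVec_mulVec, ← mulVec_mulVec, heig, mulVec_smul, mulVec_mulVec, hU1, one_mulVec]
  -- The first basis vector being an eigenvector kills the last mixed coefficient.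
  have hc3 : c' 3 = 0 := by
    rw [mulVec_single_one] at hcol
    have h2 := congrFun hcol 2
    have h3 := congrFun hcol 3
    simp [blk, hc2, Matrix.col] at h2 h3
    exact Complex.ext h2 h3
  refine ⟨c', hc2, hc3, Uᵀ, transpose_mem_orthogonal hU, fun m => ?_⟩
  rw [transpose_transpose]
  fin_cases m
  · exact hS
  · show Uᵀ * blk 0 (σ * c) * U = blk 0 (σ * c')
    rw [hσ c hc, hσ c' hc2, ← hS, Matrix.mul_smul, Matrix.smul_mul]
    congr 1
    calc _ = (Uᵀ * J) * blk 0 c * U := by simp only [Matrix.mul_assoc]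
      _ = _ := by rw [hJU]; simp only [Matrix.mul_assoc]

end PairNormalForms

end GNY
end

noncomputable section
namespace GNY

/-! ### `M = 2` -/

section NormalFormTwo

open Matrix

variable {ρ : SpinRep 2} {D : IrrepDecomposition ρ.rep} {W : Matrix (Fin 4) (Fin 4) ℝ}
  {a b : Spin 2 → Circle}

/-- The phase by which an element of `Spin(2)` rotates vectors. -/
def vecPhase (x : Spin 2) : Circle := spinCircle x ^ 2

theorem vecPhase_surjective : Function.Surjective vecPhase := fun z => by
  obtain ⟨w, rfl⟩ := exists_circle_sq z
  obtain ⟨x, rfl⟩ := spinCircle_surjective w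
  exact ⟨x, rfl⟩

theorem vecPhase_pow_ne {k : ℤ} (hk : k ≠ 0) : vecPhase ^ k ≠ 1 := fun h => by
  obtain ⟨x, hx⟩ := vecPhase_surjective (Circle.exp 1)
  exact hk (circle_exp_one_zpow k (by rw [← hx]; exact congrFun h x))

theorem vecPhase_ne_inv : vecPhase ≠ vecPhase⁻¹ := fun h => by
  refine vecPhase_pow_ne (k := 2) (by norm_num) ?_
  rw [_root_.zpow_ofNat, pow_two]
  nth_rw 2 [h]
  rw [mul_inv_cancel]

/-- The allowed ratios of the coefficients in a frame. -/
def frameSign (a b : Spin 2 → Circle) (i : Fin 4) : ℂ :=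
  slotSign (fun x => blkChar (a x) (b x) i) vecPhase

/-- The coefficients are allowed by covariance. -/
def Admissible (σ c : Fin 4 → ℂ) : Prop := ∀ i, σ i = 0 → c i = 0

/-- One allowed coefficient. -/
def unitSlot (σ : Fin 4 → ℂ) (i : Fin 4) : Fin 4 → ℂ := if σ i = 0 then 0 else Pi.single i 1

theorem unitSlot_apply_of_ne (σ : Fin 4 → ℂ) {i j : Fin 4} (h : j ≠ i) : unitSlot σ i j = 0 := by
  unfold unitSlot
  split_ifs
  · rfl
  · rw [Pi.single_eq_of_ne h]

theorem admissible_unitSlot (σ : Fin 4 → ℂ) (i : Fin 4) : Admissible σ (unitSlot σ i) := by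
  intro j hj
  by_cases h : j = i
  · subst h
    simp [unitSlot, hj]
  · exact unitSlot_apply_of_ne σ h

theorem Admissible.add {σ c d : Fin 4 → ℂ} (h : Admissible σ c) (h' : Admissible σ d) :
    Admissible σ (c + d) := fun i hi => by rw [Pi.add_apply, h i hi, h' i hi, add_zero]

theorem Admissible.smul {σ c : Fin 4 → ℂ} (h : Admissible σ c) (r : ℝ) :
    Admissible σ (r • c) := fun i hi => by rw [Pi.smul_apply, h i hi, smul_zero]

theorem smul_unitSlot {σ c : Fin 4 → ℂ} (h : Admissible σ c) {i : Fin 4} {r : ℝ} (hr : c i = r) :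
    r • unitSlot σ i = Pi.single i (c i) := by
  unfold unitSlot
  split_ifs with h0
  · rw [h i h0, Pi.single_zero, smul_zero]
  · rw [← Pi.single_smul, hr]
    simp

theorem conj_pairTuple_mem (hW : W ∈ Matrix.orthogonalGroup (Fin 4) ℝ)
    (hab : ∀ x, ρ.mat x * W = W * rotBlk (a x) (b x)) {c : Fin 4 → ℂ}
    (hc : Admissible (frameSign a b) c) :
    (pairTuple (frameSign a b) c).conj W ∈ vectorOperators ρ := by
  refine ⟨Yukawa.conj_isSymm _ (pairTuple_isSymm _ _) _, fun x φ => ?_⟩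
  have h := circleCovariant_pairTuple (a := a x) (b := b x) (ν := vecPhase x)
    (σ := frameSign a b) (c := c)
    (fun i => slotEq_slotSign (χ := fun x => blkChar (a x) (b x) i) (hc i) x) φ
  have hWt : Wᵀ * (ρ.mat x)ᵀ = (rotBlk (a x) (b x))ᵀ * Wᵀ := by
    rw [← transpose_mul, hab, transpose_mul]
  rw [Yukawa.conj_at, Yukawa.conj_at, vec_two_eq]
  show _ = W * (pairTuple (frameSign a b) c).at ![((vecPhase x : ℂ) * ⟨φ 0, φ 1⟩).re,
    ((vecPhase x : ℂ) * ⟨φ 0, φ 1⟩).im] * Wᵀ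
  rw [← h]
  calc _ = (ρ.mat x * W) * (pairTuple (frameSign a b) c).at φ * (Wᵀ * (ρ.mat x)ᵀ) := by
        simp only [Matrix.mul_assoc]
    _ = _ := by rw [hab, hWt]; simp only [Matrix.mul_assoc]

/-- Together with `conj_pairTuple_mem`: in an adapted frame the vector operators are exactly the
pairs with admissible coefficients. -/
theorem exists_conj_pairTuple (hW : W ∈ Matrix.orthogonalGroup (Fin 4) ℝ)
    (hab : ∀ x, ρ.mat x * W = W * rotBlk (a x) (b x)) {R : Yukawa 2}
    (hR : R ∈ vectorOperators ρ) :
    ∃ c, Admissible (frameSign a b) c ∧ R = (pairTuple (frameSign a b) c).conj W := by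
  have hW1 := orthogonal_transpose_mul hW
  have hW2 := orthogonal_mul_transpose hW
  obtain ⟨c, hc, hc0⟩ := exists_eq_pairTuple vecPhase_ne_inv (S := R.conj Wᵀ) (a := a) (b := b)
    (R.conj_isSymm hR.1 _) (fun x φ => by
      have h := hR.2 x φ
      rw [vec_two_eq] at h
      rw [R.conj_at, R.conj_at]
      show _ = Wᵀ * R.at ![(((spinCircle x ^ 2 : Circle) : ℂ) * ⟨φ 0, φ 1⟩).re,
        (((spinCircle x ^ 2 : Circle) : ℂ) * ⟨φ 0, φ 1⟩).im] * Wᵀᵀ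
      have hrot : rotBlk (a x) (b x) = Wᵀ * ρ.mat x * W := by
        rw [Matrix.mul_assoc, hab, ← Matrix.mul_assoc, hW1, Matrix.one_mul]
      rw [← h, hrot, transpose_mul, transpose_mul, transpose_transpose]
      calc _ = Wᵀ * ρ.mat x * (W * Wᵀ) * R.at φ * (W * Wᵀ) * (ρ.mat x)ᵀ * W := by
            simp only [Matrix.mul_assoc]
        _ = _ := by rw [hW2, Matrix.mul_one, Matrix.mul_one]; simp only [Matrix.mul_assoc])
  refine ⟨c, hc0, ?_⟩
  show R = (pairTuple (fun i => slotSign (fun x => blkChar (a x) (b x) i) vecPhase) c).conj W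
  rw [← hc]
  funext m
  show R m = W * (Wᵀ * R m * Wᵀᵀ) * Wᵀ
  calc R m = (W * Wᵀ) * R m * (W * Wᵀ) := by rw [hW2, Matrix.mul_one, Matrix.one_mul]
    _ = _ := by rw [transpose_transpose]; simp only [Matrix.mul_assoc]

theorem YukawaEquiv.conj {R S : Yukawa 2} (h : YukawaEquiv R S)
    (hW : W ∈ Matrix.orthogonalGroup (Fin 4) ℝ) : YukawaEquiv (R.conj W) (S.conj W) :=
  ((yukawaEquiv_conj R hW).symm.trans h).trans (yukawaEquiv_conj S hW)

theorem conj_add (R S : Yukawa 2) : (R + S).conj W = R.conj W + S.conj W := by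
  funext m
  show W * (R m + S m) * Wᵀ = W * R m * Wᵀ + W * S m * Wᵀ
  rw [Matrix.mul_add, Matrix.add_mul]

theorem conj_smul (r : ℝ) (R : Yukawa 2) : (r • R).conj W = r • R.conj W := by
  funext m
  show W * (r • R m) * Wᵀ = r • (W * R m * Wᵀ)
  rw [Matrix.mul_smul, Matrix.smul_mul]

/-- The blocks of a matrix in a frame. -/
theorem mul_conj_mul (hW : W ∈ Matrix.orthogonalGroup (Fin 4) ℝ) {P Q : Matrix (Fin 4) (Fin 4) ℝ}
    {d e : Fin 4 → ℝ} (hP : P = W * diagonal d * Wᵀ) (hQ : Q = W * diagonal e * Wᵀ)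
    {S : Yukawa 2} (hS : ∀ m i j, d i * S m i j * e j = 0) (m : Fin 2) :
    P * S.conj W m * Q = 0 := by
  have hW1 := orthogonal_transpose_mul hW
  have h : diagonal d * S m * diagonal e = 0 := by
    ext i j
    rw [mul_diagonal, diagonal_mul, hS]
    rfl
  rw [hP, hQ]
  calc _ = W * (diagonal d * (Wᵀ * W) * S m * (Wᵀ * W) * diagonal e) * Wᵀ := by
        simp only [Yukawa.conj, Matrix.mul_assoc]
    _ = 0 := by rw [hW1, Matrix.mul_one, Matrix.mul_one, h, Matrix.mul_zero, Matrix.zero_mul]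

/-- Every coefficient has trivial character while the vector does not, so zero is the only vector
operator. -/
theorem couplingNormalForm_of_trivial (N : ℕ) (hD : IsOrthogonalDecomposition D)
    (h : ∀ x, ρ.mat x = 1) : CouplingNormalForm N D := by
  have h0 : ∀ R ∈ vectorOperators ρ, R = 0 := by
    intro R hR
    obtain ⟨c, hc, rfl⟩ := exists_conj_pairTuple (W := 1) (a := fun _ => 1) (b := fun _ => 1)
      (one_mem _) (fun x => by rw [h, rotBlk_one]) hR
    have : c = 0 := funext fun i => hc i (by
      have hchar : (fun _ : Spin 2 => blkChar 1 1 i) = 1 := by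
        funext x
        fin_cases i <;> simp [blkChar]
      rcases slotSign_cases (fun _ : Spin 2 => blkChar 1 1 i) vecPhase with ⟨h1, -⟩ | ⟨h1, -⟩ |
        ⟨-, -, h1⟩
      · refine absurd ?_ (vecPhase_pow_ne (k := 1) one_ne_zero)
        rw [_root_.zpow_one, ← h1, hchar]
      · refine absurd ?_ (vecPhase_pow_ne (k := -1) (by norm_num))
        rw [_root_.zpow_neg_one, ← h1, hchar]
      · exact h1)
    rw [this, pairTuple_zero]
    funext m
    simp [Yukawa.conj]
  obtain ⟨T, hT, hTc, hTs, hTb⟩ := exists_default_pair hD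
  refine couplingNormalForm_of_pairs N (by norm_num) hD T hT hTc hTs
    (fun p q _ R hR hb => (hTb p q R hR hb).ne_zero) fun R hR => ⟨0, Submodule.zero_mem _, ?_⟩
  rw [h0 R hR]
  exact YukawaEquiv.refl 0

theorem eq_sum_single (c : Fin 4 → ℂ) : c = Pi.single 0 (c 0) + Pi.single 1 (c 1) +
    (Pi.single 2 (c 2) + Pi.single 3 (c 3)) := by
  funext i
  fin_cases i <;> simp

/-- The matrix elements of `R` between two summands vanish. -/
def BlockZero (D : IrrepDecomposition ρ.rep) (s t : Σ i, Fin (D.mult i)) (R : Yukawa 2) : Prop :=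
  ∀ m, D.P s * R m * D.P t = 0

theorem HasBlock.not_blockZero {s t : Σ i, Fin (D.mult i)} {R : Yukawa 2} (h : HasBlock D s t R) :
    ¬BlockZero D s t R := fun h0 => by
  obtain ⟨m, hm⟩ := h
  exact hm (h0 m)

theorem conj_pairTuple_ne_zero (hW : W ∈ Matrix.orthogonalGroup (Fin 4) ℝ)
    {σ c : Fin 4 → ℂ} (hc : c ≠ 0) : (pairTuple σ c).conj W ≠ 0 := by
  intro h
  apply hc
  apply pairTuple_eq_zero (σ := σ)
  obtain ⟨V, hV, h1⟩ := (yukawaEquiv_conj (pairTuple σ c) hW).symm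
  funext m
  rw [← h1, h]
  simp

theorem blockZero_left {p : Σ i, Fin (D.mult i)} (hW : W ∈ Matrix.orthogonalGroup (Fin 4) ℝ)
    (hp : D.P p = W * diagonal ![1, 1, 0, 0] * Wᵀ)
    {σ c : Fin 4 → ℂ} (h0 : c 0 = 0) : BlockZero D p p ((pairTuple σ c).conj W) :=
  mul_conj_mul hW hp hp fun m i j => by
    fin_cases m <;> fin_cases i <;> fin_cases j <;> simp [pairTuple, blk, h0]

theorem blockZero_right {q : Σ i, Fin (D.mult i)} (hW : W ∈ Matrix.orthogonalGroup (Fin 4) ℝ)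
    (hq : D.P q = W * diagonal ![0, 0, 1, 1] * Wᵀ)
    {σ c : Fin 4 → ℂ} (h1 : c 1 = 0) : BlockZero D q q ((pairTuple σ c).conj W) :=
  mul_conj_mul hW hq hq fun m i j => by
    fin_cases m <;> fin_cases i <;> fin_cases j <;> simp [pairTuple, blk, h1]

theorem blockZero_mixed {p q : Σ i, Fin (D.mult i)} (hW : W ∈ Matrix.orthogonalGroup (Fin 4) ℝ)
    (hp : D.P p = W * diagonal ![1, 1, 0, 0] * Wᵀ)
    (hq : D.P q = W * diagonal ![0, 0, 1, 1] * Wᵀ)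
    {σ c : Fin 4 → ℂ} (h2 : c 2 = 0) (h3 : c 3 = 0) :
    BlockZero D p q ((pairTuple σ c).conj W) ∧ BlockZero D q p ((pairTuple σ c).conj W) := by
  constructor
  · refine mul_conj_mul hW hp hq fun m i j => ?_
    fin_cases m <;> fin_cases i <;> fin_cases j <;> simp [pairTuple, blk, h2, h3]
  · refine mul_conj_mul hW hq hp fun m i j => ?_
    fin_cases m <;> fin_cases i <;> fin_cases j <;> simp [pairTuple, blk, h2, h3]

theorem unitSlot_ne_zero {σ : Fin 4 → ℂ} {i : Fin 4} (h : σ i ≠ 0) : unitSlot σ i ≠ 0 := by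
  intro h0
  have := congrFun h0 i
  simp [unitSlot, h] at this

theorem unitSlot_add_ne_zero {σ c : Fin 4 → ℂ} (hc : Admissible σ c) (h : ¬(c 2 = 0 ∧ c 3 = 0))
    (r : ℝ) (hr : r ≠ 0) : unitSlot σ 2 + r • unitSlot σ 3 ≠ 0 := by
  intro h0
  have e2 := congrFun h0 2
  have e3 := congrFun h0 3
  rw [Pi.add_apply, Pi.smul_apply, unitSlot_apply_of_ne σ (show (2 : Fin 4) ≠ 3 by decide)] at e2
  rw [Pi.add_apply, Pi.smul_apply, unitSlot_apply_of_ne σ (show (3 : Fin 4) ≠ 2 by decide)] at e3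
  refine h ⟨hc 2 ?_, hc 3 ?_⟩
  · by_contra h2
    simp [unitSlot, h2] at e2
  · by_contra h3
    simp [unitSlot, h3, hr] at e3

/-- Two rotation planes. -/
theorem couplingNormalForm_of_planes (N : ℕ) (hD : IsOrthogonalDecomposition D)
    {p q : Σ i, Fin (D.mult i)} (hpq : p ≠ q) (huniv : ∀ s, s = p ∨ s = q)
    (hW : W ∈ Matrix.orthogonalGroup (Fin 4) ℝ)
    (hab : ∀ x, ρ.mat x * W = W * rotBlk (a x) (b x))
    (hp : D.P p = W * diagonal ![1, 1, 0, 0] * Wᵀ) (hq : D.P q = W * diagonal ![0, 0, 1, 1] * Wᵀ)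
    (hnf : ∀ c, Admissible (frameSign a b) c → ∃ r₀ r₁ r₂ : ℝ, (p.1 ≠ q.1 ∨ r₂ = 0) ∧
      YukawaEquiv (pairTuple (frameSign a b) c) (pairTuple (frameSign a b)
        (r₀ • unitSlot (frameSign a b) 0 + r₁ • unitSlot (frameSign a b) 1 +
          r₂ • (unitSlot (frameSign a b) 2 + (1 : ℝ) • unitSlot (frameSign a b) 3)))) :
    CouplingNormalForm N D := by
  classical
  set σ := frameSign a b with hσ
  have hpp := fun {c : Fin 4 → ℂ} => blockZero_left hW hp (σ := σ) (c := c)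
  have hqq := fun {c : Fin 4 → ℂ} => blockZero_right hW hq (σ := σ) (c := c)
  have hx := fun {c : Fin 4 → ℂ} => blockZero_mixed hW hp hq (σ := σ) (c := c)
  -- A pair of planes carries one coupling, although two slots mix the planes; the sum of the unit
  -- slots serves as its generator.
  set E := unitSlot σ 2 + (1 : ℝ) • unitSlot σ 3 with hE
  have z := fun {i j : Fin 4} (h : j ≠ i) => unitSlot_apply_of_ne σ h
  have hE0 : E 0 = 0 := by simp [hE, z]
  have hE1 : E 1 = 0 := by simp [hE, z]
  let C : (Σ i, Fin (D.mult i)) → (Σ i, Fin (D.mult i)) → Fin 4 → ℂ := fun s t =>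
    if s = p then if t = p then unitSlot σ 0 else E else if t = p then E else unitSlot σ 1
  have Cpp : C p p = unitSlot σ 0 := by simp [C]
  have Cqq : C q q = unitSlot σ 1 := by simp [C, hpq.symm]
  have Cpq : C p q = E := by simp [C, hpq.symm]
  have Cqp : C q p = E := by simp [C, hpq.symm]
  have hadm : ∀ s t, Admissible σ (C s t) := by
    intro s t
    have h := admissible_unitSlot σ
    rcases huniv s with rfl | rfl <;> rcases huniv t with rfl | rfl
    · rw [Cpp]; exact h 0
    · rw [Cpq]; exact (h 2).add ((h 3).smul 1)
    · rw [Cqp]; exact (h 2).add ((h 3).smul 1)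
    · rw [Cqq]; exact h 1
  have hsupp : ∀ s t, SupportedOn D s t ((pairTuple σ (C s t)).conj W) := by
    have hall : ∀ {s t : Σ i, Fin (D.mult i)} {R : Yukawa 2},
        (∀ s' t', (s', t') ≠ (s, t) → (s', t') ≠ (t, s) → BlockZero D s' t' R) →
          SupportedOn D s t R := fun h => supportedOn_iff.2 h
    have ext4 : ∀ {Q : (Σ i, Fin (D.mult i)) → (Σ i, Fin (D.mult i)) → Prop},
        Q p p → Q p q → Q q p → Q q q → ∀ s t, Q s t := by
      intro Q h1 h2 h3 h4 s t
      rcases huniv s with rfl | rfl <;> rcases huniv t with rfl | rfl <;> assumption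
    refine ext4 ?_ ?_ ?_ ?_
    · rw [Cpp]
      have hm := hx (c := unitSlot σ 0) (z (by decide)) (z (by decide))
      exact hall (ext4 (fun h => absurd rfl h) (fun _ _ => hm.1) (fun _ _ => hm.2)
        (fun _ _ => hqq (z (by decide))))
    · rw [Cpq]
      exact hall (ext4 (fun _ _ => hpp hE0) (fun h => absurd rfl h) (fun _ h => absurd rfl h)
        (fun _ _ => hqq hE1))
    · rw [Cqp]
      exact hall (ext4 (fun _ _ => hpp hE0) (fun _ h => absurd rfl h) (fun h => absurd rfl h)
        (fun _ _ => hqq hE1))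
    · rw [Cqq]
      have hm := hx (c := unitSlot σ 1) (z (by decide)) (z (by decide))
      exact hall (ext4 (fun _ _ => hpp (z (by decide))) (fun _ _ => hm.1) (fun _ _ => hm.2)
        (fun h => absurd rfl h))
  refine couplingNormalForm_of_pairs N (by norm_num) hD (fun s t => (pairTuple σ (C s t)).conj W)
    (fun s t => conj_pairTuple_mem hW hab (hadm s t)) (fun s t => ?_) hsupp
    (fun s t _ R hR hb => ?_) fun R hR => ?_
  · show (pairTuple σ (C s t)).conj W = (pairTuple σ (C t s)).conj W
    rcases huniv s with rfl | rfl <;> rcases huniv t with rfl | rfl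
    · rfl
    · rw [Cpq, Cqp]
    · rw [Cpq, Cqp]
    · rfl
  · obtain ⟨c, hc, rfl⟩ := exists_conj_pairTuple hW hab hR
    have hb' := hb.not_blockZero
    apply conj_pairTuple_ne_zero hW
    rcases huniv s with rfl | rfl <;> rcases huniv t with rfl | rfl
    · rw [Cpp]
      exact unitSlot_ne_zero fun h0 => hb' (hpp (hc 0 h0))
    · rw [Cpq]
      exact unitSlot_add_ne_zero hc (fun h => hb' (hx h.1 h.2).1) 1 one_ne_zero
    · rw [Cqp]
      exact unitSlot_add_ne_zero hc (fun h => hb' (hx h.1 h.2).2) 1 one_ne_zero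
    · rw [Cqq]
      exact unitSlot_ne_zero fun h0 => hb' (hqq (hc 1 h0))
  · obtain ⟨c, hc, rfl⟩ := exists_conj_pairTuple hW hab hR
    obtain ⟨r₀, r₁, r₂, hr, he⟩ := hnf c hc
    refine ⟨_, ?_, he.conj hW⟩
    rw [pairTuple_add, pairTuple_add, pairTuple_smul, pairTuple_smul, pairTuple_smul, conj_add,
      conj_add, conj_smul, conj_smul, conj_smul, ← Cpp, ← Cqq, ← Cpq]
    refine Submodule.add_mem _ (Submodule.add_mem _
      (Submodule.smul_mem _ _ (Submodule.subset_span ⟨p, p, Or.inr rfl, rfl⟩))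
      (Submodule.smul_mem _ _ (Submodule.subset_span ⟨q, q, Or.inr rfl, rfl⟩))) ?_
    rcases hr with hr | hr
    · exact Submodule.smul_mem _ _ (Submodule.subset_span ⟨p, q, Or.inl hr, rfl⟩)
    · rw [hr, zero_smul]
      exact Submodule.zero_mem _

end NormalFormTwo

end GNY
end

noncomputable section
namespace GNY

/-! ### M = 2: two rotation planes -/

section PlanesAndLines

open Matrix

variable {ρ : SpinRep 2} {D : IrrepDecomposition ρ.rep} {W : Matrix (Fin 4) (Fin 4) ℝ}
  {a b : Spin 2 → Circle}

theorem frame_phase_mul (hW : W ∈ Matrix.orthogonalGroup (Fin 4) ℝ)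
    (hab : ∀ x, ρ.mat x * W = W * rotBlk (a x) (b x)) (x y : Spin 2) :
    a (x * y) = a x * a y ∧ b (x * y) = b x * b y := by
  apply rotBlk_injective
  have hW1 := orthogonal_transpose_mul hW
  have h : W * rotBlk (a (x * y)) (b (x * y)) = W * (rotBlk (a x) (b x) * rotBlk (a y) (b y)) := by
    have hmul : ρ.mat (x * y) = ρ.mat x * ρ.mat y := by simp [SpinRep.mat]
    rw [← hab, hmul, Matrix.mul_assoc, hab, ← Matrix.mul_assoc, hab, Matrix.mul_assoc]
  have h2 := congrArg (fun A => Wᵀ * A) h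
  simp only [← Matrix.mul_assoc, hW1, Matrix.one_mul] at h2
  rw [h2, rotBlk_mul]

theorem frameSign_eq_or {i : Fin 4} (h : frameSign a b i ≠ 0) :
    (fun x => blkChar (a x) (b x) i) = vecPhase ∨
      (fun x => blkChar (a x) (b x) i) = vecPhase⁻¹ := by
  rcases slotSign_cases (fun x => blkChar (a x) (b x) i) vecPhase with ⟨h1, -⟩ | ⟨h1, -⟩ | ⟨-, -, h1⟩
  · exact Or.inl h1
  · exact Or.inr h1
  · exact absurd h1 h

theorem frameSign_eq_zero_of_one {i : Fin 4} (h : ∀ x, blkChar (a x) (b x) i = 1) :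
    frameSign a b i = 0 := by
  have h' : (fun x => blkChar (a x) (b x) i) = 1 := funext h
  by_contra h0
  rcases frameSign_eq_or h0 with h1 | h1
  · exact vecPhase_pow_ne (k := 1) one_ne_zero (by rw [_root_.zpow_one, ← h1, h'])
  · exact vecPhase_pow_ne (k := -1) (by norm_num) (by rw [_root_.zpow_neg_one, ← h1, h'])

theorem real_eq_sum_unitSlot {σ c : Fin 4 → ℂ} (hc : Admissible σ c) {r : Fin 4 → ℝ}
    (hr : ∀ i, c i = r i) : c = r 0 • unitSlot σ 0 + r 1 • unitSlot σ 1 +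
      (r 2 • unitSlot σ 2 + r 3 • unitSlot σ 3) := by
  rw [smul_unitSlot hc (hr 0), smul_unitSlot hc (hr 1), smul_unitSlot hc (hr 2),
    smul_unitSlot hc (hr 3)]
  exact eq_sum_single c

theorem Admissible.phase {σ c : Fin 4 → ℂ} (hc : Admissible σ c) (s t : Circle) :
    Admissible σ fun i => blkChar s t i * c i := fun i hi => by
  show _ * c i = 0
  rw [hc i hi, mul_zero]

/-- Two equivalent planes in parallel frames. -/
theorem couplingNormalForm_of_parallel (N : ℕ) (hD : IsOrthogonalDecomposition D)
    {p q : Σ i, Fin (D.mult i)} (hpq : p ≠ q) (huniv : ∀ s, s = p ∨ s = q)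
    (hW : W ∈ Matrix.orthogonalGroup (Fin 4) ℝ)
    (hab : ∀ x, ρ.mat x * W = W * rotBlk (a x) (a x))
    (hp : D.P p = W * diagonal ![1, 1, 0, 0] * Wᵀ)
    (hq : D.P q = W * diagonal ![0, 0, 1, 1] * Wᵀ) : CouplingNormalForm N D := by
  refine couplingNormalForm_of_planes N hD hpq huniv hW hab hp hq fun c hc => ?_
  set σ := frameSign a a with hσ
  -- Slot 2 has the trivial character a a⁻¹ and is forbidden. The other slots share the character
  -- a², so they are allowed or forbidden together and Takagi's factorization applies.
  have h2 : c 2 = 0 := hc 2 (frameSign_eq_zero_of_one fun x => mul_inv_cancel (a x))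
  have h1 : σ 1 = σ 0 := rfl
  have h3 : σ 3 = σ 0 := by
    show slotSign (fun x => a x * a x) _ = slotSign (fun x => a x ^ 2) _
    simp only [pow_two]
  by_cases h0 : σ 0 = 0
  · have hc0 : c = 0 := funext fun i => by
      fin_cases i
      exacts [hc 0 h0, hc 1 (h1.trans h0), h2, hc 3 (h3.trans h0)]
    refine ⟨0, 0, 0, Or.inr rfl, ?_⟩
    rw [hc0]
    simp only [zero_smul, add_zero]
    exact YukawaEquiv.refl _
  obtain ⟨κ, hκ⟩ : ∃ κ : ℝ, σ 0 = κ * Complex.I := by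
    rcases slotSign_cases (fun x => blkChar (a x) (a x) 0) vecPhase with ⟨-, h⟩ | ⟨-, h⟩ | ⟨-, -, h⟩
    · exact ⟨1, h.trans (by simp)⟩
    · exact ⟨-1, h.trans (by simp)⟩
    · exact absurd h h0
  obtain ⟨c', h2', h3', he⟩ := exists_diagonal_pairTuple hκ (h1.trans hκ) (h3.trans hκ) h2
  obtain ⟨u, r, hu⟩ := exists_circle_mul_eq (c' 0)
  obtain ⟨v, s, hv⟩ := exists_circle_mul_eq (c' 1)
  obtain ⟨u, rfl⟩ := exists_circle_sq u
  obtain ⟨v, rfl⟩ := exists_circle_sq v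
  have hc' : Admissible σ c' := by
    intro i hi
    fin_cases i
    exacts [absurd hi h0, absurd (h1.symm.trans hi) h0, h2', h3']
  refine ⟨r, s, 0, Or.inr rfl, he.trans ?_⟩
  have h := real_eq_sum_unitSlot (hc'.phase u v) (r := ![r, s, 0, 0]) fun i => by
    fin_cases i
    · exact hu
    · exact hv
    · simp [h2']
    · simp [h3']
  have h' := yukawaEquiv_pairTuple σ c' u v
  rw [h] at h'
  simpa using h'

/-- Equivalent planes have parallel or antiparallel frames. -/
theorem eq_or_eq_inv_of_fst_eq (hD : IsOrthogonalDecomposition D)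
    {p q : Σ i, Fin (D.mult i)} (h : p.1 = q.1) (hpq : p ≠ q)
    (hW : W ∈ Matrix.orthogonalGroup (Fin 4) ℝ)
    (hab : ∀ x, ρ.mat x * W = W * rotBlk (a x) (b x))
    (hp : D.P p = W * diagonal ![1, 1, 0, 0] * Wᵀ)
    (hq : D.P q = W * diagonal ![0, 0, 1, 1] * Wᵀ) : b = a ∨ b = a⁻¹ := by
  obtain ⟨E, E', hE, hPE, hEE⟩ := exists_intertwining_matrix h
  have hW1 := orthogonal_transpose_mul hW
  have hW2 := orthogonal_mul_transpose hW
  -- The symmetrized intertwiner is invariant, so its nonzero coefficients have trivial character. A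
  -- coefficient in slot 2 gives b = a, one in slot 3 gives b = a⁻¹; if both vanished, E would have
  -- no part between the planes.
  have hEt : ∀ x, ρ.mat x * (E + Eᵀ) * (ρ.mat x)ᵀ = E + Eᵀ := by
    intro x
    have h1 := orthogonal_mul_transpose (ρ.mat_mem x)
    have h2 : ρ.mat x * E * (ρ.mat x)ᵀ = E := by
      rw [← hE, Matrix.mul_assoc, h1, Matrix.mul_one]
    have h3 := congrArg transpose h2
    simp only [transpose_mul, transpose_transpose] at h3
    rw [Matrix.mul_add, Matrix.add_mul, h2, Matrix.mul_assoc, h3]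
  have hsymm : (Wᵀ * (E + Eᵀ) * W).IsSymm := by
    rw [Matrix.IsSymm, transpose_mul, transpose_mul, transpose_transpose, transpose_add,
      transpose_transpose, add_comm Eᵀ, Matrix.mul_assoc]
  obtain ⟨t, c, hc⟩ := exists_blk hsymm
  have hinv : ∀ x i, (blkChar (a x) (b x) i : ℂ) * c i = c i := by
    intro x
    have hrot : rotBlk (a x) (b x) = Wᵀ * ρ.mat x * W := by
      rw [Matrix.mul_assoc, hab, ← Matrix.mul_assoc, hW1, Matrix.one_mul]
    have h1 : rotBlk (a x) (b x) * blk t c * (rotBlk (a x) (b x))ᵀ = blk t c := by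
      rw [← hc, hrot, transpose_mul, transpose_mul, transpose_transpose]
      calc _ = Wᵀ * (ρ.mat x * (W * Wᵀ) * (E + Eᵀ) * (W * Wᵀ) * (ρ.mat x)ᵀ) * W := by
            simp only [Matrix.mul_assoc]
        _ = _ := by rw [hW2, Matrix.mul_one, Matrix.mul_one, hEt]
    rw [rotBlk_conj] at h1
    exact fun i => congrFun (blk_injective h1).2 i
  have hchar : ∀ i, c i ≠ 0 → ∀ x, blkChar (a x) (b x) i = 1 := fun i hi x =>
    Circle.ext (mul_right_cancel₀ hi (by rw [hinv, Circle.coe_one, one_mul]))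
  by_cases h2 : c 2 = 0
  · by_cases h3 : c 3 = 0
    · exfalso
      have hz : D.P p * (E + Eᵀ) * D.P q = 0 := by
        have h4 : diagonal ![1, 1, 0, 0] * blk t c * diagonal ![0, 0, 1, 1] =
            (0 : Matrix (Fin 4) (Fin 4) ℝ) := by
          ext i j
          rw [mul_diagonal, diagonal_mul]
          fin_cases i <;> fin_cases j <;> simp [blk, h2, h3]
        rw [hp, hq]
        calc _ = W * (diagonal ![1, 1, 0, 0] * (Wᵀ * (E + Eᵀ) * W) * diagonal ![0, 0, 1, 1]) *
              Wᵀ := by simp only [Matrix.mul_assoc]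
          _ = 0 := by rw [hc, h4, Matrix.mul_zero, Matrix.zero_mul]
      have hEtq : Eᵀ * D.P q = 0 := by
        have h5 : D.P q * E = 0 := by
          rw [← hPE, ← Matrix.mul_assoc, P_mul_of_ne hD hpq.symm, Matrix.zero_mul]
        have := congrArg transpose h5
        rwa [transpose_mul, P_transpose, transpose_zero] at this
      rw [Matrix.mul_add, Matrix.add_mul, hPE, Matrix.mul_assoc _ Eᵀ, hEtq, Matrix.mul_zero,
        add_zero] at hz
      have hPq : D.P q = 0 := by
        rw [← P_mul_self]
        nth_rw 1 [← hEE]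
        rw [Matrix.mul_assoc, hz, Matrix.mul_zero]
      refine ne_bot_of_isIrreducible (D.irreducible q) ((Submodule.eq_bot_iff _).2 fun v hv => ?_)
      rw [← proj_of_mem hv, ← projMat_mulVec, show projMat (D.sub q).toSubmodule = 0 from hPq,
        zero_mulVec]
    · right
      funext x
      have h4 : a x * b x = 1 := hchar 3 h3 x
      exact (inv_eq_of_mul_eq_one_right h4).symm
  · left
    funext x
    have h4 : a x * (b x)⁻¹ = 1 := hchar 2 h2 x
    exact (mul_inv_eq_one.1 h4).symm

/-- Parallel and antiparallel frames are reduced to `couplingNormalForm_of_parallel`. Otherwise the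
planes are inequivalent, and at most one slot of {0, 1} and one of {2, 3} is admissible, so all
phases can be removed. -/
theorem couplingNormalForm_of_two_planes (N : ℕ) (hD : IsOrthogonalDecomposition D)
    {p q : Σ i, Fin (D.mult i)} (hpq : p ≠ q) (huniv : ∀ s, s = p ∨ s = q)
    (hW : W ∈ Matrix.orthogonalGroup (Fin 4) ℝ)
    (hab : ∀ x, ρ.mat x * W = W * rotBlk (a x) (b x))
    (hp : D.P p = W * diagonal ![1, 1, 0, 0] * Wᵀ)
    (hq : D.P q = W * diagonal ![0, 0, 1, 1] * Wᵀ)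
    (ha : ∃ x, (a x : ℂ).im ≠ 0) (hb : ∃ x, (b x : ℂ).im ≠ 0) : CouplingNormalForm N D := by
  by_cases hba : b = a
  · subst hba
    exact couplingNormalForm_of_parallel N hD hpq huniv hW hab hp hq
  by_cases hba' : b = a⁻¹
  -- Reversing the last frame vector turns the phase of the second plane into its inverse, which
  -- makes the frames parallel.
  · set F : Matrix (Fin 4) (Fin 4) ℝ := diagonal ![1, 1, 1, -1] with hF
    have hFF : F * F = 1 := by
      rw [hF, diagonal_mul_diagonal, ← diagonal_one]
      congr 1
      funext i
      fin_cases i <;> simp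
    have hFt : Fᵀ = F := by rw [hF, diagonal_transpose]
    have hFO : F ∈ Matrix.orthogonalGroup (Fin 4) ℝ := by
      rw [mem_orthogonalGroup_iff]
      show F * Fᵀ = 1
      rw [hFt, hFF]
    have hdiag : ∀ d : Fin 4 → ℝ, W * diagonal d * Wᵀ = W * F * diagonal d * (W * F)ᵀ := by
      intro d
      have hFd : F * diagonal d * F = diagonal d := by
        rw [hF, diagonal_mul_diagonal, diagonal_mul_diagonal]
        congr 1
        funext i
        fin_cases i <;> simp
      rw [transpose_mul, hFt]
      calc _ = W * (F * diagonal d * F) * Wᵀ := by rw [hFd]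
        _ = _ := by simp only [Matrix.mul_assoc]
    refine couplingNormalForm_of_parallel (W := W * F) (a := a) N hD hpq huniv (mul_mem hW hFO)
      (fun x => ?_) (hp.trans (hdiag _)) (hq.trans (hdiag _))
    rw [← Matrix.mul_assoc, hab, hba', Matrix.mul_assoc, Matrix.mul_assoc]
    congr 1
    rw [hF]
    ext i j
    rw [mul_diagonal, diagonal_mul]
    fin_cases i <;> fin_cases j <;> simp [rotBlk, Circle.coe_inv_eq_conj]
  have hmul := frame_phase_mul hW hab
  have hsq : ∀ x, ∃ y, x = y * y := fun x => by
    obtain ⟨y, hy⟩ := exists_spin_two_sq x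
    exact ⟨y, by rw [← hy, pow_two]⟩
  have hfst : p.1 ≠ q.1 := fun h =>
    (eq_or_eq_inv_of_fst_eq hD h hpq hW hab hp hq).elim hba hba'
  -- If both were admissible, a² would equal b² or its inverse. Every element of Spin(2) is a
  -- square, so b would equal a or a⁻¹.
  have h01 : frameSign a b 0 = 0 ∨ frameSign a b 1 = 0 := by
    by_contra! h
    have hsame : ¬∀ y, a y ^ 2 = b y ^ 2 := fun h => hba <| funext fun x => by
      obtain ⟨y, rfl⟩ := hsq x
      rw [(hmul y y).1, (hmul y y).2, ← pow_two, ← pow_two, h]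
    have hopp : ¬∀ y, a y ^ 2 = (b y ^ 2)⁻¹ := fun h => hba' <| funext fun x => by
      obtain ⟨y, rfl⟩ := hsq x
      rw [Pi.inv_apply, (hmul y y).1, (hmul y y).2, ← pow_two, ← pow_two, h, inv_inv]
    rcases frameSign_eq_or h.1 with h0 | h0 <;> rcases frameSign_eq_or h.2 with h1 | h1
    · exact hsame fun y => congrFun (h0.trans h1.symm) y
    · exact hopp fun y => congrFun (h0.trans (by rw [h1, inv_inv] :
        _ = (fun x => blkChar (a x) (b x) 1)⁻¹)) y
    · exact hopp fun y => congrFun (h0.trans (by rw [h1] :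
        _ = (fun x => blkChar (a x) (b x) 1)⁻¹)) y
    · exact hsame fun y => congrFun (h0.trans h1.symm) y
  -- If both were admissible, b² or a² would be trivial, hence also b or a, contrary to a genuine
  -- rotation in each plane.
  have h23 : frameSign a b 2 = 0 ∨ frameSign a b 3 = 0 := by
    by_contra! h
    have hsame : ¬∀ y, a y * (b y)⁻¹ = a y * b y := fun h => by
      obtain ⟨x, hx⟩ := hb
      obtain ⟨y, rfl⟩ := hsq x
      have h1 : (b y)⁻¹ = b y := mul_left_cancel (h y)
      rw [(hmul y y).2] at hx
      nth_rw 1 [← h1] at hx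
      rw [inv_mul_cancel] at hx
      simp at hx
    have hopp : ¬∀ y, a y * (b y)⁻¹ = (a y * b y)⁻¹ := fun h => by
      obtain ⟨x, hx⟩ := ha
      obtain ⟨y, rfl⟩ := hsq x
      have h1 : a y = (a y)⁻¹ := by
        have := h y
        rw [mul_inv] at this
        exact mul_right_cancel this
      rw [(hmul y y).1] at hx
      nth_rw 1 [h1] at hx
      rw [inv_mul_cancel] at hx
      simp at hx
    rcases frameSign_eq_or h.1 with h0 | h0 <;> rcases frameSign_eq_or h.2 with h1 | h1
    · exact hsame fun y => congrFun (h0.trans h1.symm) y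
    · exact hopp fun y => congrFun (h0.trans (by rw [h1, inv_inv] :
        _ = (fun x => blkChar (a x) (b x) 3)⁻¹)) y
    · exact hopp fun y => congrFun (h0.trans (by rw [h1] :
        _ = (fun x => blkChar (a x) (b x) 3)⁻¹)) y
    · exact hsame fun y => congrFun (h0.trans h1.symm) y
  refine couplingNormalForm_of_planes N hD hpq huniv hW hab hp hq fun c hc => ?_
  set σ := frameSign a b with hσ
  obtain ⟨s, t, r, hr⟩ := exists_real_of_mul_eq_zero (h01.imp (hc 0) (hc 1))
    (h23.imp (hc 2) (hc 3))
  have hc' := hc.phase s t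
  have he := yukawaEquiv_pairTuple σ c s t
  rw [real_eq_sum_unitSlot hc' hr] at he
  refine ⟨r 0, r 1, r 2 + r 3, Or.inl hfst, ?_⟩
  have hz : ∀ i, σ i = 0 → unitSlot σ i = 0 ∧ r i = 0 := fun i hi => by
    refine ⟨by simp [unitSlot, hi], ?_⟩
    have := (hr i).symm.trans (hc' i hi)
    exact_mod_cast this
  -- The forbidden slot contributes nothing on either side, so r 2 + r 3 is the remaining
  -- coefficient.
  have hsum : r 2 • unitSlot σ 2 + r 3 • unitSlot σ 3 =
      (r 2 + r 3) • (unitSlot σ 2 + (1 : ℝ) • unitSlot σ 3) := by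
    rcases h23 with h | h
    · rw [(hz 2 h).1, (hz 2 h).2]; simp
    · rw [(hz 3 h).1, (hz 3 h).2]; simp
  rwa [← hsum]

end PlanesAndLines

end GNY
end

noncomputable section
namespace GNY

/-! ### M = 2: one rotation plane and two fixed lines -/

section Lines

open Matrix

variable {ρ : SpinRep 2} {D : IrrepDecomposition ρ.rep} {W : Matrix (Fin 4) (Fin 4) ℝ}
  {a : Spin 2 → Circle}

/-- The projection onto p factors through the projection onto an equivalent q. This separates planes
from lines. -/
theorem rank_le_of_fst_eq {p q : Σ i, Fin (D.mult i)} (h : p.1 = q.1)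
    (hW : W ∈ Matrix.orthogonalGroup (Fin 4) ℝ) {d e : Fin 4 → ℝ}
    (hp : D.P p = W * diagonal d * Wᵀ) (hq : D.P q = W * diagonal e * Wᵀ) :
    (diagonal d).rank ≤ (diagonal e).rank := by
  obtain ⟨E, E', -, hPE, hEE⟩ := exists_intertwining_matrix h.symm
  have hW1 := orthogonal_transpose_mul hW
  have h1 : diagonal d = Wᵀ * E' * W * diagonal e * (Wᵀ * E * W) := by
    calc diagonal d = (Wᵀ * W) * diagonal d * (Wᵀ * W) := by
          rw [hW1, Matrix.mul_one, Matrix.one_mul]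
      _ = Wᵀ * (W * diagonal d * Wᵀ) * W := by simp only [Matrix.mul_assoc]
      _ = Wᵀ * (E' * ((W * diagonal e * Wᵀ) * E)) * W := by rw [← hp, ← hEE, ← hq, hPE]
      _ = _ := by simp only [Matrix.mul_assoc]
  rw [h1]
  exact (rank_mul_le_left _ _).trans (rank_mul_le_right _ _)

theorem blockZero_of_frame {p q : Σ i, Fin (D.mult i)}
    (hW : W ∈ Matrix.orthogonalGroup (Fin 4) ℝ) {d e : Fin 4 → ℝ}
    (hp : D.P p = W * diagonal d * Wᵀ) (hq : D.P q = W * diagonal e * Wᵀ) {S : Yukawa 2}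
    (hs : ∀ m, (S m).IsSymm) (hS : ∀ m i j, d i * S m i j * e j = 0) :
    BlockZero D p q (S.conj W) ∧ BlockZero D q p (S.conj W) :=
  ⟨mul_conj_mul hW hp hq hS, mul_conj_mul hW hq hp fun m i j => by
    linear_combination hS m j i - d j * e i * (hs m).apply i j⟩

theorem blockZero_lower {p q : Σ i, Fin (D.mult i)} (hW : W ∈ Matrix.orthogonalGroup (Fin 4) ℝ)
    {d e : Fin 2 → ℝ} (hp : D.P p = W * diagonal ![0, 0, d 0, d 1] * Wᵀ)
    (hq : D.P q = W * diagonal ![0, 0, e 0, e 1] * Wᵀ) {σ c : Fin 4 → ℂ} (h1 : c 1 = 0) :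
    BlockZero D p q ((pairTuple σ c).conj W) ∧ BlockZero D q p ((pairTuple σ c).conj W) := by
  refine blockZero_of_frame hW hp hq (pairTuple_isSymm σ c) fun m i j => ?_
  fin_cases m <;> fin_cases i <;> fin_cases j <;> simp [pairTuple, blk, h1]

/-- Between the plane and the third frame vector the matrix elements are those of c₂ + c₃, and for
the fourth vector those of c₂ - c₃ up to a factor i; equal signs σ extend this to the second matrix.
-/
theorem blockZero_first_line {p q : Σ i, Fin (D.mult i)}
    (hW : W ∈ Matrix.orthogonalGroup (Fin 4) ℝ) (hp : D.P p = W * diagonal ![1, 1, 0, 0] * Wᵀ)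
    (hq : D.P q = W * diagonal ![0, 0, 1, 0] * Wᵀ) {σ c : Fin 4 → ℂ} (hσ : σ 3 = σ 2)
    (h : c 2 + c 3 = 0) :
    BlockZero D p q ((pairTuple σ c).conj W) ∧ BlockZero D q p ((pairTuple σ c).conj W) := by
  have h3 : c 3 = -c 2 := by linear_combination h
  refine blockZero_of_frame hW hp hq (pairTuple_isSymm σ c) fun m i j => ?_
  fin_cases m <;> fin_cases i <;> fin_cases j <;> simp [pairTuple, blk, h3, hσ]

theorem blockZero_second_line {p q : Σ i, Fin (D.mult i)}
    (hW : W ∈ Matrix.orthogonalGroup (Fin 4) ℝ) (hp : D.P p = W * diagonal ![1, 1, 0, 0] * Wᵀ)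
    (hq : D.P q = W * diagonal ![0, 0, 0, 1] * Wᵀ) {σ c : Fin 4 → ℂ} (hσ : σ 3 = σ 2)
    (h : c 2 = c 3) :
    BlockZero D p q ((pairTuple σ c).conj W) ∧ BlockZero D q p ((pairTuple σ c).conj W) := by
  refine blockZero_of_frame hW hp hq (pairTuple_isSymm σ c) fun m i j => ?_
  fin_cases m <;> fin_cases i <;> fin_cases j <;> simp [pairTuple, blk, h, hσ]

theorem rank_diagonal_plane : (diagonal (![1, 1, 0, 0] : Fin 4 → ℝ)).rank = 2 := by
  classical
  have h : (Finset.univ.filter fun i => (![1, 1, 0, 0] : Fin 4 → ℝ) i ≠ 0) = {0, 1} := by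
    ext i
    fin_cases i <;> simp
  rw [rank_diagonal, Fintype.card_subtype, h]
  rfl

theorem rank_diagonal_single (k : Fin 4) : (diagonal (Pi.single k 1 : Fin 4 → ℝ)).rank = 1 := by
  classical
  have h : (Finset.univ.filter fun i => (Pi.single k 1 : Fin 4 → ℝ) i ≠ 0) = {k} := by
    ext i
    simp [Pi.single_apply]
  rw [rank_diagonal, Fintype.card_subtype, h]
  rfl

theorem fst_ne_of_plane_of_line {p q : Σ i, Fin (D.mult i)} {k : Fin 4}
    (hW : W ∈ Matrix.orthogonalGroup (Fin 4) ℝ) (hp : D.P p = W * diagonal ![1, 1, 0, 0] * Wᵀ)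
    (hq : D.P q = W * diagonal (Pi.single k 1) * Wᵀ) : p.1 ≠ q.1 := by
  intro h
  have := rank_le_of_fst_eq h hW hp hq
  rw [rank_diagonal_plane, rank_diagonal_single] at this
  omega

set_option maxHeartbeats 1000000 in
/-- One rotation plane and two lines. -/
theorem couplingNormalForm_of_lines (N : ℕ) (hD : IsOrthogonalDecomposition D)
    {p q r : Σ i, Fin (D.mult i)} (hpq : p ≠ q) (hpr : p ≠ r) (hqr : q ≠ r)
    (huniv : ∀ s, s = p ∨ s = q ∨ s = r)
    (hW : W ∈ Matrix.orthogonalGroup (Fin 4) ℝ)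
    (hab : ∀ x, ρ.mat x * W = W * rotBlk (a x) 1)
    (hp : D.P p = W * diagonal ![1, 1, 0, 0] * Wᵀ) (hq : D.P q = W * diagonal ![0, 0, 1, 0] * Wᵀ)
    (hr : D.P r = W * diagonal ![0, 0, 0, 1] * Wᵀ) : CouplingNormalForm N D := by
  classical
  have hfst : p.1 ≠ q.1 ∧ p.1 ≠ r.1 := by
    refine ⟨fst_ne_of_plane_of_line (k := 2) hW hp (hq.trans ?_),
      fst_ne_of_plane_of_line (k := 3) hW hp (hr.trans ?_)⟩ <;>
    · congr 3
      funext i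
      fin_cases i <;> simp
  set b : Spin 2 → Circle := fun _ => 1 with hb
  set σ := frameSign a b with hσ
  have hσ1 : σ 1 = 0 := frameSign_eq_zero_of_one fun x => one_pow 2
  have hσ3 : σ 3 = σ 2 := by
    show slotSign (fun x => a x * 1) _ = slotSign (fun x => a x * 1⁻¹) _
    simp only [inv_one]
  -- The character of slot 0 is the square of that of slot 2. If both were the vector's character or
  -- its inverse, the first or third power of that character would be trivial.
  have hσ02 : σ 0 = 0 ∨ σ 2 = 0 := by
    by_contra! h
    have e0 : (fun x => blkChar (a x) (b x) 0) = (fun x => blkChar (a x) (b x) 2) ^ 2 := by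
      funext x
      show a x ^ 2 = (a x * 1⁻¹) ^ 2
      rw [inv_one, mul_one]
    rcases frameSign_eq_or h.2 with h2 | h2 <;> rcases frameSign_eq_or h.1 with h0 | h0 <;>
      rw [e0, h2] at h0
    · refine vecPhase_pow_ne (k := 1) (by norm_num) ?_
      rw [pow_two] at h0
      rw [_root_.zpow_one]
      exact mul_eq_left.1 h0
    · refine vecPhase_pow_ne (k := 3) (by norm_num) ?_
      rw [_root_.zpow_ofNat, pow_succ, h0, inv_mul_cancel]
    · refine vecPhase_pow_ne (k := 3) (by norm_num) ?_
      rw [_root_.zpow_ofNat, pow_succ]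
      nth_rw 2 [← h0]
      rw [← mul_pow, mul_inv_cancel, one_pow]
    · refine vecPhase_pow_ne (k := 1) (by norm_num) ?_
      rw [pow_two] at h0
      rw [_root_.zpow_one]
      exact inv_eq_one.1 (mul_eq_left.1 h0)
  have hpp := fun {c : Fin 4 → ℂ} => blockZero_left hW hp (σ := σ) (c := c)
  have hqq : ∀ {c : Fin 4 → ℂ}, c 1 = 0 → BlockZero D q q ((pairTuple σ c).conj W) :=
    fun h => (blockZero_lower (d := ![1, 0]) (e := ![1, 0]) hW hq hq h).1
  have hrr : ∀ {c : Fin 4 → ℂ}, c 1 = 0 → BlockZero D r r ((pairTuple σ c).conj W) :=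
    fun h => (blockZero_lower (d := ![0, 1]) (e := ![0, 1]) hW hr hr h).1
  have hqr' : ∀ {c : Fin 4 → ℂ}, c 1 = 0 → BlockZero D q r ((pairTuple σ c).conj W) ∧
      BlockZero D r q ((pairTuple σ c).conj W) :=
    fun h => blockZero_lower (d := ![1, 0]) (e := ![0, 1]) hW hq hr h
  have hpq' := fun {c : Fin 4 → ℂ} => blockZero_first_line hW hp hq (c := c) hσ3
  have hpr' := fun {c : Fin 4 → ℂ} => blockZero_second_line hW hp hr (c := c) hσ3
  have z := fun {i j : Fin 4} (h : j ≠ i) => unitSlot_apply_of_ne σ h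
  have hu3 : unitSlot σ 3 3 = unitSlot σ 2 2 := by
    unfold unitSlot
    rw [hσ3]
    split_ifs <;> simp
  -- On the lines the group acts trivially, so slots 2 and 3 have the same character. The
  -- combinations with ε = 1 and ε = -1 couple the plane to the first and to the second line alone.
  set E : ℝ → Fin 4 → ℂ := fun ε => unitSlot σ 2 + ε • unitSlot σ 3 with hE
  have hE0 : ∀ ε, E ε 0 = 0 := fun ε => by simp [hE, z]
  have hE1 : ∀ ε, E ε 1 = 0 := fun ε => by simp [hE, z]
  have hE23 : E 1 2 = E 1 3 := by simp [hE, z, hu3]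
  have hE23' : E (-1) 2 + E (-1) 3 = 0 := by simp [hE, z, hu3]
  let C : (Σ i, Fin (D.mult i)) → (Σ i, Fin (D.mult i)) → Fin 4 → ℂ := fun s t =>
    if s = p then if t = p then unitSlot σ 0 else if t = q then E 1 else E (-1)
    else if t = p then if s = q then E 1 else E (-1) else 0
  have Cpp : C p p = unitSlot σ 0 := by simp [C]
  have Cpq : C p q = E 1 := by simp [C, hpq.symm]
  have Cqp : C q p = E 1 := by simp [C, hpq.symm]
  have Cpr : C p r = E (-1) := by simp [C, hpr.symm, hqr.symm]
  have Crp : C r p = E (-1) := by simp [C, hpr.symm, hqr.symm]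
  have Cqq : C q q = 0 := by simp [C, hpq.symm]
  have Cqr : C q r = 0 := by simp [C, hpq.symm, hpr.symm]
  have Crq : C r q = 0 := by simp [C, hpq.symm, hpr.symm]
  have Crr : C r r = 0 := by simp [C, hpr.symm]
  have ext9 : ∀ {Q : (Σ i, Fin (D.mult i)) → (Σ i, Fin (D.mult i)) → Prop},
      Q p p → Q p q ∧ Q q p → Q p r ∧ Q r p → Q q q → Q q r ∧ Q r q → Q r r → ∀ s t, Q s t := by
    rintro Q h1 ⟨h2, h3⟩ ⟨h4, h5⟩ h6 ⟨h7, h8⟩ h9 s t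
    rcases huniv s with rfl | rfl | rfl <;> rcases huniv t with rfl | rfl | rfl <;> assumption
  have adm := admissible_unitSlot σ
  have hadm : ∀ s t, Admissible σ (C s t) := by
    have h1 := (adm 2).add ((adm 3).smul 1)
    have h2 := (adm 2).add ((adm 3).smul (-1))
    have h0 : Admissible σ 0 := fun _ _ => rfl
    refine ext9 ?_ ⟨?_, ?_⟩ ⟨?_, ?_⟩ ?_ ⟨?_, ?_⟩ ?_
    · rw [Cpp]; exact adm 0
    · rw [Cpq]; exact h1
    · rw [Cqp]; exact h1
    · rw [Cpr]; exact h2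
    · rw [Crp]; exact h2
    · rw [Cqq]; exact h0
    · rw [Cqr]; exact h0
    · rw [Crq]; exact h0
    · rw [Crr]; exact h0
  have hsupp : ∀ s t, SupportedOn D s t ((pairTuple σ (C s t)).conj W) := by
    have hall : ∀ {s t : Σ i, Fin (D.mult i)} {R : Yukawa 2},
        (∀ s' t', (s', t') ≠ (s, t) → (s', t') ≠ (t, s) → BlockZero D s' t' R) →
          SupportedOn D s t R := fun h => supportedOn_iff.2 h
    have h1 : SupportedOn D p q ((pairTuple σ (E 1)).conj W) := by
      have m2 := hpr' hE23
      have m3 := hqr' (hE1 1)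
      exact hall (ext9 (fun _ _ => hpp (hE0 1))
        ⟨fun h => absurd rfl h, fun _ h => absurd rfl h⟩
        ⟨fun _ _ => m2.1, fun _ _ => m2.2⟩ (fun _ _ => hqq (hE1 1))
        ⟨fun _ _ => m3.1, fun _ _ => m3.2⟩ (fun _ _ => hrr (hE1 1)))
    have h2 : SupportedOn D p r ((pairTuple σ (E (-1))).conj W) := by
      have m2 := hpq' hE23'
      have m3 := hqr' (hE1 (-1))
      exact hall (ext9 (fun _ _ => hpp (hE0 (-1)))
        ⟨fun _ _ => m2.1, fun _ _ => m2.2⟩ ⟨fun h => absurd rfl h, fun _ h => absurd rfl h⟩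
        (fun _ _ => hqq (hE1 (-1)))
        ⟨fun _ _ => m3.1, fun _ _ => m3.2⟩ (fun _ _ => hrr (hE1 (-1))))
    have h0 : ∀ s t, SupportedOn D s t ((pairTuple σ 0).conj W) := fun s t =>
      hall fun s' t' _ _ m => by rw [pairTuple_zero]; simp [Yukawa.conj]
    refine ext9 ?_ ⟨?_, ?_⟩ ⟨?_, ?_⟩ ?_ ⟨?_, ?_⟩ ?_
    · rw [Cpp]
      have u1 : unitSlot σ 0 1 = 0 := z (by decide)
      have u2 : unitSlot σ 0 2 = 0 := z (by decide)
      have u3 : unitSlot σ 0 3 = 0 := z (by decide)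
      have m1 := hpq' (c := unitSlot σ 0) (by rw [u2, u3, add_zero])
      have m2 := hpr' (c := unitSlot σ 0) (by rw [u2, u3])
      have m3 := hqr' u1
      exact hall (ext9 (fun h => absurd rfl h) ⟨fun _ _ => m1.1, fun _ _ => m1.2⟩
        ⟨fun _ _ => m2.1, fun _ _ => m2.2⟩ (fun _ _ => hqq u1)
        ⟨fun _ _ => m3.1, fun _ _ => m3.2⟩ (fun _ _ => hrr u1))
    · rw [Cpq]; exact h1
    · rw [Cqp]; exact h1.symm
    · rw [Cpr]; exact h2
    · rw [Crp]; exact h2.symm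
    · rw [Cqq]; exact h0 _ _
    · rw [Cqr]; exact h0 _ _
    · rw [Crq]; exact h0 _ _
    · rw [Crr]; exact h0 _ _
  refine couplingNormalForm_of_pairs N (by norm_num) hD (fun s t => (pairTuple σ (C s t)).conj W)
    (fun s t => conj_pairTuple_mem hW hab (hadm s t)) (fun s t => ?_) hsupp
    (fun s t _ R hR hb => ?_) fun R hR => ?_
  · show (pairTuple σ (C s t)).conj W = (pairTuple σ (C t s)).conj W
    revert s t
    refine ext9 rfl ⟨?_, ?_⟩ ⟨?_, ?_⟩ rfl ⟨?_, ?_⟩ rfl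
    · rw [Cpq, Cqp]
    · rw [Cpq, Cqp]
    · rw [Cpr, Crp]
    · rw [Cpr, Crp]
    · rw [Cqr, Crq]
    · rw [Cqr, Crq]
  · obtain ⟨c, hc, rfl⟩ := exists_conj_pairTuple hW hab hR
    apply conj_pairTuple_ne_zero hW
    have c1 : c 1 = 0 := hc 1 hσ1
    have hmix : ∀ ε : ℝ, ε ≠ 0 → ¬(c 2 = 0 ∧ c 3 = 0) → E ε ≠ 0 := fun ε hε h =>
      unitSlot_add_ne_zero hc h ε hε
    have h1 := hmix 1 one_ne_zero
    have h2 := hmix (-1) (by norm_num)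
    replace hb := hb.not_blockZero
    revert s t
    refine ext9 ?_ ⟨?_, ?_⟩ ⟨?_, ?_⟩ ?_ ⟨?_, ?_⟩ ?_ <;> intro _ hb
    · rw [Cpp]
      exact unitSlot_ne_zero fun h0 => hb (hpp (hc 0 h0))
    · rw [Cpq]
      exact h1 fun h => hb (hpq' (by rw [h.1, h.2, add_zero])).1
    · rw [Cqp]
      exact h1 fun h => hb (hpq' (by rw [h.1, h.2, add_zero])).2
    · rw [Cpr]
      exact h2 fun h => hb (hpr' (by rw [h.1, h.2])).1
    · rw [Crp]
      exact h2 fun h => hb (hpr' (by rw [h.1, h.2])).2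
    · exact absurd (hqq c1) hb
    · exact absurd (hqr' c1).1 hb
    · exact absurd (hqr' c1).2 hb
    · exact absurd (hrr c1) hb
  · obtain ⟨c, hc, rfl⟩ := exists_conj_pairTuple hW hab hR
    have hc1 : c 1 = 0 := hc 1 hσ1
    -- Either slot 0 is absent and both mixing phases are removed together, or the mixing slots are
    -- absent. The rotation used here may mix the two lines.
    obtain ⟨s, t, k, hk⟩ : ∃ s t : Circle, ∃ k : Fin 4 → ℝ, ∀ i, blkChar s t i * c i = k i := by
      rcases hσ02 with h | h
      · exact exists_real_of_eq_zero (hc 0 h) hc1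
      · exact exists_real_of_mul_eq_zero (Or.inr hc1) (Or.inl (hc 2 h))
    have he := yukawaEquiv_pairTuple σ c s t
    rw [real_eq_sum_unitSlot (hc.phase s t) hk] at he
    have hsum : k 0 • unitSlot σ 0 + k 1 • unitSlot σ 1 +
        (k 2 • unitSlot σ 2 + k 3 • unitSlot σ 3) = k 0 • unitSlot σ 0 +
          ((k 2 + k 3) / 2) • E 1 + ((k 2 - k 3) / 2) • E (-1) := by
      have : unitSlot σ 1 = 0 := by simp [unitSlot, hσ1]
      rw [this, hE]
      module
    rw [hsum] at he
    refine ⟨_, ?_, he.conj hW⟩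
    rw [pairTuple_add, pairTuple_add, pairTuple_smul, pairTuple_smul, pairTuple_smul, conj_add,
      conj_add, conj_smul, conj_smul, conj_smul, ← Cpp, ← Cpq, ← Cpr]
    exact Submodule.add_mem _ (Submodule.add_mem _
      (Submodule.smul_mem _ _ (Submodule.subset_span ⟨p, p, Or.inr rfl, rfl⟩))
      (Submodule.smul_mem _ _ (Submodule.subset_span ⟨p, q, Or.inl hfst.1, rfl⟩)))
      (Submodule.smul_mem _ _ (Submodule.subset_span ⟨p, r, Or.inl hfst.2, rfl⟩))

/-- Every element of Spin(2) is a square, so the lines in `exists_frame` carry the trivial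
representation and its statements about squares cover the whole group. -/
theorem couplingNormalForm_two (N : ℕ) (hD : IsOrthogonalDecomposition D) :
    CouplingNormalForm N D := by
  classical
  have hmat : ∀ x, LinearMap.toMatrix' (ρ.rep x) = ρ.mat x := fun x =>
    LinearMap.toMatrix'_toLin' _
  have hsq : ∀ x : Spin 2, ∃ y, x = y * y := fun x => by
    obtain ⟨y, hy⟩ := exists_spin_two_sq x
    exact ⟨y, by rw [← hy, pow_two]⟩
  rcases exists_frame ρ.rep_dotProduct spin_two_comm
    (fun p => ne_bot_of_isIrreducible (D.irreducible p))
    (fun p => minimal_of_isIrreducible (D.irreducible p)) hD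
    D.isInternal.submodule_iSup_eq_top with h | h | h
  · refine couplingNormalForm_of_trivial N hD fun x => ?_
    obtain ⟨y, rfl⟩ := hsq x
    have : ρ.rep (y * y) = LinearMap.id := LinearMap.ext fun v => h y v
    rw [← hmat, this, LinearMap.toMatrix'_id]
  · obtain ⟨p, q, r, hpq, hpr, hqr, huniv, W, hW, a, hp, hq, hr, hab⟩ := h
    refine couplingNormalForm_of_lines N hD hpq hpr hqr (fun s => ?_) hW (a := a) (fun x => ?_)
      hp hq hr
    · have := Finset.mem_univ s
      rw [huniv] at this
      simpa using this
    · obtain ⟨y, rfl⟩ := hsq x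
      rw [← hmat, hab]
  · obtain ⟨p, q, hpq, huniv, W, hW, a, b, hp, hq, hab, ha, hb⟩ := h
    refine couplingNormalForm_of_two_planes N hD hpq (fun s => ?_) hW (a := a) (b := b)
      (fun x => ?_) hp hq ha hb
    · have := Finset.mem_univ s
      rw [huniv] at this
      simpa using this
    · rw [← hmat, hab]

end Lines

end GNY
end

theorem mainTheorem5 (M N_D : ℕ) (hM : 1 ≤ M) (hN : 1 ≤ N_D) :
    (∀ R : Yukawa M, (∀ m, (R m).IsSymm) → SOUnbroken N_D R →
      ∃ ρ : SpinRep M, TransformsAsVec ρ R) ∧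
    (∀ ρ : SpinRep M,
      ∃ D : IrrepDecomposition ρ.rep, IsOrthogonalDecomposition D ∧
        Nat.card (CouplingIndex D) = couplingBound D ∧
        ∃ F : (CouplingIndex D → ℝ) →ₗ[ℝ] Yukawa M,
          Function.Injective F ∧
          (∀ c (t : ℝ), SupportedOn D (couplingEnds D c).1 (couplingEnds D c).2
            (F (Function.update 0 c t))) ∧
          (∀ g, (∀ m, (F g m).IsSymm) ∧ TransformsAsVec ρ (F g) ∧ SOUnbroken N_D (F g)) ∧
          (∀ R : Yukawa M, (∀ m, (R m).IsSymm) → TransformsAsVec ρ R →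
            ∃ g, YukawaEquiv R (F g))) := by
  obtain rfl | rfl | hM3 : M = 1 ∨ M = 2 ∨ 3 ≤ M := by omega
  · refine ⟨fun R _ _ => exists_spinRep_one R, fun ρ => ?_⟩
    obtain ⟨D, hD⟩ := exists_irrepDecomposition ρ.rep_dotProduct
    exact ⟨D, hD, card_couplingIndex D, couplingNormalForm_one N_D hD⟩
  · refine ⟨fun R hR h => exists_spinRep_two hR (RotInvariant.of_soUnbroken hN hR h), fun ρ => ?_⟩
    obtain ⟨D, hD⟩ := exists_irrepDecomposition ρ.rep_dotProduct
    exact ⟨D, hD, card_couplingIndex D, couplingNormalForm_two N_D hD⟩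
  · refine ⟨fun R hR h => exists_spinRep_of_three_le hM3 hR (RotInvariant.of_soUnbroken hN hR h),
      fun ρ => ?_⟩
    obtain ⟨D, hD⟩ := exists_irrepDecomposition ρ.rep_dotProduct
    exact ⟨D, hD, card_couplingIndex D, couplingNormalForm_of_three_le N_D hM3 hD⟩
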